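/- **Theorem 7 (Higher-order efficiency).** Let $x_1,x_2,\dots$ be random elements with values in $\mathcal X$, let $\Theta\subset\mathbb R^{N_\theta}$, and let $g(x,\theta)\in\mathbb R^{N_g}$ be moment functions. Write $x$ for a generic $x_i$. *Assumption 1.* (1) The $x_i$ are i.i.d. (2) $\Theta$ is compact and $\theta^*\in\operatorname{int}(\Theta)$ is the unique $\theta\in\Theta$ with $E[g(x,\theta)]=0$. (3) For each $\theta\in\Theta$, $g(x,\cdot)$ is continuous at $\theta$ with probability one. (4) $E[\sup_{\theta\in\Theta}\|g(x,\theta)\|^{2+\delta}]<\infty$ for some $\delta>0$, and $E[\sup_{\theta\in\mathcal N}\|\partial g(x,\theta)/\partial\theta'\|]<\infty$ for a neighborhood $\mathcal N$ of $\theta^*$. (5) $E[g(x,\theta^*)g(x,\theta^*)']$ is finite and nonsingular and $E[\partial g(x,\theta^*)/\partial\theta']$ has rank $N_\theta$. (6) $g(x,\theta)$ is continuously differentiable in $\theta$ on $\mathcal N$. *Assumption 2.* There are a function $b$ with $E[b(x)^6]<\infty$ and a neighborhood of $\theta^*$ on which all partial derivatives of $g(x,\theta)$ in $\theta$ of orders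 $0$ to $4$ exist, are bounded by $b(x)$, and are Lipschitz in $\theta$ with constant $b(x)$. *Estimators.* From $x_1,\dots,x_n$, both estimators minimize $n^{-1}\sum_i-\ln(n\hat w_i(\theta))$ over $\theta\in\Theta$, where the weights $\hat w(\theta)$ minimize $n^{-1}\sum_i h(w_i)$ over $w_i\ge 0$ subject to $\sum_i w_i=1$ and $\sum_i w_i\,g(x_i,\theta)=0$, with $h(w)=-\ln(nw)$ for the empirical likelihood estimator $\hat\theta_{\mathrm{EL}}$ and $h(w)=nw\ln(nw)$ for the exponentially tilted empirical likelihood estimator $\hat\theta_{\mathrm{ETEL}}$ (here $-\ln 0=+\infty$, $0\ln 0=0$, and the objective is $+\infty$ where the constraints cannot be met). It is assumed that these minimizers exist with probability approaching one; $\hat\theta_{\mathrm{EL}}$ and $\hat\theta_{\mathrm{ETEL}}$ are any sequences that are such minimizers with probability approaching one. *$O(n^{-2})$ variance.* A stochastic expansion of an estimator $\hat\theta$ is a representation $$\hat\theta-\theta^*=n^{-1/2}\bar\psi+n^{-1}\bar q+n^{-3/2}\bar r+o_p(n^{-3/2}),$$ where $\bar\psi$, $\bar q$, $\bar r$ are,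 respectively, a linear, a quadratic and a cubic form, with coefficients that do not depend on $n$, in finitely many normalized sums $n^{-1/2}\sum_{i\le n}a_j(x_i)$ with $E[a_j(x)]=0$ and $E[a_j(x)^2]<\infty$, such that $\bar\psi$ and $\bar q$ are square integrable, $\bar r$ and the products $\bar r_l\bar\psi_{l'}$ are integrable, and $E[\bar r]\to0$. The $O(n^{-2})$ variance of $\hat\theta$ is $$W=\lim_{n\to\infty}\bigl(\operatorname{Var}[\bar q]+\operatorname{Covar}[\bar r,\bar\psi]+\operatorname{Covar}[\bar\psi,\bar r]\bigr).$$ *Claim.* Under Assumptions 1 and 2, $\hat\theta_{\mathrm{EL}}$ and $\hat\theta_{\mathrm{ETEL}}$ have stochastic expansions, their $O(n^{-2})$ variances exist, and these are equal: $$W^{\mathrm{ETEL}}=W^{\mathrm{EL}}.$$ Moreover $\bar\psi^{\mathrm{ETEL}}=\bar\psi^{\mathrm{EL}}=:\bar\psi$, $\bar q^{\mathrm{ETEL}}=\bar q^{\mathrm{EL}}$, and $\operatorname{Covar}[\bar r^{\mathrm{ETEL}}-\bar r^{\mathrm{EL}},\bar\psi]\to0$ as $n\to\infty$. If Assumption 2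 holds with $E[b(x)^8]<\infty$, then the remainders of both expansions are $O_p(n^{-2})$. -/

import Mathlib

open MeasureTheory ProbabilityTheory Filter Topology
open scoped ENNReal

noncomputable section

/-! ### Implied probabilities and the EL and ETEL estimators

The argument `v : Fin n → EuclideanSpace ℝ (Fin m)` stands for `v i = g(x_i, θ)`. -/

/-- Nonnegative weights on the sample with `∑ wᵢ = 1` and `∑ wᵢ g(xᵢ, θ) = 0`. -/
def feasibleWeights {n m : ℕ} (v : Fin n → EuclideanSpace ℝ (Fin m)) : Set (Fin n → ℝ) :=
  {w | (∀ i, 0 ≤ w i) ∧ ∑ i, w i = 1 ∧ ∑ i, w i • v i = 0}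

/-- `n⁻¹ ∑ -ln (n wᵢ)`. It is only used for strictly positive weights; a vanishing weight stands
for the value `+∞`. -/
def klDiscrepancy {n : ℕ} (w : Fin n → ℝ) : ℝ :=
  (n : ℝ)⁻¹ * ∑ i, -Real.log (n * w i)

/-- `n⁻¹ ∑ n wᵢ ln (n wᵢ)`, with `0 ln 0 = 0`. -/
def entropyDiscrepancy {n : ℕ} (w : Fin n → ℝ) : ℝ :=
  (n : ℝ)⁻¹ * ∑ i, n * w i * Real.log (n * w i)

/-- `w` are the EL weights: they minimize `n⁻¹ ∑ -ln (n wᵢ)` (which is `+∞` as soon as one weight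
vanishes) subject to the constraints, and the minimum is finite. -/
def IsELWeights {n m : ℕ} (v : Fin n → EuclideanSpace ℝ (Fin m)) (w : Fin n → ℝ) : Prop :=
  w ∈ feasibleWeights v ∧ (∀ i, 0 < w i) ∧
    ∀ w' ∈ feasibleWeights v, (∀ i, 0 < w' i) → klDiscrepancy w ≤ klDiscrepancy w'

/-- `w` are the exponential tilting weights: they minimize `n⁻¹ ∑ n wᵢ ln (n wᵢ)` subject to the
constraints. -/
def IsETWeights {n m : ℕ} (v : Fin n → EuclideanSpace ℝ (Fin m)) (w : Fin n → ℝ) : Prop :=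
  w ∈ feasibleWeights v ∧ ∀ w' ∈ feasibleWeights v, entropyDiscrepancy w ≤ entropyDiscrepancy w'

/-- `θhat` is an EL estimate from the sample `xs`: it minimizes over `Θ` the discrepancy
`n⁻¹ ∑ -ln (n ŵᵢ(θ))`, where `ŵ(θ)` are the EL weights. Parameters at which there are no EL
weights have the value `+∞`. -/
def IsELEstimate {𝒳 : Type*} {n m p : ℕ}
    (g : 𝒳 → EuclideanSpace ℝ (Fin p) → EuclideanSpace ℝ (Fin m))
    (Θ : Set (EuclideanSpace ℝ (Fin p))) (xs : Fin n → 𝒳) (θhat : EuclideanSpace ℝ (Fin p)) :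
    Prop :=
  θhat ∈ Θ ∧ ∃ w, IsELWeights (fun i => g (xs i) θhat) w ∧
    ∀ θ ∈ Θ, ∀ w', IsELWeights (fun i => g (xs i) θ) w' → klDiscrepancy w ≤ klDiscrepancy w'

/-- `θhat` is an ETEL estimate from the sample `xs`: it minimizes over `Θ` the discrepancy
`n⁻¹ ∑ -ln (n ŵᵢ(θ))`, where `ŵ(θ)` are the exponential tilting weights. Parameters at which the
constraints cannot be met, or at which some weight vanishes, have the value `+∞`. -/
def IsETELEstimate {𝒳 : Type*} {n m p : ℕ}
    (g : 𝒳 → EuclideanSpace ℝ (Fin p) → EuclideanSpace ℝ (Fin m))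
    (Θ : Set (EuclideanSpace ℝ (Fin p))) (xs : Fin n → 𝒳) (θhat : EuclideanSpace ℝ (Fin p)) :
    Prop :=
  θhat ∈ Θ ∧ ∃ w, IsETWeights (fun i => g (xs i) θhat) w ∧ (∀ i, 0 < w i) ∧
    ∀ θ ∈ Θ, ∀ w', IsETWeights (fun i => g (xs i) θ) w' → (∀ i, 0 < w' i) →
      klDiscrepancy w ≤ klDiscrepancy w'

/-- `θhat n` is, with probability approaching one, an EL estimate from `x₀, …, xₙ₋₁`. -/
def IsELEstimator {Ω 𝒳 : Type*} [MeasurableSpace Ω] {m p : ℕ} (μ : Measure Ω) (x : ℕ → Ω → 𝒳)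
    (g : 𝒳 → EuclideanSpace ℝ (Fin p) → EuclideanSpace ℝ (Fin m))
    (Θ : Set (EuclideanSpace ℝ (Fin p))) (θhat : ℕ → Ω → EuclideanSpace ℝ (Fin p)) : Prop :=
  Tendsto (fun n => μ {ω | ¬ IsELEstimate g Θ (fun i : Fin n => x i ω) (θhat n ω)}) atTop (𝓝 0)

/-- `θhat n` is, with probability approaching one, an ETEL estimate from `x₀, …, xₙ₋₁`. -/
def IsETELEstimator {Ω 𝒳 : Type*} [MeasurableSpace Ω] {m p : ℕ} (μ : Measure Ω) (x : ℕ → Ω → 𝒳)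
    (g : 𝒳 → EuclideanSpace ℝ (Fin p) → EuclideanSpace ℝ (Fin m))
    (Θ : Set (EuclideanSpace ℝ (Fin p))) (θhat : ℕ → Ω → EuclideanSpace ℝ (Fin p)) : Prop :=
  Tendsto (fun n => μ {ω | ¬ IsETELEstimate g Θ (fun i : Fin n => x i ω) (θhat n ω)}) atTop (𝓝 0)

/-! ### The regularity conditions -/

/-- `E[g(x, θ) g(x, θ)']`. -/
def momentCov {𝒳 : Type*} [MeasurableSpace 𝒳] {m p : ℕ} (P : Measure 𝒳)
    (g : 𝒳 → EuclideanSpace ℝ (Fin p) → EuclideanSpace ℝ (Fin m))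
    (θ : EuclideanSpace ℝ (Fin p)) : Matrix (Fin m) (Fin m) ℝ :=
  Matrix.of fun j k => ∫ y, g y θ j * g y θ k ∂P

/-- `E[∂g(x, θ)/∂θ']`. -/
def momentJacobian {𝒳 : Type*} [MeasurableSpace 𝒳] {m p : ℕ} (P : Measure 𝒳)
    (g : 𝒳 → EuclideanSpace ℝ (Fin p) → EuclideanSpace ℝ (Fin m))
    (θ : EuclideanSpace ℝ (Fin p)) : Matrix (Fin m) (Fin p) ℝ :=
  Matrix.of fun j k => ∫ y, fderiv ℝ (g y) θ (EuclideanSpace.single k 1) j ∂P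

/-- The basic regularity conditions. A finite expectation of a supremum over `θ` is expressed by
an integrable function that dominates the supremum. -/
structure RegularityConditions {Ω 𝒳 : Type*} [MeasurableSpace Ω] [MeasurableSpace 𝒳] {m p : ℕ}
    (μ : Measure Ω) (P : Measure 𝒳) (x : ℕ → Ω → 𝒳)
    (g : 𝒳 → EuclideanSpace ℝ (Fin p) → EuclideanSpace ℝ (Fin m))
    (Θ : Set (EuclideanSpace ℝ (Fin p))) (θs : EuclideanSpace ℝ (Fin p)) : Prop where
  /-- the `xᵢ` are independent -/
  indep : iIndepFun x μ
  /-- the `xᵢ` have the common law `P` -/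
  law : ∀ i, HasLaw (x i) P μ
  compact : IsCompact Θ
  interior : θs ∈ interior Θ
  /-- `θs` is the unique solution of `E[g(x, θ)] = 0` in `Θ` -/
  unique_solution : ∀ θ ∈ Θ, ∫ y, g y θ ∂P = 0 ↔ θ = θs
  /-- measurability of the moment functions -/
  measurable : ∀ θ ∈ Θ, Measurable fun y => g y θ
  /-- measurability of their local oscillation in `θ`; this is automatic if, for almost every `y`,
  `g y` is continuous on all of `Θ` -/
  measurable_osc : ∀ θ ∈ Θ, ∀ r > 0,
    AEMeasurable (fun y => ⨆ θ' ∈ Θ ∩ Metric.ball θ r, ‖g y θ' - g y θ‖ₑ) P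
  /-- continuity at each `θ ∈ Θ` with probability one -/
  continuous : ∀ θ ∈ Θ, ∀ᵐ y ∂P, ContinuousWithinAt (g y) Θ θ
  /-- `E[sup_{θ ∈ Θ} ‖g(x, θ)‖^(2 + δ)] < ∞` for some `δ > 0` -/
  moment : ∃ δ : ℝ, 0 < δ ∧ ∃ d : 𝒳 → ℝ, Integrable d P ∧
    ∀ᵐ y ∂P, ∀ θ ∈ Θ, ‖g y θ‖ ^ (2 + δ) ≤ d y
  /-- `g` is continuously differentiable in a neighborhood `N` of `θs`, and
  `E[sup_{θ ∈ N} ‖∂g(x, θ)/∂θ'‖] < ∞` -/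
  differentiable : ∃ N : Set (EuclideanSpace ℝ (Fin p)), IsOpen N ∧ θs ∈ N ∧
    (∀ᵐ y ∂P, ContDiffOn ℝ 1 (g y) N) ∧
    ∃ d : 𝒳 → ℝ, Integrable d P ∧ ∀ᵐ y ∂P, ∀ θ ∈ N, ‖fderiv ℝ (g y) θ‖ ≤ d y
  nonsingular : (momentCov P g θs).det ≠ 0
  full_rank : (momentJacobian P g θs).rank = p

/-- The smoothness conditions, with a bound `b` such that `E[b(x)^s] < ∞`: in a neighborhood `N`
of `θs`, the derivatives of `g(x, θ)` in `θ` of orders `0, …, 4` exist, are bounded by `b(x)` and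
are Lipschitz in `θ` with constant `b(x)`. -/
def SmoothnessConditions {𝒳 : Type*} [MeasurableSpace 𝒳] {m p : ℕ} (P : Measure 𝒳)
    (g : 𝒳 → EuclideanSpace ℝ (Fin p) → EuclideanSpace ℝ (Fin m))
    (θs : EuclideanSpace ℝ (Fin p)) (s : ℝ≥0∞) : Prop :=
  ∃ b : 𝒳 → ℝ, MemLp b s P ∧ ∃ N : Set (EuclideanSpace ℝ (Fin p)), IsOpen N ∧ θs ∈ N ∧
    ∀ᵐ y ∂P, ContDiffOn ℝ 4 (g y) N ∧ ∀ k : ℕ, k ≤ 4 →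
      (∀ θ ∈ N, ‖iteratedFDeriv ℝ k (g y) θ‖ ≤ b y) ∧
      ∀ θ ∈ N, ∀ θ' ∈ N,
        ‖iteratedFDeriv ℝ k (g y) θ - iteratedFDeriv ℝ k (g y) θ'‖ ≤ b y * ‖θ - θ'‖

/-! ### Stochastic expansions and the `O(n⁻²)` variance -/

/-- The data of a third-order stochastic expansion of an estimator of a `p`-dimensional parameter:
finitely many functions `a₁, …, aₖ` of an observation and the coefficients, free of `n`, of a linear
form, a quadratic form and a cubic form (with values in `ℝᵖ`) in the normalized sums
`zⱼ = n^(-1/2) ∑ᵢ aⱼ(xᵢ)`. -/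
structure ExpansionData (𝒳 : Type*) (p : ℕ) where
  k : ℕ
  a : 𝒳 → Fin k → ℝ
  lin : Fin p → Fin k → ℝ
  quad : Fin p → Fin k → Fin k → ℝ
  cub : Fin p → Fin k → Fin k → Fin k → ℝ

namespace ExpansionData

variable {Ω 𝒳 : Type*} {p : ℕ}

/-- The normalized sum `n^(-1/2) ∑_{i < n} aⱼ(xᵢ)`. -/
def z (c : ExpansionData 𝒳 p) (x : ℕ → Ω → 𝒳) (n : ℕ) (ω : Ω) (j : Fin c.k) : ℝ :=
  (√(n : ℝ))⁻¹ * ∑ i ∈ Finset.range n, c.a (x i ω) j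

/-- The component `l` of the leading term `ψ̄` (the normalized sum of the influence function). -/
def psi (c : ExpansionData 𝒳 p) (x : ℕ → Ω → 𝒳) (n : ℕ) (l : Fin p) (ω : Ω) : ℝ :=
  ∑ j, c.lin l j * c.z x n ω j

/-- The component `l` of the term `q̄` of order `n⁻¹`. -/
def q (c : ExpansionData 𝒳 p) (x : ℕ → Ω → 𝒳) (n : ℕ) (l : Fin p) (ω : Ω) : ℝ :=
  ∑ j, ∑ j', c.quad l j j' * c.z x n ω j * c.z x n ω j'

/-- The component `l` of the term `r̄` of order `n^(-3/2)`. -/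
def r (c : ExpansionData 𝒳 p) (x : ℕ → Ω → 𝒳) (n : ℕ) (l : Fin p) (ω : Ω) : ℝ :=
  ∑ j, ∑ j', ∑ j'', c.cub l j j' j'' * c.z x n ω j * c.z x n ω j' * c.z x n ω j''

/-- The remainder `(θ̂ - θs) - n^(-1/2) ψ̄ - n⁻¹ q̄ - n^(-3/2) r̄`, componentwise. -/
def remainder (c : ExpansionData 𝒳 p) (x : ℕ → Ω → 𝒳)
    (θhat : ℕ → Ω → EuclideanSpace ℝ (Fin p)) (θs : EuclideanSpace ℝ (Fin p))
    (n : ℕ) (l : Fin p) (ω : Ω) : ℝ :=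
  (θhat n ω l - θs l) - ((n : ℝ) ^ (-(1 / 2) : ℝ) * c.psi x n l ω + (n : ℝ)⁻¹ * c.q x n l ω
    + (n : ℝ) ^ (-(3 / 2) : ℝ) * c.r x n l ω)

/-- The entry `(l, l')` of `Var[q̄] + Covar[r̄, ψ̄] + Covar[ψ̄, r̄]` at sample size `n`. -/
def secondOrderVariance [MeasurableSpace Ω] (c : ExpansionData 𝒳 p) (μ : Measure Ω)
    (x : ℕ → Ω → 𝒳) (n : ℕ) (l l' : Fin p) : ℝ :=
  cov[c.q x n l, c.q x n l'; μ] + cov[c.r x n l, c.psi x n l'; μ]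
    + cov[c.psi x n l, c.r x n l'; μ]

end ExpansionData

/-- `θ̂ - θs = n^(-1/2) ψ̄ + n⁻¹ q̄ + n^(-3/2) r̄ + oₚ(n^(-3/2))`, where `ψ̄`, `q̄`, `r̄` are a linear,
a quadratic and a cubic form in normalized sums of centered, square integrable functions of the
observations (so that they are `Oₚ(1)` and `ψ̄` has mean zero), where `r̄` has mean zero in the limit,
and where the moments entering the `O(n⁻²)` variance are finite. These conditions determine `ψ̄`,
`q̄` and `r̄` up to null events. -/
structure IsStochasticExpansion {Ω 𝒳 : Type*} [MeasurableSpace Ω] [MeasurableSpace 𝒳] {p : ℕ}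
    (μ : Measure Ω) (P : Measure 𝒳) (x : ℕ → Ω → 𝒳)
    (θhat : ℕ → Ω → EuclideanSpace ℝ (Fin p)) (θs : EuclideanSpace ℝ (Fin p))
    (c : ExpansionData 𝒳 p) : Prop where
  memLp_a : ∀ j, MemLp (fun y => c.a y j) 2 P
  mean_a : ∀ j, ∫ y, c.a y j ∂P = 0
  memLp_psi : ∀ n l, MemLp (c.psi x n l) 2 μ
  memLp_q : ∀ n l, MemLp (c.q x n l) 2 μ
  integrable_r : ∀ n l, Integrable (c.r x n l) μ
  integrable_r_psi : ∀ n l l', Integrable (fun ω => c.r x n l ω * c.psi x n l' ω) μ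
  mean_r : ∀ l, Tendsto (fun n => ∫ ω, c.r x n l ω ∂μ) atTop (𝓝 0)
  remainder : ∀ l, TendstoInMeasure μ
    (fun (n : ℕ) ω => (n : ℝ) ^ (3 / 2 : ℝ) * c.remainder x θhat θs n l ω) atTop fun _ => 0

/-- `W` is the `O(n⁻²)` variance of the estimator, obtained from its stochastic expansion `c`. -/
structure HasSecondOrderVariance {Ω 𝒳 : Type*} [MeasurableSpace Ω] [MeasurableSpace 𝒳] {p : ℕ}
    (μ : Measure Ω) (P : Measure 𝒳) (x : ℕ → Ω → 𝒳)
    (θhat : ℕ → Ω → EuclideanSpace ℝ (Fin p)) (θs : EuclideanSpace ℝ (Fin p))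
    (c : ExpansionData 𝒳 p) (W : Matrix (Fin p) (Fin p) ℝ) : Prop where
  expansion : IsStochasticExpansion μ P x θhat θs c
  limit : ∀ l l', Tendsto (fun n => c.secondOrderVariance μ x n l l') atTop (𝓝 (W l l'))

/-- `Xₙ = Oₚ(1)`. -/
def BoundedInProbability {Ω : Type*} [MeasurableSpace Ω] (μ : Measure Ω) (X : ℕ → Ω → ℝ) : Prop :=
  ∀ ε : ℝ≥0∞, 0 < ε → ∃ M : ℝ, ∀ᶠ n in atTop, μ {ω | M < |X n ω|} ≤ ε

end

/-! Near `θs` both estimators are roots of p + m smooth equations in the parameter displacement and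
a multiplier of the moment conditions. For EL the weights are n wᵢ = 1 / (1 - λ'gᵢ), and the
equations are ∑ gᵢ / (1 - λ'gᵢ) = 0 and ∑ λ'∂gᵢ / (1 - λ'gᵢ) = 0. For ETEL the weights are
exponential in λ'gᵢ, and since θ is chosen by another discrepancy than the weights, a second
multiplier κ appears. After elimination of the normalization and of the tilting parameter λ, the
vector μ = -κ takes the place of the EL multiplier (`ordO_polynomial_ETEL`): up to n⁻² the two
systems agree, except for terms of degree three in the multiplier alone, in the moment rows alone
(`rowJet_c3_sub`, `cubicCoef`).

Successive substitution expands the root of such a system to third order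
(`expansion_of_estimating_equations`). Hence ψ̄ and q̄ are the same for both estimators, and the two
r̄ differ by a cubic form in the first-order term of the multiplier. That first-order term is
uncorrelated with ψ̄, by a block identity for the inverse of the bordered Jacobian
(`bordered_inv_orthogonal`). Fourth moments of normalized sums converge to the sum over the three
pairings of products of covariances (`tendsto_integral_normSum_four`), and each pairing of three
multiplier terms with one parameter term contains a vanishing covariance. So the covariance of the
difference of the r̄ with ψ̄ tends to zero, and the variances W agree.

The expansion needs rates first. At `θs` the convex dual problem has a solution of norm O(n^(-1/2)),
so weights with discrepancy O(1/n) exist there (`MomentRegime.exists_weights`). By optimality the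
discrepancy at the estimate is no larger, which forces n wᵢ - 1 to have mean square O(1/n).
Cauchy-Schwarz then gives sample moments of order n^(-1/2) at the estimate, separation gives
consistency, the rank of the Jacobian gives the rate of θ, and coercivity of the sample covariance
gives the rates of the multipliers.

Randomness is confined to a filter: `whp μ` on ℕ × Ω turns convergence in probability into
convergence along a filter, and restriction to events on which finitely many tight variables stay
below M turns Oₚ into a deterministic O. The analysis in between is deterministic (`MomentRegime`).

Moments are counted by weights. The coefficients of degree k of an estimating function are of order
b^(k+1), so that ψ̄, q̄, r̄ have total weights at most 1, 3, 5. The products q̄q̄ and r̄ψ̄ then have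
weight at most 6, which is what six moments of b allow. Eight moments make the cubic coefficients,
of order b⁴, square integrable, and this improves the remainder to Oₚ(n⁻²). -/

noncomputable section

open Asymptotics
open scoped InnerProductSpace

/-! ### Events with probability approaching one -/

/-- The filter on `ℕ × Ω` of the sequences of events whose probability approaches one. -/
def whp {Ω : Type*} [MeasurableSpace Ω] (μ : Measure Ω) : Filter (ℕ × Ω) where
  sets := {S | Tendsto (fun n => μ {ω | (n, ω) ∉ S}) atTop (𝓝 0)}
  univ_sets := by simp
  sets_of_superset := by
    intro S T hS hST
    refine tendsto_of_tendsto_of_tendsto_of_le_of_le tendsto_const_nhds hS (fun _ => zero_le)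
      fun n => measure_mono fun ω hω h => hω (hST h)
  inter_sets := by
    intro S T hS hT
    have h := Tendsto.add hS hT
    rw [add_zero] at h
    refine tendsto_of_tendsto_of_tendsto_of_le_of_le tendsto_const_nhds h (fun _ => zero_le)
      fun n => (measure_mono fun ω hω => ?_).trans (measure_union_le _ _)
    by_cases h1 : (n, ω) ∈ S
    · exact Or.inr fun h2 => hω ⟨h1, h2⟩
    · exact Or.inl h1

section Whp

variable {Ω : Type*} [MeasurableSpace Ω] {μ : Measure Ω}

lemma eventually_whp_iff {p : ℕ × Ω → Prop} :
    (∀ᶠ x in whp μ, p x) ↔ Tendsto (fun n => μ {ω | ¬ p (n, ω)}) atTop (𝓝 0) := Iff.rfl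

lemma eventually_whp_of_ae {p : ℕ × Ω → Prop} (h : ∀ᵐ ω ∂μ, ∀ n, p (n, ω)) :
    ∀ᶠ x in whp μ, p x := by
  rw [eventually_whp_iff]
  have : ∀ n, μ {ω | ¬ p (n, ω)} = 0 := fun n => by
    have : ∀ᵐ ω ∂μ, p (n, ω) := h.mono fun ω hω => hω n
    exact this
  simp [this]

lemma tendsto_fst_whp : Tendsto Prod.fst (whp μ) atTop := by
  rw [tendsto_atTop]
  intro k
  rw [eventually_whp_iff]
  refine tendsto_const_nhds.congr' ?_
  filter_upwards [eventually_ge_atTop k] with n hn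
  simp [hn]

/-- This is what lets Landau calculus along a filter stand in for stochastic order symbols. -/
lemma tendstoInMeasure_iff_whp {X : ℕ → Ω → ℝ} {c : ℝ} :
    TendstoInMeasure μ X atTop (fun _ => c) ↔
      Tendsto (fun x : ℕ × Ω => X x.1 x.2) (whp μ) (𝓝 c) := by
  rw [tendstoInMeasure_iff_norm, Metric.tendsto_nhds]
  refine forall₂_congr fun ε hε => ?_
  rw [eventually_whp_iff]
  simp only [not_lt, Real.dist_eq, Real.norm_eq_abs]

/-- The events on which a given sequence of random variables stays below a fixed bound. -/
def whpOn (μ : Measure Ω) (Y : ℕ → Ω → ℝ) (M : ℝ) : Filter (ℕ × Ω) :=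
  whp μ ⊓ 𝓟 {x | |Y x.1 x.2| ≤ M}

lemma whpOn_le (Y : ℕ → Ω → ℝ) (M : ℝ) : whpOn μ Y M ≤ whp μ := inf_le_left

lemma eventually_whpOn_bound (Y : ℕ → Ω → ℝ) (M : ℝ) :
    ∀ᶠ x in whpOn μ Y M, |Y x.1 x.2| ≤ M :=
  (inf_le_right : whpOn μ Y M ≤ _) (mem_principal_self _)

/-- The passage back to probability: tightness of `Y` leaves at most ε/2 outside the event `|Y| ≤
M`, and the exceptional events of `whp μ` cost another ε/2. The bound for `X` may depend on M, hence
on ε, which is all that Oₚ(1) asks. -/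
lemma boundedInProbability_of_whpOn {X Y : ℕ → Ω → ℝ} (hY : BoundedInProbability μ Y)
    (h : ∀ M, (fun x : ℕ × Ω => X x.1 x.2) =O[whpOn μ Y M] fun _ => (1 : ℝ)) :
    BoundedInProbability μ X := by
  intro ε hε
  have hε2 : 0 < ε / 2 := ENNReal.half_pos hε.ne'
  obtain ⟨M, hM⟩ := hY (ε / 2) hε2
  obtain ⟨C, hC⟩ := (h M).bound
  refine ⟨C, ?_⟩
  have h1 : ∀ᶠ x in whp μ, |Y x.1 x.2| ≤ M → |X x.1 x.2| ≤ C := by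
    have := eventually_inf_principal.1 hC
    filter_upwards [this] with x hx hx'
    simpa using hx hx'
  rw [eventually_whp_iff] at h1
  filter_upwards [hM, h1.eventually_le_const hε2] with n h2 h3
  calc μ {ω | C < |X n ω|} ≤ μ ({ω | M < |Y n ω|} ∪ {ω | ¬ (|Y n ω| ≤ M → |X n ω| ≤ C)}) := by
        refine measure_mono fun ω hω => ?_
        by_cases h4 : |Y n ω| ≤ M
        · exact Or.inr fun h5 => absurd (h5 h4) (not_le.2 hω)
        · exact Or.inl (not_le.1 h4)
    _ ≤ ε / 2 + ε / 2 := (measure_union_le _ _).trans (add_le_add h2 h3)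
    _ = ε := ENNReal.add_halves ε

lemma tendstoInMeasure_of_whpOn {X Y : ℕ → Ω → ℝ} (hY : BoundedInProbability μ Y)
    (h : ∀ M, Tendsto (fun x : ℕ × Ω => X x.1 x.2) (whpOn μ Y M) (𝓝 0)) :
    TendstoInMeasure μ X atTop (fun _ => 0) := by
  rw [tendstoInMeasure_iff_norm]
  intro δ hδ
  rw [ENNReal.tendsto_atTop_zero]
  intro ε hε
  have hε2 : 0 < ε / 2 := ENNReal.half_pos hε.ne'
  obtain ⟨M, hM⟩ := hY (ε / 2) hε2
  have h1 : ∀ᶠ x in whp μ, |Y x.1 x.2| ≤ M → |X x.1 x.2| < δ := by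
    have := eventually_inf_principal.1 ((Metric.tendsto_nhds.1 (h M)) δ hδ)
    filter_upwards [this] with x hx hx'
    simpa using hx hx'
  rw [eventually_whp_iff] at h1
  rw [← eventually_atTop]
  filter_upwards [hM, h1.eventually_le_const hε2] with n h2 h3
  calc μ {ω | δ ≤ ‖X n ω - 0‖} ≤
        μ ({ω | M < |Y n ω|} ∪ {ω | ¬ (|Y n ω| ≤ M → |X n ω| < δ)}) := by
        refine measure_mono fun ω hω => ?_
        by_cases h4 : |Y n ω| ≤ M
        · refine Or.inr fun h5 => absurd (h5 h4) (not_lt.2 ?_)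
          simpa using hω
        · exact Or.inl (not_le.1 h4)
    _ ≤ ε / 2 + ε / 2 := (measure_union_le _ _).trans (add_le_add h2 h3)
    _ = ε := ENNReal.add_halves ε

lemma BoundedInProbability.add {X Y : ℕ → Ω → ℝ} (hX : BoundedInProbability μ X)
    (hY : BoundedInProbability μ Y) : BoundedInProbability μ (fun n ω => X n ω + Y n ω) := by
  intro ε hε
  have hε2 : 0 < ε / 2 := ENNReal.half_pos hε.ne'
  obtain ⟨M, hM⟩ := hX (ε / 2) hε2
  obtain ⟨M', hM'⟩ := hY (ε / 2) hε2
  refine ⟨M + M', ?_⟩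
  filter_upwards [hM, hM'] with n h2 h3
  refine (measure_mono fun ω hω => ?_).trans <|
    ((measure_union_le {ω | M < |X n ω|} {ω | M' < |Y n ω|}).trans (add_le_add h2 h3)).trans
      (ENNReal.add_halves ε).le
  by_contra h
  simp only [Set.mem_union, Set.mem_ofPred_eq, not_or, not_lt] at h hω
  linarith [abs_add_le (X n ω) (Y n ω)]

lemma BoundedInProbability.abs {X : ℕ → Ω → ℝ} (hX : BoundedInProbability μ X) :
    BoundedInProbability μ (fun n ω => |X n ω|) := by
  simpa [BoundedInProbability] using hX

lemma BoundedInProbability.sum {ι : Type*} (s : Finset ι) {X : ι → ℕ → Ω → ℝ}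
    (hX : ∀ i ∈ s, BoundedInProbability μ (X i)) :
    BoundedInProbability μ (fun n ω => ∑ i ∈ s, X i n ω) := by
  classical
  induction s using Finset.induction_on with
  | empty => exact fun ε hε => ⟨0, by simp⟩
  | insert a s ha ih =>
    simp only [Finset.sum_insert ha]
    exact (hX a (by simp)).add (ih fun i hi => hX i (by simp [hi]))

end Whp

/-! ### Sample means -/

/-- The mean of `f` over the first `N x` entries of the sequence `X x`. -/
def sampleMean {I 𝒳 : Type*} (N : I → ℕ) (X : I → ℕ → 𝒳) (x : I) (f : 𝒳 → ℝ) : ℝ :=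
  (N x : ℝ)⁻¹ * ∑ i ∈ Finset.range (N x), f (X x i)

section Sampling

variable {Ω 𝒳 : Type*} [MeasurableSpace Ω] [MeasurableSpace 𝒳] {μ : Measure Ω}
  {P : Measure 𝒳} {x : ℕ → Ω → 𝒳}

lemma HasLaw.ae_comp {X : Ω → 𝒳} (h : HasLaw X P μ) {p : 𝒳 → Prop} (hp : ∀ᵐ y ∂P, p y) :
    ∀ᵐ ω ∂μ, p (X ω) := by
  rw [← h.map_eq] at hp
  exact ae_of_ae_map h.aemeasurable hp

lemma identDistrib_comp (hlaw : ∀ i, HasLaw (x i) P μ) {f : 𝒳 → ℝ} (hf : AEMeasurable f P)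
    (i j : ℕ) : IdentDistrib (fun ω => f (x i ω)) (fun ω => f (x j ω)) μ μ := by
  have h : IdentDistrib (x i) (x j) μ μ :=
    ⟨(hlaw i).aemeasurable, (hlaw j).aemeasurable, by rw [(hlaw i).map_eq, (hlaw j).map_eq]⟩
  refine h.comp_of_aemeasurable ?_
  rwa [(hlaw i).map_eq]

lemma indepFun_comp (hind : iIndepFun x μ) (hlaw : ∀ i, HasLaw (x i) P μ) {f : 𝒳 → ℝ}
    (hf : AEMeasurable f P) : iIndepFun (fun i ω => f (x i ω)) μ := by
  refine hind.comp₀ (fun _ => f) (fun i => (hlaw i).aemeasurable) fun i => ?_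
  rwa [(hlaw i).map_eq]

lemma integrable_comp_law {X : Ω → 𝒳} (h : HasLaw X P μ) {f : 𝒳 → ℝ} (hf : Integrable f P) :
    Integrable (fun ω => f (X ω)) μ := by
  rw [← h.map_eq] at hf
  exact hf.comp_aemeasurable h.aemeasurable

lemma memLp_comp_law {X : Ω → 𝒳} (h : HasLaw X P μ) {f : 𝒳 → ℝ} {q : ℝ≥0∞} (hf : MemLp f q P) :
    MemLp (fun ω => f (X ω)) q μ := by
  rw [← h.map_eq] at hf
  exact hf.comp_of_map h.aemeasurable

/-- The sample mean of `f` from the first `n` observations at `ω`. -/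
abbrev empMean (x : ℕ → Ω → 𝒳) (z : ℕ × Ω) (f : 𝒳 → ℝ) : ℝ :=
  sampleMean Prod.fst (fun (z : ℕ × Ω) i => x i z.2) z f

lemma tendsto_empMean [IsProbabilityMeasure μ] (hind : iIndepFun x μ)
    (hlaw : ∀ i, HasLaw (x i) P μ) {f : 𝒳 → ℝ} (hf : Integrable f P) :
    Tendsto (fun z => empMean x z f) (whp μ) (𝓝 (∫ y, f y ∂P)) := by
  have hlln := strong_law_ae_real (fun i ω => f (x i ω)) (integrable_comp_law (hlaw 0) hf)
    (fun i j hij => (indepFun_comp hind hlaw hf.aemeasurable).indepFun hij)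
    (fun i => identDistrib_comp hlaw hf.aemeasurable i 0)
  have hE : ∫ ω, f (x 0 ω) ∂μ = ∫ y, f y ∂P :=
    (hlaw 0).integral_comp (f := f) hf.aestronglyMeasurable
  rw [hE] at hlln
  have := tendstoInMeasure_of_tendsto_ae (μ := μ) (fun n => ?_) hlln
  · refine (tendstoInMeasure_iff_whp.1 this).congr fun z => ?_
    rw [empMean, sampleMean, div_eq_inv_mul]
  · have h : ∀ i, AEStronglyMeasurable (fun ω => f (x i ω)) μ := fun i =>
      (integrable_comp_law (hlaw i) hf).aestronglyMeasurable
    exact ((Finset.aestronglyMeasurable_fun_sum (Finset.range n) fun i _ => h i).mul_const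
      (n : ℝ)⁻¹).congr (Eventually.of_forall fun ω => by simp [div_eq_mul_inv])

lemma boundedInProbability_empMean [IsProbabilityMeasure μ] (hind : iIndepFun x μ)
    (hlaw : ∀ i, HasLaw (x i) P μ) {f : 𝒳 → ℝ} (hf : MemLp f 2 P) :
    BoundedInProbability μ (fun n ω => √(n : ℝ) * (empMean x (n, ω) f - ∫ y, f y ∂P)) := by
  intro ε hε
  have hm : ∀ i, MemLp (fun ω => f (x i ω)) 2 μ := fun i => memLp_comp_law (hlaw i) hf
  have haem : AEMeasurable f P := hf.aestronglyMeasurable.aemeasurable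
  have hE : ∀ i, ∫ ω, f (x i ω) ∂μ = ∫ y, f y ∂P := fun i =>
    (hlaw i).integral_comp (f := f) hf.aestronglyMeasurable
  set v := Var[fun ω => f (x 0 ω); μ] with hv
  have hvar : ∀ n : ℕ, Var[fun ω => ∑ i ∈ Finset.range n, f (x i ω); μ] = n * v := by
    intro n
    have := IndepFun.variance_sum (μ := μ) (s := Finset.range n) (X := fun i ω => f (x i ω))
      (fun i _ => hm i)
      (fun i _ j _ hij => (indepFun_comp hind hlaw haem).indepFun hij)
    have h2 : (fun ω => ∑ i ∈ Finset.range n, f (x i ω)) =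
        ∑ i ∈ Finset.range n, fun ω => f (x i ω) := by ext ω; simp
    rw [h2, this, Finset.sum_congr rfl fun i _ => (identDistrib_comp hlaw haem i 0).variance_eq]
    simp [hv]
  have hv0 : 0 ≤ v := variance_nonneg _ _
  -- Chebyshev's inequality at the level M√n gives the bound v / M². The choice M² = (v + 1) / ε
  -- suffices; the summand 1 keeps M positive when v = 0.
  obtain ⟨M, hM0, hM⟩ : ∃ M : ℝ, 0 < M ∧ ENNReal.ofReal (v / M ^ 2) ≤ ε := by
    rcases eq_or_ne ε ⊤ with rfl | hεt
    · exact ⟨1, one_pos, le_top⟩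
    · have hε' : 0 < ε.toReal := ENNReal.toReal_pos hε.ne' hεt
      refine ⟨√((v + 1) / ε.toReal), by positivity, ?_⟩
      rw [Real.sq_sqrt (by positivity)]
      refine ENNReal.ofReal_le_of_le_toReal ?_
      rw [div_div_eq_mul_div, div_le_iff₀ (by positivity)]
      nlinarith
  refine ⟨M, ?_⟩
  filter_upwards [eventually_gt_atTop 0] with n hn
  have hn' : (0 : ℝ) < n := by exact_mod_cast hn
  have hsum : MemLp (fun ω => ∑ i ∈ Finset.range n, f (x i ω)) 2 μ := memLp_finsetSum _ fun i _ => hm i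
  have hc := meas_ge_le_variance_div_sq (μ := μ) hsum (c := M * √n) (by positivity)
  have hEs : ∫ ω, ∑ i ∈ Finset.range n, f (x i ω) ∂μ = n * ∫ y, f y ∂P := by
    rw [integral_finsetSum _ fun i _ => (hm i).integrable one_le_two]
    simp [hE]
  rw [hvar, hEs] at hc
  refine (measure_mono fun ω hω => ?_).trans (hc.trans (le_trans (le_of_eq ?_) hM))
  · simp only [Set.mem_ofPred_eq, empMean, sampleMean] at hω ⊢
    have h3 : √(n : ℝ) * ((n : ℝ)⁻¹ * ∑ i ∈ Finset.range n, f (x i ω) - ∫ y, f y ∂P) =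
        (√(n : ℝ))⁻¹ * (∑ i ∈ Finset.range n, f (x i ω) - n * ∫ y, f y ∂P) := by
      have hs : √(n : ℝ) * √n = n := Real.mul_self_sqrt hn'.le
      have hs0 : √(n : ℝ) ≠ 0 := by positivity
      field_simp
      rw [pow_two, hs]
    rw [h3, abs_mul, abs_of_pos (by positivity : 0 < (√(n : ℝ))⁻¹), ← div_eq_inv_mul,
      lt_div_iff₀ (by positivity)] at hω
    exact hω.le
  · congr 1
    rw [mul_pow, Real.sq_sqrt hn'.le]
    field_simp

end Sampling

/-! ### Moments of normalized sums -/

section Moments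

variable {Ω 𝒳 : Type*} [MeasurableSpace Ω] [MeasurableSpace 𝒳] {μ : Measure Ω}
  {P : Measure 𝒳} {x : ℕ → Ω → 𝒳}

/-- Sums of i.i.d. vectors are independent of the next vector. -/
lemma indepFun_sum_next {K : Type*} [Finite K] (hind : iIndepFun x μ)
    (hlaw : ∀ i, HasLaw (x i) P μ) {a : K → 𝒳 → ℝ} (ha : ∀ k, Measurable (a k)) (n : ℕ) :
    IndepFun (fun ω k => ∑ i ∈ Finset.range n, a k (x i ω)) (fun ω k => a k (x n ω)) μ := by
  have haa : Measurable fun y k => a k y := measurable_pi_lambda _ ha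
  have h1 : iIndepFun (fun i ω => fun k => a k (x i ω)) μ := hind.comp (fun _ y k => a k y) fun _ => haa
  have hm : ∀ i, AEMeasurable (fun ω => fun k => a k (x i ω)) μ := fun i =>
    haa.comp_aemeasurable (hlaw i).aemeasurable
  -- The observations are only a.e. measurable, so the vectors are replaced by measurable versions
  -- before the independence of the past sum and the next term is used.
  have h2 : iIndepFun (fun i => (hm i).mk _) μ :=
    (iIndepFun_congr fun i => (hm i).ae_eq_mk).1 h1
  have h3 := h2.indepFun_sum_range_succ (fun i => (hm i).measurable_mk) n
  refine IndepFun.congr h3 ?_ (hm n).ae_eq_mk.symm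
  have h4 : ∀ᵐ ω ∂μ, ∀ i, (fun k => a k (x i ω)) = (hm i).mk _ ω :=
    ae_all_iff.2 fun i => (hm i).ae_eq_mk
  filter_upwards [h4] with ω hω
  ext k
  simp only [Finset.sum_apply]
  exact Finset.sum_congr rfl fun i _ => (congrFun (hω i) k).symm

variable [IsProbabilityMeasure μ] {K : Type*} [Fintype K] [DecidableEq K]

/-- Each sum splits into its first n terms and the new one. Multiplying out gives a sum over the set
B of factors that keep the old sum, and independence factors every summand. This recursion in n
replaces the counting of coincidences among indices in the moment formulas below. -/
lemma integrable_prod_sums (hind : iIndepFun x μ) (hlaw : ∀ i, HasLaw (x i) P μ)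
    {a : K → 𝒳 → ℝ} (ha : ∀ k, Measurable (a k))
    (hint : ∀ B : Finset K, Integrable (fun y => ∏ k ∈ B, a k y) P) (n : ℕ) (A : Finset K) :
    Integrable (fun ω => ∏ k ∈ A, ∑ i ∈ Finset.range n, a k (x i ω)) μ ∧
    ∫ ω, ∏ k ∈ A, ∑ i ∈ Finset.range (n + 1), a k (x i ω) ∂μ = ∑ B ∈ A.powerset,
      (∫ ω, ∏ k ∈ B, ∑ i ∈ Finset.range n, a k (x i ω) ∂μ) *
        ∫ y, ∏ k ∈ A \ B, a k y ∂P := by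
  have hprodm : ∀ B : Finset K, Measurable fun v : K → ℝ => ∏ k ∈ B, v k := fun B => by fun_prop
  have hI : ∀ n (B C : Finset K), IndepFun
      (fun ω => ∏ k ∈ B, ∑ i ∈ Finset.range n, a k (x i ω)) (fun ω => ∏ k ∈ C, a k (x n ω)) μ :=
    fun n B C => (indepFun_sum_next hind hlaw ha n).comp (hprodm B) (hprodm C)
  have hx : ∀ n (C : Finset K), Integrable (fun ω => ∏ k ∈ C, a k (x n ω)) μ := fun n C =>
    integrable_comp_law (hlaw n) (hint C)
  have hexp : ∀ n (A : Finset K) (ω : Ω), ∏ k ∈ A, ∑ i ∈ Finset.range (n + 1), a k (x i ω) =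
      ∑ B ∈ A.powerset, (∏ k ∈ B, ∑ i ∈ Finset.range n, a k (x i ω)) *
        ∏ k ∈ A \ B, a k (x n ω) := by
    intro n A ω
    simp only [Finset.sum_range_succ]
    rw [Finset.prod_add]
  have hind : ∀ n (A : Finset K),
      Integrable (fun ω => ∏ k ∈ A, ∑ i ∈ Finset.range n, a k (x i ω)) μ := by
    intro n
    induction n with
    | zero => intro A; simp
    | succ n ih =>
      intro A
      simp only [hexp]
      exact integrable_finsetSum _ fun B _ => (hI n B (A \ B)).integrable_mul (ih B) (hx n _)
  refine ⟨hind n A, ?_⟩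
  have hmul : ∀ B : Finset K, Integrable (fun ω =>
      (∏ k ∈ B, ∑ i ∈ Finset.range n, a k (x i ω)) * ∏ k ∈ A \ B, a k (x n ω)) μ := fun B =>
    (hI n B (A \ B)).integrable_mul (hind n B) (hx n _)
  simp only [hexp]
  rw [integral_finsetSum _ fun B _ => hmul B]
  refine Finset.sum_congr rfl fun B _ => ?_
  rw [(hI n B (A \ B)).integral_fun_mul_eq_mul_integral (hind n B).aestronglyMeasurable
    (hx n _).aestronglyMeasurable]
  congr 1
  exact (hlaw n).integral_comp (f := fun y => ∏ k ∈ A \ B, a k y) (hint _).aestronglyMeasurable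

/-- The normalized sum of `f` over the first `n` observations. -/
def normSum (x : ℕ → Ω → 𝒳) (n : ℕ) (f : 𝒳 → ℝ) (ω : Ω) : ℝ :=
  (√(n : ℝ))⁻¹ * ∑ i ∈ Finset.range n, f (x i ω)

lemma integrable_prod_normSum (hind : iIndepFun x μ) (hlaw : ∀ i, HasLaw (x i) P μ)
    {a : K → 𝒳 → ℝ} (ha : ∀ k, Measurable (a k))
    (hint : ∀ B : Finset K, Integrable (fun y => ∏ k ∈ B, a k y) P) (n : ℕ) (A : Finset K) :
    Integrable (fun ω => ∏ k ∈ A, normSum x n (a k) ω) μ := by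
  simp only [normSum, Finset.prod_mul_distrib]
  exact (integrable_prod_sums hind hlaw ha hint n A).1.const_mul _

variable [IsProbabilityMeasure P]

lemma integral_prod_sums_one (hind : iIndepFun x μ) (hlaw : ∀ i, HasLaw (x i) P μ)
    {a : K → 𝒳 → ℝ} (ha : ∀ k, Measurable (a k))
    (hint : ∀ B : Finset K, Integrable (fun y => ∏ k ∈ B, a k y) P)
    (hmean : ∀ k, ∫ y, a k y ∂P = 0) (n : ℕ) (i : K) :
    ∫ ω, ∏ k ∈ {i}, ∑ i ∈ Finset.range n, a k (x i ω) ∂μ = 0 := by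
  induction n with
  | zero => simp
  | succ n ih =>
    rw [(integrable_prod_sums hind hlaw ha hint n {i}).2, ← insert_empty_eq,
      Finset.sum_powerset_insert (by simp)]
    simp only [insert_empty_eq, Finset.powerset_empty, Finset.sum_singleton, ih]
    simp [hmean]

lemma integral_prod_sums_two (hind : iIndepFun x μ) (hlaw : ∀ i, HasLaw (x i) P μ)
    {a : K → 𝒳 → ℝ} (ha : ∀ k, Measurable (a k))
    (hint : ∀ B : Finset K, Integrable (fun y => ∏ k ∈ B, a k y) P)
    (hmean : ∀ k, ∫ y, a k y ∂P = 0) (n : ℕ) {i j : K} (hij : i ≠ j) :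
    ∫ ω, ∏ k ∈ {i, j}, ∑ i ∈ Finset.range n, a k (x i ω) ∂μ = n * ∫ y, a i y * a j y ∂P := by
  induction n with
  | zero => simp [hij]
  | succ n ih =>
    have h1 := integral_prod_sums_one hind hlaw ha hint hmean n
    rw [(integrable_prod_sums hind hlaw ha hint n _).2,
      Finset.sum_powerset_insert (by simpa using hij),
      show ({j} : Finset K) = insert j ∅ from rfl, Finset.sum_powerset_insert (by simp),
      Finset.sum_powerset_insert (by simp)]
    have e2 : ({i, j} : Finset K) \ {i, j} = ∅ := by simp
    simp only [insert_empty_eq, Finset.powerset_empty, Finset.sum_singleton] at h1 ih ⊢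
    rw [ih, h1, h1, e2]
    simp [hij, hmean]
    ring

/-- In the recursion a set B of one or two elements contributes nothing, because a single centered
factor splits off. Only B = ∅ adds to the previous value. -/
lemma integral_prod_sums_three (hind : iIndepFun x μ) (hlaw : ∀ i, HasLaw (x i) P μ)
    {a : Fin 3 → 𝒳 → ℝ} (ha : ∀ k, Measurable (a k))
    (hint : ∀ B : Finset (Fin 3), Integrable (fun y => ∏ k ∈ B, a k y) P)
    (hmean : ∀ k, ∫ y, a k y ∂P = 0) (n : ℕ) :
    ∫ ω, ∏ k ∈ {0, 1, 2}, ∑ i ∈ Finset.range n, a k (x i ω) ∂μ =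
      n * ∫ y, a 0 y * a 1 y * a 2 y ∂P := by
  induction n with
  | zero => simp
  | succ n ih =>
    have h1 := integral_prod_sums_one hind hlaw ha hint hmean n
    have h2 := fun i j hij => integral_prod_sums_two hind hlaw ha hint hmean n (i := i) (j := j) hij
    rw [(integrable_prod_sums hind hlaw ha hint n _).2]
    have hp : ({0, 1, 2} : Finset (Fin 3)).powerset =
      {∅, {0}, {1}, {2}, {0, 1}, {0, 2}, {1, 2}, {0, 1, 2}} := by decide
    have s1 : ({0, 1, 2} : Finset (Fin 3)) \ {0, 1} = {2} := by decide
    have s2 : ({0, 1, 2} : Finset (Fin 3)) \ {0, 2} = {1} := by decide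
    have s3 : ({0, 1, 2} : Finset (Fin 3)) \ {1, 2} = {0} := by decide
    rw [hp]
    repeat rw [Finset.sum_insert (by decide)]
    rw [Finset.sum_singleton, h1, h1, h1, ih, s1, s2, s3]
    simp [hmean]
    simp only [mul_assoc]
    ring

/-- The two-element sets B now survive. Each of the three pairings arises from two of them and gains
2n in the step from n to n + 1, which adds up to n (n - 1). -/
lemma integral_prod_sums_four (hind : iIndepFun x μ) (hlaw : ∀ i, HasLaw (x i) P μ)
    {a : Fin 4 → 𝒳 → ℝ} (ha : ∀ k, Measurable (a k))
    (hint : ∀ B : Finset (Fin 4), Integrable (fun y => ∏ k ∈ B, a k y) P)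
    (hmean : ∀ k, ∫ y, a k y ∂P = 0) (n : ℕ) :
    ∫ ω, ∏ k ∈ {0, 1, 2, 3}, ∑ i ∈ Finset.range n, a k (x i ω) ∂μ =
      n * ∫ y, a 0 y * a 1 y * a 2 y * a 3 y ∂P + n * (n - 1) *
        ((∫ y, a 0 y * a 1 y ∂P) * (∫ y, a 2 y * a 3 y ∂P) +
        (∫ y, a 0 y * a 2 y ∂P) * (∫ y, a 1 y * a 3 y ∂P) +
        (∫ y, a 0 y * a 3 y ∂P) * (∫ y, a 1 y * a 2 y ∂P)) := by
  induction n with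
  | zero => simp
  | succ n ih =>
    have h1 := integral_prod_sums_one hind hlaw ha hint hmean n
    have h2 := fun i j hij => integral_prod_sums_two hind hlaw ha hint hmean n (i := i) (j := j) hij
    rw [(integrable_prod_sums hind hlaw ha hint n _).2]
    have hp : ({0, 1, 2, 3} : Finset (Fin 4)).powerset =
      {∅, {0}, {1}, {2}, {3}, {0, 1}, {0, 2}, {0, 3}, {1, 2}, {1, 3}, {2, 3}, {0, 1, 2}, {0, 1, 3},
        {0, 2, 3}, {1, 2, 3}, {0, 1, 2, 3}} := by decide
    have t1 : ({0, 1, 2, 3} : Finset (Fin 4)) \ {0, 1, 2} = {3} := by decide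
    have t2 : ({0, 1, 2, 3} : Finset (Fin 4)) \ {0, 1, 3} = {2} := by decide
    have t3 : ({0, 1, 2, 3} : Finset (Fin 4)) \ {0, 2, 3} = {1} := by decide
    have t4 : ({0, 1, 2, 3} : Finset (Fin 4)) \ {1, 2, 3} = {0} := by decide
    have s1 : ({0, 1, 2, 3} : Finset (Fin 4)) \ {0, 1} = {2, 3} := by decide
    have s2 : ({0, 1, 2, 3} : Finset (Fin 4)) \ {0, 2} = {1, 3} := by decide
    have s3 : ({0, 1, 2, 3} : Finset (Fin 4)) \ {0, 3} = {1, 2} := by decide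
    have s4 : ({0, 1, 2, 3} : Finset (Fin 4)) \ {1, 2} = {0, 3} := by decide
    have s5 : ({0, 1, 2, 3} : Finset (Fin 4)) \ {1, 3} = {0, 2} := by decide
    have s6 : ({0, 1, 2, 3} : Finset (Fin 4)) \ {2, 3} = {0, 1} := by decide
    rw [hp]
    repeat rw [Finset.sum_insert (by decide)]
    rw [Finset.sum_singleton, h1, h1, h1, h1, h2 0 1 (by decide), h2 0 2 (by decide),
      h2 0 3 (by decide), h2 1 2 (by decide), h2 1 3 (by decide), h2 2 3 (by decide), ih, t1, t2,
      t3, t4, s1, s2, s3, s4, s5, s6]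
    simp [hmean]
    simp only [mul_assoc]
    ring

lemma integral_normSum_two (hind : iIndepFun x μ) (hlaw : ∀ i, HasLaw (x i) P μ)
    {a : Fin 2 → 𝒳 → ℝ} (ha : ∀ k, Measurable (a k))
    (hint : ∀ B : Finset (Fin 2), Integrable (fun y => ∏ k ∈ B, a k y) P)
    (hmean : ∀ k, ∫ y, a k y ∂P = 0) {n : ℕ} (hn : n ≠ 0) :
    ∫ ω, normSum x n (a 0) ω * normSum x n (a 1) ω ∂μ = ∫ y, a 0 y * a 1 y ∂P := by
  have h := integral_prod_sums_two hind hlaw ha hint hmean n (i := 0) (j := 1) (by decide)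
  have hn' : (0 : ℝ) < n := by positivity
  have e : ∀ ω, normSum x n (a 0) ω * normSum x n (a 1) ω =
      (n : ℝ)⁻¹ * ∏ k ∈ {0, 1}, ∑ i ∈ Finset.range n, a k (x i ω) := by
    intro ω
    have hs : (√(n : ℝ))⁻¹ * (√(n : ℝ))⁻¹ = (n : ℝ)⁻¹ := by
      rw [← mul_inv, Real.mul_self_sqrt hn'.le]
    simp only [normSum]
    rw [Finset.prod_insert (by decide), Finset.prod_singleton, ← hs]
    ring
  simp only [e]
  rw [integral_const_mul, h]
  field_simp

lemma tendsto_integral_normSum_three (hind : iIndepFun x μ) (hlaw : ∀ i, HasLaw (x i) P μ)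
    {a : Fin 3 → 𝒳 → ℝ} (ha : ∀ k, Measurable (a k))
    (hint : ∀ B : Finset (Fin 3), Integrable (fun y => ∏ k ∈ B, a k y) P)
    (hmean : ∀ k, ∫ y, a k y ∂P = 0) :
    Tendsto (fun n => ∫ ω, normSum x n (a 0) ω * normSum x n (a 1) ω * normSum x n (a 2) ω ∂μ)
      atTop (𝓝 0) := by
  have hlim : Tendsto (fun n : ℕ => (√(n : ℝ))⁻¹ * ∫ y, a 0 y * a 1 y * a 2 y ∂P) atTop (𝓝 0) := by
    have : Tendsto (fun n : ℕ => (√(n : ℝ))⁻¹) atTop (𝓝 0) :=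
      tendsto_inv_atTop_zero.comp (Real.tendsto_sqrt_atTop.comp tendsto_natCast_atTop_atTop)
    simpa using this.mul_const _
  refine hlim.congr' ?_
  filter_upwards [eventually_gt_atTop 0] with n hn
  have h := integral_prod_sums_three hind hlaw ha hint hmean n
  have hn' : (0 : ℝ) < n := by exact_mod_cast hn
  have hs : (√(n : ℝ))⁻¹ * (√(n : ℝ))⁻¹ = (n : ℝ)⁻¹ := by
    rw [← mul_inv, Real.mul_self_sqrt hn'.le]
  have e : ∀ ω, normSum x n (a 0) ω * normSum x n (a 1) ω * normSum x n (a 2) ω =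
      (√(n : ℝ))⁻¹ * (n : ℝ)⁻¹ * ∏ k ∈ {0, 1, 2}, ∑ i ∈ Finset.range n, a k (x i ω) := by
    intro ω
    simp only [normSum]
    rw [Finset.prod_insert (by decide), Finset.prod_insert (by decide), Finset.prod_singleton, ← hs]
    ring
  simp only [e]
  rw [integral_const_mul, h]
  field_simp

/-- Wick's formula in the limit: after division by n² the n (n - 1) pair terms remain and the n
diagonal terms vanish, so that the limit depends on covariances only. -/
lemma tendsto_integral_normSum_four (hind : iIndepFun x μ) (hlaw : ∀ i, HasLaw (x i) P μ)
    {a : Fin 4 → 𝒳 → ℝ} (ha : ∀ k, Measurable (a k))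
    (hint : ∀ B : Finset (Fin 4), Integrable (fun y => ∏ k ∈ B, a k y) P)
    (hmean : ∀ k, ∫ y, a k y ∂P = 0) :
    Tendsto (fun n => ∫ ω, normSum x n (a 0) ω * normSum x n (a 1) ω * normSum x n (a 2) ω *
        normSum x n (a 3) ω ∂μ) atTop
      (𝓝 ((∫ y, a 0 y * a 1 y ∂P) * (∫ y, a 2 y * a 3 y ∂P) +
        (∫ y, a 0 y * a 2 y ∂P) * (∫ y, a 1 y * a 3 y ∂P) +
        (∫ y, a 0 y * a 3 y ∂P) * (∫ y, a 1 y * a 2 y ∂P))) := by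
  set e4 := ∫ y, a 0 y * a 1 y * a 2 y * a 3 y ∂P with he4
  set pr := (∫ y, a 0 y * a 1 y ∂P) * (∫ y, a 2 y * a 3 y ∂P) +
        (∫ y, a 0 y * a 2 y ∂P) * (∫ y, a 1 y * a 3 y ∂P) +
        (∫ y, a 0 y * a 3 y ∂P) * (∫ y, a 1 y * a 2 y ∂P) with hpr
  have hlim : Tendsto (fun n : ℕ => (n : ℝ)⁻¹ * e4 + (1 - (n : ℝ)⁻¹) * pr) atTop (𝓝 pr) := by
    have : Tendsto (fun n : ℕ => (n : ℝ)⁻¹) atTop (𝓝 0) :=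
      tendsto_inv_atTop_zero.comp tendsto_natCast_atTop_atTop
    simpa using (this.mul_const e4).add ((this.const_sub 1).mul_const pr)
  refine hlim.congr' ?_
  filter_upwards [eventually_gt_atTop 0] with n hn
  have h := integral_prod_sums_four hind hlaw ha hint hmean n
  have hn' : (0 : ℝ) < n := by exact_mod_cast hn
  have hs : (√(n : ℝ))⁻¹ * (√(n : ℝ))⁻¹ = (n : ℝ)⁻¹ := by
    rw [← mul_inv, Real.mul_self_sqrt hn'.le]
  have e : ∀ ω, normSum x n (a 0) ω * normSum x n (a 1) ω * normSum x n (a 2) ω *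
      normSum x n (a 3) ω = (n : ℝ)⁻¹ * (n : ℝ)⁻¹ *
        ∏ k ∈ {0, 1, 2, 3}, ∑ i ∈ Finset.range n, a k (x i ω) := by
    intro ω
    simp only [normSum]
    rw [Finset.prod_insert (by decide), Finset.prod_insert (by decide),
      Finset.prod_insert (by decide), Finset.prod_singleton, ← hs]
    ring
  simp only [e]
  rw [integral_const_mul, h, ← he4, ← hpr]
  field_simp

end Moments

/-! ### Dual representation of the implied probabilities -/

section Weights

variable {n m : ℕ}

lemma sum_inner_weights {v : Fin n → EuclideanSpace ℝ (Fin m)} {w : Fin n → ℝ}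
    (hw : ∑ i, w i • v i = 0) (l : EuclideanSpace ℝ (Fin m)) : ∑ i, w i * ⟪l, v i⟫_ℝ = 0 := by
  have : ⟪l, ∑ i, w i • v i⟫_ℝ = ∑ i, w i * ⟪l, v i⟫_ℝ := by
    simp [inner_sum, inner_smul_right]
  rw [← this, hw, inner_zero_right]

/-- With uᵢ = n (1 - l·vᵢ), every feasible w' satisfies ∑ w'ᵢ uᵢ = n, so the tangent inequality log
(w'u) ≤ w'u - 1 sums to the comparison without loss. That the weights sum to one follows from 1 / (1
- t) = 1 + t / (1 - t) and the moment constraint. -/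
lemma isELWeights_of_dual {v : Fin n → EuclideanSpace ℝ (Fin m)} {l : EuclideanSpace ℝ (Fin m)}
    (hn : n ≠ 0) (hpos : ∀ i, 0 < 1 - ⟪l, v i⟫_ℝ)
    (hzero : ∑ i, (1 - ⟪l, v i⟫_ℝ)⁻¹ • v i = 0) :
    IsELWeights v (fun i => ((n : ℝ) * (1 - ⟪l, v i⟫_ℝ))⁻¹) := by
  have hn' : (0 : ℝ) < n := by positivity
  have hz : ∑ i, ((n : ℝ) * (1 - ⟪l, v i⟫_ℝ))⁻¹ • v i = 0 := by
    simp only [mul_inv, mul_smul, ← Finset.smul_sum, hzero, smul_zero]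
  have hwpos : ∀ i, 0 < ((n : ℝ) * (1 - ⟪l, v i⟫_ℝ))⁻¹ := fun i => by have := hpos i; positivity
  have hone : ∑ i, ((n : ℝ) * (1 - ⟪l, v i⟫_ℝ))⁻¹ = 1 := by
    have h1 := sum_inner_weights hz l
    have h2 : ∀ i, ((n : ℝ) * (1 - ⟪l, v i⟫_ℝ))⁻¹ =
        (n : ℝ)⁻¹ + ((n : ℝ) * (1 - ⟪l, v i⟫_ℝ))⁻¹ * ⟪l, v i⟫_ℝ := fun i => by
      have := (hpos i).ne'
      field_simp
      ring
    rw [Finset.sum_congr rfl fun i _ => h2 i, Finset.sum_add_distrib, h1]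
    simp [hn'.ne']
  refine ⟨⟨fun i => (hwpos i).le, hone, hz⟩, hwpos, fun w' hw' hw'pos => ?_⟩
  unfold klDiscrepancy
  refine mul_le_mul_of_nonneg_left ?_ (by positivity)
  have h3 : ∑ i, w' i * (n * (1 - ⟪l, v i⟫_ℝ)) = n := by
    have := sum_inner_weights hw'.2.2 l
    calc ∑ i, w' i * (n * (1 - ⟪l, v i⟫_ℝ)) = n * (∑ i, w' i) - n * ∑ i, w' i * ⟪l, v i⟫_ℝ := by
          rw [Finset.mul_sum, Finset.mul_sum, ← Finset.sum_sub_distrib]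
          exact Finset.sum_congr rfl fun i _ => by ring
      _ = n := by rw [this, hw'.2.1]; ring
  have h4 : ∀ i, -Real.log (n * ((n : ℝ) * (1 - ⟪l, v i⟫_ℝ))⁻¹) ≤
      -Real.log (n * w' i) + (w' i * (n * (1 - ⟪l, v i⟫_ℝ)) - 1) := fun i => by
    have hp := hpos i
    have h5 := Real.log_le_sub_one_of_pos (x := w' i * (n * (1 - ⟪l, v i⟫_ℝ)))
      (by have := hw'pos i; positivity)
    have h6 : w' i * (n * (1 - ⟪l, v i⟫_ℝ)) = (n * w' i) * (1 - ⟪l, v i⟫_ℝ) := by ring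
    rw [h6, Real.log_mul (by have := hw'pos i; positivity) hp.ne'] at h5
    rw [mul_inv, ← mul_assoc, mul_inv_cancel₀ hn'.ne', one_mul, Real.log_inv, h6]
    linarith
  refine (Finset.sum_le_sum fun i _ => h4 i).trans (le_of_eq ?_)
  rw [Finset.sum_add_distrib, Finset.sum_sub_distrib, h3]
  simp

/-- Gibbs' inequality: the logarithm of the candidate is affine in the constraint functions, so the
cross entropy ∑ n w'ᵢ log (n ŵᵢ) takes the same value at all feasible w', and entropy dominates
cross entropy for weights of equal mass. -/
lemma isETWeights_of_dual {v : Fin n → EuclideanSpace ℝ (Fin m)} {l : EuclideanSpace ℝ (Fin m)}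
    (hn : n ≠ 0) (hzero : ∑ i, Real.exp ⟪l, v i⟫_ℝ • v i = 0) :
    IsETWeights v (fun i => Real.exp ⟪l, v i⟫_ℝ / ∑ k, Real.exp ⟪l, v k⟫_ℝ) := by
  have hn' : (0 : ℝ) < n := by positivity
  have : Nonempty (Fin n) := ⟨⟨0, Nat.pos_of_ne_zero hn⟩⟩
  set S := ∑ k, Real.exp ⟪l, v k⟫_ℝ with hS
  have hSpos : 0 < S := Finset.sum_pos (fun i _ => Real.exp_pos _) Finset.univ_nonempty
  have hz : ∑ i, (Real.exp ⟪l, v i⟫_ℝ / S) • v i = 0 := by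
    simp only [div_eq_inv_mul, mul_smul, ← Finset.smul_sum, hzero, smul_zero]
  have hone : ∑ i, Real.exp ⟪l, v i⟫_ℝ / S = 1 := by
    rw [← Finset.sum_div, ← hS, div_self hSpos.ne']
  refine ⟨⟨fun i => by positivity, hone, hz⟩, fun w' hw' => ?_⟩
  unfold entropyDiscrepancy
  refine mul_le_mul_of_nonneg_left ?_ (by positivity)
  have hlog : ∀ i, Real.log (n * (Real.exp ⟪l, v i⟫_ℝ / S)) = Real.log (n / S) + ⟪l, v i⟫_ℝ := by
    intro i
    rw [show (n : ℝ) * (Real.exp ⟪l, v i⟫_ℝ / S) = n / S * Real.exp ⟪l, v i⟫_ℝ by ring,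
      Real.log_mul (by positivity) (Real.exp_pos _).ne', Real.log_exp]
  have hval : ∀ w ∈ feasibleWeights v,
      ∑ i, n * w i * Real.log (n * (Real.exp ⟪l, v i⟫_ℝ / S)) = n * Real.log (n / S) := by
    intro w hw
    have h1 := sum_inner_weights hw.2.2 l
    calc ∑ i, n * w i * Real.log (n * (Real.exp ⟪l, v i⟫_ℝ / S))
        = n * Real.log (n / S) * ∑ i, w i + n * ∑ i, w i * ⟪l, v i⟫_ℝ := by
          rw [Finset.mul_sum, Finset.mul_sum, ← Finset.sum_add_distrib]
          exact Finset.sum_congr rfl fun i _ => by rw [hlog]; ring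
      _ = n * Real.log (n / S) := by rw [h1, hw.2.1]; ring
  rw [hval _ ⟨fun i => by positivity, hone, hz⟩, ← hval w' hw']
  have h4 : ∀ i, n * w' i * Real.log (n * (Real.exp ⟪l, v i⟫_ℝ / S)) ≤
      n * w' i * Real.log (n * w' i) + (n * (Real.exp ⟪l, v i⟫_ℝ / S) - n * w' i) := by
    intro i
    have he : 0 < n * (Real.exp ⟪l, v i⟫_ℝ / S) := by positivity
    -- A vanishing weight is treated apart because the tangent inequality below divides by it.
    rcases (hw'.1 i).eq_or_lt with h0 | h0
    · rw [← h0]; simpa using he.le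
    · have h5 := Real.log_le_sub_one_of_pos (x := n * (Real.exp ⟪l, v i⟫_ℝ / S) / (n * w' i))
        (by positivity)
      rw [Real.log_div he.ne' (by positivity)] at h5
      have h6 := mul_le_mul_of_nonneg_left h5 (by positivity : 0 ≤ n * w' i)
      have h7 : n * w' i * (n * (Real.exp ⟪l, v i⟫_ℝ / S) / (n * w' i) - 1) =
          n * (Real.exp ⟪l, v i⟫_ℝ / S) - n * w' i := by field_simp
      rw [h7] at h6
      linarith
  refine (Finset.sum_le_sum fun i _ => h4 i).trans (le_of_eq ?_)
  rw [Finset.sum_add_distrib, Finset.sum_sub_distrib, ← Finset.mul_sum, ← Finset.mul_sum, hone,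
    hw'.2.1]
  simp

/-- A linear functional that annihilates the directions along which the constraints stay satisfied
is a combination of the constraints. -/
lemma exists_multiplier {v : Fin n → EuclideanSpace ℝ (Fin m)} {c : Fin n → ℝ}
    (h : ∀ d : Fin n → ℝ, ∑ i, d i = 0 → ∑ i, d i • v i = 0 → ∑ i, d i * c i = 0) :
    ∃ (a : ℝ) (l : EuclideanSpace ℝ (Fin m)), ∀ i, c i = a + ⟪l, v i⟫_ℝ := by
  -- The index `none` stands for the total mass and `some j` for the j-th moment constraint. A
  -- functional that vanishes on the common kernel lies in the span of these functionals.
  let φ : Option (Fin m) → (Fin n → ℝ) →ₗ[ℝ] ℝ := fun o =>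
    match o with
    | none => ∑ i, LinearMap.proj i
    | some j => ∑ i, v i j • LinearMap.proj i
  let ψ : (Fin n → ℝ) →ₗ[ℝ] ℝ := ∑ i, c i • LinearMap.proj i
  have hker : (⨅ o, LinearMap.ker (φ o)) ≤ LinearMap.ker ψ := by
    intro d hd
    simp only [Submodule.mem_iInf, LinearMap.mem_ker] at hd ⊢
    have h0 := hd none
    have h1 := fun j => hd (some j)
    simp only [φ, LinearMap.sum_apply, LinearMap.proj_apply, LinearMap.smul_apply,
      smul_eq_mul] at h0 h1
    have := h d h0 (by
      ext j
      simp only [PiLp.zero_apply]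
      rw [← h1 j]
      simp [mul_comm])
    simp only [ψ, LinearMap.sum_apply, LinearMap.proj_apply, LinearMap.smul_apply, smul_eq_mul]
    rw [← this]
    exact Finset.sum_congr rfl fun i _ => mul_comm _ _
  have hs := mem_span_of_iInf_ker_le_ker hker
  obtain ⟨t, ht⟩ := (Submodule.mem_span_range_iff_exists_fun ℝ).1 hs
  refine ⟨t none, WithLp.toLp 2 fun j => t (some j), fun i => ?_⟩
  have := LinearMap.congr_fun ht (Pi.single i 1)
  simp only [φ, ψ, Fintype.sum_option, LinearMap.add_apply, LinearMap.sum_apply,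
    LinearMap.smul_apply, LinearMap.proj_apply, smul_eq_mul] at this
  simp only [Pi.single_apply, mul_ite, mul_one, mul_zero, Finset.sum_ite_eq', Finset.mem_univ,
    if_true] at this
  rw [← this]
  simp [PiLp.inner_apply, mul_comm]

/-- First-order condition for weights that minimize a separable discrepancy. -/
lemma exists_multiplier_of_min {v : Fin n → EuclideanSpace ℝ (Fin m)} {w : Fin n → ℝ}
    {f : Fin n → ℝ → ℝ} {c : Fin n → ℝ} (hw : w ∈ feasibleWeights v) (hpos : ∀ i, 0 < w i)
    (hf : ∀ i, HasDerivAt (f i) (c i) (w i))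
    (hmin : ∀ w' ∈ feasibleWeights v, (∀ i, 0 < w' i) → ∑ i, f i (w i) ≤ ∑ i, f i (w' i)) :
    ∃ (a : ℝ) (l : EuclideanSpace ℝ (Fin m)), ∀ i, c i = a + ⟪l, v i⟫_ℝ := by
  refine exists_multiplier fun d hd0 hd1 => ?_
  -- Since w is strictly positive, w + t d is feasible for small t of both signs, so the derivative
  -- in each admissible direction d vanishes.
  let F : ℝ → ℝ := fun t => ∑ i, f i (w i + t * d i)
  have hF : HasDerivAt F (∑ i, d i * c i) 0 := by
    have : ∀ i, HasDerivAt (fun t => f i (w i + t * d i)) (c i * d i) 0 := by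
      intro i
      have h1 : HasDerivAt (fun t : ℝ => w i + t * d i) (d i) 0 := by
        simpa using ((hasDerivAt_id (0 : ℝ)).mul_const (d i)).const_add (w i)
      have h2 : HasDerivAt (f i) (c i) (w i + 0 * d i) := by simpa using hf i
      exact h2.comp 0 h1
    have h3 := HasDerivAt.fun_sum fun i (_ : i ∈ Finset.univ) => this i
    simpa [F, mul_comm] using h3
  refine IsLocalMin.hasDerivAt_eq_zero (f := F) (a := 0) ?_ hF
  have hev : ∀ᶠ t : ℝ in 𝓝 0, ∀ i, 0 < w i + t * d i := by
    rw [eventually_all]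
    intro i
    have : Tendsto (fun t : ℝ => w i + t * d i) (𝓝 0) (𝓝 (w i + 0 * d i)) :=
      (tendsto_id.mul_const _).const_add _
    refine this.eventually_const_lt ?_
    simpa using hpos i
  filter_upwards [hev] with t ht
  have := hmin (fun i => w i + t * d i) ⟨fun i => (ht i).le, ?_, ?_⟩ ht
  · simpa [F] using this
  · rw [Finset.sum_add_distrib, ← Finset.mul_sum, hd0, hw.2.1]; simp
  · simp only [add_smul, mul_smul, Finset.sum_add_distrib, ← Finset.smul_sum, hd1, hw.2.2]; simp

/-- Stationarity reads -1 / wᵢ = a + l·vᵢ. Multiplication by wᵢ and summation over i force a = -n,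
so only the moment multiplier, divided by n, remains. -/
lemma IsELWeights.exists_dual {v : Fin n → EuclideanSpace ℝ (Fin m)} {w : Fin n → ℝ}
    (h : IsELWeights v w) : ∃ l : EuclideanSpace ℝ (Fin m), ∀ i, (n * w i)⁻¹ = 1 - ⟪l, v i⟫_ℝ := by
  obtain ⟨hw, hpos, hmin⟩ := h
  rcases Nat.eq_zero_or_pos n with rfl | hn
  · exact ⟨0, fun i => i.elim0⟩
  have hn' : (0 : ℝ) < n := by exact_mod_cast hn
  obtain ⟨a, l, hl⟩ := exists_multiplier_of_min (f := fun _ t => -Real.log (n * t))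
    (c := fun i => -(w i)⁻¹) hw hpos (fun i => by
      have h1 := (Real.hasDerivAt_log (x := n * w i) (by have := hpos i; positivity)).comp (w i)
        ((hasDerivAt_id (w i)).const_mul (n : ℝ))
      have h2 := h1.neg
      convert! h2 using 1
      have := (hpos i).ne'
      field_simp) (fun w' hw' hw'pos => by
      have := hmin w' hw' hw'pos
      unfold klDiscrepancy at this
      exact le_of_mul_le_mul_left this (by positivity))
  have h0 := sum_inner_weights hw.2.2 l
  have ha : a = -n := by
    have h1 : ∀ i, w i * a + w i * ⟪l, v i⟫_ℝ = -1 := fun i => by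
      rw [← mul_add, ← hl i]
      have := (hpos i).ne'
      field_simp
    have h2 := Finset.sum_congr rfl fun i (_ : i ∈ Finset.univ) => h1 i
    rw [Finset.sum_add_distrib, h0, ← Finset.sum_mul, hw.2.1] at h2
    simpa using h2
  refine ⟨(n : ℝ)⁻¹ • l, fun i => ?_⟩
  rw [inner_smul_left, mul_inv]
  have := hl i
  rw [ha] at this
  have h3 : (w i)⁻¹ = n - ⟪l, v i⟫_ℝ := by linarith
  rw [h3]
  simp
  field_simp

/-- Positivity has to be assumed here, because the entropy stays finite on the boundary of the
simplex. The constant a is kept as an unknown; the normalization of the weights later serves as an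
equation for it. -/
lemma IsETWeights.exists_dual {v : Fin n → EuclideanSpace ℝ (Fin m)} {w : Fin n → ℝ}
    (h : IsETWeights v w) (hpos : ∀ i, 0 < w i) :
    ∃ (a : ℝ) (l : EuclideanSpace ℝ (Fin m)), ∀ i, Real.log (n * w i) = a + ⟪l, v i⟫_ℝ := by
  obtain ⟨hw, hmin⟩ := h
  rcases Nat.eq_zero_or_pos n with rfl | hn
  · exact ⟨0, 0, fun i => i.elim0⟩
  have hn' : (0 : ℝ) < n := by exact_mod_cast hn
  obtain ⟨a, l, hl⟩ := exists_multiplier_of_min (f := fun _ t => n * t * Real.log (n * t))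
    (c := fun i => n * Real.log (n * w i) + n) hw hpos (fun i => by
      have hd := (hasDerivAt_id (w i)).const_mul (n : ℝ)
      have h1 := (Real.hasDerivAt_log (x := n * w i) (by have := hpos i; positivity)).comp (w i) hd
      have h2 := hd.mul h1
      convert! h2 using 1
      have := (hpos i).ne'
      simp
      field_simp) (fun w' hw' _ => by
      have := hmin w' hw'
      unfold entropyDiscrepancy at this
      exact le_of_mul_le_mul_left this (by positivity))
  refine ⟨(n : ℝ)⁻¹ * a - 1, (n : ℝ)⁻¹ • l, fun i => ?_⟩
  rw [inner_smul_left]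
  have := hl i
  have h3 : Real.log (n * w i) = (n : ℝ)⁻¹ * (a + ⟪l, v i⟫_ℝ) - 1 := by
    rw [← this]; field_simp; ring
  rw [h3]
  simp
  ring

end Weights

/-! ### Existence of the implied probabilities through the convex dual problem -/

section DualExistence

variable {n m : ℕ}

/-- A convex dual problem has an interior solution in a small ball. -/
lemma exists_dual_critical {v : Fin n → EuclideanSpace ℝ (Fin m)} (hn : n ≠ 0) {c r κ : ℝ}
    (hr : 0 < r) (hκ : 0 < κ) {ρ ρ' : ℝ → ℝ}
    (hρ : ∀ t, |t| ≤ 1 / 2 → HasDerivAt ρ (ρ' t) t)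
    (hρκ : ∀ t, |t| ≤ 1 / 2 → ρ 0 + t + κ * t ^ 2 ≤ ρ t)
    (hcoer : ∀ l : EuclideanSpace ℝ (Fin m), c * ‖l‖ ^ 2 ≤ (n : ℝ)⁻¹ * ∑ i, ⟪l, v i⟫_ℝ ^ 2)
    (hsmall : ∀ i, ‖v i‖ * r ≤ 1 / 2) (hg : ‖(n : ℝ)⁻¹ • ∑ i, v i‖ < κ * c * r) :
    ∃ l : EuclideanSpace ℝ (Fin m), ‖l‖ ≤ r ∧ (∑ i, ρ' ⟪l, v i⟫_ℝ • v i = 0) ∧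
      ∑ i, ρ ⟪l, v i⟫_ℝ ≤ n * ρ 0 := by
  have hn' : (0 : ℝ) < n := by positivity
  let f : EuclideanSpace ℝ (Fin m) → ℝ := fun l => ∑ i, ρ ⟪l, v i⟫_ℝ
  have habs : ∀ l : EuclideanSpace ℝ (Fin m), ‖l‖ ≤ r → ∀ i, |⟪l, v i⟫_ℝ| ≤ 1 / 2 := by
    intro l hl i
    calc |⟪l, v i⟫_ℝ| ≤ ‖l‖ * ‖v i‖ := abs_real_inner_le_norm _ _
      _ ≤ r * ‖v i‖ := by gcongr
      _ ≤ 1 / 2 := by rw [mul_comm]; exact hsmall i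
  have hder : ∀ l : EuclideanSpace ℝ (Fin m), ‖l‖ ≤ r →
      HasFDerivAt f (∑ i, ρ' ⟪l, v i⟫_ℝ • innerSL ℝ (v i)) l := by
    intro l hl
    refine HasFDerivAt.fun_sum fun i _ => ?_
    have h1 : HasFDerivAt (fun l : EuclideanSpace ℝ (Fin m) => ⟪l, v i⟫_ℝ) (innerSL ℝ (v i)) l := by
      have := (innerSL ℝ (v i)).hasFDerivAt (x := l)
      refine this.congr_of_eventuallyEq (Eventually.of_forall fun l => ?_)
      simp [real_inner_comm]
    exact (hρ _ (habs l hl i)).comp_hasFDerivAt l h1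
  have hcont : ContinuousOn f (Metric.closedBall 0 r) := fun l hl =>
    (hder l (by simpa using hl)).continuousAt.continuousWithinAt
  obtain ⟨l, hl, hmin⟩ := (isCompact_closedBall (0 : EuclideanSpace ℝ (Fin m)) r).exists_isMinOn
    ⟨0, by simp [hr.le]⟩ hcont
  have hlr : ‖l‖ ≤ r := by simpa using hl
  have hle : f l ≤ n * ρ 0 := by
    have := hmin (show (0 : EuclideanSpace ℝ (Fin m)) ∈ Metric.closedBall 0 r by simp [hr.le])
    simpa [f] using this
  -- On the sphere ‖l‖ = r the quadratic gain κ c r² exceeds the linear loss r ‖mean of v‖, by `hg`.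
  -- A minimizer over the ball is therefore interior, hence a critical point.
  have hlt : ‖l‖ < r := by
    refine lt_of_le_of_ne hlr fun heq => ?_
    have h1 : n * ρ 0 + ∑ i, ⟪l, v i⟫_ℝ + κ * ∑ i, ⟪l, v i⟫_ℝ ^ 2 ≤ f l := by
      calc n * ρ 0 + ∑ i, ⟪l, v i⟫_ℝ + κ * ∑ i, ⟪l, v i⟫_ℝ ^ 2
          = ∑ i, (ρ 0 + ⟪l, v i⟫_ℝ + κ * ⟪l, v i⟫_ℝ ^ 2) := by
            rw [Finset.sum_add_distrib, Finset.sum_add_distrib, Finset.mul_sum]; simp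
        _ ≤ f l := Finset.sum_le_sum fun i _ => hρκ _ (habs l hlr i)
    have h2 : ∑ i, ⟪l, v i⟫_ℝ = n * ⟪l, (n : ℝ)⁻¹ • ∑ i, v i⟫_ℝ := by
      rw [inner_smul_right, inner_sum]; field_simp
    have h3 : -(r * ‖(n : ℝ)⁻¹ • ∑ i, v i‖) ≤ ⟪l, (n : ℝ)⁻¹ • ∑ i, v i⟫_ℝ := by
      have := neg_le_of_abs_le (abs_real_inner_le_norm l ((n : ℝ)⁻¹ • ∑ i, v i))
      rwa [heq] at this
    have h4 : c * r ^ 2 * n ≤ ∑ i, ⟪l, v i⟫_ℝ ^ 2 := by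
      have := hcoer l
      rw [heq, ← div_eq_inv_mul, le_div_iff₀ hn'] at this
      exact this
    have h5 : ∑ i, ⟪l, v i⟫_ℝ + κ * ∑ i, ⟪l, v i⟫_ℝ ^ 2 ≤ 0 := by linarith
    have h6 : n * (r * (κ * c * r - ‖(n : ℝ)⁻¹ • ∑ i, v i‖)) ≤ 0 := by
      rw [h2] at h5
      have h7 := mul_le_mul_of_nonneg_left h3 hn'.le
      have h8 := mul_le_mul_of_nonneg_left h4 hκ.le
      nlinarith
    have h9 : 0 < n * (r * (κ * c * r - ‖(n : ℝ)⁻¹ • ∑ i, v i‖)) := by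
      have : 0 < κ * c * r - ‖(n : ℝ)⁻¹ • ∑ i, v i‖ := by linarith
      positivity
    linarith
  refine ⟨l, hlr, ?_, hle⟩
  have hloc : IsLocalMin f l := hmin.isLocalMin (Metric.closedBall_mem_nhds_of_mem (by simpa using hlt))
  have hz := hloc.hasFDerivAt_eq_zero (hder l hlr)
  refine ext_inner_right ℝ fun h => ?_
  have := DFunLike.congr_fun hz h
  simp only [sum_inner, inner_smul_left, inner_zero_left]
  simpa using this

lemma one_add_add_sq_le_exp {t : ℝ} (ht : |t| ≤ 1 / 2) : 1 + t + 1 / 4 * t ^ 2 ≤ Real.exp t := by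
  have h1 := Real.add_one_le_exp (t / 2)
  have h2 : Real.exp t = Real.exp (t / 2) ^ 2 := by rw [← Real.exp_nat_mul]; ring_nf
  rw [h2]
  have := (abs_le.1 ht).1
  nlinarith

lemma add_sq_le_neg_log {t : ℝ} (ht : |t| ≤ 1 / 2) :
    t + 1 / 8 * t ^ 2 ≤ -Real.log (1 - t) := by
  have h1 := (abs_le.1 ht).1
  have h2 := (abs_le.1 ht).2
  have h4 : 1 - t ≤ Real.exp (-(t + 1 / 8 * t ^ 2)) := by
    have h5 := Real.add_one_le_exp (-(t + 1 / 8 * t ^ 2) / 2)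
    have h6 : Real.exp (-(t + 1 / 8 * t ^ 2)) = Real.exp (-(t + 1 / 8 * t ^ 2) / 2) ^ 2 := by
      rw [← Real.exp_nat_mul]; ring_nf
    rw [h6]
    have h7 : 0 ≤ -(t + 1 / 8 * t ^ 2) / 2 + 1 := by nlinarith
    have h8 := pow_le_pow_left₀ h7 h5 2
    refine le_trans ?_ h8
    -- With s = t + t²/8 this quantity is (1 - s/2)² - (1 - t).
    have h9 : 0 ≤ t ^ 2 * (1 / 8 + t / 16 + t ^ 2 / 256) := by
      have : 0 ≤ 1 / 8 + t / 16 + t ^ 2 / 256 := by nlinarith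
      positivity
    nlinarith
  have := Real.log_le_log (by linarith) h4
  rw [Real.log_exp] at this
  linarith

/-- The dual solution l lies in the ball of radius r, and log (1 - t) ≤ -t bounds the discrepancy by
the inner product of -l with the mean of v. In the application both r and the mean are of order
n^(-1/2), so the discrepancy is O(1/n). -/
lemma exists_isELWeights {v : Fin n → EuclideanSpace ℝ (Fin m)} (hn : n ≠ 0) {c r : ℝ}
    (hr : 0 < r)
    (hcoer : ∀ l : EuclideanSpace ℝ (Fin m), c * ‖l‖ ^ 2 ≤ (n : ℝ)⁻¹ * ∑ i, ⟪l, v i⟫_ℝ ^ 2)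
    (hsmall : ∀ i, ‖v i‖ * r ≤ 1 / 2) (hg : ‖(n : ℝ)⁻¹ • ∑ i, v i‖ < 1 / 8 * c * r) :
    ∃ w, IsELWeights v w ∧ klDiscrepancy w ≤ r * ‖(n : ℝ)⁻¹ • ∑ i, v i‖ := by
  have hn' : (0 : ℝ) < n := by positivity
  obtain ⟨l, hl, hz, -⟩ := exists_dual_critical hn hr (by norm_num : (0 : ℝ) < 1 / 8)
    (ρ := fun t => -Real.log (1 - t)) (ρ' := fun t => (1 - t)⁻¹) (fun t ht => by
      have h0 : 1 - t ≠ 0 := by have := (abs_le.1 ht).2; linarith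
      have h1 := ((Real.hasDerivAt_log h0).comp t ((hasDerivAt_id t).const_sub 1)).neg
      convert! h1 using 1
      simp)
    (fun t ht => by simpa using add_sq_le_neg_log ht) hcoer hsmall hg
  have hpos : ∀ i, 0 < 1 - ⟪l, v i⟫_ℝ := by
    intro i
    have h1 : |⟪l, v i⟫_ℝ| ≤ 1 / 2 :=
      calc |⟪l, v i⟫_ℝ| ≤ ‖l‖ * ‖v i‖ := abs_real_inner_le_norm _ _
        _ ≤ r * ‖v i‖ := by gcongr
        _ ≤ 1 / 2 := by rw [mul_comm]; exact hsmall i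
    have := (abs_le.1 h1).2
    linarith
  refine ⟨_, isELWeights_of_dual hn hpos hz, ?_⟩
  have h2 : ⟪-l, (n : ℝ)⁻¹ • ∑ i, v i⟫_ℝ ≤ r * ‖(n : ℝ)⁻¹ • ∑ i, v i‖ :=
    (real_inner_le_norm _ _).trans (by rw [norm_neg]; gcongr)
  refine le_trans ?_ h2
  rw [inner_smul_right, inner_sum]
  unfold klDiscrepancy
  refine mul_le_mul_of_nonneg_left (Finset.sum_le_sum fun i _ => ?_) (by positivity)
  dsimp only
  rw [mul_inv, ← mul_assoc, mul_inv_cancel₀ hn'.ne', one_mul, Real.log_inv, neg_neg, inner_neg_left]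
  have := Real.log_le_sub_one_of_pos (hpos i)
  linarith

/-- Comparison of the dual minimizer with l = 0 gives ∑ exp (l·vᵢ) ≤ n. Hence n wᵢ ≥ exp (l·vᵢ), so
-log (n wᵢ) ≤ -l·vᵢ, and the discrepancy is bounded as for EL. -/
lemma exists_isETWeights {v : Fin n → EuclideanSpace ℝ (Fin m)} (hn : n ≠ 0) {c r : ℝ}
    (hr : 0 < r)
    (hcoer : ∀ l : EuclideanSpace ℝ (Fin m), c * ‖l‖ ^ 2 ≤ (n : ℝ)⁻¹ * ∑ i, ⟪l, v i⟫_ℝ ^ 2)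
    (hsmall : ∀ i, ‖v i‖ * r ≤ 1 / 2) (hg : ‖(n : ℝ)⁻¹ • ∑ i, v i‖ < 1 / 4 * c * r) :
    ∃ w, IsETWeights v w ∧ (∀ i, 0 < w i) ∧
      klDiscrepancy w ≤ r * ‖(n : ℝ)⁻¹ • ∑ i, v i‖ := by
  have hn' : (0 : ℝ) < n := by positivity
  have : Nonempty (Fin n) := ⟨⟨0, Nat.pos_of_ne_zero hn⟩⟩
  obtain ⟨l, hl, hz, hle⟩ := exists_dual_critical hn hr (by norm_num : (0 : ℝ) < 1 / 4)
    (ρ := Real.exp) (ρ' := Real.exp) (fun t _ => Real.hasDerivAt_exp t)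
    (fun t ht => by simpa using one_add_add_sq_le_exp ht) hcoer hsmall hg
  have hSpos : 0 < ∑ k, Real.exp ⟪l, v k⟫_ℝ :=
    Finset.sum_pos (fun i _ => Real.exp_pos _) Finset.univ_nonempty
  refine ⟨_, isETWeights_of_dual hn hz, fun i => by positivity, ?_⟩
  have h2 : ⟪-l, (n : ℝ)⁻¹ • ∑ i, v i⟫_ℝ ≤ r * ‖(n : ℝ)⁻¹ • ∑ i, v i‖ :=
    (real_inner_le_norm _ _).trans (by rw [norm_neg]; gcongr)
  refine le_trans ?_ h2
  rw [inner_smul_right, inner_sum]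
  unfold klDiscrepancy
  refine mul_le_mul_of_nonneg_left (Finset.sum_le_sum fun i _ => ?_) (by positivity)
  rw [inner_neg_left, neg_le_neg_iff]
  have h3 : Real.exp ⟪l, v i⟫_ℝ ≤
      n * (Real.exp ⟪l, v i⟫_ℝ / ∑ k, Real.exp ⟪l, v k⟫_ℝ) := by
    rw [mul_div_assoc', le_div_iff₀ hSpos, mul_comm]
    simp only [Real.exp_zero, mul_one] at hle
    gcongr
  have := Real.log_le_log (Real.exp_pos _) h3
  rwa [Real.log_exp] at this

end DualExistence

/-! ### Quadratic bounds from the Kullback-Leibler discrepancy -/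

/-- The Hellinger bound: with s = √ρ the right side is s² - 1 - 2 log s, and log s ≤ s - 1. -/
lemma sqrt_sub_one_sq_le {ρ : ℝ} (hρ : 0 < ρ) : (√ρ - 1) ^ 2 ≤ ρ - 1 - Real.log ρ := by
  have h1 := Real.log_le_sub_one_of_pos (Real.sqrt_pos.2 hρ)
  have h2 : Real.log ρ = 2 * Real.log √ρ := by rw [Real.log_sqrt hρ.le]; ring
  have h3 := Real.sq_sqrt hρ.le
  nlinarith

/-- Quadratic bounds for a ratio of weights whose divergence is at most `K`. -/
lemma exists_quadratic_bound (K : ℝ) : ∃ C : ℝ, 0 < C ∧ ∀ ρ : ℝ, 0 < ρ →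
    ρ - 1 - Real.log ρ ≤ K → (ρ - 1) ^ 2 ≤ C * (ρ - 1 - Real.log ρ) ∧
      (ρ⁻¹ - 1) ^ 2 ≤ C * (ρ - 1 - Real.log ρ) ∧
      Real.log ρ ^ 2 ≤ C * (ρ - 1 - Real.log ρ) := by
  -- A bounds (√ρ + 1)², because |√ρ - 1| ≤ √K. The factor exp (K + 1)² in B bounds ρ⁻², because
  -- -log ρ ≤ K + 1.
  set A := (√K + 2) ^ 2 with hA
  set B := Real.exp (K + 1) ^ 2 * A with hB
  have hApos : 0 < A := by positivity
  have hBpos : 0 < B := by positivity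
  refine ⟨A + B, by positivity, fun ρ hρ hK => ?_⟩
  have h0 := sqrt_sub_one_sq_le hρ
  set H := ρ - 1 - Real.log ρ with hH
  have hH0 : 0 ≤ H := (sq_nonneg _).trans h0
  have h1 : |√ρ - 1| ≤ √K := Real.abs_le_sqrt (h0.trans hK)
  have h2 : √ρ + 1 ≤ √K + 2 := by linarith [(abs_le.1 h1).2]
  have h3 : (ρ - 1) ^ 2 ≤ A * H := by
    have h4 : (ρ - 1) ^ 2 = (√ρ + 1) ^ 2 * (√ρ - 1) ^ 2 := by
      have := Real.sq_sqrt hρ.le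
      rw [← mul_pow]
      congr 1
      nlinarith
    rw [h4]
    have : (√ρ + 1) ^ 2 ≤ A := pow_le_pow_left₀ (by positivity) h2 2
    gcongr
  have h5 : ρ⁻¹ ≤ Real.exp (K + 1) := by
    rw [← Real.exp_log (inv_pos.2 hρ), Real.log_inv]
    exact Real.exp_le_exp.2 (by linarith)
  have h6 : (ρ⁻¹ - 1) ^ 2 ≤ B * H := by
    have h7 : (ρ⁻¹ - 1) ^ 2 = ρ⁻¹ ^ 2 * (ρ - 1) ^ 2 := by field_simp; ring
    rw [h7, hB, mul_assoc]
    have : ρ⁻¹ ^ 2 ≤ Real.exp (K + 1) ^ 2 := pow_le_pow_left₀ (by positivity) h5 2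
    gcongr
  have hAH : 0 ≤ A * H := by positivity
  have hBH : 0 ≤ B * H := by positivity
  refine ⟨by linarith, by linarith, ?_⟩
  have h8 := Real.log_le_sub_one_of_pos hρ
  have h9 := Real.log_le_sub_one_of_pos (inv_pos.2 hρ)
  rw [Real.log_inv] at h9
  have : Real.log ρ ^ 2 ≤ (ρ - 1) ^ 2 + (ρ⁻¹ - 1) ^ 2 := by
    rcases le_total 0 (Real.log ρ) with h | h
    · have := pow_le_pow_left₀ h h8 2
      nlinarith [sq_nonneg (ρ⁻¹ - 1)]
    · have := pow_le_pow_left₀ (neg_nonneg.2 h) h9 2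
      nlinarith [sq_nonneg (ρ - 1)]
  linarith

/-- Weights with a discrepancy of order `1 / n` are close to `1 / n` in mean square. -/
lemma mean_sq_le_of_klDiscrepancy {n m : ℕ} (hn : n ≠ 0) {v : Fin n → EuclideanSpace ℝ (Fin m)}
    {w : Fin n → ℝ} (hw : w ∈ feasibleWeights v) (hpos : ∀ i, 0 < w i) {K C : ℝ}
    (hC : ∀ ρ : ℝ, 0 < ρ →
      ρ - 1 - Real.log ρ ≤ K → (ρ - 1) ^ 2 ≤ C * (ρ - 1 - Real.log ρ) ∧
      (ρ⁻¹ - 1) ^ 2 ≤ C * (ρ - 1 - Real.log ρ) ∧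
      Real.log ρ ^ 2 ≤ C * (ρ - 1 - Real.log ρ)) (hkl : n * klDiscrepancy w ≤ K) :
    (n : ℝ)⁻¹ * ∑ i, (n * w i - 1) ^ 2 ≤ C * klDiscrepancy w ∧
    (n : ℝ)⁻¹ * ∑ i, ((n * w i)⁻¹ - 1) ^ 2 ≤ C * klDiscrepancy w ∧
    (n : ℝ)⁻¹ * ∑ i, Real.log (n * w i) ^ 2 ≤ C * klDiscrepancy w := by
  have hn' : (0 : ℝ) < n := by positivity
  have hρ : ∀ i, 0 < n * w i := fun i => by have := hpos i; positivity
  -- Because ∑ n wᵢ = n, the linear parts cancel. The summands are nonnegative, so each single one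
  -- is at most K, and the quadratic bounds apply term by term.
  have hsum : ∑ i, (n * w i - 1 - Real.log (n * w i)) = n * klDiscrepancy w := by
    unfold klDiscrepancy
    rw [Finset.sum_sub_distrib, Finset.sum_sub_distrib, ← Finset.mul_sum, hw.2.1,
      ← mul_assoc, mul_inv_cancel₀ hn'.ne', Finset.sum_neg_distrib]
    simp
  have hnn : ∀ i, 0 ≤ n * w i - 1 - Real.log (n * w i) := fun i =>
    (sq_nonneg _).trans (sqrt_sub_one_sq_le (hρ i))
  have hb := fun i => hC _ (hρ i) ((Finset.single_le_sum (fun i _ => hnn i) (Finset.mem_univ i)).trans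
    (hsum.le.trans hkl))
  have hfin : ∀ f : Fin n → ℝ, (∀ i, f i ≤ C * (n * w i - 1 - Real.log (n * w i))) →
      (n : ℝ)⁻¹ * ∑ i, f i ≤ C * klDiscrepancy w := by
    intro f hf
    have h1 := Finset.sum_le_sum fun i (_ : i ∈ Finset.univ) => hf i
    rw [← Finset.mul_sum, hsum] at h1
    rw [← div_eq_inv_mul, div_le_iff₀ hn']
    linarith
  exact ⟨hfin _ fun i => (hb i).1, hfin _ fun i => (hb i).2.1, hfin _ fun i => (hb i).2.2⟩

/-! ### First-order conditions of the EL and ETEL estimators -/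

section FirstOrder

variable {n m p : ℕ}

/-- The derivative of `(θ, l) ↦ ⟪l, G θ⟫`. -/
def innerDeriv (D : EuclideanSpace ℝ (Fin p) →L[ℝ] EuclideanSpace ℝ (Fin m))
    (v l : EuclideanSpace ℝ (Fin m)) :
    EuclideanSpace ℝ (Fin p) × EuclideanSpace ℝ (Fin m) →L[ℝ] ℝ :=
  ((innerSL ℝ l).comp D).comp (ContinuousLinearMap.fst ℝ _ _) +
    (innerSL ℝ v).comp (ContinuousLinearMap.snd ℝ _ _)

lemma innerDeriv_apply (D : EuclideanSpace ℝ (Fin p) →L[ℝ] EuclideanSpace ℝ (Fin m))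
    (v l k : EuclideanSpace ℝ (Fin m)) (h : EuclideanSpace ℝ (Fin p)) :
    innerDeriv D v l (h, k) = ⟪l, D h⟫_ℝ + ⟪k, v⟫_ℝ := by
  simp [innerDeriv, real_inner_comm]

/-- Strict derivatives are what the Lagrange multiplier theorem asks for; continuous
differentiability supplies them. -/
lemma hasStrictFDerivAt_inner_snd {G : EuclideanSpace ℝ (Fin p) → EuclideanSpace ℝ (Fin m)}
    {θ : EuclideanSpace ℝ (Fin p)} (hG : ContDiffAt ℝ 1 G θ) (l : EuclideanSpace ℝ (Fin m)) :
    HasStrictFDerivAt (fun z : EuclideanSpace ℝ (Fin p) × EuclideanSpace ℝ (Fin m) =>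
      ⟪z.2, G z.1⟫_ℝ) (innerDeriv (fderiv ℝ G θ) (G θ) l) (θ, l) := by
  have hc : ContDiffAt ℝ 1 (fun z : EuclideanSpace ℝ (Fin p) × EuclideanSpace ℝ (Fin m) =>
      ⟪z.2, G z.1⟫_ℝ) (θ, l) :=
    contDiffAt_snd.inner ℝ (ContDiffAt.comp (θ, l) hG contDiffAt_fst)
  have h1 := hc.hasStrictFDerivAt one_ne_zero
  have h2 : HasFDerivAt (fun z : EuclideanSpace ℝ (Fin p) × EuclideanSpace ℝ (Fin m) =>
      ⟪z.2, G z.1⟫_ℝ) (innerDeriv (fderiv ℝ G θ) (G θ) l) (θ, l) := by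
    have hG' : HasFDerivAt G (fderiv ℝ G θ) θ := (hG.differentiableAt one_ne_zero).hasFDerivAt
    have hG2 : HasFDerivAt (fun z : EuclideanSpace ℝ (Fin p) × EuclideanSpace ℝ (Fin m) => G z.1)
        ((fderiv ℝ G θ).comp (ContinuousLinearMap.fst ℝ _ _)) (θ, l) :=
      HasFDerivAt.comp (θ, l) hG' hasFDerivAt_fst
    have h3 := HasFDerivAt.inner ℝ (hasFDerivAt_snd (𝕜 := ℝ) (p := (θ, l))) hG2
    refine h3.congr_fderiv ?_
    ext z <;> simp [innerDeriv, real_inner_comm]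
  rwa [h2.fderiv] at h1

/-- Lagrange multipliers for a minimum under the constraint `∑ τ(⟪l, Gᵢ θ⟫) Gᵢ θ = 0`. -/
lemma exists_lagrange_multiplier
    {G : Fin n → EuclideanSpace ℝ (Fin p) → EuclideanSpace ℝ (Fin m)}
    {θ : EuclideanSpace ℝ (Fin p)} (hG : ∀ i, ContDiffAt ℝ 1 (G i) θ)
    {l : EuclideanSpace ℝ (Fin m)} {τ : ℝ → ℝ} {τ' : Fin n → ℝ}
    (hτ : ∀ i, HasStrictDerivAt τ (τ' i) ⟪l, G i θ⟫_ℝ)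
    {φ : EuclideanSpace ℝ (Fin p) × EuclideanSpace ℝ (Fin m) → ℝ}
    {φ' : EuclideanSpace ℝ (Fin p) × EuclideanSpace ℝ (Fin m) →L[ℝ] ℝ}
    (hφ : HasStrictFDerivAt φ φ' (θ, l))
    (hzero : ∑ i, τ ⟪l, G i θ⟫_ℝ • G i θ = 0)
    (hmin : ∀ᶠ z in 𝓝 (θ, l), ∑ i, τ ⟪z.2, G i z.1⟫_ℝ • G i z.1 = 0 → φ (θ, l) ≤ φ z) :
    ∃ (κ : EuclideanSpace ℝ (Fin m)) (Λ₀ : ℝ), ¬ (κ = 0 ∧ Λ₀ = 0) ∧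
      ∀ h k, ∑ i, (τ' i * (⟪l, fderiv ℝ (G i) θ h⟫_ℝ + ⟪k, G i θ⟫_ℝ) * ⟪κ, G i θ⟫_ℝ +
        τ ⟪l, G i θ⟫_ℝ * ⟪κ, fderiv ℝ (G i) θ h⟫_ℝ) + Λ₀ * φ' (h, k) = 0 := by
  let F : EuclideanSpace ℝ (Fin p) × EuclideanSpace ℝ (Fin m) → EuclideanSpace ℝ (Fin m) :=
    fun z => ∑ i, τ ⟪z.2, G i z.1⟫_ℝ • G i z.1
  have hF : HasStrictFDerivAt F (∑ i, (τ ⟪l, G i θ⟫_ℝ •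
      ((fderiv ℝ (G i) θ).comp (ContinuousLinearMap.fst ℝ _ _)) +
      (τ' i • innerDeriv (fderiv ℝ (G i) θ) (G i θ) l).smulRight (G i θ))) (θ, l) := by
    refine HasStrictFDerivAt.fun_sum fun i _ => ?_
    have h1 : HasStrictFDerivAt (fun z : EuclideanSpace ℝ (Fin p) × EuclideanSpace ℝ (Fin m) =>
        τ ⟪z.2, G i z.1⟫_ℝ) (τ' i • innerDeriv (fderiv ℝ (G i) θ) (G i θ) l) (θ, l) :=
      HasStrictDerivAt.comp_hasStrictFDerivAt (θ, l) (hτ i) (hasStrictFDerivAt_inner_snd (hG i) l)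
    have h2 : HasStrictFDerivAt (fun z : EuclideanSpace ℝ (Fin p) × EuclideanSpace ℝ (Fin m) =>
        G i z.1) ((fderiv ℝ (G i) θ).comp (ContinuousLinearMap.fst ℝ _ _)) (θ, l) :=
      HasStrictFDerivAt.comp (θ, l) ((hG i).hasStrictFDerivAt one_ne_zero) hasStrictFDerivAt_fst
    exact h1.smul h2
  have hext : IsLocalExtrOn φ {z | F z = F (θ, l)} (θ, l) := by
    refine Or.inl ?_
    have hF0 : F (θ, l) = 0 := hzero
    refine eventually_nhdsWithin_iff.2 ?_
    filter_upwards [hmin] with z hz hzF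
    exact hz (hzF.trans hF0)
  -- No constraint qualification is imposed, so the multiplier Λ₀ of the objective might vanish.
  -- This is excluded in each application by nondegeneracy of the second sample moments.
  obtain ⟨Λ, Λ₀, hne, hΛ⟩ := hext.exists_linear_map_of_hasStrictFDerivAt hF hφ
  let κ := (InnerProductSpace.toDual ℝ (EuclideanSpace ℝ (Fin m))).symm Λ.toContinuousLinearMap
  have hκ : ∀ y, Λ y = ⟪κ, y⟫_ℝ := fun y => by simp [κ]
  refine ⟨κ, Λ₀, ?_, fun h k => ?_⟩
  · rintro ⟨h1, h2⟩
    refine hne (Prod.ext (LinearMap.ext fun y => ?_) h2)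
    simp [hκ, h1]
  · have h1 := hΛ (h, k)
    rw [hκ] at h1
    rw [← h1, smul_eq_mul]
    congr 1
    simp only [FunLike.coe_sum, Finset.sum_apply, inner_sum]
    refine Finset.sum_congr rfl fun i _ => ?_
    simp [innerDeriv_apply, inner_add_right, inner_smul_right]
    ring

/-- First-order conditions of the EL estimator. -/
lemma IsELEstimate.foc {𝒳 : Type*} {g : 𝒳 → EuclideanSpace ℝ (Fin p) → EuclideanSpace ℝ (Fin m)}
    {Θ : Set (EuclideanSpace ℝ (Fin p))} {xs : Fin n → 𝒳} {θ : EuclideanSpace ℝ (Fin p)}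
    (hn : n ≠ 0) (hint : θ ∈ interior Θ) (hG : ∀ i, ContDiffAt ℝ 1 (g (xs i)) θ)
    {w : Fin n → ℝ} (hw : IsELWeights (fun i => g (xs i) θ) w)
    (hmin : ∀ θ' ∈ Θ, ∀ w', IsELWeights (fun i => g (xs i) θ') w' →
      klDiscrepancy w ≤ klDiscrepancy w')
    {l : EuclideanSpace ℝ (Fin m)} (hl : ∀ i, (n * w i)⁻¹ = 1 - ⟪l, g (xs i) θ⟫_ℝ)
    (hcoer : ∀ k : EuclideanSpace ℝ (Fin m), ∑ i, ⟪k, g (xs i) θ⟫_ℝ ^ 2 = 0 → k = 0)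
    (h : EuclideanSpace ℝ (Fin p)) :
    (n : ℝ)⁻¹ * ∑ i, (1 - ⟪l, g (xs i) θ⟫_ℝ)⁻¹ * ⟪l, fderiv ℝ (g (xs i)) θ h⟫_ℝ = 0 := by
  have hn' : (0 : ℝ) < n := by positivity
  obtain ⟨hfeas, hpos, -⟩ := hw
  have hT : ∀ i, 0 < 1 - ⟪l, g (xs i) θ⟫_ℝ := fun i => by
    rw [← hl i]; have := hpos i; positivity
  have hwi : ∀ i, n * w i = (1 - ⟪l, g (xs i) θ⟫_ℝ)⁻¹ := fun i => by rw [← hl i, inv_inv]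
  have hzero : ∑ i, (1 - ⟪l, g (xs i) θ⟫_ℝ)⁻¹ • g (xs i) θ = 0 := by
    simp only [← hwi, mul_smul, ← Finset.smul_sum, hfeas.2.2, smul_zero]
  have hτ : ∀ i, HasStrictDerivAt (fun t : ℝ => (1 - t)⁻¹)
      ((1 - ⟪l, g (xs i) θ⟫_ℝ)⁻¹ ^ 2) ⟪l, g (xs i) θ⟫_ℝ := fun i => by
    have h1 := (hasStrictDerivAt_inv (hT i).ne').comp _
      ((hasStrictDerivAt_id ⟪l, g (xs i) θ⟫_ℝ).const_sub 1)
    convert! h1 using 1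
    simp
  have hφ : HasStrictFDerivAt
      (fun z : EuclideanSpace ℝ (Fin p) × EuclideanSpace ℝ (Fin m) =>
        ∑ i, Real.log (1 - ⟪z.2, g (xs i) z.1⟫_ℝ))
      (∑ i, (-(1 - ⟪l, g (xs i) θ⟫_ℝ)⁻¹) • innerDeriv (fderiv ℝ (g (xs i)) θ) (g (xs i) θ) l)
      (θ, l) := by
    refine HasStrictFDerivAt.fun_sum fun i _ => ?_
    have h1 : HasStrictDerivAt (fun t : ℝ => Real.log (1 - t))
        (-(1 - ⟪l, g (xs i) θ⟫_ℝ)⁻¹) ⟪l, g (xs i) θ⟫_ℝ := by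
      have h1 := (Real.hasStrictDerivAt_log (hT i).ne').comp _
        ((hasStrictDerivAt_id ⟪l, g (xs i) θ⟫_ℝ).const_sub 1)
      convert! h1 using 1
      simp
    exact HasStrictDerivAt.comp_hasStrictFDerivAt (θ, l) h1 (hasStrictFDerivAt_inner_snd (hG i) l)
  have hkl : ∀ (θ' : EuclideanSpace ℝ (Fin p)) (l' : EuclideanSpace ℝ (Fin m)) (w' : Fin n → ℝ),
      (∀ i, n * w' i = (1 - ⟪l', g (xs i) θ'⟫_ℝ)⁻¹) →
      klDiscrepancy w' = (n : ℝ)⁻¹ * ∑ i, Real.log (1 - ⟪l', g (xs i) θ'⟫_ℝ) := by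
    intro θ' l' w' h'
    simp only [klDiscrepancy, h', Real.log_inv, neg_neg]
  have hev : ∀ᶠ z : EuclideanSpace ℝ (Fin p) × EuclideanSpace ℝ (Fin m) in 𝓝 (θ, l),
      (z.1 ∈ Θ ∧ ∀ i, 0 < 1 - ⟪z.2, g (xs i) z.1⟫_ℝ) := by
    refine Eventually.and ?_ ?_
    · have h1 : Tendsto Prod.fst (𝓝 (θ, l)) (𝓝 θ) := continuous_fst.tendsto (θ, l)
      exact h1 (mem_interior_iff_mem_nhds.1 hint)
    · rw [eventually_all]
      intro i
      have h1 := ((hasStrictFDerivAt_inner_snd (hG i) l).continuousAt.tendsto.const_sub 1)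
      exact h1.eventually_const_lt (hT i)
  -- The minimization over θ becomes a constrained one over pairs (θ, l): every nearby pair that
  -- satisfies the dual equation produces EL weights at its θ, with which the estimate may be
  -- compared.
  obtain ⟨κ, Λ₀, hne, hΛ⟩ := exists_lagrange_multiplier hG hτ hφ hzero (by
    filter_upwards [hev] with z hz hz0
    have h1 := isELWeights_of_dual hn hz.2 hz0
    have h2 := hmin z.1 hz.1 _ h1
    rw [hkl θ l w hwi, hkl z.1 z.2 _ fun i => by
      rw [mul_inv, ← mul_assoc, mul_inv_cancel₀ hn'.ne', one_mul]] at h2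
    exact le_of_mul_le_mul_left h2 (by positivity))
  have hzk : ∀ k : EuclideanSpace ℝ (Fin m),
      ∑ i, (1 - ⟪l, g (xs i) θ⟫_ℝ)⁻¹ * ⟪k, g (xs i) θ⟫_ℝ = 0 := fun k => sum_inner_weights hzero k
  -- Variation of l alone: the derivative of the objective in l is the constraint and vanishes, and
  -- what is left is a definite quadratic form in κ. This is the envelope theorem; only the direct
  -- dependence on θ survives.
  have hκ : κ = 0 := by
    have h1 := hΛ 0 κ
    simp only [map_zero, inner_zero_right, zero_add, mul_zero, add_zero, FunLike.coe_sum,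
      Finset.sum_apply, FunLike.coe_smul, Pi.smul_apply, innerDeriv_apply, smul_eq_mul, neg_mul,
      Finset.sum_neg_distrib, hzk, neg_zero] at h1
    refine hcoer κ ?_
    have h2 : ∀ i ∈ Finset.univ, (1 - ⟪l, g (xs i) θ⟫_ℝ)⁻¹ ^ 2 * ⟪κ, g (xs i) θ⟫_ℝ *
        ⟪κ, g (xs i) θ⟫_ℝ = 0 := by
      refine (Finset.sum_eq_zero_iff_of_nonneg fun i _ => ?_).1 h1
      rw [mul_assoc]
      exact mul_nonneg (sq_nonneg _) (mul_self_nonneg _)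
    refine Finset.sum_eq_zero fun i hi => ?_
    have h3 := h2 i hi
    have h4 := (inv_pos.2 (hT i)).ne'
    rw [mul_assoc] at h3
    have h5 := (mul_eq_zero.1 h3).resolve_left (pow_ne_zero 2 h4)
    rw [pow_two, h5]
  have hΛ0 : Λ₀ ≠ 0 := fun h0 => hne ⟨hκ, h0⟩
  have h1 := hΛ h 0
  simp only [hκ, inner_zero_left, mul_zero, add_zero, Finset.sum_const_zero, zero_add,
    FunLike.coe_sum, Finset.sum_apply, FunLike.coe_smul, Pi.smul_apply, innerDeriv_apply,
    smul_eq_mul, neg_mul, Finset.sum_neg_distrib] at h1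
  have h2 := (mul_eq_zero.1 h1).resolve_left hΛ0
  rw [neg_eq_zero.1 h2, mul_zero]

/-- First-order conditions of the ETEL estimator. -/
lemma IsETELEstimate.foc {𝒳 : Type*}
    {g : 𝒳 → EuclideanSpace ℝ (Fin p) → EuclideanSpace ℝ (Fin m)}
    {Θ : Set (EuclideanSpace ℝ (Fin p))} {xs : Fin n → 𝒳} {θ : EuclideanSpace ℝ (Fin p)}
    (hn : n ≠ 0) (hint : θ ∈ interior Θ) (hG : ∀ i, ContDiffAt ℝ 1 (g (xs i)) θ)
    {w : Fin n → ℝ} (hw : IsETWeights (fun i => g (xs i) θ) w) (hpos : ∀ i, 0 < w i)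
    (hmin : ∀ θ' ∈ Θ, ∀ w', IsETWeights (fun i => g (xs i) θ') w' → (∀ i, 0 < w' i) →
      klDiscrepancy w ≤ klDiscrepancy w')
    {a : ℝ} {l : EuclideanSpace ℝ (Fin m)}
    (hl : ∀ i, Real.log (n * w i) = a + ⟪l, g (xs i) θ⟫_ℝ)
    (hcoer : ∀ k : EuclideanSpace ℝ (Fin m), ∑ i, ⟪k, g (xs i) θ⟫_ℝ ^ 2 = 0 → k = 0) :
    ∃ κ : EuclideanSpace ℝ (Fin m),
      (∀ k, (n : ℝ)⁻¹ * ∑ i, n * w i * ⟪κ, g (xs i) θ⟫_ℝ * ⟪k, g (xs i) θ⟫_ℝ =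
        (n : ℝ)⁻¹ * ∑ i, ⟪k, g (xs i) θ⟫_ℝ) ∧
      ∀ h, (n : ℝ)⁻¹ * ∑ i, (n * w i * ⟪l + κ, fderiv ℝ (g (xs i)) θ h⟫_ℝ -
        ⟪l, fderiv ℝ (g (xs i)) θ h⟫_ℝ +
        n * w i * ⟪l, fderiv ℝ (g (xs i)) θ h⟫_ℝ * ⟪κ, g (xs i) θ⟫_ℝ) = 0 := by
  have hn' : (0 : ℝ) < n := by positivity
  have : Nonempty (Fin n) := ⟨⟨0, Nat.pos_of_ne_zero hn⟩⟩
  obtain ⟨hfeas, -⟩ := hw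
  have hSpos : ∀ (θ' : EuclideanSpace ℝ (Fin p)) (l' : EuclideanSpace ℝ (Fin m)),
      0 < ∑ i, Real.exp ⟪l', g (xs i) θ'⟫_ℝ := fun _ _ =>
    Finset.sum_pos (fun i _ => Real.exp_pos _) Finset.univ_nonempty
  set S := ∑ i, Real.exp ⟪l, g (xs i) θ⟫_ℝ with hS
  have hS0 : 0 < S := hSpos θ l
  have hwa : ∀ i, n * w i = Real.exp a * Real.exp ⟪l, g (xs i) θ⟫_ℝ := fun i => by
    rw [← Real.exp_add, ← hl i, Real.exp_log (by have := hpos i; positivity)]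
  have hea : Real.exp a = n / S := by
    have h1 : ∑ i, n * w i = Real.exp a * S := by
      rw [hS, Finset.mul_sum]; exact Finset.sum_congr rfl fun i _ => hwa i
    rw [← Finset.mul_sum, hfeas.2.1, mul_one] at h1
    rw [h1]; field_simp
  have hwi : ∀ i, n * w i = n * (Real.exp ⟪l, g (xs i) θ⟫_ℝ / S) := fun i => by
    rw [hwa, hea]; ring
  have hexp : ∀ i, Real.exp ⟪l, g (xs i) θ⟫_ℝ = S / n * (n * w i) := fun i => by
    rw [hwi]; field_simp
  have hzero : ∑ i, Real.exp ⟪l, g (xs i) θ⟫_ℝ • g (xs i) θ = 0 := by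
    simp only [hexp, mul_smul, ← Finset.smul_sum, hfeas.2.2, smul_zero]
  have hφ : HasStrictFDerivAt
      (fun z : EuclideanSpace ℝ (Fin p) × EuclideanSpace ℝ (Fin m) =>
        Real.log (∑ i, Real.exp ⟪z.2, g (xs i) z.1⟫_ℝ) - (n : ℝ)⁻¹ * ∑ i, ⟪z.2, g (xs i) z.1⟫_ℝ)
      (S⁻¹ • (∑ i, Real.exp ⟪l, g (xs i) θ⟫_ℝ •
          innerDeriv (fderiv ℝ (g (xs i)) θ) (g (xs i) θ) l) -
        (n : ℝ)⁻¹ • ∑ i, innerDeriv (fderiv ℝ (g (xs i)) θ) (g (xs i) θ) l) (θ, l) := by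
    have h1 := fun i => hasStrictFDerivAt_inner_snd (hG i) l
    have h2 : HasStrictFDerivAt (fun z : EuclideanSpace ℝ (Fin p) × EuclideanSpace ℝ (Fin m) =>
        ∑ i, Real.exp ⟪z.2, g (xs i) z.1⟫_ℝ) (∑ i, Real.exp ⟪l, g (xs i) θ⟫_ℝ •
          innerDeriv (fderiv ℝ (g (xs i)) θ) (g (xs i) θ) l) (θ, l) :=
      HasStrictFDerivAt.fun_sum fun i _ => (h1 i).exp
    have h3 : HasStrictFDerivAt (fun z : EuclideanSpace ℝ (Fin p) × EuclideanSpace ℝ (Fin m) =>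
        ∑ i, ⟪z.2, g (xs i) z.1⟫_ℝ)
          (∑ i, innerDeriv (fderiv ℝ (g (xs i)) θ) (g (xs i) θ) l) (θ, l) :=
      HasStrictFDerivAt.fun_sum fun i _ => h1 i
    exact (h2.log hS0.ne').sub (h3.const_mul _)
  have hkl : ∀ (θ' : EuclideanSpace ℝ (Fin p)) (l' : EuclideanSpace ℝ (Fin m)) (w' : Fin n → ℝ),
      (∀ i, n * w' i = n * (Real.exp ⟪l', g (xs i) θ'⟫_ℝ / ∑ i, Real.exp ⟪l', g (xs i) θ'⟫_ℝ)) →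
      klDiscrepancy w' = (Real.log (∑ i, Real.exp ⟪l', g (xs i) θ'⟫_ℝ) -
        (n : ℝ)⁻¹ * ∑ i, ⟪l', g (xs i) θ'⟫_ℝ) - Real.log n := by
    intro θ' l' w' h'
    have h0 := hSpos θ' l'
    have h1 : ∀ i, -Real.log (n * w' i) = Real.log (∑ i, Real.exp ⟪l', g (xs i) θ'⟫_ℝ) -
        Real.log n - ⟪l', g (xs i) θ'⟫_ℝ := fun i => by
      rw [h', Real.log_mul hn'.ne' (div_pos (Real.exp_pos _) h0).ne',
        Real.log_div (Real.exp_pos _).ne' h0.ne',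
        Real.log_exp]
      ring
    simp only [klDiscrepancy, h1, Finset.sum_sub_distrib, Finset.sum_const, Finset.card_univ,
      Fintype.card_fin, nsmul_eq_mul]
    field_simp
    ring
  have hev : ∀ᶠ z : EuclideanSpace ℝ (Fin p) × EuclideanSpace ℝ (Fin m) in 𝓝 (θ, l), z.1 ∈ Θ := by
    have h1 : Tendsto Prod.fst (𝓝 (θ, l)) (𝓝 θ) := continuous_fst.tendsto (θ, l)
    exact h1 (mem_interior_iff_mem_nhds.1 hint)
  obtain ⟨κ, Λ₀, hne, hΛ⟩ := exists_lagrange_multiplier hG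
    (fun i => Real.hasStrictDerivAt_exp ⟪l, g (xs i) θ⟫_ℝ) hφ hzero (by
    filter_upwards [hev] with z hz hz0
    have h0 := hSpos z.1 z.2
    have h1 := isETWeights_of_dual hn hz0
    have h2 := hmin z.1 hz _ h1 fun i => div_pos (Real.exp_pos _) h0
    rw [hkl θ l w hwi, hkl z.1 z.2 _ fun i => rfl] at h2
    simpa using h2)
  have hzk : ∀ k : EuclideanSpace ℝ (Fin m),
      ∑ i, Real.exp ⟪l, g (xs i) θ⟫_ℝ * ⟪k, g (xs i) θ⟫_ℝ = 0 := fun k => sum_inner_weights hzero k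
  have hk : ∀ k : EuclideanSpace ℝ (Fin m), ∑ i, Real.exp ⟪l, g (xs i) θ⟫_ℝ *
      ⟪k, g (xs i) θ⟫_ℝ * ⟪κ, g (xs i) θ⟫_ℝ = Λ₀ * ((n : ℝ)⁻¹ * ∑ i, ⟪k, g (xs i) θ⟫_ℝ) := by
    intro k
    have h1 := hΛ 0 k
    simp only [map_zero, inner_zero_right, zero_add, mul_zero, add_zero, FunLike.coe_sum,
      Finset.sum_apply, FunLike.coe_smul, Pi.smul_apply, innerDeriv_apply, smul_eq_mul,
      FunLike.coe_sub, Pi.sub_apply, hzk, zero_sub] at h1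
    linarith
  -- If Λ₀ = 0, variation of l in the direction κ makes a definite quadratic form in κ vanish,
  -- against nontriviality of the multipliers. Unlike for EL, κ is not shown to vanish: the
  -- objective is not the dual function that defines the weights.
  have hΛ0 : Λ₀ ≠ 0 := by
    intro h0
    refine hne ⟨hcoer κ ?_, h0⟩
    have h1 := hk κ
    rw [h0, zero_mul] at h1
    have h2 : ∀ i ∈ Finset.univ, Real.exp ⟪l, g (xs i) θ⟫_ℝ * ⟪κ, g (xs i) θ⟫_ℝ *
        ⟪κ, g (xs i) θ⟫_ℝ = 0 := by
      refine (Finset.sum_eq_zero_iff_of_nonneg fun i _ => ?_).1 h1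
      rw [mul_assoc]
      exact mul_nonneg (Real.exp_pos _).le (mul_self_nonneg _)
    refine Finset.sum_eq_zero fun i hi => ?_
    have h3 := h2 i hi
    rw [mul_assoc] at h3
    rw [pow_two, (mul_eq_zero.1 h3).resolve_left (Real.exp_pos _).ne']
  -- The factor S / Λ₀ turns the exponentials into n wᵢ and normalizes the multiplier of the
  -- objective to one.
  refine ⟨(S / Λ₀) • κ, fun k => ?_, fun h => ?_⟩
  · have h1 := hk k
    have h2 : ∀ i, n * w i * ⟪(S / Λ₀) • κ, g (xs i) θ⟫_ℝ * ⟪k, g (xs i) θ⟫_ℝ =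
        (n / Λ₀) * (Real.exp ⟪l, g (xs i) θ⟫_ℝ * ⟪k, g (xs i) θ⟫_ℝ * ⟪κ, g (xs i) θ⟫_ℝ) := by
      intro i
      rw [hexp, inner_smul_left]
      simp
      field_simp
    rw [Finset.sum_congr rfl fun i _ => h2 i, ← Finset.mul_sum, h1]
    field_simp
  · have h1 := hΛ h 0
    simp only [inner_zero_left, add_zero, FunLike.coe_sum, Finset.sum_apply, FunLike.coe_smul,
      Pi.smul_apply, innerDeriv_apply, smul_eq_mul, FunLike.coe_sub, Pi.sub_apply] at h1
    have h2 : ∀ i, (n * w i * ⟪l + (S / Λ₀) • κ, fderiv ℝ (g (xs i)) θ h⟫_ℝ -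
        ⟪l, fderiv ℝ (g (xs i)) θ h⟫_ℝ +
        n * w i * ⟪l, fderiv ℝ (g (xs i)) θ h⟫_ℝ * ⟪(S / Λ₀) • κ, g (xs i) θ⟫_ℝ) =
        (n / Λ₀) * ((Real.exp ⟪l, g (xs i) θ⟫_ℝ * ⟪l, fderiv ℝ (g (xs i)) θ h⟫_ℝ *
          ⟪κ, g (xs i) θ⟫_ℝ + Real.exp ⟪l, g (xs i) θ⟫_ℝ * ⟪κ, fderiv ℝ (g (xs i)) θ h⟫_ℝ) +
          Λ₀ * (S⁻¹ * (Real.exp ⟪l, g (xs i) θ⟫_ℝ * ⟪l, fderiv ℝ (g (xs i)) θ h⟫_ℝ) -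
          (n : ℝ)⁻¹ * ⟪l, fderiv ℝ (g (xs i)) θ h⟫_ℝ)) := by
      intro i
      rw [hexp, inner_add_left, inner_smul_left, inner_smul_left]
      simp
      field_simp
      ring
    rw [Finset.sum_congr rfl fun i _ => h2 i, ← Finset.mul_sum, Finset.sum_add_distrib,
      ← Finset.mul_sum, Finset.sum_sub_distrib, ← Finset.mul_sum, ← Finset.mul_sum, h1]
    simp

end FirstOrder

/-! ### Third-order Taylor polynomials -/

/-- The coefficients of a polynomial of degree three in the variables `β i`, `i : ι`. -/
structure Jet (ι : Type*) where
  c0 : ℝ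
  c1 : ι → ℝ
  c2 : ι → ι → ℝ
  c3 : ι → ι → ι → ℝ

namespace Jet

variable {ι : Type*}

/-- The product, truncated at degree three. -/
def mul (a b : Jet ι) : Jet ι where
  c0 := a.c0 * b.c0
  c1 j := a.c0 * b.c1 j + a.c1 j * b.c0
  c2 j k := a.c0 * b.c2 j k + a.c1 j * b.c1 k + a.c2 j k * b.c0
  c3 j k l := a.c0 * b.c3 j k l + a.c1 j * b.c2 k l + a.c2 j k * b.c1 l + a.c3 j k l * b.c0

/-- The sum of two polynomials. -/
def add (a b : Jet ι) : Jet ι where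
  c0 := a.c0 + b.c0
  c1 j := a.c1 j + b.c1 j
  c2 j k := a.c2 j k + b.c2 j k
  c3 j k l := a.c3 j k l + b.c3 j k l

/-- The sum of a finite family of polynomials. -/
def sum {α : Type*} [Fintype α] (a : α → Jet ι) : Jet ι where
  c0 := ∑ s, (a s).c0
  c1 j := ∑ s, (a s).c1 j
  c2 j k := ∑ s, (a s).c2 j k
  c3 j k l := ∑ s, (a s).c3 j k l

/-- The constant polynomial `1`. -/
def one : Jet ι where
  c0 := 1
  c1 _ := 0
  c2 _ _ := 0
  c3 _ _ _ := 0

/-- The variable `β i`. -/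
def var [DecidableEq ι] (i : ι) : Jet ι where
  c0 := 0
  c1 j := if j = i then 1 else 0
  c2 _ _ := 0
  c3 _ _ _ := 0

variable [Fintype ι]

/-- The part of degree one. -/
def part1 (a : Jet ι) (β : ι → ℝ) : ℝ := ∑ j, a.c1 j * β j

/-- The part of degree two. -/
def part2 (a : Jet ι) (β : ι → ℝ) : ℝ := ∑ j, ∑ k, a.c2 j k * β j * β k

/-- The part of degree three. -/
def part3 (a : Jet ι) (β : ι → ℝ) : ℝ := ∑ j, ∑ k, ∑ l, a.c3 j k l * β j * β k * β l

/-- The value of the polynomial. -/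
def eval (a : Jet ι) (β : ι → ℝ) : ℝ := a.c0 + a.part1 β + a.part2 β + a.part3 β

lemma part1_mul (a b : Jet ι) (β : ι → ℝ) :
    (a.mul b).part1 β = a.c0 * b.part1 β + a.part1 β * b.c0 := by
  simp only [part1, mul, Finset.mul_sum, Finset.sum_mul, ← Finset.sum_add_distrib]
  exact Finset.sum_congr rfl fun j _ => by ring

lemma part2_mul (a b : Jet ι) (β : ι → ℝ) :
    (a.mul b).part2 β = a.c0 * b.part2 β + a.part1 β * b.part1 β + a.part2 β * b.c0 := by
  simp only [part1, part2, mul, Finset.sum_mul_sum]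
  simp only [Finset.mul_sum, Finset.sum_mul, ← Finset.sum_add_distrib]
  exact Finset.sum_congr rfl fun j _ => Finset.sum_congr rfl fun k _ => by ring

lemma part3_mul (a b : Jet ι) (β : ι → ℝ) :
    (a.mul b).part3 β = a.c0 * b.part3 β + a.part1 β * b.part2 β + a.part2 β * b.part1 β +
      a.part3 β * b.c0 := by
  have h1 : a.part1 β * b.part2 β = ∑ j, ∑ k, ∑ l, a.c1 j * b.c2 k l * β j * β k * β l := by
    rw [part1, Finset.sum_mul]
    refine Finset.sum_congr rfl fun j _ => ?_
    rw [part2, Finset.mul_sum]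
    refine Finset.sum_congr rfl fun k _ => ?_
    rw [Finset.mul_sum]
    exact Finset.sum_congr rfl fun l _ => by ring
  have h2 : a.part2 β * b.part1 β = ∑ j, ∑ k, ∑ l, a.c2 j k * b.c1 l * β j * β k * β l := by
    rw [part2, Finset.sum_mul]
    refine Finset.sum_congr rfl fun j _ => ?_
    rw [Finset.sum_mul]
    refine Finset.sum_congr rfl fun k _ => ?_
    rw [part1, Finset.mul_sum]
    exact Finset.sum_congr rfl fun l _ => by ring
  rw [h1, h2]
  simp only [part3, mul, Finset.mul_sum, Finset.sum_mul, ← Finset.sum_add_distrib]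
  exact Finset.sum_congr rfl fun j _ => Finset.sum_congr rfl fun k _ =>
      Finset.sum_congr rfl fun l _ => by ring

lemma eval_add (a b : Jet ι) (β : ι → ℝ) : (a.add b).eval β = a.eval β + b.eval β := by
  simp only [eval, part1, part2, part3, add, add_mul, Finset.sum_add_distrib]
  ring

lemma eval_sum {α : Type*} [Fintype α] (a : α → Jet ι) (β : ι → ℝ) :
    (sum a).eval β = ∑ s, (a s).eval β := by
  simp only [eval, part1, part2, part3, sum, Finset.sum_mul, Finset.sum_add_distrib]
  congr 1
  · congr 1
    · congr 1
      rw [Finset.sum_comm]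
    · symm
      rw [Finset.sum_comm]
      exact Finset.sum_congr rfl fun j _ => Finset.sum_comm
  · symm
    rw [Finset.sum_comm]
    refine Finset.sum_congr rfl fun j _ => ?_
    rw [Finset.sum_comm]
    exact Finset.sum_congr rfl fun k _ => Finset.sum_comm

end Jet

/-- `c` is the third-order Taylor polynomial of `f` at `0`, with coefficients of degree `k` and
remainder (`k = 4`) controlled by `S * B ^ k` in the region `B * ‖β‖ ≤ 1`. -/
structure HasJet {ι : Type*} [Fintype ι] (f : (ι → ℝ) → ℝ) (c : Jet ι) (B S : ℝ) : Prop where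
  b0 : |c.c0| ≤ S
  b1 : ∀ j, |c.c1 j| ≤ S * B
  b2 : ∀ j k, |c.c2 j k| ≤ S * B ^ 2
  b3 : ∀ j k l, |c.c3 j k l| ≤ S * B ^ 3
  rem : ∀ β, B * ‖β‖ ≤ 1 → |f β - c.eval β| ≤ S * (B * ‖β‖) ^ 4

namespace HasJet

variable {ι : Type*} [Fintype ι] {f f' : (ι → ℝ) → ℝ} {c c' : Jet ι} {B S S' : ℝ}

lemma nonneg (h : HasJet f c B S) : 0 ≤ S := (abs_nonneg _).trans h.b0

lemma mono (h : HasJet f c B S) (hB : 0 ≤ B) (hS : S ≤ S') : HasJet f c B S' where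
  b0 := h.b0.trans hS
  b1 j := (h.b1 j).trans (by gcongr)
  b2 j k := (h.b2 j k).trans (by gcongr)
  b3 j k l := (h.b3 j k l).trans (by gcongr)
  rem β hβ := (h.rem β hβ).trans (by gcongr)

lemma add (h : HasJet f c B S) (h' : HasJet f' c' B S') :
    HasJet (fun β => f β + f' β) (c.add c') B (S + S') where
  b0 := (abs_add_le _ _).trans (add_le_add h.b0 h'.b0)
  b1 j := (abs_add_le _ _).trans (by linarith [h.b1 j, h'.b1 j])
  b2 j k := (abs_add_le _ _).trans (by linarith [h.b2 j k, h'.b2 j k])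
  b3 j k l := (abs_add_le _ _).trans (by linarith [h.b3 j k l, h'.b3 j k l])
  rem β hβ := by
    rw [Jet.eval_add, show f β + f' β - (c.eval β + c'.eval β) =
      (f β - c.eval β) + (f' β - c'.eval β) by ring]
    exact (abs_add_le _ _).trans (by linarith [h.rem β hβ, h'.rem β hβ])

lemma sum {α : Type*} [Fintype α] {f : α → (ι → ℝ) → ℝ} {c : α → Jet ι}
    (h : ∀ s, HasJet (f s) (c s) B S) :
    HasJet (fun β => ∑ s, f s β) (Jet.sum c) B (Fintype.card α * S) where
  b0 := (Finset.abs_sum_le_sum_abs _ _).trans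
    ((Finset.sum_le_card_nsmul _ _ _ fun s _ => (h s).b0).trans (by simp))
  b1 j := (Finset.abs_sum_le_sum_abs _ _).trans
    ((Finset.sum_le_card_nsmul _ _ _ fun s _ => (h s).b1 j).trans (by simp [mul_assoc]))
  b2 j k := (Finset.abs_sum_le_sum_abs _ _).trans
    ((Finset.sum_le_card_nsmul _ _ _ fun s _ => (h s).b2 j k).trans (by simp [mul_assoc]))
  b3 j k l := (Finset.abs_sum_le_sum_abs _ _).trans
    ((Finset.sum_le_card_nsmul _ _ _ fun s _ => (h s).b3 j k l).trans (by simp [mul_assoc]))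
  rem β hβ := by
    rw [Jet.eval_sum, ← Finset.sum_sub_distrib]
    exact (Finset.abs_sum_le_sum_abs _ _).trans
      ((Finset.sum_le_card_nsmul _ _ _ fun s _ => (h s).rem β hβ).trans (by simp [mul_assoc]))

lemma one (hB : 0 ≤ B) : HasJet (fun _ => 1) (Jet.one : Jet ι) B 1 where
  b0 := by simp [Jet.one]
  b1 j := by simpa [Jet.one] using hB
  b2 j k := by simp [Jet.one]; positivity
  b3 j k l := by simp [Jet.one]; positivity
  rem β hβ := by simp [Jet.one, Jet.eval, Jet.part1, Jet.part2, Jet.part3]; positivity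

/-- The scale B⁻¹ is the least one that admits the coefficient 1 in degree one. It makes each factor
β in a product cancel one power of B. -/
lemma var [DecidableEq ι] (hB : 0 < B) (i : ι) : HasJet (fun β => β i) (Jet.var i) B B⁻¹ where
  b0 := by simp [Jet.var, hB.le]
  b1 j := by
    rw [inv_mul_cancel₀ hB.ne']
    simp only [Jet.var]
    split_ifs <;> simp
  b2 j k := by simp [Jet.var]; positivity
  b3 j k l := by simp [Jet.var]; positivity
  rem β hβ := by simp [Jet.var, Jet.eval, Jet.part1, Jet.part2, Jet.part3]; positivity

lemma abs_part1_le (h : HasJet f c B S) (β : ι → ℝ) :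
    |c.part1 β| ≤ Fintype.card ι * S * (B * ‖β‖) := by
  refine (Finset.abs_sum_le_sum_abs _ _).trans
    ((Finset.sum_le_card_nsmul _ _ (S * (B * ‖β‖)) fun j _ => ?_).trans
      (by simp [mul_assoc]))
  rw [abs_mul, ← mul_assoc]
  exact mul_le_mul (h.b1 j) (norm_le_pi_norm β j) (abs_nonneg _) ((abs_nonneg _).trans (h.b1 j))

lemma abs_part2_le (h : HasJet f c B S) (β : ι → ℝ) :
    |c.part2 β| ≤ (Fintype.card ι : ℝ) ^ 2 * S * (B * ‖β‖) ^ 2 := by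
  have h1 : ∀ j k, |c.c2 j k * β j * β k| ≤ S * (B * ‖β‖) ^ 2 := fun j k => by
    rw [abs_mul, abs_mul, mul_pow, ← mul_assoc, pow_two ‖β‖, ← mul_assoc]
    have hc := h.b2 j k
    have hc0 := (abs_nonneg _).trans hc
    have hj : |β j| ≤ ‖β‖ := norm_le_pi_norm β j
    have hk : |β k| ≤ ‖β‖ := norm_le_pi_norm β k
    gcongr
  refine (Finset.abs_sum_le_sum_abs _ _).trans
    ((Finset.sum_le_card_nsmul _ _ (Fintype.card ι * (S * (B * ‖β‖) ^ 2)) fun j _ => ?_).trans ?_)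
  · exact (Finset.abs_sum_le_sum_abs _ _).trans
      ((Finset.sum_le_card_nsmul _ _ _ fun k _ => h1 j k).trans (by simp))
  · simp
    exact le_of_eq (by ring)

lemma abs_part3_le (h : HasJet f c B S) (β : ι → ℝ) :
    |c.part3 β| ≤ (Fintype.card ι : ℝ) ^ 3 * S * (B * ‖β‖) ^ 3 := by
  have h1 : ∀ j k l, |c.c3 j k l * β j * β k * β l| ≤ S * (B * ‖β‖) ^ 3 := fun j k l => by
    have hc := h.b3 j k l
    have hc0 := (abs_nonneg _).trans hc
    have hj : |β j| ≤ ‖β‖ := norm_le_pi_norm β j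
    have hk : |β k| ≤ ‖β‖ := norm_le_pi_norm β k
    have hl : |β l| ≤ ‖β‖ := norm_le_pi_norm β l
    calc |c.c3 j k l * β j * β k * β l| = |c.c3 j k l| * |β j| * |β k| * |β l| := by
          rw [abs_mul, abs_mul, abs_mul]
      _ ≤ S * B ^ 3 * ‖β‖ * ‖β‖ * ‖β‖ := by gcongr
      _ = _ := by ring
  refine (Finset.abs_sum_le_sum_abs _ _).trans
    ((Finset.sum_le_card_nsmul _ _ (Fintype.card ι * (Fintype.card ι * (S * (B * ‖β‖) ^ 3)))
      fun j _ => ?_).trans ?_)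
  · refine (Finset.abs_sum_le_sum_abs _ _).trans
      ((Finset.sum_le_card_nsmul _ _ (Fintype.card ι * (S * (B * ‖β‖) ^ 3)) fun k _ => ?_).trans
        (by simp))
    exact (Finset.abs_sum_le_sum_abs _ _).trans
      ((Finset.sum_le_card_nsmul _ _ _ fun l _ => h1 j k l).trans (by simp))
  · simp
    exact le_of_eq (by ring)

/-- The constant in the product rule for Taylor polynomials in `d` variables. -/
def mulConst (ι : Type*) [Fintype ι] : ℝ := 15 * ((1 + Fintype.card ι : ℝ) ^ 3) ^ 2

-- In terms of t = B‖β‖ ≤ 1, a part of degree k is at most (1 + d)³ S tᵏ in d variables. The error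
-- of the truncated product consists of six products of parts of total degree at least four, two
-- products of a polynomial with a remainder, at most 4 units each, and one product of remainders: 6
-- + 4 + 4 + 1 = 15.
set_option maxHeartbeats 400000 in
lemma mul (h : HasJet f c B S) (h' : HasJet f' c' B S') (hB : 0 ≤ B) :
    HasJet (fun β => f β * f' β) (c.mul c') B (mulConst ι * (S * S')) := by
  have hS := h.nonneg
  have hS' := h'.nonneg
  set d := (Fintype.card ι : ℝ) with hd
  have hd0 : 0 ≤ d := by positivity
  set D : ℝ := (1 + d) ^ 3 with hD
  have hD1 : 1 ≤ D := one_le_pow₀ (by linarith)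
  have hdD : d ≤ D := by nlinarith [sq_nonneg d, mul_nonneg hd0 (sq_nonneg d)]
  have hdD2 : d ^ 2 ≤ D := by nlinarith [sq_nonneg d, mul_nonneg hd0 (sq_nonneg d)]
  have hdD3 : d ^ 3 ≤ D := by nlinarith [sq_nonneg d, mul_nonneg hd0 (sq_nonneg d)]
  have hK : mulConst ι = 15 * D ^ 2 := rfl
  have hSS : 0 ≤ S * S' := mul_nonneg hS hS'
  have hK4 : 4 ≤ mulConst ι := by rw [hK]; nlinarith
  have hle : 4 * (S * S') ≤ mulConst ι * (S * S') := by gcongr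
  have key : ∀ {a a' A A' : ℝ}, |a| ≤ A → |a'| ≤ A' → |a * a'| ≤ A * A' := by
    intro a a' A A' h1 h2
    rw [abs_mul]
    exact mul_le_mul h1 h2 (abs_nonneg _) ((abs_nonneg _).trans h1)
  refine ⟨?_, fun j => ?_, fun j k => ?_, fun j k l => ?_, fun β hβ => ?_⟩
  · exact (key h.b0 h'.b0).trans (by linarith)
  · have h1 := key h.b0 (h'.b1 j)
    have h2 := key (h.b1 j) h'.b0
    refine (abs_add_le _ _).trans ?_
    have := mul_le_mul_of_nonneg_right hle hB
    linarith only [h1, h2, this, mul_nonneg hSS hB]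
  · have h1 := key h.b0 (h'.b2 j k)
    have h2 := key (h.b1 j) (h'.b1 k)
    have h3 := key (h.b2 j k) h'.b0
    have e : |(c.mul c').c2 j k| ≤ |c.c0 * c'.c2 j k| + |c.c1 j * c'.c1 k| + |c.c2 j k * c'.c0| :=
      (abs_add_le _ _).trans (add_le_add (abs_add_le _ _) le_rfl)
    refine e.trans ?_
    have := mul_le_mul_of_nonneg_right hle (pow_nonneg hB 2)
    linarith only [h1, h2, h3, this, mul_nonneg hSS (pow_nonneg hB 2)]
  · have h1 := key h.b0 (h'.b3 j k l)
    have h2 := key (h.b1 j) (h'.b2 k l)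
    have h3 := key (h.b2 j k) (h'.b1 l)
    have h4 := key (h.b3 j k l) h'.b0
    have e : |(c.mul c').c3 j k l| ≤ |c.c0 * c'.c3 j k l| + |c.c1 j * c'.c2 k l| +
        |c.c2 j k * c'.c1 l| + |c.c3 j k l * c'.c0| :=
      (abs_add_le _ _).trans (add_le_add ((abs_add_le _ _).trans
        (add_le_add (abs_add_le _ _) le_rfl)) le_rfl)
    refine e.trans ?_
    have := mul_le_mul_of_nonneg_right hle (pow_nonneg hB 3)
    linarith only [h1, h2, h3, h4, this, mul_nonneg hSS (pow_nonneg hB 3)]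
  · set t := B * ‖β‖ with ht
    have ht0 : 0 ≤ t := by positivity
    have p0 : ∀ {c : Jet ι} {S : ℝ}, 0 ≤ S → |c.c0| ≤ S → |c.c0| ≤ D * S := fun hS h0 =>
      h0.trans (le_mul_of_one_le_left hS hD1)
    have q1 : |c.part1 β| ≤ D * S * t := (h.abs_part1_le β).trans (by gcongr)
    have q2 : |c.part2 β| ≤ D * S * t ^ 2 := (h.abs_part2_le β).trans (by gcongr)
    have q3 : |c.part3 β| ≤ D * S * t ^ 3 := (h.abs_part3_le β).trans (by gcongr)
    have q1' : |c'.part1 β| ≤ D * S' * t := (h'.abs_part1_le β).trans (by gcongr)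
    have q2' : |c'.part2 β| ≤ D * S' * t ^ 2 := (h'.abs_part2_le β).trans (by gcongr)
    have q3' : |c'.part3 β| ≤ D * S' * t ^ 3 := (h'.abs_part3_le β).trans (by gcongr)
    have q0 : |c.c0| ≤ D * S := p0 hS h.b0
    have q0' : |c'.c0| ≤ D * S' := p0 hS' h'.b0
    have r := h.rem β hβ
    have r' := h'.rem β hβ
    have hDS : 0 ≤ D * S := by positivity
    have hDS' : 0 ≤ D * S' := by positivity
    have tk : ∀ k, t ^ (k + 4) ≤ t ^ 4 := fun k => by
      rw [pow_add]; exact mul_le_of_le_one_left (by positivity) (pow_le_one₀ ht0 hβ)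
    have t1 : t ≤ 1 := hβ
    have t2 : t ^ 2 ≤ 1 := pow_le_one₀ ht0 hβ
    have t3 : t ^ 3 ≤ 1 := pow_le_one₀ ht0 hβ
    have t4 : t ^ 4 ≤ 1 := pow_le_one₀ ht0 hβ
    have ev : |c.eval β| ≤ 4 * (D * S) := by
      have : |c.eval β| ≤ |c.c0| + |c.part1 β| + |c.part2 β| + |c.part3 β| :=
        (abs_add_le _ _).trans (add_le_add ((abs_add_le _ _).trans
          (add_le_add (abs_add_le _ _) le_rfl)) le_rfl)
      have u1 := mul_le_of_le_one_right hDS t1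
      have u2 := mul_le_of_le_one_right hDS t2
      have u3 := mul_le_of_le_one_right hDS t3
      linarith only [this, q0, q1, q2, q3, u1, u2, u3]
    have ev' : |c'.eval β| ≤ 4 * (D * S') := by
      have : |c'.eval β| ≤ |c'.c0| + |c'.part1 β| + |c'.part2 β| + |c'.part3 β| :=
        (abs_add_le _ _).trans (add_le_add ((abs_add_le _ _).trans
          (add_le_add (abs_add_le _ _) le_rfl)) le_rfl)
      have u1 := mul_le_of_le_one_right hDS' t1
      have u2 := mul_le_of_le_one_right hDS' t2
      have u3 := mul_le_of_le_one_right hDS' t3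
      linarith only [this, q0', q1', q2', q3', u1, u2, u3]
    have e : f β * f' β - (c.mul c').eval β =
        c.part1 β * c'.part3 β + c.part2 β * c'.part2 β + c.part3 β * c'.part1 β +
        c.part2 β * c'.part3 β + c.part3 β * c'.part2 β + c.part3 β * c'.part3 β +
        c.eval β * (f' β - c'.eval β) + (f β - c.eval β) * c'.eval β +
        (f β - c.eval β) * (f' β - c'.eval β) := by
      have : (c.mul c').eval β = c.c0 * c'.c0 + (c.mul c').part1 β + (c.mul c').part2 β +
        (c.mul c').part3 β := rfl
      rw [this, Jet.part1_mul, Jet.part2_mul, Jet.part3_mul]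
      simp only [Jet.eval]
      ring
    have m1 := key q1 q3'
    have m2 := key q2 q2'
    have m3 := key q3 q1'
    have m4 := key q2 q3'
    have m5 := key q3 q2'
    have m6 := key q3 q3'
    have m7 := key ev r'
    have m8 := key r ev'
    have m9 := key r r'
    have hx : ∀ a b : ℝ, |a + b| ≤ |a| + |b| := abs_add_le
    rw [e]
    have tri : ∀ a1 a2 a3 a4 a5 a6 a7 a8 a9 : ℝ,
        |a1 + a2 + a3 + a4 + a5 + a6 + a7 + a8 + a9| ≤
        |a1| + |a2| + |a3| + |a4| + |a5| + |a6| + |a7| + |a8| + |a9| := by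
      intro a1 a2 a3 a4 a5 a6 a7 a8 a9
      refine (hx _ _).trans (add_le_add ((hx _ _).trans (add_le_add ((hx _ _).trans (add_le_add
        ((hx _ _).trans (add_le_add ((hx _ _).trans (add_le_add ((hx _ _).trans (add_le_add
        ((hx _ _).trans (add_le_add (hx _ _) le_rfl)) le_rfl)) le_rfl)) le_rfl)) le_rfl))
        le_rfl)) le_rfl)
    refine (tri _ _ _ _ _ _ _ _ _).trans ?_
    set Q := S * S' with hQ
    have w : 0 ≤ t ^ 4 := by positivity
    have DD : D ≤ D ^ 2 := by nlinarith only [hD1]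
    have D2 : 1 ≤ D ^ 2 := by nlinarith only [hD1]
    have b1 : D * S * t * (D * S' * t ^ 3) ≤ D ^ 2 * Q * t ^ 4 := le_of_eq (by rw [hQ]; ring)
    have b2 : D * S * t ^ 2 * (D * S' * t ^ 2) ≤ D ^ 2 * Q * t ^ 4 := le_of_eq (by rw [hQ]; ring)
    have b3 : D * S * t ^ 3 * (D * S' * t) ≤ D ^ 2 * Q * t ^ 4 := le_of_eq (by rw [hQ]; ring)
    have b4 : D * S * t ^ 2 * (D * S' * t ^ 3) ≤ D ^ 2 * Q * t ^ 4 := by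
      rw [show D * S * t ^ 2 * (D * S' * t ^ 3) = D ^ 2 * Q * t ^ (1 + 4) by rw [hQ]; ring]
      have := tk 1
      gcongr
    have b5 : D * S * t ^ 3 * (D * S' * t ^ 2) ≤ D ^ 2 * Q * t ^ 4 := by
      rw [show D * S * t ^ 3 * (D * S' * t ^ 2) = D ^ 2 * Q * t ^ (1 + 4) by rw [hQ]; ring]
      have := tk 1
      gcongr
    have b6 : D * S * t ^ 3 * (D * S' * t ^ 3) ≤ D ^ 2 * Q * t ^ 4 := by
      rw [show D * S * t ^ 3 * (D * S' * t ^ 3) = D ^ 2 * Q * t ^ (2 + 4) by rw [hQ]; ring]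
      have := tk 2
      gcongr
    have b7 : 4 * (D * S) * (S' * t ^ 4) ≤ 4 * (D ^ 2 * Q * t ^ 4) := by
      rw [show 4 * (D * S) * (S' * t ^ 4) = 4 * (D * Q * t ^ 4) by rw [hQ]; ring]
      gcongr
    have b8 : S * t ^ 4 * (4 * (D * S')) ≤ 4 * (D ^ 2 * Q * t ^ 4) := by
      rw [show S * t ^ 4 * (4 * (D * S')) = 4 * (D * Q * t ^ 4) by rw [hQ]; ring]
      gcongr
    have b9 : S * t ^ 4 * (S' * t ^ 4) ≤ D ^ 2 * Q * t ^ 4 := by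
      rw [show S * t ^ 4 * (S' * t ^ 4) = 1 * Q * t ^ (4 + 4) by rw [hQ]; ring]
      have := tk 4
      gcongr
    rw [hK]
    linarith only [m1.trans b1, m2.trans b2, m3.trans b3, m4.trans b4, m5.trans b5, m6.trans b6,
      m7.trans b7, m8.trans b8, m9.trans b9]

end HasJet

/-! ### Orders of magnitude -/

/-- `f = O(ε ^ k)` along the filter `l`. -/
def OrdO {I : Type*} (l : Filter I) (ε : I → ℝ) (k : ℕ) (f : I → ℝ) : Prop :=
  f =O[l] fun x => ε x ^ k

namespace OrdO

variable {I : Type*} {l : Filter I} {ε : I → ℝ} {k k' : ℕ} {f f' : I → ℝ}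

lemma add (h : OrdO l ε k f) (h' : OrdO l ε k f') : OrdO l ε k (fun x => f x + f' x) :=
  IsBigO.add h h'

lemma sub (h : OrdO l ε k f) (h' : OrdO l ε k f') : OrdO l ε k (fun x => f x - f' x) :=
  IsBigO.sub h h'

lemma neg (h : OrdO l ε k f) : OrdO l ε k (fun x => -f x) := IsBigO.neg_left h

lemma mul (h : OrdO l ε k f) (h' : OrdO l ε k' f') : OrdO l ε (k + k') (fun x => f x * f' x) := by
  have := IsBigO.mul h h'
  simpa only [OrdO, pow_add] using this

lemma const_mul (c : ℝ) (h : OrdO l ε k f) : OrdO l ε k (fun x => c * f x) :=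
  IsBigO.const_mul_left h c

lemma sum {α : Type*} {s : Finset α} {f : α → I → ℝ} (h : ∀ a ∈ s, OrdO l ε k (f a)) :
    OrdO l ε k (fun x => ∑ a ∈ s, f a x) := IsBigO.fun_sum h

lemma mono (hε : Tendsto ε l (𝓝 0)) (hk : k ≤ k') (h : OrdO l ε k' f) : OrdO l ε k f := by
  refine IsBigO.trans h ?_
  have h1 : (fun x => ε x ^ (k' - k)) =O[l] fun _ => (1 : ℝ) := (hε.pow _).isBigO_one ℝ
  have h2 := h1.mul (isBigO_refl (fun x => ε x ^ k) l)
  simpa only [one_mul, ← pow_add, Nat.sub_add_cancel hk] using h2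

lemma const (c : ℝ) : OrdO l ε 0 (fun _ => c) := by
  simpa [OrdO] using isBigO_const_const c (one_ne_zero (α := ℝ)) l

lemma congr (h : OrdO l ε k f) (hf : ∀ᶠ x in l, f x = f' x) : OrdO l ε k f' :=
  IsBigO.congr' h hf EventuallyEq.rfl

end OrdO

/-! ### The formal solution of the estimating equations to third order -/

section Expansion

variable {ι : Type*} [Fintype ι]

/-- The first-order term of the solution of the estimating equations. -/
def solOne (N : ι → ι → ℝ) (ζ0 : ι → ℝ) (i : ι) : ℝ := -∑ j, N i j * ζ0 j

/-- The second-order term of the solution of the estimating equations. -/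
def solTwo (N : ι → ι → ℝ) (m2 : ι → ι → ι → ℝ) (ζ0 : ι → ℝ) (ζ1 : ι → ι → ℝ) (i : ι) : ℝ :=
  -∑ j, N i j * (∑ k, ζ1 j k * solOne N ζ0 k +
    ∑ k, ∑ r, m2 j k r * (solOne N ζ0 k * solOne N ζ0 r))

/-- The third-order term of the solution of the estimating equations. -/
def solThree (N : ι → ι → ℝ) (m2 : ι → ι → ι → ℝ) (m3 : ι → ι → ι → ι → ℝ) (ζ0 : ι → ℝ)
    (ζ1 : ι → ι → ℝ) (ζ2 : ι → ι → ι → ℝ) (i : ι) : ℝ :=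
  -∑ j, N i j * (∑ k, ζ1 j k * solTwo N m2 ζ0 ζ1 k +
    ∑ k, ∑ r, m2 j k r * (solOne N ζ0 k * solTwo N m2 ζ0 ζ1 r +
      solTwo N m2 ζ0 ζ1 k * solOne N ζ0 r) +
    ∑ k, ∑ r, ζ2 j k r * (solOne N ζ0 k * solOne N ζ0 r) +
    ∑ k, ∑ r, ∑ s, m3 j k r s * (solOne N ζ0 k * solOne N ζ0 r * solOne N ζ0 s))

variable {I : Type*} {l : Filter I} {ε : I → ℝ}

/-- Multiplication by the inverse `N` of the mean Jacobian turns the equations into a fixed-point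
equation for β, in which every substitution of the last approximation gains a factor ε: first β = b1
+ O(ε²), then b1 + b2 + O(ε³), then the conclusion. The fluctuation `E` of the cubic coefficients is
only assumed to be O(1), so its contribution stays visible in the conclusion, to be estimated
according to the available moments. -/
lemma expansion_of_estimating_equations [DecidableEq ι] (hε : Tendsto ε l (𝓝 0))
    {M N : ι → ι → ℝ} (hNM : ∀ i k, ∑ j, N i j * M j k = if i = k then 1 else 0)
    {m2 : ι → ι → ι → ℝ} {m3 : ι → ι → ι → ι → ℝ} {β ζ0 : I → ι → ℝ} {ζ1 : I → ι → ι → ℝ}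
    {ζ2 : I → ι → ι → ι → ℝ} {E : I → ι → ι → ι → ι → ℝ}
    (hβ : ∀ i, OrdO l ε 1 (fun x => β x i)) (h0 : ∀ i, OrdO l ε 1 (fun x => ζ0 x i))
    (h1 : ∀ i j, OrdO l ε 1 (fun x => ζ1 x i j)) (h2 : ∀ i j k, OrdO l ε 1 (fun x => ζ2 x i j k))
    (hE : ∀ i j k r, OrdO l ε 0 (fun x => E x i j k r))
    (heq : ∀ j, OrdO l ε 4 (fun x => ζ0 x j + ∑ k, (M j k + ζ1 x j k) * β x k +
      ∑ k, ∑ r, (m2 j k r + ζ2 x j k r) * (β x k * β x r) +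
      ∑ k, ∑ r, ∑ s, (m3 j k r s + E x j k r s) * (β x k * β x r * β x s))) (i : ι) :
    OrdO l ε 4 (fun x => β x i - (solOne N (ζ0 x) i + solTwo N m2 (ζ0 x) (ζ1 x) i +
      solThree N m2 m3 (ζ0 x) (ζ1 x) (ζ2 x) i) +
      ∑ j, N i j * ∑ k, ∑ r, ∑ s, E x j k r s * (β x k * β x r * β x s)) := by
  set R : I → ι → ℝ := fun x j => ζ0 x j + ∑ k, (M j k + ζ1 x j k) * β x k +
      ∑ k, ∑ r, (m2 j k r + ζ2 x j k r) * (β x k * β x r) +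
      ∑ k, ∑ r, ∑ s, (m3 j k r s + E x j k r s) * (β x k * β x r * β x s) with hR
  have hMβ : ∀ x i, β x i = ∑ j, N i j * ∑ k, M j k * β x k := by
    intro x i
    have : ∑ j, N i j * ∑ k, M j k * β x k = ∑ k, (∑ j, N i j * M j k) * β x k := by
      simp only [Finset.mul_sum, Finset.sum_mul]
      rw [Finset.sum_comm]
      exact Finset.sum_congr rfl fun k _ => Finset.sum_congr rfl fun j _ => by ring
    rw [this]
    simp [hNM]
  have hb1 : ∀ i, OrdO l ε 1 (fun x => solOne N (ζ0 x) i) := fun i =>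
    OrdO.neg (OrdO.sum fun j _ => (h0 j).const_mul _)
  have hb2 : ∀ i, OrdO l ε 2 (fun x => solTwo N m2 (ζ0 x) (ζ1 x) i) := fun i =>
    OrdO.neg (OrdO.sum fun j _ => OrdO.const_mul _ (OrdO.add
      (OrdO.sum fun k _ => (h1 j k).mul (hb1 k))
      (OrdO.sum fun k _ => OrdO.sum fun r _ => OrdO.const_mul _ ((hb1 k).mul (hb1 r)))))
  set b1 : I → ι → ℝ := fun x => solOne N (ζ0 x) with hb1d
  set b2 : I → ι → ℝ := fun x => solTwo N m2 (ζ0 x) (ζ1 x) with hb2d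
  have hcub : ∀ j, OrdO l ε 3 (fun x => ∑ k, ∑ r, ∑ s, (m3 j k r s + E x j k r s) *
      (β x k * β x r * β x s)) := fun j =>
    OrdO.sum fun k _ => OrdO.sum fun r _ => OrdO.sum fun s _ => by
      have := ((OrdO.const (l := l) (ε := ε) (m3 j k r s)).add (hE j k r s)).mul
        (((hβ k).mul (hβ r)).mul (hβ s))
      simpa using this
  have hdiff1 : ∀ i, OrdO l ε 2 (fun x => β x i - b1 x i) := by
    intro i
    have e : ∀ x, β x i - b1 x i = ∑ j, N i j * (R x j - ∑ k, ζ1 x j k * β x k -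
        ∑ k, ∑ r, (m2 j k r + ζ2 x j k r) * (β x k * β x r) -
        ∑ k, ∑ r, ∑ s, (m3 j k r s + E x j k r s) * (β x k * β x r * β x s)) := by
      intro x
      simp only [hb1d, solOne]
      rw [hMβ x i, sub_neg_eq_add, ← Finset.sum_add_distrib]
      refine Finset.sum_congr rfl fun j _ => ?_
      simp only [hR, add_mul, Finset.sum_add_distrib]
      ring
    simp only [e]
    refine OrdO.sum fun j _ => OrdO.const_mul _ (OrdO.sub (OrdO.sub (OrdO.sub ?_ ?_) ?_) ?_)
    · exact (heq j).mono hε (by norm_num)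
    · exact OrdO.sum fun k _ => (h1 j k).mul (hβ k)
    · refine OrdO.sum fun k _ => OrdO.sum fun r _ => ?_
      have := ((OrdO.const (l := l) (ε := ε) (m2 j k r)).add
        ((h2 j k r).mono hε (Nat.zero_le _))).mul ((hβ k).mul (hβ r))
      simpa using this
    · exact (hcub j).mono hε (by norm_num)
  have hprod1 : ∀ k r, OrdO l ε 3 (fun x => β x k * β x r - b1 x k * b1 x r) := by
    intro k r
    have := ((hdiff1 k).mul (hβ r)).add ((hb1 k).mul (hdiff1 r))
    refine this.congr (Eventually.of_forall fun x => ?_)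
    ring
  have hdiff2 : ∀ i, OrdO l ε 3 (fun x => β x i - b1 x i - b2 x i) := by
    intro i
    have e : ∀ x, β x i - b1 x i - b2 x i = ∑ j, N i j * (R x j -
        ∑ k, ζ1 x j k * (β x k - b1 x k) -
        ∑ k, ∑ r, m2 j k r * (β x k * β x r - b1 x k * b1 x r) -
        ∑ k, ∑ r, ζ2 x j k r * (β x k * β x r) -
        ∑ k, ∑ r, ∑ s, (m3 j k r s + E x j k r s) * (β x k * β x r * β x s)) := by
      intro x
      simp only [hb2d, solTwo, hb1d]
      rw [hMβ x i, sub_neg_eq_add]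
      conv_lhs => rw [solOne]
      rw [sub_neg_eq_add, ← Finset.sum_add_distrib, ← Finset.sum_add_distrib]
      refine Finset.sum_congr rfl fun j _ => ?_
      simp only [hR, add_mul, mul_sub, Finset.sum_add_distrib, Finset.sum_sub_distrib]
      ring
    simp only [e]
    refine OrdO.sum fun j _ => OrdO.const_mul _
      (OrdO.sub (OrdO.sub (OrdO.sub (OrdO.sub ?_ ?_) ?_) ?_) ?_)
    · exact (heq j).mono hε (by norm_num)
    · exact OrdO.sum fun k _ => (h1 j k).mul (hdiff1 k)
    · exact OrdO.sum fun k _ => OrdO.sum fun r _ => (hprod1 k r).const_mul _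
    · exact OrdO.sum fun k _ => OrdO.sum fun r _ => (h2 j k r).mul ((hβ k).mul (hβ r))
    · exact hcub j
  have hprod2 : ∀ k r, OrdO l ε 4 (fun x => β x k * β x r - b1 x k * b1 x r -
      (b1 x k * b2 x r + b2 x k * b1 x r)) := by
    intro k r
    have := (((hdiff2 k).mul (hβ r)).add ((hb1 k).mul (hdiff2 r))).add ((hb2 k).mul (hdiff1 r))
    refine this.congr (Eventually.of_forall fun x => ?_)
    ring
  have hprod3 : ∀ k r s, OrdO l ε 4 (fun x => β x k * β x r * β x s -
      b1 x k * b1 x r * b1 x s) := by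
    intro k r s
    have := ((hprod1 k r).mul (hβ s)).add (((hb1 k).mul (hb1 r)).mul (hdiff1 s))
    refine this.congr (Eventually.of_forall fun x => ?_)
    ring
  -- An exact identity: each sum on the right compares one term of the equations at β with its
  -- approximation from the lower-order solution, and the preceding bounds make every such
  -- difference O(ε⁴).
  have e : ∀ x, β x i - (b1 x i + b2 x i + solThree N m2 m3 (ζ0 x) (ζ1 x) (ζ2 x) i) +
      ∑ j, N i j * ∑ k, ∑ r, ∑ s, E x j k r s * (β x k * β x r * β x s) =
      ∑ j, N i j * (R x j -
        ∑ k, ζ1 x j k * (β x k - b1 x k - b2 x k) -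
        ∑ k, ∑ r, m2 j k r * (β x k * β x r - b1 x k * b1 x r -
          (b1 x k * b2 x r + b2 x k * b1 x r)) -
        ∑ k, ∑ r, ζ2 x j k r * (β x k * β x r - b1 x k * b1 x r) -
        ∑ k, ∑ r, ∑ s, m3 j k r s * (β x k * β x r * β x s - b1 x k * b1 x r * b1 x s)) := by
    intro x
    have e1 : b1 x i = -∑ j, N i j * ζ0 x j := rfl
    have e2 : b2 x i = -∑ j, N i j * (∑ k, ζ1 x j k * b1 x k +
      ∑ k, ∑ r, m2 j k r * (b1 x k * b1 x r)) := rfl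
    have e3 : solThree N m2 m3 (ζ0 x) (ζ1 x) (ζ2 x) i = -∑ j, N i j *
      (∑ k, ζ1 x j k * b2 x k +
      ∑ k, ∑ r, m2 j k r * (b1 x k * b2 x r + b2 x k * b1 x r) +
      ∑ k, ∑ r, ζ2 x j k r * (b1 x k * b1 x r) +
      ∑ k, ∑ r, ∑ s, m3 j k r s * (b1 x k * b1 x r * b1 x s)) := rfl
    rw [e1, e2, e3, hMβ x i, ← neg_add, ← neg_add, sub_neg_eq_add, ← Finset.sum_add_distrib,
      ← Finset.sum_add_distrib, ← Finset.sum_add_distrib, ← Finset.sum_add_distrib]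
    refine Finset.sum_congr rfl fun j _ => ?_
    simp only [hR, add_mul, mul_sub, mul_add, Finset.sum_add_distrib, Finset.sum_sub_distrib]
    ring
  refine OrdO.congr ?_ (Eventually.of_forall fun x => (e x).symm)
  refine OrdO.sum fun j _ => OrdO.const_mul _
    (OrdO.sub (OrdO.sub (OrdO.sub (OrdO.sub (heq j) ?_) ?_) ?_) ?_)
  · exact OrdO.sum fun k _ => (h1 j k).mul (hdiff2 k)
  · exact OrdO.sum fun k _ => OrdO.sum fun r _ => (hprod2 k r).const_mul _
  · exact OrdO.sum fun k _ => OrdO.sum fun r _ => (h2 j k r).mul (hprod1 k r)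
  · exact OrdO.sum fun k _ => OrdO.sum fun r _ => OrdO.sum fun s _ => (hprod3 k r s).const_mul _

end Expansion

/-! ### Graded forms -/

section Forms

variable {J : Type*} [Fintype J] (w : J → ℕ)

/-- Linear forms whose terms have weight at most `n`. -/
def IsForm1 (n : ℕ) (f : (J → ℝ) → ℝ) : Prop :=
  ∃ c : J → ℝ, (∀ j, c j ≠ 0 → w j ≤ n) ∧ ∀ z, f z = ∑ j, c j * z j

/-- Quadratic forms whose terms have weight at most `n`. -/
def IsForm2 (n : ℕ) (f : (J → ℝ) → ℝ) : Prop :=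
  ∃ c : J → J → ℝ, (∀ j k, c j k ≠ 0 → w j + w k ≤ n) ∧ ∀ z, f z = ∑ j, ∑ k, c j k * z j * z k

/-- Cubic forms whose terms have weight at most `n`. -/
def IsForm3 (n : ℕ) (f : (J → ℝ) → ℝ) : Prop :=
  ∃ c : J → J → J → ℝ, (∀ j k l, c j k l ≠ 0 → w j + w k + w l ≤ n) ∧
    ∀ z, f z = ∑ j, ∑ k, ∑ l, c j k l * z j * z k * z l

variable {w} {n n' : ℕ} {f f' : (J → ℝ) → ℝ}

lemma IsForm1.coord [DecidableEq J] (j : J) (hj : w j ≤ n) : IsForm1 w n (fun z => z j) :=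
  ⟨fun i => if i = j then 1 else 0, fun i hi => by
    have : i = j := by by_contra h; simp [h] at hi
    rwa [this], fun z => by simp⟩

lemma IsForm2.mono (hn : n ≤ n') (h : IsForm2 w n f) : IsForm2 w n' f := by
  obtain ⟨c, hc, hf⟩ := h
  exact ⟨c, fun j k hj => (hc j k hj).trans hn, hf⟩

lemma IsForm3.mono (hn : n ≤ n') (h : IsForm3 w n f) : IsForm3 w n' f := by
  obtain ⟨c, hc, hf⟩ := h
  exact ⟨c, fun j k l hj => (hc j k l hj).trans hn, hf⟩

lemma IsForm1.const_mul (a : ℝ) (h : IsForm1 w n f) : IsForm1 w n (fun z => a * f z) := by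
  obtain ⟨c, hc, hf⟩ := h
  exact ⟨fun j => a * c j, fun j hj => hc j (right_ne_zero_of_mul hj), fun z => by
    simp only [hf, Finset.mul_sum, mul_assoc]⟩

lemma IsForm2.const_mul (a : ℝ) (h : IsForm2 w n f) : IsForm2 w n (fun z => a * f z) := by
  obtain ⟨c, hc, hf⟩ := h
  exact ⟨fun j k => a * c j k, fun j k hj => hc j k (right_ne_zero_of_mul hj), fun z => by
    simp only [hf, Finset.mul_sum, mul_assoc]⟩

lemma IsForm3.const_mul (a : ℝ) (h : IsForm3 w n f) : IsForm3 w n (fun z => a * f z) := by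
  obtain ⟨c, hc, hf⟩ := h
  exact ⟨fun j k l => a * c j k l, fun j k l hj => hc j k l (right_ne_zero_of_mul hj), fun z => by
    simp only [hf, Finset.mul_sum, mul_assoc]⟩

lemma IsForm1.sum {α : Type*} {s : Finset α} {f : α → (J → ℝ) → ℝ}
    (h : ∀ a ∈ s, IsForm1 w n (f a)) : IsForm1 w n (fun z => ∑ a ∈ s, f a z) := by
  choose! c hc hf using h
  refine ⟨fun j => ∑ a ∈ s, c a j, fun j hj => ?_, fun z => ?_⟩
  · obtain ⟨a, ha, hne⟩ := Finset.exists_ne_zero_of_sum_ne_zero hj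
    exact hc a ha j hne
  · beta_reduce
    rw [Finset.sum_congr rfl fun a ha => hf a ha z, Finset.sum_comm]
    simp only [Finset.sum_mul]

lemma IsForm2.sum {α : Type*} {s : Finset α} {f : α → (J → ℝ) → ℝ}
    (h : ∀ a ∈ s, IsForm2 w n (f a)) : IsForm2 w n (fun z => ∑ a ∈ s, f a z) := by
  choose! c hc hf using h
  refine ⟨fun j k => ∑ a ∈ s, c a j k, fun j k hj => ?_, fun z => ?_⟩
  · obtain ⟨a, ha, hne⟩ := Finset.exists_ne_zero_of_sum_ne_zero hj
    exact hc a ha j k hne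
  · beta_reduce
    rw [Finset.sum_congr rfl fun a ha => hf a ha z, Finset.sum_comm]
    simp only [Finset.sum_mul]
    exact Finset.sum_congr rfl fun j _ => Finset.sum_comm

lemma IsForm3.sum {α : Type*} {s : Finset α} {f : α → (J → ℝ) → ℝ}
    (h : ∀ a ∈ s, IsForm3 w n (f a)) : IsForm3 w n (fun z => ∑ a ∈ s, f a z) := by
  choose! c hc hf using h
  refine ⟨fun j k l => ∑ a ∈ s, c a j k l, fun j k l hj => ?_, fun z => ?_⟩
  · obtain ⟨a, ha, hne⟩ := Finset.exists_ne_zero_of_sum_ne_zero hj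
    exact hc a ha j k l hne
  · beta_reduce
    rw [Finset.sum_congr rfl fun a ha => hf a ha z, Finset.sum_comm]
    simp only [Finset.sum_mul]
    refine Finset.sum_congr rfl fun j _ => ?_
    rw [Finset.sum_comm]
    exact Finset.sum_congr rfl fun k _ => Finset.sum_comm

lemma IsForm2.add (h : IsForm2 w n f) (h' : IsForm2 w n f') :
    IsForm2 w n (fun z => f z + f' z) := by
  have := IsForm2.sum (w := w) (n := n) (s := Finset.univ) (f := fun b : Bool => bif b then f else f')
    (by intro a _; cases a <;> assumption)
  simpa using this

lemma IsForm3.add (h : IsForm3 w n f) (h' : IsForm3 w n f') :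
    IsForm3 w n (fun z => f z + f' z) := by
  have := IsForm3.sum (w := w) (n := n) (s := Finset.univ) (f := fun b : Bool => bif b then f else f')
    (by intro a _; cases a <;> assumption)
  simpa using this

lemma IsForm1.mul (h : IsForm1 w n f) (h' : IsForm1 w n' f') :
    IsForm2 w (n + n') (fun z => f z * f' z) := by
  obtain ⟨c, hc, hf⟩ := h
  obtain ⟨c', hc', hf'⟩ := h'
  refine ⟨fun j k => c j * c' k, fun j k hj => add_le_add (hc j (left_ne_zero_of_mul hj))
    (hc' k (right_ne_zero_of_mul hj)), fun z => ?_⟩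
  beta_reduce
  rw [hf, hf', Finset.sum_mul_sum]
  exact Finset.sum_congr rfl fun j _ => Finset.sum_congr rfl fun k _ => by ring

lemma IsForm2.mul (h : IsForm2 w n f) (h' : IsForm1 w n' f') :
    IsForm3 w (n + n') (fun z => f z * f' z) := by
  obtain ⟨c, hc, hf⟩ := h
  obtain ⟨c', hc', hf'⟩ := h'
  refine ⟨fun j k l => c j k * c' l, fun j k l hj => add_le_add (hc j k (left_ne_zero_of_mul hj))
    (hc' l (right_ne_zero_of_mul hj)), fun z => ?_⟩
  beta_reduce
  rw [hf, hf', Finset.sum_mul]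
  refine Finset.sum_congr rfl fun j _ => ?_
  rw [Finset.sum_mul]
  refine Finset.sum_congr rfl fun k _ => ?_
  rw [Finset.mul_sum]
  exact Finset.sum_congr rfl fun l _ => by ring

variable {ι : Type*} [Fintype ι] [DecidableEq J] {e0 : ι → J} {e1 : ι → ι → J}
  {e2 : ι → ι → ι → J}

lemma isForm1_solOne (N : ι → ι → ℝ) (h0 : ∀ i, w (e0 i) ≤ 1) (i : ι) :
    IsForm1 w 1 (fun z => solOne N (fun i => z (e0 i)) i) := by
  have := (IsForm1.sum (w := w) (n := 1) (s := Finset.univ) fun j _ =>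
    (IsForm1.coord (w := w) (e0 j) (h0 j)).const_mul (N i j)).const_mul (-1)
  simp only [neg_one_mul] at this
  exact this

lemma isForm2_solTwo (N : ι → ι → ℝ) (m2 : ι → ι → ι → ℝ) (h0 : ∀ i, w (e0 i) ≤ 1)
    (h1 : ∀ i j, w (e1 i j) ≤ 2) (i : ι) :
    IsForm2 w 3 (fun z => solTwo N m2 (fun i => z (e0 i)) (fun i j => z (e1 i j)) i) := by
  have hb := isForm1_solOne (e0 := e0) N h0
  have := (IsForm2.sum (w := w) (n := 3) (s := Finset.univ) fun j _ =>
    ((IsForm2.sum (s := Finset.univ) fun k _ =>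
      (IsForm1.coord (w := w) (e1 j k) (h1 j k)).mul (hb k)).add
    (IsForm2.sum (s := Finset.univ) fun k _ => IsForm2.sum (s := Finset.univ) fun r _ =>
      (((hb k).mul (hb r)).mono (by norm_num : 1 + 1 ≤ 2 + 1)).const_mul
        (m2 j k r))).const_mul (N i j)).const_mul (-1)
  simp only [neg_one_mul] at this
  exact this

/-- The weight 5 is attained by ζ1 · b2, with 2 + 3, and by ζ2 · b1 · b1, with 3 + 1 + 1. Together
with the weight 1 of the linear term this stays within six moments of the bound. -/
lemma isForm3_solThree (N : ι → ι → ℝ) (m2 : ι → ι → ι → ℝ) (m3 : ι → ι → ι → ι → ℝ)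
    (h0 : ∀ i, w (e0 i) ≤ 1) (h1 : ∀ i j, w (e1 i j) ≤ 2) (h2 : ∀ i j k, w (e2 i j k) ≤ 3)
    (i : ι) :
    IsForm3 w 5 (fun z => solThree N m2 m3 (fun i => z (e0 i)) (fun i j => z (e1 i j))
      (fun i j k => z (e2 i j k)) i) := by
  have hb := isForm1_solOne (e0 := e0) N h0
  have hb2 := isForm2_solTwo (e0 := e0) (e1 := e1) N m2 h0 h1
  have hcomm : ∀ {f f' : (J → ℝ) → ℝ}, IsForm1 w 1 f → IsForm2 w 3 f' →
      IsForm3 w 5 (fun z => f z * f' z) := fun hf hf' => by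
    simpa only [mul_comm] using (hf'.mul hf).mono (by norm_num : 3 + 1 ≤ 5)
  have hcomm2 : ∀ {f f' : (J → ℝ) → ℝ}, IsForm1 w 2 f → IsForm2 w 3 f' →
      IsForm3 w 5 (fun z => f z * f' z) := fun hf hf' => by
    simpa only [mul_comm] using (hf'.mul hf)
  have hcomm3 : ∀ {f f' : (J → ℝ) → ℝ}, IsForm1 w 3 f → IsForm2 w 2 f' →
      IsForm3 w 5 (fun z => f z * f' z) := fun hf hf' => by
    simpa only [mul_comm] using (hf'.mul hf)
  have := (IsForm3.sum (w := w) (n := 5) (s := Finset.univ) fun j _ =>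
    ((((IsForm3.sum (s := Finset.univ) fun k _ =>
      hcomm2 (IsForm1.coord (w := w) (e1 j k) (h1 j k)) (hb2 k)).add
    (IsForm3.sum (s := Finset.univ) fun k _ => IsForm3.sum (s := Finset.univ) fun r _ =>
      ((hcomm (hb k) (hb2 r)).add (((hb2 k).mul (hb r)).mono (by norm_num : 3 + 1 ≤ 5))).const_mul
        (m2 j k r))).add
    (IsForm3.sum (s := Finset.univ) fun k _ => IsForm3.sum (s := Finset.univ) fun r _ =>
      hcomm3 (IsForm1.coord (w := w) (e2 j k r) (h2 j k r)) ((hb k).mul (hb r)))).add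
    (IsForm3.sum (s := Finset.univ) fun k _ => IsForm3.sum (s := Finset.univ) fun r _ =>
      IsForm3.sum (s := Finset.univ) fun s _ =>
      ((((hb k).mul (hb r)).mul (hb s)).mono (by norm_num : 1 + 1 + 1 ≤ 5)).const_mul
        (m3 j k r s))).const_mul (N i j)).const_mul (-1)
  simp only [neg_one_mul] at this
  exact this

end Forms

/-! ### Taylor polynomials of the moment functions -/

section Taylor

/-- A third-order Taylor estimate on the unit interval. -/
lemma norm_taylor_three_le {F : Type*} [NormedAddCommGroup F] [NormedSpace ℝ F]
    {φ0 φ1 φ2 φ3 : ℝ → F} {C : ℝ}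
    (h0 : ∀ t ∈ Set.Icc (0 : ℝ) 1, HasDerivAt φ0 (φ1 t) t)
    (h1 : ∀ t ∈ Set.Icc (0 : ℝ) 1, HasDerivAt φ1 (φ2 t) t)
    (h2 : ∀ t ∈ Set.Icc (0 : ℝ) 1, HasDerivAt φ2 (φ3 t) t)
    (h3 : ∀ t ∈ Set.Icc (0 : ℝ) 1, ‖φ3 t - φ3 0‖ ≤ C) :
    ‖φ0 1 - (φ0 0 + φ1 0 + (1 / 2 : ℝ) • φ2 0 + (1 / 6 : ℝ) • φ3 0)‖ ≤ C := by
  have hC : 0 ≤ C := (norm_nonneg _).trans (h3 0 (by simp))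
  -- The mean value inequality on the unit interval, applied three times from φ2 down to φ0. The
  -- factorials that integration would gain are not needed.
  have mv : ∀ {ψ ψ' : ℝ → F}, ψ 0 = 0 → (∀ t ∈ Set.Icc (0 : ℝ) 1, HasDerivAt ψ (ψ' t) t) →
      (∀ t ∈ Set.Icc (0 : ℝ) 1, ‖ψ' t‖ ≤ C) → ∀ t ∈ Set.Icc (0 : ℝ) 1, ‖ψ t‖ ≤ C := by
    intro ψ ψ' hz hd hb t ht
    have := Convex.norm_image_sub_le_of_norm_hasDerivWithin_le
      (fun x hx => (hd x hx).hasDerivWithinAt) hb (convex_Icc (0 : ℝ) 1)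
      (Set.left_mem_Icc.2 zero_le_one) ht
    rw [hz, sub_zero, sub_zero, Real.norm_eq_abs, abs_of_nonneg ht.1] at this
    exact this.trans (mul_le_of_le_one_right hC ht.2)
  have r2 : ∀ t ∈ Set.Icc (0 : ℝ) 1, ‖φ2 t - φ2 0 - t • φ3 0‖ ≤ C := by
    refine mv (by simp) (fun t ht => ?_) h3
    have := ((h2 t ht).sub_const (φ2 0)).sub ((hasDerivAt_id t).smul_const (φ3 0))
    simpa using! this
  have r1 : ∀ t ∈ Set.Icc (0 : ℝ) 1, ‖φ1 t - φ1 0 - t • φ2 0 - (t ^ 2 / 2) • φ3 0‖ ≤ C := by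
    refine mv (by simp) (fun t ht => ?_) r2
    have hd : HasDerivAt (fun t : ℝ => t ^ 2 / 2) t t := by
      have := ((hasDerivAt_pow 2 t).div_const 2)
      simpa using! this
    have := (((h1 t ht).sub_const (φ1 0)).sub ((hasDerivAt_id t).smul_const (φ2 0))).sub
      (hd.smul_const (φ3 0))
    simpa using! this
  have r0 : ∀ t ∈ Set.Icc (0 : ℝ) 1,
      ‖φ0 t - φ0 0 - t • φ1 0 - (t ^ 2 / 2) • φ2 0 - (t ^ 3 / 6) • φ3 0‖ ≤ C := by
    refine mv (by simp) (fun t ht => ?_) r1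
    have hd : HasDerivAt (fun t : ℝ => t ^ 2 / 2) t t := by
      have := ((hasDerivAt_pow 2 t).div_const 2)
      simpa using! this
    have hd3 : HasDerivAt (fun t : ℝ => t ^ 3 / 6) (t ^ 2 / 2) t := by
      have := ((hasDerivAt_pow 3 t).div_const 6)
      convert! this using 1
      simp
      ring
    have := ((((h0 t ht).sub_const (φ0 0)).sub ((hasDerivAt_id t).smul_const (φ1 0))).sub
      (hd.smul_const (φ2 0))).sub (hd3.smul_const (φ3 0))
    simpa using! this
  have := r0 1 (by simp)
  convert this using 2
  simp
  abel

variable {m p : ℕ}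

/-- The moment function of a single observation is smooth near `θs`, with derivatives of orders
`0, …, 4` bounded by `B` and Lipschitz with constant `B`. -/
structure LocallySmooth (G : EuclideanSpace ℝ (Fin p) → EuclideanSpace ℝ (Fin m))
    (θs : EuclideanSpace ℝ (Fin p)) (r B : ℝ) : Prop where
  contDiff : ContDiffOn ℝ 4 G (Metric.ball θs r)
  bound : ∀ k ≤ 4, ∀ θ ∈ Metric.ball θs r, ‖iteratedFDeriv ℝ k G θ‖ ≤ B
  lip : ∀ k ≤ 4, ∀ θ ∈ Metric.ball θs r, ∀ θ' ∈ Metric.ball θs r,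
    ‖iteratedFDeriv ℝ k G θ - iteratedFDeriv ℝ k G θ'‖ ≤ B * ‖θ - θ'‖

variable {G : EuclideanSpace ℝ (Fin p) → EuclideanSpace ℝ (Fin m)}
  {θs : EuclideanSpace ℝ (Fin p)} {r B : ℝ}

lemma LocallySmooth.contDiffAt (h : LocallySmooth G θs r B) {θ : EuclideanSpace ℝ (Fin p)}
    (hθ : θ ∈ Metric.ball θs r) : ContDiffAt ℝ 4 G θ :=
  h.contDiff.contDiffAt (Metric.isOpen_ball.mem_nhds hθ)

/-- The derivative of a partial derivative along a line. -/
lemma LocallySmooth.hasDerivAt (h : LocallySmooth G θs r B) {θ u : EuclideanSpace ℝ (Fin p)}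
    {t : ℝ} (ht : θ + t • u ∈ Metric.ball θs r) {k : ℕ} (hk : k < 4)
    (v : Fin k → EuclideanSpace ℝ (Fin p)) :
    HasDerivAt (fun s : ℝ => iteratedFDeriv ℝ k G (θ + s • u) v)
      (iteratedFDeriv ℝ (k + 1) G (θ + t • u) (Matrix.vecCons u v)) t := by
  have h1 : DifferentiableAt ℝ (iteratedFDeriv ℝ k G) (θ + t • u) :=
    (h.contDiffAt ht).differentiableAt_iteratedFDeriv (by exact_mod_cast hk)
  have h2 : HasDerivAt (fun s : ℝ => θ + s • u) u t := by
    simpa using! ((hasDerivAt_id t).smul_const u).const_add θ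
  have h3 := h1.hasFDerivAt.comp_hasDerivAt t h2
  have h4 := (ContinuousMultilinearMap.apply ℝ
    (fun _ : Fin k => EuclideanSpace ℝ (Fin p)) (EuclideanSpace ℝ (Fin m)) v).hasFDerivAt.comp_hasDerivAt t h3
  rw [iteratedFDeriv_succ_apply_left]
  exact h4

/-- Partial derivatives of `G`, in terms of the coordinate directions `σ`. -/
def partialCoef (G : EuclideanSpace ℝ (Fin p) → EuclideanSpace ℝ (Fin m))
    (θ : EuclideanSpace ℝ (Fin p)) {k : ℕ} (σ : Fin k → Fin p) (j : Fin m) : ℝ :=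
  iteratedFDeriv ℝ k G θ (fun i => EuclideanSpace.single (σ i) 1) j

lemma LocallySmooth.abs_partialCoef_le (h : LocallySmooth G θs r B) {θ : EuclideanSpace ℝ (Fin p)}
    (hθ : θ ∈ Metric.ball θs r) {k : ℕ} (hk : k ≤ 4) (σ : Fin k → Fin p) (j : Fin m) :
    |partialCoef G θ σ j| ≤ B := by
  have h1 := (iteratedFDeriv ℝ k G θ).le_opNorm (fun i => EuclideanSpace.single (σ i) (1 : ℝ))
  simp only [PiLp.norm_single, norm_one, Finset.prod_const_one, mul_one] at h1
  exact (PiLp.norm_apply_le _ j).trans (h1.trans (h.bound k hk θ hθ))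

/-- This and the next two lemmas expand the first, second and third slot in coordinates, so that
derivatives in a direction u become sums of partial derivatives. -/
lemma multilinear_cons_sum {k : ℕ} {F : Type*} [NormedAddCommGroup F] [NormedSpace ℝ F]
    (f : ContinuousMultilinearMap ℝ (fun _ : Fin (k + 1) => EuclideanSpace ℝ (Fin p)) F)
    (u : EuclideanSpace ℝ (Fin p)) (v : Fin k → EuclideanSpace ℝ (Fin p)) :
    f (Matrix.vecCons u v) = ∑ a, u a • f (Matrix.vecCons (EuclideanSpace.single a 1) v) := by
  have h1 : ∀ x, f (Matrix.vecCons x v) = (f.curryLeft x) v := fun x => by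
    simp [ContinuousMultilinearMap.curryLeft_apply, Matrix.vecCons]
  have h2 : u = ∑ a, u a • EuclideanSpace.single a (1 : ℝ) := by
    ext b
    simp [Pi.single_apply]
  simp only [h1]
  conv_lhs => rw [h2]
  rw [map_sum]
  simp

lemma multilinear_cons_cons_sum {k : ℕ} {F : Type*} [NormedAddCommGroup F] [NormedSpace ℝ F]
    (f : ContinuousMultilinearMap ℝ (fun _ : Fin (k + 1 + 1) => EuclideanSpace ℝ (Fin p)) F)
    (u x : EuclideanSpace ℝ (Fin p)) (v : Fin k → EuclideanSpace ℝ (Fin p)) :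
    f (Matrix.vecCons x (Matrix.vecCons u v)) =
      ∑ a, u a • f (Matrix.vecCons x (Matrix.vecCons (EuclideanSpace.single a 1) v)) := by
  have h1 : ∀ w, f (Matrix.vecCons x w) = (f.curryLeft x) w := fun w => by
    simp [ContinuousMultilinearMap.curryLeft_apply, Matrix.vecCons]
  simp only [h1]
  exact multilinear_cons_sum _ _ _

lemma multilinear_cons_cons_cons_sum {k : ℕ} {F : Type*} [NormedAddCommGroup F] [NormedSpace ℝ F]
    (f : ContinuousMultilinearMap ℝ (fun _ : Fin (k + 1 + 1 + 1) => EuclideanSpace ℝ (Fin p)) F)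
    (u x y : EuclideanSpace ℝ (Fin p)) (v : Fin k → EuclideanSpace ℝ (Fin p)) :
    f (Matrix.vecCons x (Matrix.vecCons y (Matrix.vecCons u v))) = ∑ a, u a •
      f (Matrix.vecCons x (Matrix.vecCons y (Matrix.vecCons (EuclideanSpace.single a 1) v))) := by
  have h1 : ∀ w, f (Matrix.vecCons x w) = (f.curryLeft x) w := fun w => by
    simp [ContinuousMultilinearMap.curryLeft_apply, Matrix.vecCons]
  simp only [h1]
  exact multilinear_cons_cons_sum _ _ _ _

/-- The polynomial with Taylor coefficients `D0, D1, D2, D3` in the variables `β (inl a)`. -/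
def taylorJet (m : ℕ) (D0 : ℝ) (D1 : Fin p → ℝ) (D2 : Fin p → Fin p → ℝ)
    (D3 : Fin p → Fin p → Fin p → ℝ) : Jet (Fin p ⊕ Fin m) where
  c0 := D0
  c1 a := match a with
    | .inl a => D1 a
    | .inr _ => 0
  c2 a b := match a, b with
    | .inl a, .inl b => 1 / 2 * D2 a b
    | _, _ => 0
  c3 a b c := match a, b, c with
    | .inl a, .inl b, .inl c => 1 / 6 * D3 a b c
    | _, _, _ => 0

/-- The displacement of the parameter contained in `β`. -/
def thetaPart (β : Fin p ⊕ Fin m → ℝ) : EuclideanSpace ℝ (Fin p) :=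
  WithLp.toLp 2 fun a => β (.inl a)

@[simp] lemma thetaPart_apply (β : Fin p ⊕ Fin m → ℝ) (a : Fin p) :
    thetaPart β a = β (.inl a) := rfl

lemma norm_thetaPart_le (β : Fin p ⊕ Fin m → ℝ) : ‖thetaPart β‖ ≤ p * ‖β‖ := by
  have h2 : thetaPart β = ∑ a, β (.inl a) • EuclideanSpace.single a (1 : ℝ) := by
    ext b
    simp [Pi.single_apply]
  rw [h2]
  refine (norm_sum_le _ _).trans ((Finset.sum_le_card_nsmul _ _ ‖β‖ fun a _ => ?_).trans ?_)
  · rw [norm_smul]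
    simpa using norm_le_pi_norm β (.inl a)
  · simp

/-- The factor (1 + p)⁴ pays for the comparison of the Euclidean norm of the parameter part with the
sup norm of β, in a remainder of degree four. The coefficients need only be bounded by B, since B ≥
1 leaves room in the bounds B · Bᵏ. -/
lemma hasJet_taylorJet {f : (Fin p ⊕ Fin m → ℝ) → ℝ} {D0 : ℝ} {D1 : Fin p → ℝ}
    {D2 : Fin p → Fin p → ℝ} {D3 : Fin p → Fin p → Fin p → ℝ} (hB : 1 ≤ B)
    (h0 : |D0| ≤ B) (h1 : ∀ a, |D1 a| ≤ B) (h2 : ∀ a b, |D2 a b| ≤ B)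
    (h3 : ∀ a b c, |D3 a b c| ≤ B)
    (hrem : ∀ β, B * ‖β‖ ≤ 1 → |f β - (D0 + ∑ a, β (.inl a) * D1 a +
      1 / 2 * ∑ a, ∑ b, β (.inl a) * (β (.inl b) * D2 a b) + 1 / 6 * ∑ a, ∑ b, ∑ c,
        β (.inl a) * (β (.inl b) * (β (.inl c) * D3 a b c)))| ≤ B * ‖thetaPart β‖ ^ 4) :
    HasJet f (taylorJet m D0 D1 D2 D3) B ((1 + p) ^ 4 * B) := by
  have hB0 : 0 ≤ B := by linarith
  have hp : (1 : ℝ) ≤ (1 + p) ^ 4 := one_le_pow₀ (by simp)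
  have hS : B ≤ (1 + p) ^ 4 * B := le_mul_of_one_le_left hB0 hp
  have hS0 : 0 ≤ (1 + p) ^ 4 * B := by positivity
  have hk : ∀ k, (1 + p) ^ 4 * B ≤ (1 + p) ^ 4 * B * B ^ k := fun k =>
    le_mul_of_one_le_right hS0 (one_le_pow₀ hB)
  refine ⟨h0.trans hS, fun a => ?_, fun a b => ?_, fun a b c => ?_, fun β hβ => ?_⟩
  · have := hk 1
    rw [pow_one] at this
    rcases a with a | a
    · exact (h1 a).trans (hS.trans this)
    · simpa [taylorJet] using hS0.trans this
  · rcases a with a | a <;> rcases b with b | b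
    · have h := h2 a b
      simp only [taylorJet, abs_mul]
      rw [abs_of_pos (by norm_num : (0 : ℝ) < 1 / 2)]
      linarith [hk 2, abs_nonneg (D2 a b)]
    all_goals simpa [taylorJet] using hS0.trans (hk 2)
  · rcases a with a | a <;> rcases b with b | b <;> rcases c with c | c
    · have h := h3 a b c
      simp only [taylorJet, abs_mul]
      rw [abs_of_pos (by norm_num : (0 : ℝ) < 1 / 6)]
      linarith [hk 3, abs_nonneg (D3 a b c)]
    all_goals simpa [taylorJet] using hS0.trans (hk 3)
  · have e : (taylorJet m D0 D1 D2 D3).eval β = D0 + ∑ a, β (.inl a) * D1 a +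
      1 / 2 * ∑ a, ∑ b, β (.inl a) * (β (.inl b) * D2 a b) + 1 / 6 * ∑ a, ∑ b, ∑ c,
        β (.inl a) * (β (.inl b) * (β (.inl c) * D3 a b c)) := by
      simp only [Jet.eval, Jet.part1, Jet.part2, Jet.part3, taylorJet, Fintype.sum_sum_type,
        zero_mul, Finset.sum_const_zero, add_zero, Finset.mul_sum]
      congr 1
      · congr 1
        · congr 1
          exact Finset.sum_congr rfl fun a _ => mul_comm _ _
        · exact Finset.sum_congr rfl fun a _ => Finset.sum_congr rfl fun b _ => by ring
      · exact Finset.sum_congr rfl fun a _ => Finset.sum_congr rfl fun b _ =>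
          Finset.sum_congr rfl fun c _ => by ring
    rw [e]
    refine (hrem β hβ).trans ?_
    have h4 : ‖thetaPart β‖ ^ 4 ≤ ((1 + p) * (B * ‖β‖)) ^ 4 := by
      refine pow_le_pow_left₀ (norm_nonneg _) ((norm_thetaPart_le β).trans ?_) 4
      have : ‖β‖ ≤ B * ‖β‖ := le_mul_of_one_le_left (norm_nonneg _) hB
      have hp0 : (0 : ℝ) ≤ p := by positivity
      nlinarith [norm_nonneg β]
    calc B * ‖thetaPart β‖ ^ 4 ≤ B * ((1 + p) * (B * ‖β‖)) ^ 4 := by gcongr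
      _ = _ := by rw [mul_pow]; ring

/-- The Taylor polynomial of `β ↦ G (θs + thetaPart β) j`. -/
def momentJet (G : EuclideanSpace ℝ (Fin p) → EuclideanSpace ℝ (Fin m))
    (θs : EuclideanSpace ℝ (Fin p)) (j : Fin m) : Jet (Fin p ⊕ Fin m) :=
  taylorJet m (G θs j) (fun a => partialCoef G θs ![a] j) (fun a b => partialCoef G θs ![a, b] j)
    fun a b c => partialCoef G θs ![a, b, c] j

/-- The Taylor polynomial of `β ↦ ∂ₗ G (θs + thetaPart β) j`. -/
def derivJet (G : EuclideanSpace ℝ (Fin p) → EuclideanSpace ℝ (Fin m))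
    (θs : EuclideanSpace ℝ (Fin p)) (l : Fin p) (j : Fin m) : Jet (Fin p ⊕ Fin m) :=
  taylorJet m (partialCoef G θs ![l] j) (fun a => partialCoef G θs ![a, l] j)
    (fun a b => partialCoef G θs ![a, b, l] j) fun a b c => partialCoef G θs ![a, b, c, l] j

lemma partialCoef_one (θ : EuclideanSpace ℝ (Fin p)) (l : Fin p) (j : Fin m) :
    partialCoef G θ ![l] j = fderiv ℝ G θ (EuclideanSpace.single l 1) j := by
  rw [partialCoef, iteratedFDeriv_one_apply]
  simp

/-- The condition p < B r places the whole region B‖β‖ ≤ 1, in which a jet is required to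
approximate, inside the ball of smoothness. -/
lemma LocallySmooth.thetaPart_mem (hBr : p < B * r) (hB : 1 ≤ B)
    {β : Fin p ⊕ Fin m → ℝ} (hβ : B * ‖β‖ ≤ 1) {t : ℝ} (ht : t ∈ Set.Icc (0 : ℝ) 1) :
    θs + t • thetaPart β ∈ Metric.ball θs r := by
  rw [mem_ball_iff_norm, add_sub_cancel_left, norm_smul, Real.norm_eq_abs, abs_of_nonneg ht.1]
  have h1 := norm_thetaPart_le β
  have hB0 : 0 < B := by linarith
  have h2 : B * (t * ‖thetaPart β‖) ≤ p := by
    calc B * (t * ‖thetaPart β‖) ≤ B * (1 * (p * ‖β‖)) := by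
          have := ht.1
          have := ht.2
          gcongr
      _ = p * (B * ‖β‖) := by ring
      _ ≤ p * 1 := by gcongr
      _ = p := mul_one _
  exact lt_of_mul_lt_mul_left (h2.trans_lt hBr) hB0.le

lemma LocallySmooth.norm_apply_sub_le (h : LocallySmooth G θs r B) {k : ℕ} (hk : k ≤ 4)
    {θ θ' : EuclideanSpace ℝ (Fin p)} (hθ : θ ∈ Metric.ball θs r) (hθ' : θ' ∈ Metric.ball θs r)
    (v : Fin k → EuclideanSpace ℝ (Fin p)) :
    ‖iteratedFDeriv ℝ k G θ v - iteratedFDeriv ℝ k G θ' v‖ ≤ B * ‖θ - θ'‖ * ∏ i, ‖v i‖ := by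
  have := (iteratedFDeriv ℝ k G θ - iteratedFDeriv ℝ k G θ').le_opNorm v
  rw [sub_apply] at this
  refine this.trans ?_
  have h1 := h.lip k hk θ hθ θ' hθ'
  gcongr

lemma single_vecCons {k : ℕ} (a : Fin p) (σ : Fin k → Fin p) :
    (fun i => EuclideanSpace.single (Matrix.vecCons a σ i) (1 : ℝ)) =
      Matrix.vecCons (EuclideanSpace.single a 1) fun i => EuclideanSpace.single (σ i) 1 := by
  funext i
  refine Fin.cases ?_ (fun i => ?_) i <;> simp

/-- Taylor's formula along the segment from `θs`, with the Lipschitz bound for the highest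
derivative in the remainder. For k = 1 this uses the fourth derivative and its Lipschitz constant,
which is why four orders of smoothness are assumed. -/
lemma LocallySmooth.hasJet_partialCoef (h : LocallySmooth G θs r B) (hB : 1 ≤ B)
    (hBr : p < B * r) {k : ℕ} (hk : k ≤ 1) (σ : Fin k → Fin p) (j : Fin m) :
    HasJet (fun β => partialCoef G (θs + thetaPart β) σ j)
      (taylorJet m (partialCoef G θs σ j) (fun a => partialCoef G θs (Matrix.vecCons a σ) j)
        (fun a b => partialCoef G θs (Matrix.vecCons a (Matrix.vecCons b σ)) j)
        fun a b c => partialCoef G θs (Matrix.vecCons a (Matrix.vecCons b (Matrix.vecCons c σ))) j)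
      B ((1 + p) ^ 4 * B) := by
  have hr : 0 < r := by
    have : (0 : ℝ) ≤ p := by positivity
    by_contra hr
    nlinarith
  have hmem : θs ∈ Metric.ball θs r := Metric.mem_ball_self hr
  refine hasJet_taylorJet hB (h.abs_partialCoef_le hmem (by lia) _ _)
    (fun a => h.abs_partialCoef_le hmem (by lia) _ _)
    (fun a b => h.abs_partialCoef_le hmem (by lia) _ _)
    (fun a b c => h.abs_partialCoef_le hmem (by lia) _ _) fun β hβ => ?_
  set u := thetaPart β with hu
  set v : Fin k → EuclideanSpace ℝ (Fin p) := fun i => EuclideanSpace.single (σ i) 1 with hv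
  have hin : ∀ t ∈ Set.Icc (0 : ℝ) 1, θs + t • u ∈ Metric.ball θs r := fun t ht =>
    LocallySmooth.thetaPart_mem hBr hB hβ ht
  have hv1 : ∏ i, ‖v i‖ = 1 := by simp [hv]
  have key := norm_taylor_three_le
    (φ0 := fun t => iteratedFDeriv ℝ k G (θs + t • u) v)
    (φ1 := fun t => iteratedFDeriv ℝ (k + 1) G (θs + t • u) (Matrix.vecCons u v))
    (φ2 := fun t => iteratedFDeriv ℝ (k + 1 + 1) G (θs + t • u)
      (Matrix.vecCons u (Matrix.vecCons u v)))
    (φ3 := fun t => iteratedFDeriv ℝ (k + 1 + 1 + 1) G (θs + t • u)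
      (Matrix.vecCons u (Matrix.vecCons u (Matrix.vecCons u v)))) (C := B * ‖u‖ ^ 4)
    (fun t ht => h.hasDerivAt (hin t ht) (by lia) _)
    (fun t ht => h.hasDerivAt (hin t ht) (by lia) _)
    (fun t ht => h.hasDerivAt (hin t ht) (by lia) _) (fun t ht => by
      refine (h.norm_apply_sub_le (by lia) (hin t ht) (hin 0 (by simp)) _).trans ?_
      simp only [zero_smul, add_zero, add_sub_cancel_left, norm_smul, Real.norm_eq_abs,
        abs_of_nonneg ht.1, Fin.prod_univ_succ, Matrix.cons_val_zero, Matrix.cons_val_succ, hv1]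
      have hB0 : 0 ≤ B := by linarith
      have : t * ‖u‖ ≤ ‖u‖ := mul_le_of_le_one_left (norm_nonneg _) ht.2
      calc B * (t * ‖u‖) * (‖u‖ * (‖u‖ * (‖u‖ * 1))) ≤ B * ‖u‖ * (‖u‖ * (‖u‖ * (‖u‖ * 1))) := by
            gcongr
        _ = _ := by ring)
  have key2 := (PiLp.norm_apply_le _ j).trans key
  simp only [zero_smul, add_zero, one_smul] at key2
  simp only [multilinear_cons_cons_cons_sum _ u, multilinear_cons_cons_sum _ u,
    multilinear_cons_sum _ u] at key2
  simp only [PiLp.sub_apply, PiLp.add_apply, PiLp.smul_apply, WithLp.ofLp_sum, Finset.sum_apply,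
    smul_eq_mul, Real.norm_eq_abs, hu, thetaPart_apply] at key2
  simp only [partialCoef, single_vecCons]
  refine le_of_eq_of_le ?_ key2
  congr 2
  simp only [Finset.mul_sum]
  congr 1
  · congr 1
    rw [Finset.sum_comm]
    refine Finset.sum_congr rfl fun a _ => Finset.sum_congr rfl fun b _ => by ring
  · rw [Finset.sum_comm]
    conv_rhs => rw [Finset.sum_comm]
    refine Finset.sum_congr rfl fun b _ => ?_
    rw [Finset.sum_comm]
    exact Finset.sum_congr rfl fun a _ => Finset.sum_congr rfl fun c _ => by ring

lemma LocallySmooth.hasJet_moment (h : LocallySmooth G θs r B) (hB : 1 ≤ B) (hBr : p < B * r)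
    (j : Fin m) :
    HasJet (fun β => G (θs + thetaPart β) j) (momentJet G θs j) B ((1 + p) ^ 4 * B) :=
  h.hasJet_partialCoef hB hBr zero_le_one ![] j

lemma LocallySmooth.hasJet_deriv (h : LocallySmooth G θs r B) (hB : 1 ≤ B) (hBr : p < B * r)
    (l : Fin p) (j : Fin m) :
    HasJet (fun β => fderiv ℝ G (θs + thetaPart β) (EuclideanSpace.single l 1) j)
      (derivJet G θs l j) B ((1 + p) ^ 4 * B) := by
  simp only [← partialCoef_one]
  exact h.hasJet_partialCoef hB hBr le_rfl ![l] j

end Taylor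

/-! ### The estimating functions of a single observation -/

/-- The multiple of a polynomial. -/
def Jet.smul {ι : Type*} (a : ℝ) (c : Jet ι) : Jet ι where
  c0 := a * c.c0
  c1 j := a * c.c1 j
  c2 j k := a * c.c2 j k
  c3 j k l := a * c.c3 j k l

lemma HasJet.smul {ι : Type*} [Fintype ι] {f : (ι → ℝ) → ℝ} {c : Jet ι} {B S a : ℝ}
    (h : HasJet f c B S) (ha : |a| ≤ 1) : HasJet (fun β => a * f β) (c.smul a) B S where
  b0 := by
    simp only [Jet.smul, abs_mul]
    exact (mul_le_of_le_one_left (abs_nonneg _) ha).trans h.b0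
  b1 j := by
    simp only [Jet.smul, abs_mul]
    exact (mul_le_of_le_one_left (abs_nonneg _) ha).trans (h.b1 j)
  b2 j k := by
    simp only [Jet.smul, abs_mul]
    exact (mul_le_of_le_one_left (abs_nonneg _) ha).trans (h.b2 j k)
  b3 j k l := by
    simp only [Jet.smul, abs_mul]
    exact (mul_le_of_le_one_left (abs_nonneg _) ha).trans (h.b3 j k l)
  rem β hβ := by
    have e : (c.smul a).eval β = a * c.eval β := by
      simp only [Jet.smul, Jet.eval, Jet.part1, Jet.part2, Jet.part3, mul_add, Finset.mul_sum,
        mul_assoc]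
    rw [e, ← mul_sub, abs_mul]
    exact (mul_le_of_le_one_left (abs_nonneg _) ha).trans (h.rem β hβ)

section Rows

variable {m p : ℕ}

/-- The polynomial of `∑ⱼ β (inr j) * f j β`. -/
def pairJet (c : Fin m → Jet (Fin p ⊕ Fin m)) : Jet (Fin p ⊕ Fin m) :=
  Jet.sum fun j => (Jet.var (.inr j)).mul (c j)

/-- The polynomial of `1 + T + T ^ 2 + τ * T ^ 3`. -/
def cubicJet (τ : ℝ) (T : Jet (Fin p ⊕ Fin m)) : Jet (Fin p ⊕ Fin m) :=
  Jet.one.add (T.add ((T.mul T).add ((T.mul (T.mul T)).smul τ)))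

/-- The inner product of the multiplier contained in `β` with the moment function. -/
def tilt (G : EuclideanSpace ℝ (Fin p) → EuclideanSpace ℝ (Fin m))
    (θs : EuclideanSpace ℝ (Fin p)) (β : Fin p ⊕ Fin m → ℝ) : ℝ :=
  ∑ j, β (.inr j) * G (θs + thetaPart β) j

/-- The truncated estimating functions: the components `inr j` are those of the moment conditions,
the components `inl l` those of the first-order conditions for the parameter. -/
def rowFun (G : EuclideanSpace ℝ (Fin p) → EuclideanSpace ℝ (Fin m))
    (θs : EuclideanSpace ℝ (Fin p)) (τ : ℝ) (i : Fin p ⊕ Fin m) (β : Fin p ⊕ Fin m → ℝ) : ℝ :=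
  (match i with
    | .inl l => ∑ j, β (.inr j) * fderiv ℝ G (θs + thetaPart β) (EuclideanSpace.single l 1) j
    | .inr j => G (θs + thetaPart β) j) *
    (1 + (tilt G θs β + (tilt G θs β * tilt G θs β +
      τ * (tilt G θs β * (tilt G θs β * tilt G θs β)))))

/-- The Taylor polynomials of the truncated estimating functions. -/
def rowJet (G : EuclideanSpace ℝ (Fin p) → EuclideanSpace ℝ (Fin m))
    (θs : EuclideanSpace ℝ (Fin p)) (τ : ℝ) (i : Fin p ⊕ Fin m) : Jet (Fin p ⊕ Fin m) :=
  (match i with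
    | .inl l => pairJet (derivJet G θs l)
    | .inr j => momentJet G θs j).mul (cubicJet τ (pairJet (momentJet G θs)))

/-- The scale B⁻¹ of the variable cancels the scale B of the moment function, so a contraction with
the multiplier has a scale free of B. -/
lemma HasJet.pair {f : Fin m → (Fin p ⊕ Fin m → ℝ) → ℝ} {c : Fin m → Jet (Fin p ⊕ Fin m)}
    {B S : ℝ} (hB : 0 < B) (h : ∀ j, HasJet (f j) (c j) B (S * B)) :
    HasJet (fun β => ∑ j, β (.inr j) * f j β) (pairJet c) B
      (m * (mulConst (Fin p ⊕ Fin m) * S)) := by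
  have := HasJet.sum fun j => (HasJet.var hB (.inr j)).mul (h j) hB.le
  rw [Fintype.card_fin] at this
  refine this.mono hB.le (le_of_eq ?_)
  field_simp

lemma HasJet.cubic {f : (Fin p ⊕ Fin m → ℝ) → ℝ} {c : Jet (Fin p ⊕ Fin m)} {B S τ : ℝ}
    (hB : 0 ≤ B) (hτ : |τ| ≤ 1) (h : HasJet f c B S) :
    HasJet (fun β => 1 + (f β + (f β * f β + τ * (f β * (f β * f β))))) (cubicJet τ c) B
      (1 + (S + (mulConst (Fin p ⊕ Fin m) * (S * S) + mulConst (Fin p ⊕ Fin m) *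
        (S * (mulConst (Fin p ⊕ Fin m) * (S * S)))))) :=
  (HasJet.one hB).add (h.add ((h.mul h hB).add ((h.mul (h.mul h hB) hB).smul hτ)))

/-- The tilt and its powers have scales free of B by `HasJet.pair`, so a row inherits at most one
factor B, from an uncontracted moment function. Its coefficients of degree k are therefore of order
B^(k+1); all later moment requirements rest on this count. -/
lemma exists_hasJet_row (m p : ℕ) : ∃ K : ℝ, 0 < K ∧
    ∀ (G : EuclideanSpace ℝ (Fin p) → EuclideanSpace ℝ (Fin m)) (θs : EuclideanSpace ℝ (Fin p))
      (r B τ : ℝ), LocallySmooth G θs r B → 1 ≤ B → p < B * r → |τ| ≤ 1 →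
      ∀ i, HasJet (rowFun G θs τ i) (rowJet G θs τ i) B (K * B) := by
  set κ := HasJet.mulConst (Fin p ⊕ Fin m) with hκ
  have hκ0 : 0 ≤ κ := by
    rw [hκ, HasJet.mulConst]
    positivity
  set S := (m : ℝ) * (κ * (1 + p) ^ 4) with hS
  have hS0 : 0 ≤ S := by positivity
  set Q := 1 + (S + (κ * (S * S) + κ * (S * (κ * (S * S))))) with hQ
  have hQ0 : 0 ≤ Q := by positivity
  refine ⟨κ * (((1 + p) ^ 4 + S) * Q) + 1, by positivity, ?_⟩
  intro G θs r B τ h hB hBr hτ i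
  have hB0 : 0 < B := by linarith
  have hT := HasJet.pair hB0 fun j => h.hasJet_moment hB hBr j
  have hQ := HasJet.cubic hB0.le hτ hT
  rcases i with l | j
  · have := (HasJet.pair hB0 fun j => h.hasJet_deriv hB hBr l j).mul hQ hB0.le
    refine this.mono hB0.le ?_
    calc κ * (S * Q) ≤ (κ * (((1 + p) ^ 4 + S) * Q) + 1) * 1 := by
          have : 0 ≤ κ * ((1 + p) ^ 4 * Q) := by positivity
          nlinarith
      _ ≤ _ := by gcongr
  · have := (h.hasJet_moment hB hBr j).mul hQ hB0.le
    refine this.mono hB0.le ?_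
    calc κ * ((1 + p) ^ 4 * B * Q) = (κ * ((1 + p) ^ 4 * Q)) * B := by ring
      _ ≤ _ := by
        gcongr
        have : 0 ≤ κ * (S * Q) := by positivity
        nlinarith

variable (G : EuclideanSpace ℝ (Fin p) → EuclideanSpace ℝ (Fin m))
  (θs : EuclideanSpace ℝ (Fin p)) (τ : ℝ)

lemma pairJet_c0 (c : Fin m → Jet (Fin p ⊕ Fin m)) : (pairJet c).c0 = 0 := by
  simp [pairJet, Jet.sum, Jet.mul, Jet.var]

lemma pairJet_c1_inl (c : Fin m → Jet (Fin p ⊕ Fin m)) (l : Fin p) :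
    (pairJet c).c1 (.inl l) = 0 := by
  simp [pairJet, Jet.sum, Jet.mul, Jet.var]

lemma pairJet_c1_inr (c : Fin m → Jet (Fin p ⊕ Fin m)) (j : Fin m) :
    (pairJet c).c1 (.inr j) = (c j).c0 := by
  simp [pairJet, Jet.sum, Jet.mul, Jet.var]

lemma pairJet_c2_inr (c : Fin m → Jet (Fin p ⊕ Fin m)) (j k : Fin m) :
    (pairJet c).c2 (.inr j) (.inr k) = (c j).c1 (.inr k) := by
  simp [pairJet, Jet.sum, Jet.mul, Jet.var]

lemma rowJet_c0_inl (l : Fin p) : (rowJet G θs τ (.inl l)).c0 = 0 := by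
  simp [rowJet, Jet.mul, pairJet_c0]

lemma rowJet_c0_inr (j : Fin m) : (rowJet G θs τ (.inr j)).c0 = G θs j := by
  simp [rowJet, Jet.mul, Jet.add, Jet.one, Jet.smul, pairJet_c0, cubicJet, momentJet, taylorJet]

lemma rowJet_c1_inl_inl (l l' : Fin p) : (rowJet G θs τ (.inl l)).c1 (.inl l') = 0 := by
  simp [rowJet, Jet.mul, pairJet_c0, pairJet_c1_inl]

lemma rowJet_c1_inl_inr (l : Fin p) (j : Fin m) :
    (rowJet G θs τ (.inl l)).c1 (.inr j) = fderiv ℝ G θs (EuclideanSpace.single l 1) j := by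
  simp [rowJet, Jet.mul, Jet.add, Jet.one, Jet.smul, pairJet_c0, pairJet_c1_inr, cubicJet, derivJet,
    taylorJet, partialCoef_one]

lemma rowJet_c1_inr_inl (j : Fin m) (l : Fin p) :
    (rowJet G θs τ (.inr j)).c1 (.inl l) = fderiv ℝ G θs (EuclideanSpace.single l 1) j := by
  simp [rowJet, Jet.mul, Jet.add, Jet.one, Jet.smul, pairJet_c0, pairJet_c1_inl, cubicJet,
    momentJet, taylorJet, partialCoef_one]

lemma rowJet_c1_inr_inr (j k : Fin m) :
    (rowJet G θs τ (.inr j)).c1 (.inr k) = G θs j * G θs k := by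
  simp [rowJet, Jet.mul, Jet.add, Jet.one, Jet.smul, pairJet_c0, pairJet_c1_inr, cubicJet,
    momentJet, taylorJet]

lemma rowJet_c2_inr_inr (j k k' : Fin m) :
    (rowJet G θs τ (.inr j)).c2 (.inr k) (.inr k') = G θs j * (G θs k * G θs k') := by
  simp [rowJet, Jet.mul, Jet.add, Jet.one, Jet.smul, pairJet_c0, pairJet_c1_inr, pairJet_c2_inr,
    cubicJet, momentJet, taylorJet]

/-- Up to degree two the polynomials do not depend on `τ`. -/
lemma rowJet_c0_eq (τ' : ℝ) (i : Fin p ⊕ Fin m) :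
    (rowJet G θs τ i).c0 = (rowJet G θs τ' i).c0 := by
  rcases i with l | j <;>
    simp [rowJet, Jet.mul, Jet.add, Jet.one, Jet.smul, pairJet_c0, cubicJet]

lemma rowJet_c1_eq (τ' : ℝ) (i j : Fin p ⊕ Fin m) :
    (rowJet G θs τ i).c1 j = (rowJet G θs τ' i).c1 j := by
  rcases i with l | j <;>
    simp [rowJet, Jet.mul, Jet.add, Jet.one, Jet.smul, pairJet_c0, cubicJet]

lemma rowJet_c2_eq (τ' : ℝ) (i j k : Fin p ⊕ Fin m) :
    (rowJet G θs τ i).c2 j k = (rowJet G θs τ' i).c2 j k := by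
  rcases i with l | j <;>
    simp [rowJet, Jet.mul, Jet.add, Jet.one, Jet.smul, pairJet_c0, cubicJet]

/-- The coefficients of degree three depend on `τ` through fourth moments only. -/
lemma rowJet_c3_sub (τ' : ℝ) (i j k l : Fin p ⊕ Fin m) :
    (rowJet G θs τ i).c3 j k l - (rowJet G θs τ' i).c3 j k l = (τ - τ') *
      match i, j, k, l with
      | .inr i, .inr j, .inr k, .inr l => G θs i * (G θs j * (G θs k * G θs l))
      | _, _, _, _ => 0 := by
  rcases i with i | i
  · simp [rowJet, Jet.mul, Jet.add, Jet.one, Jet.smul, pairJet_c0, cubicJet]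
  · rcases j with j | j <;> rcases k with k | k <;> rcases l with l | l <;>
    simp [rowJet, Jet.mul, Jet.add, Jet.one, Jet.smul, pairJet_c0, pairJet_c1_inl, pairJet_c1_inr,
      cubicJet, momentJet, taylorJet]
    ring

end Rows

/-! ### Measurability of the coefficients -/

/-- A random polynomial with almost everywhere measurable coefficients. -/
structure JetAEMeasurable {𝒳 ι : Type*} [MeasurableSpace 𝒳] (c : 𝒳 → Jet ι) (P : Measure 𝒳) :
    Prop where
  c0 : AEMeasurable (fun y => (c y).c0) P
  c1 : ∀ j, AEMeasurable (fun y => (c y).c1 j) P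
  c2 : ∀ j k, AEMeasurable (fun y => (c y).c2 j k) P
  c3 : ∀ j k l, AEMeasurable (fun y => (c y).c3 j k l) P

namespace JetAEMeasurable

variable {𝒳 ι : Type*} [MeasurableSpace 𝒳] {P : Measure 𝒳} {c d : 𝒳 → Jet ι}

lemma const (c : Jet ι) : JetAEMeasurable (fun _ : 𝒳 => c) P :=
  ⟨aemeasurable_const, fun _ => aemeasurable_const, fun _ _ => aemeasurable_const,
    fun _ _ _ => aemeasurable_const⟩

lemma add (hc : JetAEMeasurable c P) (hd : JetAEMeasurable d P) :
    JetAEMeasurable (fun y => (c y).add (d y)) P :=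
  ⟨hc.c0.add hd.c0, fun j => (hc.c1 j).add (hd.c1 j), fun j k => (hc.c2 j k).add (hd.c2 j k),
    fun j k l => (hc.c3 j k l).add (hd.c3 j k l)⟩

lemma smul (a : ℝ) (hc : JetAEMeasurable c P) : JetAEMeasurable (fun y => (c y).smul a) P :=
  ⟨hc.c0.const_mul a, fun j => (hc.c1 j).const_mul a, fun j k => (hc.c2 j k).const_mul a,
    fun j k l => (hc.c3 j k l).const_mul a⟩

lemma mul (hc : JetAEMeasurable c P) (hd : JetAEMeasurable d P) :
    JetAEMeasurable (fun y => (c y).mul (d y)) P :=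
  ⟨hc.c0.mul hd.c0, fun j => (hc.c0.mul (hd.c1 j)).add ((hc.c1 j).mul hd.c0),
    fun j k => ((hc.c0.mul (hd.c2 j k)).add ((hc.c1 j).mul (hd.c1 k))).add ((hc.c2 j k).mul hd.c0),
    fun j k l => (((hc.c0.mul (hd.c3 j k l)).add ((hc.c1 j).mul (hd.c2 k l))).add
      ((hc.c2 j k).mul (hd.c1 l))).add ((hc.c3 j k l).mul hd.c0)⟩

lemma sum {α : Type*} [Fintype α] {c : α → 𝒳 → Jet ι} (hc : ∀ a, JetAEMeasurable (c a) P) :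
    JetAEMeasurable (fun y => Jet.sum fun a => c a y) P :=
  ⟨Finset.aemeasurable_fun_sum _ fun a _ => (hc a).c0,
    fun j => Finset.aemeasurable_fun_sum _ fun a _ => (hc a).c1 j,
    fun j k => Finset.aemeasurable_fun_sum _ fun a _ => (hc a).c2 j k,
    fun j k l => Finset.aemeasurable_fun_sum _ fun a _ => (hc a).c3 j k l⟩

end JetAEMeasurable

section

variable {𝒳 : Type*} [MeasurableSpace 𝒳] {P : Measure 𝒳} {m p : ℕ}
  {g : 𝒳 → EuclideanSpace ℝ (Fin p) → EuclideanSpace ℝ (Fin m)}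
  {θs : EuclideanSpace ℝ (Fin p)} {r : ℝ} {b : 𝒳 → ℝ}

/-- Each derivative is an a.e. limit of difference quotients of the preceding one along a sequence
of steps; the shift by `n0` keeps the points in the ball. -/
lemma aemeasurable_iteratedFDeriv (hs : ∀ᵐ y ∂P, LocallySmooth (g y) θs r (b y))
    (hm : ∀ θ ∈ Metric.ball θs r, AEMeasurable (fun y => g y θ) P) {k : ℕ} (hk : k ≤ 4)
    (v : Fin k → EuclideanSpace ℝ (Fin p)) {θ : EuclideanSpace ℝ (Fin p)}
    (hθ : θ ∈ Metric.ball θs r) :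
    AEMeasurable (fun y => iteratedFDeriv ℝ k (g y) θ v) P := by
  induction k generalizing θ with
  | zero => simpa [iteratedFDeriv_zero_apply] using hm θ hθ
  | succ k ih =>
    set u := v 0
    set w : Fin k → EuclideanSpace ℝ (Fin p) := fun i => v i.succ
    have hv : v = Matrix.vecCons u w := by
      funext i
      refine Fin.cases rfl (fun i => rfl) i
    have hcont : Tendsto (fun n : ℕ => θ + ((n : ℝ) + 1)⁻¹ • u) atTop (𝓝 θ) := by
      have h1 : Tendsto (fun n : ℕ => ((n : ℝ) + 1)⁻¹) atTop (𝓝 0) := by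
        simpa using tendsto_one_div_add_atTop_nhds_zero_nat (𝕜 := ℝ)
      simpa using tendsto_const_nhds.add (h1.smul_const u)
    obtain ⟨n0, hn0⟩ := eventually_atTop.1 (hcont.eventually (Metric.isOpen_ball.mem_nhds hθ))
    have ht : Tendsto (fun n : ℕ => (((n + n0 : ℕ) : ℝ) + 1)⁻¹) atTop (𝓝[≠] 0) := by
      refine tendsto_nhdsWithin_iff.2 ⟨?_, Eventually.of_forall fun n => ?_⟩
      · have h1 : Tendsto (fun n : ℕ => ((n : ℝ) + 1)⁻¹) atTop (𝓝 0) := by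
          simpa using tendsto_one_div_add_atTop_nhds_zero_nat (𝕜 := ℝ)
        exact h1.comp (tendsto_add_atTop_nat n0)
      · have : (0 : ℝ) < ((n + n0 : ℕ) : ℝ) + 1 := by positivity
        simpa using this.ne'
    refine aemeasurable_of_tendsto_metrizable_ae atTop (f := fun (n : ℕ) y =>
      ((((n + n0 : ℕ) : ℝ) + 1)⁻¹)⁻¹ • (iteratedFDeriv ℝ k (g y)
        (θ + (((n + n0 : ℕ) : ℝ) + 1)⁻¹ • u) w - iteratedFDeriv ℝ k (g y) θ w)) (fun n => ?_) ?_
    · exact ((ih (by lia) w (hn0 (n + n0) (Nat.le_add_left _ _))).sub (ih (by lia) w hθ)).const_smul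
        ((((n + n0 : ℕ) : ℝ) + 1)⁻¹)⁻¹
    · filter_upwards [hs] with y hy
      have hd := hy.hasDerivAt (θ := θ) (u := u) (t := 0) (by simpa using hθ) (k := k) (by lia) w
      have := (hasDerivAt_iff_tendsto_slope_zero.1 hd).comp ht
      simp only [zero_add, zero_smul, add_zero] at this
      rw [hv]
      exact this

lemma aemeasurable_partialCoef (hs : ∀ᵐ y ∂P, LocallySmooth (g y) θs r (b y))
    (hm : ∀ θ ∈ Metric.ball θs r, AEMeasurable (fun y => g y θ) P) {k : ℕ} (hk : k ≤ 4)
    (σ : Fin k → Fin p) {θ : EuclideanSpace ℝ (Fin p)} (hθ : θ ∈ Metric.ball θs r) (j : Fin m) :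
    AEMeasurable (fun y => partialCoef (g y) θ σ j) P := by
  have := aemeasurable_iteratedFDeriv hs hm hk (fun i => EuclideanSpace.single (σ i) 1) hθ
  exact (EuclideanSpace.proj (𝕜 := ℝ) j).continuous.measurable.comp_aemeasurable this

lemma jetAEMeasurable_taylorJet {D0 : 𝒳 → ℝ} {D1 : Fin p → 𝒳 → ℝ} {D2 : Fin p → Fin p → 𝒳 → ℝ}
    {D3 : Fin p → Fin p → Fin p → 𝒳 → ℝ} (h0 : AEMeasurable D0 P) (h1 : ∀ a, AEMeasurable (D1 a) P)
    (h2 : ∀ a b, AEMeasurable (D2 a b) P) (h3 : ∀ a b c, AEMeasurable (D3 a b c) P) :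
    JetAEMeasurable (fun y => taylorJet m (D0 y) (fun a => D1 a y) (fun a b => D2 a b y)
      fun a b c => D3 a b c y) P := by
  refine ⟨h0, fun a => ?_, fun a b => ?_, fun a b c => ?_⟩
  · rcases a with a | a
    · exact h1 a
    · exact aemeasurable_const
  · rcases a with a | a <;> rcases b with b | b
    · exact (h2 a b).const_mul _
    all_goals exact aemeasurable_const
  · rcases a with a | a <;> rcases b with b | b <;> rcases c with c | c
    · exact (h3 a b c).const_mul _
    all_goals exact aemeasurable_const

lemma jetAEMeasurable_rowJet (hr : 0 < r) (hs : ∀ᵐ y ∂P, LocallySmooth (g y) θs r (b y))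
    (hm : ∀ θ ∈ Metric.ball θs r, AEMeasurable (fun y => g y θ) P) (τ : ℝ) (i : Fin p ⊕ Fin m) :
    JetAEMeasurable (fun y => rowJet (g y) θs τ i) P := by
  have hθ : θs ∈ Metric.ball θs r := Metric.mem_ball_self hr
  have hmom : ∀ j, JetAEMeasurable (fun y => momentJet (g y) θs j) P := fun j =>
    jetAEMeasurable_taylorJet
      (aemeasurable_partialCoef (k := 0) hs hm (by norm_num) ![] hθ j)
      (fun a => aemeasurable_partialCoef hs hm (by norm_num) ![a] hθ j)
      (fun a b => aemeasurable_partialCoef hs hm (by norm_num) ![a, b] hθ j)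
      (fun a b c => aemeasurable_partialCoef hs hm (by norm_num) ![a, b, c] hθ j)
  have hder : ∀ l j, JetAEMeasurable (fun y => derivJet (g y) θs l j) P := fun l j =>
    jetAEMeasurable_taylorJet (aemeasurable_partialCoef hs hm (by norm_num) ![l] hθ j)
      (fun a => aemeasurable_partialCoef hs hm (by norm_num) ![a, l] hθ j)
      (fun a b => aemeasurable_partialCoef hs hm (by norm_num) ![a, b, l] hθ j)
      (fun a b c => aemeasurable_partialCoef hs hm (by norm_num) ![a, b, c, l] hθ j)
  have hpair : ∀ {c : Fin m → 𝒳 → Jet (Fin p ⊕ Fin m)}, (∀ j, JetAEMeasurable (c j) P) →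
      JetAEMeasurable (fun y => pairJet fun j => c j y) P := fun hc =>
    JetAEMeasurable.sum fun j => (JetAEMeasurable.const _).mul (hc j)
  have hT := hpair hmom
  have hQ : JetAEMeasurable (fun y => cubicJet τ (pairJet (momentJet (g y) θs))) P :=
    (JetAEMeasurable.const _).add (hT.add ((hT.mul hT).add ((hT.mul (hT.mul hT)).smul τ)))
  rcases i with l | j
  · exact (hpair (hder l)).mul hQ
  · exact (hmom j).mul hQ

end

/-! ### Orders of magnitude that are uniform over the sample -/

section Sample

variable {I 𝒳 : Type*}

/-- The rate `n ^ (-1/2)`. -/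
def rate (N : I → ℕ) (x : I) : ℝ := (√(N x : ℝ))⁻¹

/-- The filter on pairs of an index and a point of the corresponding sample. -/
def sampleFilter (l : Filter I) (N : I → ℕ) (X : I → ℕ → 𝒳) : Filter (I × 𝒳) :=
  comap Prod.fst l ⊓ 𝓟 {z | ∃ i < N z.1, z.2 = X z.1 i}

/-- `f = O(n ^ (-k/2) * b ^ j)` uniformly over the sample. -/
def SampleO (l : Filter I) (N : I → ℕ) (X : I → ℕ → 𝒳) (b : 𝒳 → ℝ) (k j : ℕ) (f : I × 𝒳 → ℝ) :
    Prop :=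
  f =O[sampleFilter l N X] fun z => rate N z.1 ^ k * b z.2 ^ j

/-- The sample size tends to infinity and the sample mean of `b ^ 6` remains bounded. -/
structure SampleZone (l : Filter I) (N : I → ℕ) (X : I → ℕ → 𝒳) (b : 𝒳 → ℝ) : Prop where
  tendsto : Tendsto N l atTop
  one_le : ∀ y, 1 ≤ b y
  mean : OrdO l (rate N) 0 (fun x => sampleMean N X x fun y => b y ^ 6)

variable {l : Filter I} {N : I → ℕ} {X : I → ℕ → 𝒳} {b : 𝒳 → ℝ}

lemma eventually_sampleFilter_iff {q : I × 𝒳 → Prop} :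
    (∀ᶠ z in sampleFilter l N X, q z) ↔ ∀ᶠ x in l, ∀ i < N x, q (x, X x i) := by
  rw [sampleFilter, eventually_inf_principal, eventually_comap]
  refine eventually_congr (Eventually.of_forall fun x => ?_)
  constructor
  · intro h i hi
    exact h (x, X x i) rfl ⟨i, hi, rfl⟩
  · rintro h ⟨x', y⟩ rfl ⟨i, hi, hy⟩
    have h1 := h i hi
    simp only at hy
    rwa [← hy] at h1

lemma tendsto_fst_sampleFilter : Tendsto Prod.fst (sampleFilter l N X) l :=
  tendsto_comap.mono_left inf_le_left

lemma rate_nonneg (x : I) : 0 ≤ rate N x := inv_nonneg.2 (Real.sqrt_nonneg _)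

lemma rate_sq (x : I) : rate N x ^ 2 = (N x : ℝ)⁻¹ := by
  rw [rate, inv_pow, Real.sq_sqrt (Nat.cast_nonneg _)]

namespace SampleZone

lemma tendsto_rate (h : SampleZone l N X b) : Tendsto (rate N) l (𝓝 0) :=
  tendsto_inv_atTop_zero.comp (Real.tendsto_sqrt_atTop.comp
    (tendsto_natCast_atTop_atTop.comp h.tendsto))

lemma pos (h : SampleZone l N X b) (y : 𝒳) : 0 < b y := zero_lt_one.trans_le (h.one_le y)

lemma eventually_ne (h : SampleZone l N X b) : ∀ᶠ x in l, N x ≠ 0 :=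
  (h.tendsto.eventually (eventually_gt_atTop 0)).mono fun _ hx => hx.ne'

/-- A single b(xᵢ)⁶ is at most the sum over the sample, which is O(n), so the maximum of b over the
sample is O(n^(1/6)). This makes λ'g(xᵢ, θ) small uniformly over the sample when λ is of order
n^(-1/2). -/
lemma tendsto_rate_mul (h : SampleZone l N X b) :
    Tendsto (fun z : I × 𝒳 => rate N z.1 * b z.2) (sampleFilter l N X) (𝓝 0) := by
  obtain ⟨K, hK⟩ := h.mean.bound
  rw [Metric.tendsto_nhds]
  intro δ hδ
  have h1 : Tendsto (fun x => K * rate N x ^ 4) l (𝓝 0) := by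
    simpa using (h.tendsto_rate.pow 4).const_mul K
  rw [eventually_sampleFilter_iff]
  filter_upwards [hK, h.eventually_ne, h1.eventually_lt_const (by positivity : 0 < δ ^ 6)]
    with x hx hN hδ' i hi
  have hN0 : (0 : ℝ) < N x := by positivity
  have hb := h.pos
  have hle : b (X x i) ^ 6 ≤ N x * K := by
    have h2 : b (X x i) ^ 6 ≤ ∑ i ∈ Finset.range (N x), b (X x i) ^ 6 :=
      Finset.single_le_sum (f := fun i => b (X x i) ^ 6)
        (fun j _ => (pow_pos (hb _) 6).le) (Finset.mem_range.2 hi)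
    have h3 := (le_abs_self _).trans hx
    rw [sampleMean, pow_zero, norm_one, mul_one, inv_mul_le_iff₀ hN0] at h3
    exact h2.trans h3
  have hr := rate_nonneg (N := N) x
  have h4 : (rate N x * b (X x i)) ^ 6 < δ ^ 6 := by
    refine lt_of_le_of_lt ?_ hδ'
    rw [mul_pow]
    calc rate N x ^ 6 * b (X x i) ^ 6 ≤ rate N x ^ 6 * (N x * K) := by gcongr
      _ = K * rate N x ^ 4 * (rate N x ^ 2 * N x) := by ring
      _ = K * rate N x ^ 4 := by rw [rate_sq, inv_mul_cancel₀ hN0.ne', mul_one]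
  have h5 := lt_of_pow_lt_pow_left₀ 6 hδ.le h4
  rw [Real.dist_eq, sub_zero, abs_of_nonneg (mul_nonneg hr (hb _).le)]
  exact h5

end SampleZone

namespace SampleO

variable {k k' j j' : ℕ} {f f' : I × 𝒳 → ℝ}

lemma add (h : SampleO l N X b k j f) (h' : SampleO l N X b k j f') :
    SampleO l N X b k j (fun z => f z + f' z) := IsBigO.add h h'

lemma sub (h : SampleO l N X b k j f) (h' : SampleO l N X b k j f') :
    SampleO l N X b k j (fun z => f z - f' z) := IsBigO.sub h h'

lemma const_mul (c : ℝ) (h : SampleO l N X b k j f) : SampleO l N X b k j (fun z => c * f z) :=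
  IsBigO.const_mul_left h c

lemma mul (h : SampleO l N X b k j f) (h' : SampleO l N X b k' j' f') :
    SampleO l N X b (k + k') (j + j') (fun z => f z * f' z) := by
  have := IsBigO.mul h h'
  refine this.congr_right fun z => ?_
  ring

lemma sum {α : Type*} {s : Finset α} {f : α → I × 𝒳 → ℝ}
    (h : ∀ a ∈ s, SampleO l N X b k j (f a)) :
    SampleO l N X b k j (fun z => ∑ a ∈ s, f a z) := IsBigO.fun_sum h

lemma congr (h : SampleO l N X b k j f) (hf : ∀ᶠ z in sampleFilter l N X, f z = f' z) :
    SampleO l N X b k j f' := IsBigO.congr' h hf EventuallyEq.rfl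

lemma mono (hz : SampleZone l N X b) (hk : k' ≤ k) (hj : j ≤ j') (h : SampleO l N X b k j f) :
    SampleO l N X b k' j' f := by
  refine IsBigO.trans h (IsBigO.of_bound 1 ?_)
  rw [eventually_sampleFilter_iff]
  filter_upwards [hz.tendsto_rate.eventually_le_const zero_lt_one] with x hx i _
  have hb := hz.one_le (X x i)
  have hr := rate_nonneg (N := N) x
  rw [one_mul, Real.norm_of_nonneg (by positivity), Real.norm_of_nonneg (by positivity)]
  exact mul_le_mul (pow_le_pow_of_le_one hr hx hk) (pow_le_pow_right₀ hb hj) (by positivity)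
    (by positivity)

lemma of_ordO {f : I → ℝ} (h : OrdO l (rate N) k f) :
    SampleO l N X b k 0 (fun z => f z.1) := by
  have := IsBigO.comp_tendsto h (tendsto_fst_sampleFilter (l := l) (N := N) (X := X))
  refine this.congr_right fun z => ?_
  simp

lemma tendsto_zero (hz : SampleZone l N X b) (hj : j ≤ k) (hk : k ≠ 0)
    (h : SampleO l N X b k j f) : Tendsto f (sampleFilter l N X) (𝓝 0) := by
  have h1 := h.mono hz le_rfl hj
  have h2 := hz.tendsto_rate_mul.pow k
  rw [zero_pow hk] at h2
  refine IsBigO.trans_tendsto h1 ?_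
  simpa [mul_pow] using h2

/-- The sample mean of a uniformly small quantity. -/
lemma sampleMean (hz : SampleZone l N X b) (hj : j ≤ 6) (h : SampleO l N X b k j f) :
    OrdO l (rate N) k (fun x => sampleMean N X x fun y => f (x, y)) := by
  obtain ⟨C, hC0, hC⟩ := (h.mono hz le_rfl hj).exists_nonneg
  obtain ⟨K, hK⟩ := hz.mean.bound
  refine IsBigO.of_bound (C * K) ?_
  filter_upwards [eventually_sampleFilter_iff.1 hC.bound, hK, hz.eventually_ne] with x hx hKx hN
  have hN0 : (0 : ℝ) < N x := by positivity
  have hr := rate_nonneg (N := N) x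
  have hb : ∀ y, 0 < b y := hz.pos
  have h3 := (le_abs_self _).trans hKx
  rw [pow_zero, norm_one, mul_one] at h3
  rw [Real.norm_eq_abs, Real.norm_of_nonneg (pow_nonneg hr k)]
  calc |_root_.sampleMean N X x fun y => f (x, y)|
      ≤ (N x : ℝ)⁻¹ * ∑ i ∈ Finset.range (N x), C * (rate N x ^ k * b (X x i) ^ 6) := by
        rw [_root_.sampleMean, abs_mul, abs_of_pos (inv_pos.2 hN0)]
        refine mul_le_mul_of_nonneg_left ((Finset.abs_sum_le_sum_abs _ _).trans
          (Finset.sum_le_sum fun i hi => ?_)) (inv_pos.2 hN0).le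
        have := hx i (Finset.mem_range.1 hi)
        rwa [Real.norm_eq_abs, Real.norm_of_nonneg] at this
        have := hb (X x i)
        positivity
    _ = C * rate N x ^ k * _root_.sampleMean N X x fun y => b y ^ 6 := by
        rw [_root_.sampleMean, ← Finset.mul_sum, ← Finset.mul_sum]
        ring
    _ ≤ C * rate N x ^ k * K := by gcongr
    _ = _ := by ring

end SampleO

lemma sampleMean_add (x : I) (f f' : 𝒳 → ℝ) :
    sampleMean N X x (fun y => f y + f' y) = sampleMean N X x f + sampleMean N X x f' := by
  simp [sampleMean, Finset.sum_add_distrib, mul_add]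

lemma sampleMean_sub (x : I) (f f' : 𝒳 → ℝ) :
    sampleMean N X x (fun y => f y - f' y) = sampleMean N X x f - sampleMean N X x f' := by
  simp [sampleMean, Finset.sum_sub_distrib, mul_sub]

lemma sampleMean_const_mul (x : I) (c : ℝ) (f : 𝒳 → ℝ) :
    sampleMean N X x (fun y => c * f y) = c * sampleMean N X x f := by
  simp only [sampleMean, ← Finset.mul_sum]
  ring

lemma sampleMean_mul_const (x : I) (c : ℝ) (f : 𝒳 → ℝ) :
    sampleMean N X x (fun y => f y * c) = sampleMean N X x f * c := by
  simp only [sampleMean, ← Finset.sum_mul]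
  ring

lemma sampleMean_sum {α : Type*} (s : Finset α) (x : I) (f : α → 𝒳 → ℝ) :
    sampleMean N X x (fun y => ∑ a ∈ s, f a y) = ∑ a ∈ s, sampleMean N X x (f a) := by
  simp only [sampleMean, Finset.mul_sum]
  exact Finset.sum_comm

lemma sampleMean_congr {x : I} {f f' : 𝒳 → ℝ} (h : ∀ i < N x, f (X x i) = f' (X x i)) :
    sampleMean N X x f = sampleMean N X x f' := by
  rw [sampleMean, sampleMean, Finset.sum_congr rfl fun i hi => h i (Finset.mem_range.1 hi)]

lemma sampleMean_mono {x : I} {f f' : 𝒳 → ℝ} (h : ∀ i < N x, f (X x i) ≤ f' (X x i)) :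
    sampleMean N X x f ≤ sampleMean N X x f' :=
  mul_le_mul_of_nonneg_left (Finset.sum_le_sum fun i hi => h i (Finset.mem_range.1 hi))
    (by positivity)

lemma sampleMean_const {x : I} (hx : N x ≠ 0) (c : ℝ) : sampleMean N X x (fun _ => c) = c := by
  simp [sampleMean, hx]

/-- The Cauchy–Schwarz inequality for sample means. -/
lemma sampleMean_mul_sq_le (x : I) (f f' : 𝒳 → ℝ) :
    sampleMean N X x (fun y => f y * f' y) ^ 2 ≤
      sampleMean N X x (fun y => f y ^ 2) * sampleMean N X x (fun y => f' y ^ 2) := by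
  have := Finset.sum_mul_sq_le_sq_mul_sq (Finset.range (N x)) (fun i => f (X x i))
    (fun i => f' (X x i))
  simp only [sampleMean]
  rw [mul_pow, mul_mul_mul_comm, ← sq]
  gcongr

lemma sampleMean_eq_sum_fin (x : I) (f : 𝒳 → ℝ) :
    sampleMean N X x f = (N x : ℝ)⁻¹ * ∑ i : Fin (N x), f (X x i) := by
  rw [sampleMean, Finset.sum_range]

/-- The sample mean of a family of polynomials, evaluated at a small argument. -/
lemma sampleMean_sub_eval {ι : Type*} [Fintype ι] (hz : SampleZone l N X b) {K : ℝ}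
    {f : 𝒳 → (ι → ℝ) → ℝ} {c : 𝒳 → Jet ι}
    (hf : ∀ᶠ x in l, ∀ i < N x, HasJet (f (X x i)) (c (X x i)) (b (X x i)) (K * b (X x i)))
    {β : I → ι → ℝ} (hβ : ∀ i, OrdO l (rate N) 1 (fun x => β x i)) :
    OrdO l (rate N) 4 (fun x => sampleMean N X x (fun y => f y (β x)) -
      sampleMean N X x (fun y => (c y).eval (β x))) := by
  have hβn : OrdO l (rate N) 1 (fun x => ‖β x‖) :=
    IsBigO.norm_left (isBigO_pi.2 hβ)
  have hsmall : SampleO l N X b 1 1 (fun z => b z.2 * ‖β z.1‖) := by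
    have h1 : SampleO l N X b 0 1 (fun z => b z.2) := by
      refine (isBigO_refl (fun z : I × 𝒳 => b z.2) _).congr_right fun z => ?_
      simp
    exact h1.mul (SampleO.of_ordO hβn)
  have hle := (hsmall.tendsto_zero hz le_rfl one_ne_zero).eventually_le_const zero_lt_one
  -- The remainder of one observation is K b (b‖β‖)⁴, of degree five in b, and so has a bounded
  -- sample mean after scaling.
  have h5 : SampleO l N X b 4 5 (fun z => f z.2 (β z.1) - (c z.2).eval (β z.1)) := by
    have h1 : SampleO l N X b 0 1 (fun z => K * b z.2) := by
      refine ((isBigO_refl (fun z : I × 𝒳 => b z.2) _).const_mul_left K).congr_right fun z => ?_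
      simp
    have h2 := h1.mul (hsmall.mul (hsmall.mul (hsmall.mul hsmall)))
    refine IsBigO.trans (IsBigO.of_bound 1 ?_) h2
    have hf' : ∀ᶠ z in sampleFilter l N X, HasJet (f z.2) (c z.2) (b z.2) (K * b z.2) :=
      eventually_sampleFilter_iff.2 hf
    filter_upwards [hle, hf'] with z hz1 hz2
    have := hz2.rem _ hz1
    rw [one_mul, Real.norm_eq_abs]
    refine this.trans (le_trans (le_of_eq ?_) (le_abs_self _))
    ring
  refine (h5.sampleMean hz (by norm_num)).congr (Eventually.of_forall fun x => ?_)
  rw [sampleMean_sub]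

end Sample

/-! ### Consistency and rates of convergence -/

section Coercive

variable {n : ℕ}

/-- A positive form attains a positive minimum on the unit sphere, and homogeneity does the rest.
The sphere is empty only in dimension zero. -/
lemma exists_coercive_of_pos {S : Matrix (Fin n) (Fin n) ℝ}
    (hS : ∀ v : EuclideanSpace ℝ (Fin n), v ≠ 0 → 0 < ∑ j, ∑ k, S j k * (v j * v k)) :
    ∃ c : ℝ, 0 < c ∧ ∀ v : EuclideanSpace ℝ (Fin n),
      c * ‖v‖ ^ 2 ≤ ∑ j, ∑ k, S j k * (v j * v k) := by
  rcases (Metric.sphere (0 : EuclideanSpace ℝ (Fin n)) 1).eq_empty_or_nonempty with he | hne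
  · refine ⟨1, one_pos, fun v => ?_⟩
    have hv : v = 0 := by
      by_contra hv
      have : (‖v‖⁻¹ • v) ∈ Metric.sphere (0 : EuclideanSpace ℝ (Fin n)) 1 := by
        simp [norm_smul, hv]
      simp [he] at this
    simp [hv]
  · have hcont : Continuous fun v : EuclideanSpace ℝ (Fin n) => ∑ j, ∑ k, S j k * (v j * v k) := by
      fun_prop
    obtain ⟨v0, hv0, hmin⟩ := (isCompact_sphere (0 : EuclideanSpace ℝ (Fin n)) 1).exists_isMinOn
      hne hcont.continuousOn
    have hv0' : v0 ≠ 0 := by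
      rintro rfl
      simp at hv0
    refine ⟨_, hS v0 hv0', fun v => ?_⟩
    rcases eq_or_ne v 0 with rfl | hv
    · simp
    · have hvn : 0 < ‖v‖ := norm_pos_iff.2 hv
      have h1 : (‖v‖⁻¹ • v) ∈ Metric.sphere (0 : EuclideanSpace ℝ (Fin n)) 1 := by
        simp [norm_smul, hv]
      have h2 := isMinOn_iff.1 hmin _ h1
      have h3 : ∑ j, ∑ k, S j k * ((‖v‖⁻¹ • v) j * (‖v‖⁻¹ • v) k) =
          (‖v‖ ^ 2)⁻¹ * ∑ j, ∑ k, S j k * (v j * v k) := by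
        simp only [Finset.mul_sum, PiLp.smul_apply, smul_eq_mul]
        exact Finset.sum_congr rfl fun j _ => Finset.sum_congr rfl fun k _ => by ring
      rw [h3, ← div_eq_inv_mul, le_div_iff₀ (by positivity)] at h2
      exact h2

lemma abs_mul_apply_le (v : EuclideanSpace ℝ (Fin n)) (j k : Fin n) : |v j * v k| ≤ ‖v‖ ^ 2 := by
  rw [abs_mul, sq]
  exact mul_le_mul (PiLp.norm_apply_le v j) (PiLp.norm_apply_le v k) (abs_nonneg _) (norm_nonneg _)

/-- Coercivity is stable under small perturbations of the matrix. -/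
lemma eventually_coercive {I : Type*} {l : Filter I} {S : Matrix (Fin n) (Fin n) ℝ}
    (hS : ∀ v : EuclideanSpace ℝ (Fin n), v ≠ 0 → 0 < ∑ j, ∑ k, S j k * (v j * v k))
    {A : I → Fin n → Fin n → ℝ} (hA : ∀ j k, Tendsto (fun x => A x j k) l (𝓝 (S j k))) :
    ∃ c : ℝ, 0 < c ∧ ∀ᶠ x in l, ∀ v : EuclideanSpace ℝ (Fin n),
      c * ‖v‖ ^ 2 ≤ ∑ j, ∑ k, A x j k * (v j * v k) := by
  obtain ⟨c, hc, hcS⟩ := exists_coercive_of_pos hS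
  refine ⟨c / 2, by positivity, ?_⟩
  have h0 : Tendsto (fun x => ∑ j, ∑ k, |A x j k - S j k|) l (𝓝 0) := by
    have : Tendsto (fun x => ∑ j, ∑ k, |A x j k - S j k|) l (𝓝 (∑ j : Fin n, ∑ k : Fin n, 0)) :=
      tendsto_finsetSum _ fun j _ => tendsto_finsetSum _ fun k _ => by
        have := ((hA j k).sub_const (S j k)).abs
        simpa using this
    simpa using this
  filter_upwards [h0.eventually_le_const (by positivity : 0 < c / 2)] with x hx v
  have h1 := hcS v
  have h2 : ∑ j, ∑ k, S j k * (v j * v k) - ∑ j, ∑ k, A x j k * (v j * v k) ≤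
      (∑ j, ∑ k, |A x j k - S j k|) * ‖v‖ ^ 2 := by
    rw [← Finset.sum_sub_distrib, Finset.sum_mul]
    refine Finset.sum_le_sum fun j _ => ?_
    rw [← Finset.sum_sub_distrib, Finset.sum_mul]
    refine Finset.sum_le_sum fun k _ => ?_
    rw [← sub_mul]
    refine (le_abs_self _).trans ?_
    rw [abs_mul, abs_sub_comm]
    exact mul_le_mul_of_nonneg_left (abs_mul_apply_le v j k) (abs_nonneg _)
  have h3 : (∑ j, ∑ k, |A x j k - S j k|) * ‖v‖ ^ 2 ≤ c / 2 * ‖v‖ ^ 2 := by gcongr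
  linarith

lemma inner_eq_sum (v w : EuclideanSpace ℝ (Fin n)) : ⟪v, w⟫_ℝ = ∑ j, v j * w j := by
  rw [PiLp.inner_apply]
  simp [mul_comm]

lemma norm_le_sum_abs (v : EuclideanSpace ℝ (Fin n)) : ‖v‖ ≤ ∑ j, |v j| := by
  have h2 : v = ∑ a, v a • EuclideanSpace.single a (1 : ℝ) := by
    ext b
    simp [Pi.single_apply]
  conv_lhs => rw [h2]
  refine (norm_sum_le _ _).trans (Finset.sum_le_sum fun a _ => ?_)
  simp [norm_smul]

lemma sampleMean_inner_sq {I 𝒳 : Type*} {N : I → ℕ} {X : I → ℕ → 𝒳} (x : I)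
    (f : 𝒳 → EuclideanSpace ℝ (Fin n)) (v : EuclideanSpace ℝ (Fin n)) :
    sampleMean N X x (fun y => ⟪v, f y⟫_ℝ ^ 2) =
      ∑ j, ∑ k, sampleMean N X x (fun y => f y j * f y k) * (v j * v k) := by
  have : ∀ y, ⟪v, f y⟫_ℝ ^ 2 = ∑ j, ∑ k, (f y j * f y k) * (v j * v k) := fun y => by
    rw [inner_eq_sum, sq, Finset.sum_mul_sum]
    exact Finset.sum_congr rfl fun j _ => Finset.sum_congr rfl fun k _ => by ring
  simp only [this, sampleMean_sum, sampleMean_mul_const]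

end Coercive

/-! ### Deterministic conditions on large samples -/

section Regime

variable {I 𝒳 : Type*} {m p : ℕ}

/-- The deterministic properties of large samples on which the asymptotic analysis rests. -/
structure MomentRegime (l : Filter I) (N : I → ℕ) (X : I → ℕ → 𝒳) (b : 𝒳 → ℝ)
    (g : 𝒳 → EuclideanSpace ℝ (Fin p) → EuclideanSpace ℝ (Fin m))
    (Θ : Set (EuclideanSpace ℝ (Fin p))) (θs : EuclideanSpace ℝ (Fin p)) (r : ℝ)
    (S : Matrix (Fin m) (Fin m) ℝ) (Γ : Matrix (Fin m) (Fin p) ℝ) (D : 𝒳 → ℝ) : Prop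
    extends SampleZone l N X b where
  pos_radius : 0 < r
  large : ∀ y, p < b y * r
  smooth : ∀ᶠ x in l, ∀ i < N x, LocallySmooth (g (X x i)) θs r (b (X x i))
  ball : Metric.ball θs r ⊆ Θ
  mean_g : ∀ j, OrdO l (rate N) 1 (fun x => sampleMean N X x fun y => g y θs j)
  cov : ∀ j k, OrdO l (rate N) 1 (fun x => sampleMean N X x (fun y => g y θs j * g y θs k) - S j k)
  jac : ∀ j a, OrdO l (rate N) 1 (fun x => sampleMean N X x
    (fun y => fderiv ℝ (g y) θs (EuclideanSpace.single a 1) j) - Γ j a)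
  dom : ∀ᶠ x in l, ∀ i < N x, ∀ θ ∈ Θ, ‖g (X x i) θ‖ ^ 2 ≤ D (X x i)
  mean_dom : OrdO l (rate N) 0 (fun x => sampleMean N X x D)
  sep : ∀ ρ > 0, ∃ η > 0, ∀ᶠ x in l, ∀ θ ∈ Θ, ρ ≤ ‖θ - θs‖ →
    ∃ j, η ≤ |sampleMean N X x fun y => g y θ j|
  pos : ∀ v : EuclideanSpace ℝ (Fin m), v ≠ 0 → 0 < ∑ j, ∑ k, S j k * (v j * v k)
  inj : ∀ u : EuclideanSpace ℝ (Fin p), (∀ j, ∑ a, Γ j a * u a = 0) → u = 0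

lemma OrdO.tendsto_of_sub {l : Filter I} {ε : I → ℝ} (hε : Tendsto ε l (𝓝 0)) {f : I → ℝ} {c : ℝ}
    (h : OrdO l ε 1 (fun x => f x - c)) : Tendsto f l (𝓝 c) := by
  have h1 : Tendsto (fun x => f x - c) l (𝓝 0) :=
    IsBigO.trans_tendsto h (by simpa using hε)
  simpa using h1.add_const c

variable {l : Filter I} {N : I → ℕ} {X : I → ℕ → 𝒳} {b : 𝒳 → ℝ}
  {g : 𝒳 → EuclideanSpace ℝ (Fin p) → EuclideanSpace ℝ (Fin m)}
  {Θ : Set (EuclideanSpace ℝ (Fin p))} {θs : EuclideanSpace ℝ (Fin p)} {r : ℝ}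
  {S : Matrix (Fin m) (Fin m) ℝ} {Γ : Matrix (Fin m) (Fin p) ℝ} {D : 𝒳 → ℝ}

lemma LocallySmooth.norm_le {G : EuclideanSpace ℝ (Fin p) → EuclideanSpace ℝ (Fin m)} {B : ℝ}
    (h : LocallySmooth G θs r B) {θ : EuclideanSpace ℝ (Fin p)} (hθ : θ ∈ Metric.ball θs r) :
    ‖G θ‖ ≤ B := by
  have := h.bound 0 (by norm_num) θ hθ
  rwa [norm_iteratedFDeriv_zero] at this

lemma LocallySmooth.norm_sub_le {G : EuclideanSpace ℝ (Fin p) → EuclideanSpace ℝ (Fin m)} {B : ℝ}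
    (h : LocallySmooth G θs r B) {θ θ' : EuclideanSpace ℝ (Fin p)} (hθ : θ ∈ Metric.ball θs r)
    (hθ' : θ' ∈ Metric.ball θs r) : ‖G θ - G θ'‖ ≤ B * ‖θ - θ'‖ := by
  have := h.norm_apply_sub_le (k := 0) (by norm_num) hθ hθ' ![]
  simpa [iteratedFDeriv_zero_apply] using this

namespace MomentRegime

lemma sampleO_b (h : MomentRegime l N X b g Θ θs r S Γ D) :
    SampleO l N X b 0 1 (fun z => b z.2) := by
  have _ := h.pos_radius
  refine (isBigO_refl (fun z : I × 𝒳 => b z.2) _).congr_right fun z => ?_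
  simp

/-- Estimators that converge to `θs`. -/
lemma eventually_mem_ball (h : MomentRegime l N X b g Θ θs r S Γ D)
    {θ : I → EuclideanSpace ℝ (Fin p)} (hθ : Tendsto θ l (𝓝 θs)) :
    ∀ᶠ x in l, θ x ∈ Metric.ball θs r :=
  hθ.eventually (Metric.isOpen_ball.mem_nhds (Metric.mem_ball_self h.pos_radius))

lemma sampleO_g (h : MomentRegime l N X b g Θ θs r S Γ D)
    {θ : I → EuclideanSpace ℝ (Fin p)} (hθ : Tendsto θ l (𝓝 θs)) (j : Fin m) :
    SampleO l N X b 0 1 (fun z => g z.2 (θ z.1) j) := by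
  refine IsBigO.trans (IsBigO.of_bound 1 ?_) h.sampleO_b
  rw [eventually_sampleFilter_iff]
  filter_upwards [h.smooth, h.eventually_mem_ball hθ] with x hx hθx i hi
  rw [one_mul, Real.norm_of_nonneg (h.toSampleZone.pos _).le]
  exact (PiLp.norm_apply_le _ j).trans ((hx i hi).norm_le hθx)

lemma sampleO_deriv (h : MomentRegime l N X b g Θ θs r S Γ D)
    {θ : I → EuclideanSpace ℝ (Fin p)} (hθ : Tendsto θ l (𝓝 θs)) (a : Fin p) (j : Fin m) :
    SampleO l N X b 0 1 (fun z => fderiv ℝ (g z.2) (θ z.1) (EuclideanSpace.single a 1) j) := by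
  refine IsBigO.trans (IsBigO.of_bound 1 ?_) h.sampleO_b
  rw [eventually_sampleFilter_iff]
  filter_upwards [h.smooth, h.eventually_mem_ball hθ] with x hx hθx i hi
  rw [one_mul, Real.norm_of_nonneg (h.toSampleZone.pos _).le, ← partialCoef_one]
  exact (hx i hi).abs_partialCoef_le hθx (by norm_num) _ _

/-- Sample means of products at an estimator differ little from those at `θs`. -/
lemma tendsto_cov (h : MomentRegime l N X b g Θ θs r S Γ D)
    {θ : I → EuclideanSpace ℝ (Fin p)} (hθ : Tendsto θ l (𝓝 θs)) (j k : Fin m) :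
    Tendsto (fun x => sampleMean N X x fun y => g y (θ x) j * g y (θ x) k) l (𝓝 (S j k)) := by
  have h1 := (h.cov j k).tendsto_of_sub h.tendsto_rate
  obtain ⟨K, hK⟩ := h.mean.bound
  have h2 : Tendsto (fun x => 2 * K * ‖θ x - θs‖) l (𝓝 0) := by
    have := (tendsto_iff_norm_sub_tendsto_zero.1 hθ).const_mul (2 * K)
    simpa using this
  have h3 : Tendsto (fun x => sampleMean N X x (fun y => g y (θ x) j * g y (θ x) k) -
      sampleMean N X x (fun y => g y θs j * g y θs k)) l (𝓝 0) := by
    refine squeeze_zero_norm' ?_ h2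
    filter_upwards [h.smooth, h.eventually_mem_ball hθ, hK, h.eventually_ne] with x hx hθx hKx hN
    have hmem := Metric.mem_ball_self (x := θs) h.pos_radius
    rw [← sampleMean_sub, Real.norm_eq_abs, sampleMean, abs_mul, abs_of_nonneg (by positivity)]
    have h4 : ∀ i ∈ Finset.range (N x), |g (X x i) (θ x) j * g (X x i) (θ x) k -
        g (X x i) θs j * g (X x i) θs k| ≤ b (X x i) ^ 6 * (2 * ‖θ x - θs‖) := by
      intro i hi
      have hs := hx i (Finset.mem_range.1 hi)
      have hb := h.one_le (X x i)
      have e1 : ∀ j, |g (X x i) (θ x) j - g (X x i) θs j| ≤ b (X x i) * ‖θ x - θs‖ := fun j =>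
        (PiLp.norm_apply_le (g (X x i) (θ x) - g (X x i) θs) j).trans (hs.norm_sub_le hθx hmem)
      have e2 : ∀ {θ'} (_ : θ' ∈ Metric.ball θs r) j, |g (X x i) θ' j| ≤ b (X x i) := fun hθ' j =>
        (PiLp.norm_apply_le _ j).trans (hs.norm_le hθ')
      calc _ = |(g (X x i) (θ x) j - g (X x i) θs j) * g (X x i) (θ x) k +
            g (X x i) θs j * (g (X x i) (θ x) k - g (X x i) θs k)| := by ring_nf
        _ ≤ b (X x i) * ‖θ x - θs‖ * b (X x i) + b (X x i) * (b (X x i) * ‖θ x - θs‖) := by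
            refine (abs_add_le _ _).trans (add_le_add ?_ ?_)
            · rw [abs_mul]
              exact mul_le_mul (e1 j) (e2 hθx k) (abs_nonneg _) (by positivity)
            · rw [abs_mul]
              exact mul_le_mul (e2 hmem j) (e1 k) (abs_nonneg _) (by positivity)
        _ = b (X x i) ^ 2 * (2 * ‖θ x - θs‖) := by ring
        _ ≤ _ := by
            gcongr
            norm_num
    calc (N x : ℝ)⁻¹ * _ ≤ (N x : ℝ)⁻¹ * ∑ i ∈ Finset.range (N x),
          b (X x i) ^ 6 * (2 * ‖θ x - θs‖) := by
          refine mul_le_mul_of_nonneg_left ((Finset.abs_sum_le_sum_abs _ _).trans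
            (Finset.sum_le_sum h4)) (by positivity)
      _ = sampleMean N X x (fun y => b y ^ 6) * (2 * ‖θ x - θs‖) := by
          rw [← Finset.sum_mul, sampleMean]
          ring
      _ ≤ K * (2 * ‖θ x - θs‖) := by
          have := (le_abs_self _).trans hKx
          rw [pow_zero, norm_one, mul_one] at this
          gcongr
      _ = _ := by ring
  simpa using h3.add h1

lemma exists_coercive (h : MomentRegime l N X b g Θ θs r S Γ D)
    {θ : I → EuclideanSpace ℝ (Fin p)} (hθ : Tendsto θ l (𝓝 θs)) :
    ∃ c : ℝ, 0 < c ∧ ∀ᶠ x in l, ∀ v : EuclideanSpace ℝ (Fin m),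
      c * ‖v‖ ^ 2 ≤ sampleMean N X x (fun y => ⟪v, g y (θ x)⟫_ℝ ^ 2) := by
  obtain ⟨c, hc, hev⟩ := eventually_coercive h.pos fun j k => h.tendsto_cov hθ j k
  refine ⟨c, hc, hev.mono fun x hx v => ?_⟩
  rw [sampleMean_inner_sq]
  exact hx v

end MomentRegime

end Regime

/-! ### Consistency and the rate of the parameter -/

section Rates

variable {I 𝒳 : Type*} {m p : ℕ} {l : Filter I} {N : I → ℕ} {X : I → ℕ → 𝒳} {b : 𝒳 → ℝ}
  {g : 𝒳 → EuclideanSpace ℝ (Fin p) → EuclideanSpace ℝ (Fin m)}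
  {Θ : Set (EuclideanSpace ℝ (Fin p))} {θs : EuclideanSpace ℝ (Fin p)} {r : ℝ}
  {S : Matrix (Fin m) (Fin m) ℝ} {Γ : Matrix (Fin m) (Fin p) ℝ} {D : 𝒳 → ℝ}

/-- A second-order Taylor estimate for the moment function. -/
lemma LocallySmooth.norm_sub_sub_le {G : EuclideanSpace ℝ (Fin p) → EuclideanSpace ℝ (Fin m)}
    {B : ℝ} (h : LocallySmooth G θs r B) (hB : 0 ≤ B) {θ : EuclideanSpace ℝ (Fin p)}
    (hθ : θ ∈ Metric.ball θs r) :
    ‖G θ - G θs - fderiv ℝ G θs (θ - θs)‖ ≤ B * ‖θ - θs‖ ^ 2 := by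
  set u := θ - θs with hu
  have hur : ‖u‖ < r := mem_ball_iff_norm.1 hθ
  have hin : ∀ t ∈ Set.Icc (0 : ℝ) 1, θs + t • u ∈ Metric.ball θs r := fun t ht => by
    rw [mem_ball_iff_norm, add_sub_cancel_left, norm_smul, Real.norm_of_nonneg ht.1]
    exact (mul_le_of_le_one_left (norm_nonneg _) ht.2).trans_lt hur
  have hd : ∀ t ∈ Set.Icc (0 : ℝ) 1, HasDerivWithinAt
      (fun t : ℝ => iteratedFDeriv ℝ 0 G (θs + t • u) ![] - t • iteratedFDeriv ℝ 1 G θs ![u])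
      (iteratedFDeriv ℝ 1 G (θs + t • u) ![u] - iteratedFDeriv ℝ 1 G θs ![u])
      (Set.Icc 0 1) t := fun t ht => by
    have h1 := h.hasDerivAt (hin t ht) (k := 0) (by norm_num) ![]
    have h2 := h1.sub ((hasDerivAt_id t).smul_const (iteratedFDeriv ℝ 1 G θs ![u]))
    rw [one_smul] at h2
    exact h2.hasDerivWithinAt
  have := Convex.norm_image_sub_le_of_norm_hasDerivWithin_le (C := B * ‖u‖ ^ 2) hd
    (fun t ht => by
      refine (h.norm_apply_sub_le (by norm_num) (hin t ht)
        (Metric.mem_ball_self ((norm_nonneg _).trans_lt hur)) _).trans ?_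
      have : t * ‖u‖ ≤ ‖u‖ := mul_le_of_le_one_left (norm_nonneg _) ht.2
      simp only [add_sub_cancel_left, norm_smul, Real.norm_of_nonneg ht.1, Fin.prod_univ_one,
        Matrix.cons_val_zero]
      calc B * (t * ‖u‖) * ‖u‖ ≤ B * ‖u‖ * ‖u‖ := by gcongr
        _ = _ := by ring)
    (convex_Icc (0 : ℝ) 1) (Set.left_mem_Icc.2 zero_le_one) (Set.right_mem_Icc.2 zero_le_one)
  simp only [iteratedFDeriv_zero_apply, iteratedFDeriv_one_apply, one_smul, zero_smul, add_zero,
    sub_zero, norm_one, mul_one, Matrix.cons_val_zero] at this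
  have e : θs + u = θ := by simp [hu]
  rw [e] at this
  rwa [sub_right_comm]

lemma fderiv_apply_eq_sum (G : EuclideanSpace ℝ (Fin p) → EuclideanSpace ℝ (Fin m))
    (θ u : EuclideanSpace ℝ (Fin p)) (j : Fin m) :
    fderiv ℝ G θ u j = ∑ a, fderiv ℝ G θ (EuclideanSpace.single a 1) j * u a := by
  have h2 : u = ∑ a, u a • EuclideanSpace.single a (1 : ℝ) := by
    ext b
    simp [Pi.single_apply]
  conv_lhs => rw [h2]
  rw [map_sum]
  simp [mul_comm]

lemma norm_mean_le (x : I) (f : 𝒳 → EuclideanSpace ℝ (Fin m)) :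
    ‖(N x : ℝ)⁻¹ • ∑ i : Fin (N x), f (X x i)‖ ≤ ∑ j, |sampleMean N X x fun y => f y j| := by
  refine (norm_le_sum_abs _).trans (le_of_eq (Finset.sum_congr rfl fun j _ => ?_))
  simp [sampleMean_eq_sum_fin]

namespace MomentRegime

/-- Weights at `θs` exist and have a small discrepancy. -/
lemma exists_weights (h : MomentRegime l N X b g Θ θs r S Γ D) :
    ∃ C : ℝ, ∀ᶠ x in l,
      (∃ w, IsELWeights (fun i : Fin (N x) => g (X x i) θs) w ∧
        klDiscrepancy w ≤ C * (N x : ℝ)⁻¹) ∧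
      ∃ w, IsETWeights (fun i : Fin (N x) => g (X x i) θs) w ∧ (∀ i, 0 < w i) ∧
        klDiscrepancy w ≤ C * (N x : ℝ)⁻¹ := by
  obtain ⟨c, hc, hcoer⟩ := h.exists_coercive (θ := fun _ => θs) tendsto_const_nhds
  have hmean : OrdO l (rate N) 1 (fun x => ∑ j, |sampleMean N X x fun y => g y θs j|) :=
    OrdO.sum fun j _ => IsBigO.norm_left (h.mean_g j)
  obtain ⟨A, hA, hAb⟩ := hmean.exists_pos
  -- The dual ball has radius R n^(-1/2), where A n^(-1/2) bounds the mean of g at `θs`. This R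
  -- ensures A < c R / 8, the requirement of `exists_isELWeights`; that of `exists_isETWeights`,
  -- with 1/4, is weaker.
  set R := 8 * A / c + 1 with hR
  have hR0 : 0 < R := by positivity
  have hRA : A < 1 / 8 * c * R := by
    rw [hR]
    field_simp
    linarith
  have hsm := (h.tendsto_rate_mul.mul_const R).eventually_le_const
    (by norm_num : (0 : ℝ) * R < 1 / 2)
  refine ⟨R * A, ?_⟩
  filter_upwards [hcoer, hAb.bound, h.eventually_ne, eventually_sampleFilter_iff.1 hsm, h.smooth]
    with x hx hAx hN hs hloc
  have hN0 : (0 : ℝ) < N x := by positivity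
  have hε : 0 < rate N x := inv_pos.2 (Real.sqrt_pos.2 hN0)
  have hnorm : ‖(N x : ℝ)⁻¹ • ∑ i : Fin (N x), g (X x i) θs‖ ≤ A * rate N x := by
    refine (norm_mean_le x fun y => g y θs).trans ((le_abs_self _).trans ?_)
    simpa [abs_of_pos hε] using hAx
  have hco : ∀ v : EuclideanSpace ℝ (Fin m), c * ‖v‖ ^ 2 ≤
      (N x : ℝ)⁻¹ * ∑ i : Fin (N x), ⟪v, g (X x i) θs⟫_ℝ ^ 2 := fun v => by
    rw [← sampleMean_eq_sum_fin x fun y => ⟪v, g y θs⟫_ℝ ^ 2]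
    exact hx v
  have hsmall : ∀ i : Fin (N x), ‖g (X x i) θs‖ * (R * rate N x) ≤ 1 / 2 := fun i => by
    have h1 := (hloc i i.2).norm_le (Metric.mem_ball_self h.pos_radius)
    have h2 := hs i i.2
    calc ‖g (X x i) θs‖ * (R * rate N x) ≤ b (X x i) * (R * rate N x) := by gcongr
      _ = rate N x * b (X x i) * R := by ring
      _ ≤ 1 / 2 := h2
  have hlt : A * rate N x < 1 / 8 * c * (R * rate N x) := by
    have := mul_lt_mul_of_pos_right hRA hε
    linarith
  have hkl : R * rate N x * ‖(N x : ℝ)⁻¹ • ∑ i : Fin (N x), g (X x i) θs‖ ≤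
      R * A * (N x : ℝ)⁻¹ := by
    calc R * rate N x * ‖(N x : ℝ)⁻¹ • ∑ i : Fin (N x), g (X x i) θs‖
        ≤ R * rate N x * (A * rate N x) := by gcongr
      _ = R * A * rate N x ^ 2 := by ring
      _ = _ := by rw [rate_sq]
  have hRr : 0 < R * rate N x := by positivity
  constructor
  · obtain ⟨w, hw, hwk⟩ := exists_isELWeights hN hRr hco hsmall (hnorm.trans_lt hlt)
    exact ⟨w, hw, hwk.trans hkl⟩
  · obtain ⟨w, hw, hpos, hwk⟩ := exists_isETWeights hN hRr hco hsmall
      (hnorm.trans_lt (hlt.trans_le (by nlinarith)))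
    exact ⟨w, hw, hpos, hwk.trans hkl⟩

variable {θ : I → EuclideanSpace ℝ (Fin p)} {ρ : I → 𝒳 → ℝ}

/-- The moment conditions hold approximately at an estimator with small discrepancy. -/
lemma ordO_mean (h : MomentRegime l N X b g Θ θs r S Γ D) (hΘ : ∀ᶠ x in l, θ x ∈ Θ)
    (hzero : ∀ j, ∀ᶠ x in l, sampleMean N X x (fun y => ρ x y * g y (θ x) j) = 0)
    (hρ : OrdO l (rate N) 2 (fun x => sampleMean N X x fun y => (ρ x y - 1) ^ 2)) (j : Fin m) :
    OrdO l (rate N) 1 (fun x => sampleMean N X x fun y => g y (θ x) j) := by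
  have h2 : OrdO l (rate N) 2 (fun x => (sampleMean N X x fun y => g y (θ x) j) ^ 2) := by
    have h3 := (hρ.mul h.mean_dom)
    refine IsBigO.trans (IsBigO.of_bound 1 ?_) h3
    filter_upwards [hΘ, hzero j, h.dom] with x hx hz hd
    -- The weighted mean vanishes, so the plain mean is minus that of (ρ - 1) g. Cauchy-Schwarz
    -- bounds it with the dominating function of ‖g‖² on all of Θ, so no consistency is presupposed.
    have e : sampleMean N X x (fun y => g y (θ x) j) =
        -sampleMean N X x (fun y => (ρ x y - 1) * g y (θ x) j) := by
      simp only [sub_mul, sampleMean_sub, one_mul, hz]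
      ring
    rw [one_mul, e, neg_sq, Real.norm_of_nonneg (sq_nonneg _)]
    refine (sampleMean_mul_sq_le x _ _).trans (le_trans ?_ (le_abs_self _))
    refine mul_le_mul_of_nonneg_left (sampleMean_mono fun i hi => ?_) ?_
    · refine le_trans ?_ (hd i hi _ hx)
      rw [← sq_abs]
      exact pow_le_pow_left₀ (abs_nonneg _) (PiLp.norm_apply_le (g (X x i) (θ x)) j) 2
    · exact mul_nonneg (by positivity) (Finset.sum_nonneg fun i _ => sq_nonneg _)
  have h4 : (fun x => (sampleMean N X x fun y => g y (θ x) j) ^ 2) =O[l]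
      fun x => (rate N x ^ 1) ^ 2 := by simpa [OrdO] using h2
  exact IsBigO.of_pow two_ne_zero h4

/-- Outside each ball about `θs` some sample moment exceeds a fixed η, uniformly in θ, by `sep`;
means that tend to zero exclude this. -/
lemma tendsto_of_ordO_mean (h : MomentRegime l N X b g Θ θs r S Γ D) (hΘ : ∀ᶠ x in l, θ x ∈ Θ)
    (hmean : ∀ j, OrdO l (rate N) 1 (fun x => sampleMean N X x fun y => g y (θ x) j)) :
    Tendsto θ l (𝓝 θs) := by
  rw [tendsto_iff_norm_sub_tendsto_zero, Metric.tendsto_nhds]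
  intro δ hδ
  obtain ⟨η, hη, hsep⟩ := h.sep δ hδ
  have h1 : ∀ j, Tendsto (fun x => sampleMean N X x fun y => g y (θ x) j) l (𝓝 0) := fun j =>
    IsBigO.trans_tendsto (hmean j) (by simpa using h.tendsto_rate)
  have h2 : ∀ᶠ x in l, ∀ j, |sampleMean N X x fun y => g y (θ x) j| < η :=
    eventually_all.2 fun j => by
      have := (h1 j).abs
      rw [abs_zero] at this
      exact this.eventually_lt_const hη
  filter_upwards [hΘ, hsep, h2] with x hx hs h2x
  rw [Real.dist_eq, sub_zero, abs_norm]
  by_contra hlt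
  obtain ⟨j, hj⟩ := hs _ hx (not_lt.1 hlt)
  exact absurd (h2x j) (not_lt.2 hj)

/-- Injectivity of Γ gives √c ‖u‖ ≤ ∑ |(Γu)ⱼ| for u = θ - `θs`. By the Taylor estimate Γu is a
difference of sample moments up to q‖u‖, where q → 0 by consistency; once q ≤ √c / 2 this error is
absorbed in the left side. -/
lemma ordO_theta (h : MomentRegime l N X b g Θ θs r S Γ D) (hθ : Tendsto θ l (𝓝 θs))
    (hmean : ∀ j, OrdO l (rate N) 1 (fun x => sampleMean N X x fun y => g y (θ x) j)) (a : Fin p) :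
    OrdO l (rate N) 1 (fun x => θ x a - θs a) := by
  set M : Matrix (Fin p) (Fin p) ℝ := fun a a' => ∑ j, Γ j a * Γ j a' with hM
  have hMq : ∀ u : EuclideanSpace ℝ (Fin p),
      ∑ a, ∑ a', M a a' * (u a * u a') = ∑ j, (∑ a, Γ j a * u a) ^ 2 := fun u => by
    simp only [hM, Finset.sum_mul]
    rw [Finset.sum_congr rfl fun a _ => Finset.sum_comm, Finset.sum_comm]
    refine Finset.sum_congr rfl fun j _ => ?_
    rw [sq, Finset.sum_mul_sum]
    exact Finset.sum_congr rfl fun a _ => Finset.sum_congr rfl fun a' _ => by ring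
  obtain ⟨c, hc, hcoer⟩ := exists_coercive_of_pos (S := M) fun u hu => by
    rw [hMq]
    by_contra hle
    have h0 : ∑ j, (∑ a, Γ j a * u a) ^ 2 = 0 :=
      le_antisymm (not_lt.1 hle) (Finset.sum_nonneg fun j _ => sq_nonneg _)
    refine hu (h.inj u fun j => ?_)
    have := (Finset.sum_eq_zero_iff_of_nonneg fun j _ => sq_nonneg _).1 h0 j (Finset.mem_univ j)
    simpa using this
  have hcoer' : ∀ u : EuclideanSpace ℝ (Fin p), √c * ‖u‖ ≤ ∑ j, |∑ a, Γ j a * u a| := fun u => by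
    refine le_of_sq_le_sq ?_ (Finset.sum_nonneg fun j _ => abs_nonneg _)
    rw [mul_pow, Real.sq_sqrt hc.le]
    refine (hcoer u).trans ?_
    rw [hMq]
    have := Finset.sum_sq_le_sq_sum_of_nonneg (s := Finset.univ)
      (f := fun j => |∑ a, Γ j a * u a|) fun j _ => abs_nonneg _
    simpa using this
  obtain ⟨K, hK⟩ := h.mean.bound
  set q : I → ℝ := fun x => ∑ j, (K * ‖θ x - θs‖ + ∑ a, |sampleMean N X x
    (fun y => fderiv ℝ (g y) θs (EuclideanSpace.single a 1) j) - Γ j a|) with hq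
  have hq0 : Tendsto q l (𝓝 0) := by
    have : Tendsto q l (𝓝 (∑ j : Fin m, (K * 0 + ∑ a : Fin p, 0))) := by
      refine tendsto_finsetSum _ fun j _ =>
        ((tendsto_iff_norm_sub_tendsto_zero.1 hθ).const_mul K).add
          (tendsto_finsetSum _ fun a _ => ?_)
      have h1 := (h.jac j a).tendsto_of_sub h.tendsto_rate
      simpa using (h1.sub_const (Γ j a)).abs
    simpa using this
  have hf1 : OrdO l (rate N) 1 (fun x => ∑ j, |sampleMean N X x (fun y => g y (θ x) j) -
      sampleMean N X x (fun y => g y θs j)|) :=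
    OrdO.sum fun j _ => IsBigO.norm_left ((hmean j).sub (h.mean_g j))
  refine IsBigO.trans (IsBigO.of_bound (2 / √c) ?_) hf1
  have hsc : 0 < √c := Real.sqrt_pos.2 hc
  filter_upwards [hq0.eventually_le_const (by positivity : 0 < √c / 2), h.smooth,
    h.eventually_mem_ball hθ, hK, h.eventually_ne] with x hqx hs hθx hKx hN
  rw [pow_zero, norm_one, mul_one] at hKx
  set u := θ x - θs with hu
  have hKb : sampleMean N X x b ≤ K := by
    refine (sampleMean_mono fun i _ => ?_).trans ((le_abs_self _).trans hKx)
    exact le_self_pow₀ (h.one_le _) (by norm_num)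
  have hR : ∀ j, |sampleMean N X x (fun y => g y (θ x) j - g y θs j -
      fderiv ℝ (g y) θs u j)| ≤ K * ‖u‖ ^ 2 := fun j => by
    have h1 : |sampleMean N X x (fun y => g y (θ x) j - g y θs j - fderiv ℝ (g y) θs u j)| ≤
        sampleMean N X x fun y => b y * ‖u‖ ^ 2 := by
      rw [sampleMean, abs_mul, abs_of_nonneg (by positivity)]
      refine mul_le_mul_of_nonneg_left ((Finset.abs_sum_le_sum_abs _ _).trans
        (Finset.sum_le_sum fun i hi => ?_)) (by positivity)
      exact (PiLp.norm_apply_le (g (X x i) (θ x) - g (X x i) θs - fderiv ℝ (g (X x i)) θs u) j).trans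
        ((hs i (Finset.mem_range.1 hi)).norm_sub_sub_le (h.toSampleZone.pos _).le hθx)
    rw [sampleMean_mul_const] at h1
    exact h1.trans (by gcongr)
  have hlin : ∀ j, |∑ a, Γ j a * u a| ≤ |sampleMean N X x (fun y => g y (θ x) j) -
      sampleMean N X x (fun y => g y θs j)| + (K * ‖u‖ + ∑ a, |sampleMean N X x
        (fun y => fderiv ℝ (g y) θs (EuclideanSpace.single a 1) j) - Γ j a|) * ‖u‖ := fun j => by
    have e : ∑ a, Γ j a * u a = (sampleMean N X x (fun y => g y (θ x) j) -
        sampleMean N X x (fun y => g y θs j)) - sampleMean N X x (fun y => g y (θ x) j - g y θs j -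
          fderiv ℝ (g y) θs u j) - ∑ a, (sampleMean N X x
        (fun y => fderiv ℝ (g y) θs (EuclideanSpace.single a 1) j) - Γ j a) * u a := by
      simp only [sampleMean_sub, fderiv_apply_eq_sum _ _ u, sampleMean_sum, sampleMean_mul_const,
        sub_mul, Finset.sum_sub_distrib]
      ring
    rw [e]
    refine (abs_sub _ _).trans ?_
    have h1 := abs_sub (sampleMean N X x (fun y => g y (θ x) j) -
        sampleMean N X x (fun y => g y θs j)) (sampleMean N X x (fun y => g y (θ x) j - g y θs j -
          fderiv ℝ (g y) θs u j))
    have h2 : |∑ a, (sampleMean N X x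
        (fun y => fderiv ℝ (g y) θs (EuclideanSpace.single a 1) j) - Γ j a) * u a| ≤
        (∑ a, |sampleMean N X x
          (fun y => fderiv ℝ (g y) θs (EuclideanSpace.single a 1) j) - Γ j a|) * ‖u‖ := by
      rw [Finset.sum_mul]
      refine (Finset.abs_sum_le_sum_abs _ _).trans (Finset.sum_le_sum fun a _ => ?_)
      rw [abs_mul]
      exact mul_le_mul_of_nonneg_left (PiLp.norm_apply_le u a) (abs_nonneg _)
    have h3 := hR j
    linarith
  have h4 := (hcoer' u).trans (Finset.sum_le_sum fun j _ => hlin j)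
  rw [Finset.sum_add_distrib, ← Finset.sum_mul] at h4
  have h5 : q x * ‖u‖ ≤ √c / 2 * ‖u‖ := by gcongr
  have h6 : |u a| ≤ ‖u‖ := PiLp.norm_apply_le u a
  rw [Real.norm_eq_abs, Real.norm_of_nonneg (Finset.sum_nonneg fun j _ => abs_nonneg _),
    div_mul_eq_mul_div, le_div_iff₀ hsc]
  have h7 : |θ x a - θs a| ≤ ‖u‖ := h6
  nlinarith

end MomentRegime

end Rates

/-! ### The estimating equations of the two estimators -/

section Multipliers

variable {I 𝒳 : Type*} {m p : ℕ} {l : Filter I} {N : I → ℕ} {X : I → ℕ → 𝒳} {b : 𝒳 → ℝ}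
  {g : 𝒳 → EuclideanSpace ℝ (Fin p) → EuclideanSpace ℝ (Fin m)}
  {Θ : Set (EuclideanSpace ℝ (Fin p))} {θs : EuclideanSpace ℝ (Fin p)} {r : ℝ}
  {S : Matrix (Fin m) (Fin m) ℝ} {Γ : Matrix (Fin m) (Fin p) ℝ} {D : 𝒳 → ℝ}
  {θ : I → EuclideanSpace ℝ (Fin p)}

lemma exists_eventually_of_eventually_exists {α β : Type*} [Nonempty β] {l : Filter α}
    {q : α → β → Prop} (h : ∀ᶠ x in l, ∃ y, q x y) : ∃ f : α → β, ∀ᶠ x in l, q x (f x) := by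
  classical
  refine ⟨fun x => if hx : ∃ y, q x y then hx.choose else Classical.arbitrary β, ?_⟩
  filter_upwards [h] with x hx
  rw [dif_pos hx]
  exact hx.choose_spec

lemma ordO_of_sq {ε : I → ℝ} {f h : I → ℝ} (hh : OrdO l ε 2 h) (C : ℝ)
    (hf : ∀ᶠ x in l, f x ^ 2 ≤ C * h x) : OrdO l ε 1 f := by
  have h1 : OrdO l ε 2 (fun x => f x ^ 2) := by
    refine IsBigO.trans (IsBigO.of_bound 1 ?_) (hh.const_mul C)
    filter_upwards [hf] with x hx
    rw [one_mul, Real.norm_of_nonneg (sq_nonneg _)]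
    exact hx.trans (le_abs_self _)
  have h4 : (fun x => f x ^ 2) =O[l] fun x => (ε x ^ 1) ^ 2 := by simpa [OrdO] using h1
  exact IsBigO.of_pow two_ne_zero h4

lemma ordO_coord {ε : I → ℝ} {v : I → EuclideanSpace ℝ (Fin m)} {k : ℕ}
    (h : OrdO l ε k (fun x => ‖v x‖)) (j : Fin m) : OrdO l ε k (fun x => v x j) :=
  IsBigO.trans (IsBigO.of_bound 1 (Eventually.of_forall fun x => by
    simpa using PiLp.norm_apply_le (v x) j)) h

lemma feasible_sampleMean {x : I} {w : Fin (N x) → ℝ} {f : 𝒳 → EuclideanSpace ℝ (Fin m)}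
    (hN : N x ≠ 0) (hw : w ∈ feasibleWeights fun i : Fin (N x) => f (X x i)) {ρ : 𝒳 → ℝ}
    (hρ : ∀ i : Fin (N x), ρ (X x i) = N x * w i) :
    sampleMean N X x ρ = 1 ∧ ∀ j, sampleMean N X x (fun y => ρ y * f y j) = 0 := by
  have hN0 : (N x : ℝ) ≠ 0 := by positivity
  constructor
  · rw [sampleMean_eq_sum_fin]
    simp only [hρ, ← Finset.mul_sum, hw.2.1]
    field_simp
  · intro j
    have h1 := congrArg (fun v : EuclideanSpace ℝ (Fin m) => v j) hw.2.2
    simp only [WithLp.ofLp_sum, Finset.sum_apply, PiLp.smul_apply, smul_eq_mul,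
      PiLp.zero_apply] at h1
    rw [sampleMean_eq_sum_fin]
    simp only [hρ, mul_assoc, ← Finset.mul_sum, h1, mul_zero]

namespace MomentRegime

lemma ball_subset_interior (h : MomentRegime l N X b g Θ θs r S Γ D) :
    Metric.ball θs r ⊆ interior Θ := interior_maximal h.ball Metric.isOpen_ball

lemma mem_theta (h : MomentRegime l N X b g Θ θs r S Γ D) : θs ∈ Θ :=
  h.ball (Metric.mem_ball_self h.pos_radius)

lemma injective_of_coercive {x : I} {θ : EuclideanSpace ℝ (Fin p)} {c : ℝ} (hc : 0 < c)
    (hx : ∀ v : EuclideanSpace ℝ (Fin m),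
      c * ‖v‖ ^ 2 ≤ sampleMean N X x (fun y => ⟪v, g y θ⟫_ℝ ^ 2))
    (k : EuclideanSpace ℝ (Fin m)) (hk : ∑ i : Fin (N x), ⟪k, g (X x i) θ⟫_ℝ ^ 2 = 0) : k = 0 := by
  have h1 := hx k
  rw [sampleMean_eq_sum_fin, hk, mul_zero] at h1
  have h2 : ‖k‖ ^ 2 ≤ 0 := by
    by_contra h3
    have := mul_pos hc (not_le.1 h3)
    linarith
  have h3 : ‖k‖ = 0 := by
    have := le_antisymm h2 (sq_nonneg _)
    simpa using this
  exact norm_eq_zero.1 h3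

/-- Rates of convergence and estimating equations of the EL estimator. -/
lemma exists_EL_multiplier (h : MomentRegime l N X b g Θ θs r S Γ D)
    (hest : ∀ᶠ x in l, IsELEstimate g Θ (fun i : Fin (N x) => X x i) (θ x)) :
    Tendsto θ l (𝓝 θs) ∧ (∀ a, OrdO l (rate N) 1 (fun x => θ x a - θs a)) ∧
    ∃ lam : I → EuclideanSpace ℝ (Fin m), (∀ j, OrdO l (rate N) 1 (fun x => lam x j)) ∧
      (∀ᶠ x in l, ∀ j, sampleMean N X x
        (fun y => (1 - ⟪lam x, g y (θ x)⟫_ℝ)⁻¹ * g y (θ x) j) = 0) ∧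
      ∀ᶠ x in l, ∀ a, sampleMean N X x (fun y => (1 - ⟪lam x, g y (θ x)⟫_ℝ)⁻¹ *
        ⟪lam x, fderiv ℝ (g y) (θ x) (EuclideanSpace.single a 1)⟫_ℝ) = 0 := by
  obtain ⟨C0, hC0⟩ := h.exists_weights
  obtain ⟨C, hCpos, hC⟩ := exists_quadratic_bound C0
  have hex : ∀ᶠ x in l, ∃ lam : EuclideanSpace ℝ (Fin m), ∃ w : Fin (N x) → ℝ,
      IsELWeights (fun i => g (X x i) (θ x)) w ∧
      (∀ θ' ∈ Θ, ∀ w', IsELWeights (fun i : Fin (N x) => g (X x i) θ') w' →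
        klDiscrepancy w ≤ klDiscrepancy w') ∧
      (∀ i, (N x * w i)⁻¹ = 1 - ⟪lam, g (X x i) (θ x)⟫_ℝ) ∧
      klDiscrepancy w ≤ C0 * (N x : ℝ)⁻¹ := by
    -- Optimality is used against `θs` only: the weights at the estimate have a discrepancy no
    -- larger than the O(1/n) attained there.
    filter_upwards [hest, hC0] with x ⟨_, w, hw, hmin⟩ ⟨⟨w0, hw0, hk0⟩, _⟩
    obtain ⟨lam, hlam⟩ := hw.exists_dual
    exact ⟨lam, w, hw, hmin, hlam, (hmin θs h.mem_theta w0 hw0).trans hk0⟩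
  obtain ⟨lam, hlam⟩ := exists_eventually_of_eventually_exists hex
  -- Two mean squares are needed: that of n w - 1 controls the sample moments, and that of (n w)⁻¹ -
  -- 1 = -λ'g controls the multiplier through coercivity.
  have hsq : ∀ᶠ x in l, (∀ j, sampleMean N X x
        (fun y => (1 - ⟪lam x, g y (θ x)⟫_ℝ)⁻¹ * g y (θ x) j) = 0) ∧
      sampleMean N X x (fun y => ((1 - ⟪lam x, g y (θ x)⟫_ℝ)⁻¹ - 1) ^ 2) ≤
        C * C0 * rate N x ^ 2 ∧
      sampleMean N X x (fun y => ⟪lam x, g y (θ x)⟫_ℝ ^ 2) ≤ C * C0 * rate N x ^ 2 := by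
    filter_upwards [hlam, h.eventually_ne] with x ⟨w, hw, _, hl, hk⟩ hN
    have hN0 : (0 : ℝ) < N x := by positivity
    have hρ : ∀ i : Fin (N x), (1 - ⟪lam x, g (X x i) (θ x)⟫_ℝ)⁻¹ = N x * w i := fun i => by
      rw [← hl i, inv_inv]
    have hk' : N x * klDiscrepancy w ≤ C0 := by
      calc N x * klDiscrepancy w ≤ N x * (C0 * (N x : ℝ)⁻¹) := by gcongr
        _ = C0 := by field_simp
    obtain ⟨h1, h2, -⟩ := mean_sq_le_of_klDiscrepancy hN hw.1 hw.2.1 hC hk'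
    have hle : C * klDiscrepancy w ≤ C * C0 * rate N x ^ 2 := by
      rw [rate_sq, mul_assoc]
      gcongr
    refine ⟨(feasible_sampleMean hN hw.1
      (ρ := fun y => (1 - ⟪lam x, g y (θ x)⟫_ℝ)⁻¹) hρ).2, ?_, ?_⟩
    · rw [sampleMean_eq_sum_fin]
      simp only [hρ]
      exact h1.trans hle
    · rw [sampleMean_eq_sum_fin]
      refine le_trans (le_of_eq ?_) (h2.trans hle)
      simp only [hl]
      congr 1
      exact Finset.sum_congr rfl fun i _ => by ring
  have hord : ∀ {f : I → ℝ}, (∀ x, 0 ≤ f x) → (∀ᶠ x in l, f x ≤ C * C0 * rate N x ^ 2) →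
      OrdO l (rate N) 2 f := fun hf hle => by
    refine IsBigO.of_bound (C * C0) ?_
    filter_upwards [hle] with x hx
    rwa [Real.norm_of_nonneg (hf x), Real.norm_of_nonneg (sq_nonneg _)]
  have hnn : ∀ (x : I) (f : 𝒳 → ℝ), 0 ≤ sampleMean N X x fun y => f y ^ 2 := fun x f =>
    mul_nonneg (by positivity) (Finset.sum_nonneg fun i _ => sq_nonneg _)
  have hΘ : ∀ᶠ x in l, θ x ∈ Θ := hest.mono fun x hx => hx.1
  have hmean := h.ordO_mean (θ := θ) (ρ := fun x y => (1 - ⟪lam x, g y (θ x)⟫_ℝ)⁻¹) hΘ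
    (fun j => hsq.mono fun x hx => hx.1 j) (hord (fun x => hnn x _) (hsq.mono fun x hx => hx.2.1))
  have hθ := h.tendsto_of_ordO_mean hΘ hmean
  refine ⟨hθ, h.ordO_theta hθ hmean, lam, ?_, hsq.mono fun x hx => hx.1, ?_⟩
  · obtain ⟨c, hc, hcoer⟩ := h.exists_coercive hθ
    refine ordO_coord (ordO_of_sq (hord (fun x => hnn x _) (hsq.mono fun x hx => hx.2.2)) c⁻¹ ?_)
    filter_upwards [hcoer] with x hx
    rw [← div_eq_inv_mul, le_div_iff₀ hc, mul_comm]
    exact hx _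
  · obtain ⟨c, hc, hcoer⟩ := h.exists_coercive hθ
    filter_upwards [hlam, hcoer, h.eventually_ne, h.eventually_mem_ball hθ, h.smooth]
      with x ⟨w, hw, hmin, hl, _⟩ hx hN hball hs a
    rw [sampleMean_eq_sum_fin]
    exact IsELEstimate.foc (xs := fun i : Fin (N x) => X x i) hN (h.ball_subset_interior hball)
      (fun i => ((hs i i.2).contDiffAt hball).of_le (by norm_num)) hw hmin hl
      (injective_of_coercive hc hx) _

/-- Rates of convergence and estimating equations of the ETEL estimator. -/
lemma exists_ETEL_multiplier (h : MomentRegime l N X b g Θ θs r S Γ D)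
    (hest : ∀ᶠ x in l, IsETELEstimate g Θ (fun i : Fin (N x) => X x i) (θ x)) :
    Tendsto θ l (𝓝 θs) ∧ (∀ a, OrdO l (rate N) 1 (fun x => θ x a - θs a)) ∧
    ∃ (α : I → ℝ) (lam kap : I → EuclideanSpace ℝ (Fin m)), OrdO l (rate N) 1 α ∧
      (∀ j, OrdO l (rate N) 1 (fun x => lam x j)) ∧ (∀ j, OrdO l (rate N) 1 (fun x => kap x j)) ∧
      (∀ᶠ x in l, sampleMean N X x (fun y => Real.exp (α x + ⟪lam x, g y (θ x)⟫_ℝ)) = 1) ∧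
      (∀ᶠ x in l, ∀ j, sampleMean N X x
        (fun y => Real.exp (α x + ⟪lam x, g y (θ x)⟫_ℝ) * g y (θ x) j) = 0) ∧
      (∀ᶠ x in l, ∀ j, sampleMean N X x (fun y => Real.exp (α x + ⟪lam x, g y (θ x)⟫_ℝ) *
        ⟪kap x, g y (θ x)⟫_ℝ * g y (θ x) j) = sampleMean N X x (fun y => g y (θ x) j)) ∧
      ∀ᶠ x in l, ∀ a, sampleMean N X x (fun y => Real.exp (α x + ⟪lam x, g y (θ x)⟫_ℝ) *
        ⟪lam x + kap x, fderiv ℝ (g y) (θ x) (EuclideanSpace.single a 1)⟫_ℝ -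
        ⟪lam x, fderiv ℝ (g y) (θ x) (EuclideanSpace.single a 1)⟫_ℝ +
        Real.exp (α x + ⟪lam x, g y (θ x)⟫_ℝ) *
          ⟪lam x, fderiv ℝ (g y) (θ x) (EuclideanSpace.single a 1)⟫_ℝ *
          ⟪kap x, g y (θ x)⟫_ℝ) = 0 := by
  obtain ⟨C0, hC0⟩ := h.exists_weights
  obtain ⟨C, hCpos, hC⟩ := exists_quadratic_bound C0
  have hex : ∀ᶠ x in l, ∃ z : ℝ × EuclideanSpace ℝ (Fin m), ∃ w : Fin (N x) → ℝ,
      IsETWeights (fun i => g (X x i) (θ x)) w ∧ (∀ i, 0 < w i) ∧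
      (∀ θ' ∈ Θ, ∀ w', IsETWeights (fun i : Fin (N x) => g (X x i) θ') w' → (∀ i, 0 < w' i) →
        klDiscrepancy w ≤ klDiscrepancy w') ∧
      (∀ i, Real.log (N x * w i) = z.1 + ⟪z.2, g (X x i) (θ x)⟫_ℝ) ∧
      klDiscrepancy w ≤ C0 * (N x : ℝ)⁻¹ := by
    filter_upwards [hest, hC0] with x ⟨_, w, hw, hpos, hmin⟩ ⟨_, w0, hw0, hpos0, hk0⟩
    obtain ⟨a, lam, hlam⟩ := hw.exists_dual hpos
    exact ⟨(a, lam), w, hw, hpos, hmin, hlam, (hmin θs h.mem_theta w0 hw0 hpos0).trans hk0⟩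
  obtain ⟨z, hz⟩ := exists_eventually_of_eventually_exists hex
  set α : I → ℝ := fun x => (z x).1 with hα
  set lam : I → EuclideanSpace ℝ (Fin m) := fun x => (z x).2 with hlamd
  have hρeq : ∀ {x : I} {w : Fin (N x) → ℝ}, N x ≠ 0 → (∀ i, 0 < w i) →
      (∀ i, Real.log (N x * w i) = α x + ⟪lam x, g (X x i) (θ x)⟫_ℝ) →
      ∀ i : Fin (N x), Real.exp (α x + ⟪lam x, g (X x i) (θ x)⟫_ℝ) = N x * w i :=
    fun hN hpos hl i => by
      rw [← hl i, Real.exp_log]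
      have := hpos i
      positivity
  have hsq : ∀ᶠ x in l,
      sampleMean N X x (fun y => Real.exp (α x + ⟪lam x, g y (θ x)⟫_ℝ)) = 1 ∧
      (∀ j, sampleMean N X x
        (fun y => Real.exp (α x + ⟪lam x, g y (θ x)⟫_ℝ) * g y (θ x) j) = 0) ∧
      sampleMean N X x (fun y => (Real.exp (α x + ⟪lam x, g y (θ x)⟫_ℝ) - 1) ^ 2) ≤
        C * C0 * rate N x ^ 2 ∧
      sampleMean N X x (fun y => (α x + ⟪lam x, g y (θ x)⟫_ℝ) ^ 2) ≤ C * C0 * rate N x ^ 2 := by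
    filter_upwards [hz, h.eventually_ne] with x ⟨w, hw, hpos, _, hl, hk⟩ hN
    have hN0 : (0 : ℝ) < N x := by positivity
    have hρ := hρeq hN hpos hl
    have hk' : N x * klDiscrepancy w ≤ C0 := by
      calc N x * klDiscrepancy w ≤ N x * (C0 * (N x : ℝ)⁻¹) := by gcongr
        _ = C0 := by field_simp
    obtain ⟨h1, -, h2⟩ := mean_sq_le_of_klDiscrepancy hN hw.1 hpos hC hk'
    have hle : C * klDiscrepancy w ≤ C * C0 * rate N x ^ 2 := by
      rw [rate_sq, mul_assoc]
      gcongr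
    have hf := feasible_sampleMean (f := fun y => g y (θ x)) hN hw.1
      (ρ := fun y => Real.exp (α x + ⟪lam x, g y (θ x)⟫_ℝ)) hρ
    refine ⟨hf.1, hf.2, ?_, ?_⟩
    · rw [sampleMean_eq_sum_fin]
      simp only [hρ]
      exact h1.trans hle
    · rw [sampleMean_eq_sum_fin]
      refine le_trans (le_of_eq ?_) (h2.trans hle)
      simp only [hl]
      rfl
  have hord : ∀ {f : I → ℝ}, (∀ x, 0 ≤ f x) → (∀ᶠ x in l, f x ≤ C * C0 * rate N x ^ 2) →
      OrdO l (rate N) 2 f := fun hf hle => by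
    refine IsBigO.of_bound (C * C0) ?_
    filter_upwards [hle] with x hx
    rwa [Real.norm_of_nonneg (hf x), Real.norm_of_nonneg (sq_nonneg _)]
  have hnn : ∀ (x : I) (f : 𝒳 → ℝ), 0 ≤ sampleMean N X x fun y => f y ^ 2 := fun x f =>
    mul_nonneg (by positivity) (Finset.sum_nonneg fun i _ => sq_nonneg _)
  have hΘ : ∀ᶠ x in l, θ x ∈ Θ := hest.mono fun x hx => hx.1
  have hmean := h.ordO_mean (θ := θ) (ρ := fun x y => Real.exp (α x + ⟪lam x, g y (θ x)⟫_ℝ)) hΘ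
    (fun j => hsq.mono fun x hx => hx.2.1 j)
    (hord (fun x => hnn x _) (hsq.mono fun x hx => hx.2.2.1))
  have hθ := h.tendsto_of_ordO_mean hΘ hmean
  obtain ⟨c, hc, hcoer⟩ := h.exists_coercive hθ
  have hgn : OrdO l (rate N) 1 (fun x => ∑ j, |sampleMean N X x fun y => g y (θ x) j|) :=
    OrdO.sum fun j _ => IsBigO.norm_left (hmean j)
  have hgn0 : Tendsto (fun x => ∑ j, |sampleMean N X x fun y => g y (θ x) j|) l (𝓝 0) :=
    IsBigO.trans_tendsto hgn (by simpa using h.tendsto_rate)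
  have hinner : ∀ (x : I) (v : EuclideanSpace ℝ (Fin m)),
      |sampleMean N X x fun y => ⟪v, g y (θ x)⟫_ℝ| ≤
        ‖v‖ * ∑ j, |sampleMean N X x fun y => g y (θ x) j| := fun x v => by
    simp only [inner_eq_sum, sampleMean_sum, sampleMean_const_mul, Finset.mul_sum]
    refine (Finset.abs_sum_le_sum_abs _ _).trans (Finset.sum_le_sum fun j _ => ?_)
    rw [abs_mul]
    exact mul_le_mul_of_nonneg_right (PiLp.norm_apply_le v j) (abs_nonneg _)
  set c' := min (1 / 2) (c / 2) with hc'
  have hc'0 : 0 < c' := by positivity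
  -- The mean square of α + λ'g bounds α and λ jointly: the cross term 2αλ'ḡ is negligible because
  -- the sample moments ḡ tend to zero, and c' is small enough to leave half of each diagonal term.
  have hquad : ∀ᶠ x in l, c' * (α x ^ 2 + ‖lam x‖ ^ 2) ≤
      sampleMean N X x (fun y => (α x + ⟪lam x, g y (θ x)⟫_ℝ) ^ 2) := by
    filter_upwards [hcoer, hgn0.eventually_le_const hc'0, h.eventually_ne] with x hx hg hN
    have e : sampleMean N X x (fun y => (α x + ⟪lam x, g y (θ x)⟫_ℝ) ^ 2) =
        α x ^ 2 + 2 * α x * sampleMean N X x (fun y => ⟪lam x, g y (θ x)⟫_ℝ) +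
          sampleMean N X x (fun y => ⟪lam x, g y (θ x)⟫_ℝ ^ 2) := by
      simp only [add_sq, sampleMean_add, sampleMean_const_mul, sampleMean_const hN]
    have h1 := hx (lam x)
    have h2 : -(2 * α x * sampleMean N X x (fun y => ⟪lam x, g y (θ x)⟫_ℝ)) ≤
        c' * (α x ^ 2 + ‖lam x‖ ^ 2) := by
      have h3 := (hinner x (lam x)).trans (mul_le_mul_of_nonneg_left hg (norm_nonneg _))
      have h4 : |2 * α x * sampleMean N X x (fun y => ⟪lam x, g y (θ x)⟫_ℝ)| ≤
          2 * |α x| * (‖lam x‖ * c') := by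
        rw [abs_mul, abs_mul, abs_two]
        gcongr
      have h5 := neg_le_abs (2 * α x * sampleMean N X x (fun y => ⟪lam x, g y (θ x)⟫_ℝ))
      have h6 : 2 * |α x| * (‖lam x‖ * c') ≤ c' * (α x ^ 2 + ‖lam x‖ ^ 2) := by
        rw [← sq_abs (α x)]
        nlinarith [sq_nonneg (|α x| - ‖lam x‖)]
      linarith
    have h7 : c' ≤ 1 / 2 := min_le_left _ _
    have h8 : c' ≤ c / 2 := min_le_right _ _
    rw [e]
    nlinarith [sq_nonneg (α x), sq_nonneg ‖lam x‖]
  have hsm := hord (f := fun x => sampleMean N X x (fun y => (α x + ⟪lam x, g y (θ x)⟫_ℝ) ^ 2))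
    (fun x => hnn x _) (hsq.mono fun x hx => hx.2.2.2)
  have hαO : OrdO l (rate N) 1 α := ordO_of_sq hsm c'⁻¹ <| by
    filter_upwards [hquad] with x hx
    rw [← div_eq_inv_mul, le_div_iff₀ hc'0]
    nlinarith [sq_nonneg ‖lam x‖]
  have hlamO : ∀ j, OrdO l (rate N) 1 (fun x => lam x j) := ordO_coord <| ordO_of_sq hsm c'⁻¹ <| by
    filter_upwards [hquad] with x hx
    rw [← div_eq_inv_mul, le_div_iff₀ hc'0]
    nlinarith [sq_nonneg (α x)]
  have hfoc : ∀ᶠ x in l, ∃ κ : EuclideanSpace ℝ (Fin m),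
      (∀ k : EuclideanSpace ℝ (Fin m), sampleMean N X x
        (fun y => Real.exp (α x + ⟪lam x, g y (θ x)⟫_ℝ) * ⟪κ, g y (θ x)⟫_ℝ * ⟪k, g y (θ x)⟫_ℝ) =
          sampleMean N X x (fun y => ⟪k, g y (θ x)⟫_ℝ)) ∧
      ∀ a, sampleMean N X x (fun y => Real.exp (α x + ⟪lam x, g y (θ x)⟫_ℝ) *
        ⟪lam x + κ, fderiv ℝ (g y) (θ x) (EuclideanSpace.single a 1)⟫_ℝ -
        ⟪lam x, fderiv ℝ (g y) (θ x) (EuclideanSpace.single a 1)⟫_ℝ +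
        Real.exp (α x + ⟪lam x, g y (θ x)⟫_ℝ) *
          ⟪lam x, fderiv ℝ (g y) (θ x) (EuclideanSpace.single a 1)⟫_ℝ *
          ⟪κ, g y (θ x)⟫_ℝ) = 0 := by
    filter_upwards [hz, hcoer, h.eventually_ne, h.eventually_mem_ball hθ, h.smooth]
      with x ⟨w, hw, hpos, hmin, hl, _⟩ hx hN hball hs
    obtain ⟨κ, hκ1, hκ2⟩ := IsETELEstimate.foc (xs := fun i : Fin (N x) => X x i) hN
      (h.ball_subset_interior hball)
      (fun i => ((hs i i.2).contDiffAt hball).of_le (by norm_num)) hw hpos hmin hl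
      (injective_of_coercive hc hx)
    have hρ := hρeq hN hpos hl
    refine ⟨κ, fun k => ?_, fun a => ?_⟩
    · rw [sampleMean_eq_sum_fin, sampleMean_eq_sum_fin]
      simp only [hρ]
      exact hκ1 k
    · rw [sampleMean_eq_sum_fin]
      simp only [hρ]
      exact hκ2 _
  obtain ⟨kap, hkap⟩ := exists_eventually_of_eventually_exists hfoc
  refine ⟨hθ, h.ordO_theta hθ hmean, α, lam, kap, hαO, hlamO, ?_, hsq.mono fun x hx => hx.1,
    hsq.mono fun x hx => hx.2.1, ?_, hkap.mono fun x hx => hx.2⟩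
  -- With weights bounded below by 1/2, the equation for κ tested with κ itself gives (c/2)‖κ‖² ≤
  -- ‖κ‖ ∑ |ḡⱼ|, and ḡ is of order n^(-1/2).
  · have hexp : ∀ᶠ x in l, ∀ i < N x, 1 / 2 ≤ Real.exp (α x + ⟪lam x, g (X x i) (θ x)⟫_ℝ) := by
      have h1 : SampleO l N X b 1 1 (fun z => α z.1 + ⟪lam z.1, g z.2 (θ z.1)⟫_ℝ) := by
        refine ((SampleO.of_ordO hαO).mono h.toSampleZone le_rfl (by norm_num)).add ?_
        simp only [inner_eq_sum]
        exact SampleO.sum fun j _ => (SampleO.of_ordO (hlamO j)).mul (h.sampleO_g hθ j)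
      have h2 := (Real.continuous_exp.tendsto 0).comp
        (h1.tendsto_zero h.toSampleZone le_rfl one_ne_zero)
      rw [Real.exp_zero] at h2
      exact eventually_sampleFilter_iff.1 (h2.eventually_const_le (by norm_num))
    refine ordO_coord ?_
    refine IsBigO.trans (IsBigO.of_bound (2 / c) ?_) hgn
    filter_upwards [hexp, hcoer, hkap] with x hx1 hx2 ⟨hx3, _⟩
    rw [norm_norm, Real.norm_of_nonneg (Finset.sum_nonneg fun j _ => abs_nonneg _),
      div_mul_eq_mul_div, le_div_iff₀ hc]
    have h1 := hx2 (kap x)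
    have h2 := hx3 (kap x)
    have h3 : 1 / 2 * sampleMean N X x (fun y => ⟪kap x, g y (θ x)⟫_ℝ ^ 2) ≤ sampleMean N X x
        (fun y => Real.exp (α x + ⟪lam x, g y (θ x)⟫_ℝ) * ⟪kap x, g y (θ x)⟫_ℝ *
          ⟪kap x, g y (θ x)⟫_ℝ) := by
      rw [← sampleMean_const_mul]
      refine sampleMean_mono fun i hi => ?_
      rw [mul_assoc, ← sq]
      exact mul_le_mul_of_nonneg_right (hx1 i hi) (sq_nonneg _)
    have h4 := (le_abs_self _).trans (hinner x (kap x))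
    rcases eq_or_ne ‖kap x‖ 0 with h0 | h0
    · rw [h0, zero_mul]
      positivity
    · have h5 : 0 < ‖kap x‖ := (norm_nonneg _).lt_of_ne' h0
      nlinarith
  · filter_upwards [hkap] with x hx j
    have h1 := hx.1 (EuclideanSpace.single j 1)
    simpa [EuclideanSpace.inner_single_left] using h1

end MomentRegime

end Multipliers

/-! ### Reduction of the estimating equations to polynomial form -/

section Reduction

variable {I 𝒳 : Type*} {m p : ℕ} {l : Filter I} {N : I → ℕ} {X : I → ℕ → 𝒳} {b : 𝒳 → ℝ}

/-- Remainders of the exponential series. -/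
lemma SampleO.exp_sub (hz : SampleZone l N X b) {s : I × 𝒳 → ℝ} (hs : SampleO l N X b 1 1 s) :
    SampleO l N X b 1 1 (fun z => Real.exp (s z) - 1) ∧
    SampleO l N X b 2 2 (fun z => Real.exp (s z) - 1 - s z) ∧
    SampleO l N X b 3 3 (fun z => Real.exp (s z) - 1 - s z - 1 / 2 * (s z * s z)) := by
  have h0 := hs.tendsto_zero hz le_rfl one_ne_zero
  have key : ∀ n, (fun z => Real.exp (s z) - ∑ i ∈ Finset.range n, s z ^ i / i.factorial)
      =O[sampleFilter l N X] fun z => s z ^ n := fun n =>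
    (Real.exp_sub_sum_range_isBigO_pow n).comp_tendsto h0
  refine ⟨?_, ?_, ?_⟩
  · have := (key 1).trans (IsBigO.pow hs 1)
    refine IsBigO.congr this (fun z => ?_) fun z => ?_
    · simp
    · ring
  · have := (key 2).trans (IsBigO.pow hs 2)
    refine IsBigO.congr this (fun z => ?_) fun z => ?_
    · simp [Finset.sum_range_succ]
      ring
    · ring
  · have := (key 3).trans (IsBigO.pow hs 3)
    refine IsBigO.congr this (fun z => ?_) fun z => ?_
    · simp [Finset.sum_range_succ]
      ring
    · ring

variable {γ : Fin m → I × 𝒳 → ℝ} {φ : Fin p → Fin m → I × 𝒳 → ℝ}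

/-- A linear combination of the moment functions. -/
def combine (γ : Fin m → I × 𝒳 → ℝ) (v : I → Fin m → ℝ) (z : I × 𝒳) : ℝ := ∑ k, v z.1 k * γ k z

lemma SampleO.combine {k : ℕ} {v : I → Fin m → ℝ} (hγ : ∀ j, SampleO l N X b 0 1 (γ j))
    (hv : ∀ j, OrdO l (rate N) k (fun x => v x j)) : SampleO l N X b k 1 (combine γ v) := by
  refine SampleO.sum fun j _ => ?_
  have := (SampleO.of_ordO (X := X) (b := b) (hv j)).mul (hγ j)
  simpa using this

lemma sampleMean_mul_combine (f : I × 𝒳 → ℝ) (v : I → Fin m → ℝ) (x : I) :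
    sampleMean N X x (fun y => f (x, y) * combine γ v (x, y)) =
      ∑ k, sampleMean N X x (fun y => f (x, y) * γ k (x, y)) * v x k := by
  simp only [combine, Finset.mul_sum, sampleMean_sum]
  refine Finset.sum_congr rfl fun k _ => ?_
  rw [← sampleMean_mul_const]
  exact sampleMean_congr fun i _ => by ring

/-- The polynomial form of the estimating equations of the EL estimator. -/
lemma ordO_polynomial_EL (hz : SampleZone l N X b) (hγ : ∀ j, SampleO l N X b 0 1 (γ j))
    {mu : I → Fin m → ℝ} (hmu : ∀ j, OrdO l (rate N) 1 (fun x => mu x j)) {f : I × 𝒳 → ℝ}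
    (hf : SampleO l N X b 0 1 f)
    (h0 : ∀ᶠ x in l, sampleMean N X x (fun y => (1 - combine γ mu (x, y))⁻¹ * f (x, y)) = 0) :
    OrdO l (rate N) 4 (fun x => sampleMean N X x fun y => f (x, y) *
      (1 + (combine γ mu (x, y) + (combine γ mu (x, y) * combine γ mu (x, y) +
        1 * (combine γ mu (x, y) * (combine γ mu (x, y) * combine γ mu (x, y))))))) := by
  have hT : SampleO l N X b 1 1 (combine γ mu) := SampleO.combine hγ hmu
  have hT0 := hT.tendsto_zero hz le_rfl one_ne_zero
  have hinv : SampleO l N X b 0 0 (fun z => (1 - combine γ mu z)⁻¹) := by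
    have h1 : Tendsto (fun z => (1 - combine γ mu z)⁻¹) (sampleFilter l N X) (𝓝 (1 - 0)⁻¹) :=
      (tendsto_const_nhds.sub hT0).inv₀ (by norm_num)
    refine (h1.isBigO_one ℝ).congr_right fun z => ?_
    simp
  -- The geometric series: (1 - T)⁻¹ differs from 1 + T + T² + T³ by (1 - T)⁻¹ T⁴, which after
  -- multiplication by f is of order n⁻² b⁵.
  have hR := (hf.mul hinv).mul (hT.mul (hT.mul (hT.mul hT)))
  have hne : ∀ᶠ x in l, ∀ i < N x, 1 - combine γ mu (x, X x i) ≠ 0 := by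
    have h2 := hT0.eventually_lt_const (zero_lt_one)
    filter_upwards [eventually_sampleFilter_iff.1 h2] with x hx i hi
    have := hx i hi
    linarith
  refine (hR.sampleMean hz (by norm_num)).neg.congr ?_
  filter_upwards [h0, hne] with x hx hn
  have e : sampleMean N X x (fun y => f (x, y) *
      (1 + (combine γ mu (x, y) + (combine γ mu (x, y) * combine γ mu (x, y) +
        1 * (combine γ mu (x, y) * (combine γ mu (x, y) * combine γ mu (x, y))))))) =
      sampleMean N X x (fun y => (1 - combine γ mu (x, y))⁻¹ * f (x, y) -
        f (x, y) * (1 - combine γ mu (x, y))⁻¹ * (combine γ mu (x, y) * (combine γ mu (x, y) *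
          (combine γ mu (x, y) * combine γ mu (x, y))))) := by
    refine sampleMean_congr fun i hi => ?_
    have := hn i hi
    field_simp
    ring
  rw [e, sampleMean_sub, hx, zero_sub]

/-- The cubic coefficients in which the estimating equations of the two estimators differ. -/
def cubicCoef (S V : Fin m → Fin m → ℝ) (H : Fin m → Fin m → Fin m → ℝ) (j k r s : Fin m) : ℝ :=
  1 / 2 * (S j k * S r s) + 1 / 2 * ∑ a, ∑ c, H j k a * V a c * H c r s

/-- The polynomial form of the estimating equations of the ETEL estimator. -/
lemma ordO_polynomial_ETEL (hz : SampleZone l N X b) (hγ : ∀ j, SampleO l N X b 0 1 (γ j))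
    (hφ : ∀ a j, SampleO l N X b 0 1 (φ a j)) {α : I → ℝ} {lam mu : I → Fin m → ℝ}
    (hα : OrdO l (rate N) 1 α) (hlam : ∀ j, OrdO l (rate N) 1 (fun x => lam x j))
    (hmu : ∀ j, OrdO l (rate N) 1 (fun x => mu x j))
    {S V : Fin m → Fin m → ℝ} {H : Fin m → Fin m → Fin m → ℝ}
    (hS : ∀ j k, OrdO l (rate N) 1
      (fun x => sampleMean N X x (fun y => γ j (x, y) * γ k (x, y)) - S j k))
    (hH : ∀ j k r, OrdO l (rate N) 1
      (fun x => sampleMean N X x (fun y => γ j (x, y) * (γ k (x, y) * γ r (x, y))) - H j k r))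
    (hV : ∀ v : Fin m → ℝ, ∀ k, v k = ∑ j, V k j * ∑ i, S j i * v i)
    (e1 : ∀ᶠ x in l, sampleMean N X x (fun y => Real.exp (α x + combine γ lam (x, y))) = 1)
    (e2 : ∀ᶠ x in l, ∀ j, sampleMean N X x
      (fun y => Real.exp (α x + combine γ lam (x, y)) * γ j (x, y)) = 0)
    (e3 : ∀ᶠ x in l, ∀ j, sampleMean N X x (fun y => Real.exp (α x + combine γ lam (x, y)) *
      combine γ mu (x, y) * γ j (x, y)) = -sampleMean N X x (fun y => γ j (x, y)))
    (e4 : ∀ᶠ x in l, ∀ a, sampleMean N X x (fun y => Real.exp (α x + combine γ lam (x, y)) *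
      (combine (φ a) lam (x, y) - combine (φ a) mu (x, y)) - combine (φ a) lam (x, y) -
      Real.exp (α x + combine γ lam (x, y)) * combine (φ a) lam (x, y) *
        combine γ mu (x, y)) = 0) :
    (∀ j, OrdO l (rate N) 4 (fun x => sampleMean N X x (fun y => γ j (x, y) *
      (1 + (combine γ mu (x, y) + (combine γ mu (x, y) * combine γ mu (x, y) +
        1 / 2 * (combine γ mu (x, y) * (combine γ mu (x, y) * combine γ mu (x, y))))))) +
      ∑ k, ∑ r, ∑ s, cubicCoef S V H j k r s * mu x k * mu x r * mu x s)) ∧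
    ∀ a, OrdO l (rate N) 4 (fun x => sampleMean N X x (fun y => combine (φ a) mu (x, y) *
      (1 + (combine γ mu (x, y) + (combine γ mu (x, y) * combine γ mu (x, y) +
        1 / 2 * (combine γ mu (x, y) * (combine γ mu (x, y) * combine γ mu (x, y)))))))) := by
  have hε := hz.tendsto_rate
  -- The unknowns to be eliminated are α and δ = λ - μ. Both turn out to be of order n⁻¹ with
  -- explicit quadratic leading terms in μ: the equations `e1`, `e2` determine α, and `e2`, `e3`
  -- determine δ. In what follows T = μ'γ, d = δ'γ, t = λ'γ, s = α + t and E = exp s.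
  set del : I → Fin m → ℝ := fun x k => lam x k - mu x k with hdel
  set T := combine γ mu with hTd
  set d := combine γ del with hdd
  set t := combine γ lam with htd
  set s : I × 𝒳 → ℝ := fun z => α z.1 + t z with hsd
  set E : I × 𝒳 → ℝ := fun z => Real.exp (s z) with hEd
  have htTd : ∀ z, t z = T z + d z := fun z => by
    simp only [htd, hTd, hdd, combine, hdel, sub_mul, Finset.sum_sub_distrib]
    ring
  have hT : SampleO l N X b 1 1 T := SampleO.combine hγ hmu
  have ht : SampleO l N X b 1 1 t := SampleO.combine hγ hlam
  have hs : SampleO l N X b 1 1 s :=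
    ((SampleO.of_ordO hα).mono hz le_rfl (by norm_num)).add ht
  obtain ⟨hE1, hE2, hE3⟩ := SampleO.exp_sub hz hs
  change SampleO l N X b 1 1 (fun z => E z - 1) at hE1
  change SampleO l N X b 2 2 (fun z => E z - 1 - s z) at hE2
  change SampleO l N X b 3 3 (fun z => E z - 1 - s z - 1 / 2 * (s z * s z)) at hE3
  -- the sample moments have order `n ^ (-1/2)`
  have hmean : ∀ j, OrdO l (rate N) 1 (fun x => sampleMean N X x fun y => γ j (x, y)) := fun j => by
    refine ((hE1.mul (hγ j)).sampleMean hz (by norm_num)).neg.congr ?_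
    filter_upwards [e2] with x hx
    have := hx j
    simp only [sub_mul, one_mul, sampleMean_sub]
    change sampleMean N X x (fun y => E (x, y) * γ j (x, y)) = 0 at this
    rw [this]
    ring
  have hts : ∀ x, sampleMean N X x (fun y => t (x, y)) =
      ∑ k, sampleMean N X x (fun y => γ k (x, y)) * lam x k := fun x => by
    have := sampleMean_mul_combine (N := N) (X := X) (γ := γ) (fun _ => 1) lam x
    simpa only [one_mul] using this
  -- From mean E = 1: α = -λ'γ̄ - mean (E - 1 - s), where λ, the sample moments γ̄ and s are all of
  -- order n^(-1/2).
  have hα2 : OrdO l (rate N) 2 α := by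
    have h1 := (hE2.sampleMean hz (by norm_num)).neg.sub
      (OrdO.sum (s := Finset.univ) fun k _ => (hmean k).mul (hlam k))
    refine h1.congr ?_
    filter_upwards [e1, hz.eventually_ne] with x hx hN
    change sampleMean N X x (fun y => E (x, y)) = 1 at hx
    simp only [hsd, sampleMean_sub, sampleMean_add, sampleMean_const hN, hx, hts]
    ring
  have hdmean : ∀ j x, sampleMean N X x (fun y => γ j (x, y) * d (x, y)) =
      ∑ k, sampleMean N X x (fun y => γ j (x, y) * γ k (x, y)) * del x k := fun j x =>
    sampleMean_mul_combine _ _ _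
  have hdel1 : ∀ j, OrdO l (rate N) 1 (fun x => del x j) := fun j => (hlam j).sub (hmu j)
  -- inversion of the covariance matrix
  have hinv : ∀ {k : ℕ} {v : I → Fin m → ℝ},
      (∀ j, OrdO l (rate N) k (fun x => ∑ i, S j i * v x i)) →
      ∀ j, OrdO l (rate N) k (fun x => v x j) := fun hv j =>
    (OrdO.sum (s := Finset.univ) fun i _ => (hv i).const_mul (V j i)).congr
      (Eventually.of_forall fun x => (hV _ j).symm)
  have hSd : ∀ {k : ℕ} j, (∀ i, OrdO l (rate N) k (fun x => del x i)) →
      OrdO l (rate N) (k + 1) (fun x => sampleMean N X x (fun y => γ j (x, y) * d (x, y)) -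
        ∑ i, S j i * del x i) := fun {k} j hk => by
    refine (OrdO.sum (s := Finset.univ) fun i _ => (hk i).mul (hS j i)).congr
      (Eventually.of_forall fun x => ?_)
    rw [hdmean, ← Finset.sum_sub_distrib]
    exact Finset.sum_congr rfl fun i _ => by ring
  -- Subtracting `e3` from `e2` gives mean E(1 - T)γ = γ̄. To first order E(1 - T) is 1 + α + d, the
  -- terms T cancelling, so mean γd is of order n⁻¹, and the covariance matrix is inverted.
  have hdel2 : ∀ j, OrdO l (rate N) 2 (fun x => del x j) := by
    refine hinv fun j => ?_
    have h1 : OrdO l (rate N) 2 (fun x => sampleMean N X x (fun y => γ j (x, y) * d (x, y))) := by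
      have h2 := (((hα.mul (hmean j)).neg).sub
        ((hE2.mul (hγ j)).sampleMean hz (by norm_num))).add
        ((hE1.mul ((hγ j).mul hT)).sampleMean hz (by norm_num))
      refine h2.congr ?_
      filter_upwards [e2, e3] with x hx2 hx3
      have h3 := hx2 j
      have h4 := hx3 j
      change sampleMean N X x (fun y => E (x, y) * γ j (x, y)) = 0 at h3
      change sampleMean N X x (fun y => E (x, y) * T (x, y) * γ j (x, y)) = _ at h4
      have e : sampleMean N X x (fun y => γ j (x, y) * d (x, y)) =
          sampleMean N X x (fun y => E (x, y) * γ j (x, y)) -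
          sampleMean N X x (fun y => E (x, y) * T (x, y) * γ j (x, y)) -
          sampleMean N X x (fun y => γ j (x, y)) -
          α x * sampleMean N X x (fun y => γ j (x, y)) -
          sampleMean N X x (fun y => (E (x, y) - 1 - s (x, y)) * γ j (x, y)) +
          sampleMean N X x (fun y => (E (x, y) - 1) * (γ j (x, y) * T (x, y))) := by
        rw [← sampleMean_const_mul, ← sampleMean_sub, ← sampleMean_sub, ← sampleMean_sub,
          ← sampleMean_sub, ← sampleMean_add]
        refine sampleMean_congr fun i _ => ?_
        simp only [hsd, htTd]
        ring
      rw [e, h3, h4]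
      ring
    have h2 := h1.sub (hSd j hdel1)
    refine h2.congr (Eventually.of_forall fun x => ?_)
    ring
  have hd : SampleO l N X b 2 1 d := SampleO.combine hγ hdel2
  have hsT : SampleO l N X b 2 1 (fun z => s z - T z) := by
    refine (((SampleO.of_ordO hα2).mono hz le_rfl (by norm_num)).add hd).congr
      (Eventually.of_forall fun z => ?_)
    simp only [hsd, htTd]
    ring
  have hbil : ∀ {k k' : ℕ} {v w : I → Fin m → ℝ} (j : Fin m),
      (∀ i, OrdO l (rate N) k (fun x => v x i)) → (∀ i, OrdO l (rate N) k' (fun x => w x i)) →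
      OrdO l (rate N) (k + k' + 1) (fun x => sampleMean N X x (fun y => γ j (x, y) *
        (combine γ v (x, y) * combine γ w (x, y))) - ∑ i, ∑ r, H j i r * v x i * w x r) := by
    intro k k' v w j hv hw
    refine (OrdO.sum (s := Finset.univ) fun i _ => OrdO.sum (s := Finset.univ) fun r _ =>
      ((hv i).mul (hw r)).mul (hH j i r)).congr (Eventually.of_forall fun x => ?_)
    have e : sampleMean N X x (fun y => γ j (x, y) * (combine γ v (x, y) * combine γ w (x, y))) =
        ∑ i, ∑ r, sampleMean N X x (fun y => γ j (x, y) * (γ i (x, y) * γ r (x, y))) *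
          (v x i * w x r) := by
      simp only [← sampleMean_mul_const, ← sampleMean_sum]
      refine sampleMean_congr fun n _ => ?_
      rw [combine, combine, Finset.sum_mul_sum, Finset.mul_sum]
      refine Finset.sum_congr rfl fun i _ => ?_
      rw [Finset.mul_sum]
      exact Finset.sum_congr rfl fun r _ => by ring
    rw [e, ← Finset.sum_sub_distrib]
    refine Finset.sum_congr rfl fun i _ => ?_
    rw [← Finset.sum_sub_distrib]
    exact Finset.sum_congr rfl fun r _ => by ring
  have hST : ∀ j, OrdO l (rate N) 2 (fun x => sampleMean N X x (fun y => γ j (x, y) * T (x, y)) -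
      ∑ i, S j i * mu x i) := fun j => by
    refine (OrdO.sum (s := Finset.univ) fun i _ => (hmu i).mul (hS j i)).congr
      (Eventually.of_forall fun x => ?_)
    rw [hTd, sampleMean_mul_combine, ← Finset.sum_sub_distrib]
    exact Finset.sum_congr rfl fun i _ => by ring
  have hgT : ∀ j, OrdO l (rate N) 1 (fun x => sampleMean N X x (fun y => γ j (x, y) * T (x, y))) :=
    fun j => ((hγ j).mul hT).sampleMean hz (by norm_num)
  have hTT : OrdO l (rate N) 3 (fun x => sampleMean N X x (fun y => T (x, y) * T (x, y)) -
      ∑ k, ∑ i, S k i * mu x i * mu x k) := by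
    refine (OrdO.sum (s := Finset.univ) fun k _ => (hST k).mul (hmu k)).congr
      (Eventually.of_forall fun x => ?_)
    rw [hTd, sampleMean_mul_combine, ← Finset.sum_sub_distrib]
    refine Finset.sum_congr rfl fun k _ => ?_
    rw [sub_mul, Finset.sum_mul]
    congr 2
    exact sampleMean_congr fun i _ => mul_comm _ _
  have hsT1 : SampleO l N X b 1 1 (fun z => s z + T z) := hs.add hT
  -- By `e1` and `e2` the mean of Es - E + 1 is α, while pointwise it is s²/2 up to third order.
  -- Since s - T is of order n⁻¹, this yields α = μ'Sμ / 2.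
  have hα3 : OrdO l (rate N) 3 (fun x => α x - 1 / 2 * ∑ k, ∑ i, S k i * mu x i * mu x k) := by
    have h1 := (((((hE2.mul hs).sampleMean hz (by norm_num)).sub
      (hE3.sampleMean hz (by norm_num))).add
      (((hsT.mul hsT1).sampleMean hz (by norm_num)).const_mul (1 / 2)))).add
      (hTT.const_mul (1 / 2))
    refine h1.congr ?_
    filter_upwards [e1, e2] with x hx1 hx2
    change sampleMean N X x (fun y => E (x, y)) = 1 at hx1
    change ∀ j, sampleMean N X x (fun y => E (x, y) * γ j (x, y)) = 0 at hx2
    have h2 : sampleMean N X x (fun y => E (x, y) * t (x, y)) = 0 := by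
      rw [htd, sampleMean_mul_combine]
      exact Finset.sum_eq_zero fun k _ => by rw [hx2, zero_mul]
    have e : sampleMean N X x (fun y => (E (x, y) - 1 - s (x, y)) * s (x, y)) -
        sampleMean N X x (fun y => E (x, y) - 1 - s (x, y) - 1 / 2 * (s (x, y) * s (x, y))) +
        1 / 2 * sampleMean N X x (fun y => (s (x, y) - T (x, y)) * (s (x, y) + T (x, y))) +
        1 / 2 * sampleMean N X x (fun y => T (x, y) * T (x, y)) =
        α x * sampleMean N X x (fun y => E (x, y)) +
          sampleMean N X x (fun y => E (x, y) * t (x, y)) -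
          sampleMean N X x (fun y => E (x, y)) + sampleMean N X x (fun _ => 1) := by
      simp only [← sampleMean_const_mul, ← sampleMean_sub, ← sampleMean_add]
      refine sampleMean_congr fun i _ => ?_
      simp only [hsd]
      ring
    have hN : sampleMean N X x (fun _ => (1 : ℝ)) = 1 := by
      refine sampleMean_const (fun h0 => ?_) 1
      simp [sampleMean, h0] at hx1
    rw [hx1, h2, hN] at e
    linarith
  set Q : I → Fin m → ℝ := fun x c => ∑ k, ∑ r, H c k r * mu x k * mu x r with hQ
  -- The relation mean E(1 - T)γ = γ̄ one order further: the quadratic part s²/2 - sT is -T²/2 up to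
  -- smaller terms, so Sδ is half the quadratic form of the third moments `H`.
  have hdel3 : ∀ j, OrdO l (rate N) 3 (fun x => del x j - 1 / 2 * ∑ c, V j c * Q x c) := by
    have h0 : ∀ c, OrdO l (rate N) 3 (fun x => ∑ i, S c i * del x i - 1 / 2 * Q x c) := by
      intro c
      have h1 := (((((hα2.mul (hmean c)).neg.sub
        ((hE3.mul (hγ c)).sampleMean hz (by norm_num))).add
        ((hE2.mul ((hγ c).mul hT)).sampleMean hz (by norm_num))).sub
        ((((((hγ c).mul (hsT.mul hsT)).mono hz (k' := 3) (by norm_num) le_rfl).sampleMean hz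
          (by norm_num))).const_mul (1 / 2))).add
        ((hbil c hmu hmu).const_mul (1 / 2))).sub (hSd c hdel2)
      refine h1.congr ?_
      filter_upwards [e2, e3] with x hx2 hx3
      have h3 := hx2 c
      have h4 := hx3 c
      change sampleMean N X x (fun y => E (x, y) * γ c (x, y)) = 0 at h3
      change sampleMean N X x (fun y => E (x, y) * T (x, y) * γ c (x, y)) = _ at h4
      have e : sampleMean N X x (fun y => γ c (x, y) * d (x, y)) -
          1 / 2 * sampleMean N X x (fun y => γ c (x, y) * (T (x, y) * T (x, y))) =
          sampleMean N X x (fun y => E (x, y) * γ c (x, y)) -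
          sampleMean N X x (fun y => E (x, y) * T (x, y) * γ c (x, y)) -
          sampleMean N X x (fun y => γ c (x, y)) -
          α x * sampleMean N X x (fun y => γ c (x, y)) -
          sampleMean N X x (fun y => (E (x, y) - 1 - s (x, y) - 1 / 2 * (s (x, y) * s (x, y))) *
            γ c (x, y)) +
          sampleMean N X x (fun y => (E (x, y) - 1 - s (x, y)) * (γ c (x, y) * T (x, y))) -
          1 / 2 * sampleMean N X x (fun y => γ c (x, y) *
            ((s (x, y) - T (x, y)) * (s (x, y) - T (x, y)))) := by
        simp only [← sampleMean_const_mul, ← sampleMean_sub, ← sampleMean_add]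
        refine sampleMean_congr fun i _ => ?_
        simp only [hsd, htTd]
        ring
      rw [h3, h4] at e
      simp only [hQ]
      linarith
    intro j
    refine (OrdO.sum (s := Finset.univ) fun c _ => (h0 c).const_mul (V j c)).congr
      (Eventually.of_forall fun x => ?_)
    simp only [mul_sub, Finset.sum_sub_distrib]
    rw [← hV, Finset.mul_sum]
    congr 1
    exact Finset.sum_congr rfl fun c _ => by ring
  constructor
  · intro j
    set q : I → ℝ := fun x => ∑ k, ∑ i, S k i * mu x i * mu x k with hq
    have hq2 : OrdO l (rate N) 2 q :=
      OrdO.sum (s := Finset.univ) fun k _ => OrdO.sum (s := Finset.univ) fun i _ =>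
        (((hmu i).const_mul (S k i)).mul (hmu k))
    have h1 := (((((hE3.mul (hT.mul (hγ j))).sampleMean hz (by norm_num)).add
      ((((hγ j).mul (hT.mul (hsT.mul hsT1))).sampleMean hz (by norm_num)).const_mul (1 / 2))).add
      (hbil j hmu hdel2)).add ((hα3.mul (hgT j)).add ((hq2.mul (hST j)).const_mul (1 / 2)))).add
      (OrdO.sum (s := Finset.univ) fun k _ => OrdO.sum (s := Finset.univ) fun a _ =>
        ((hmu k).mul (hdel3 a)).const_mul (H j k a))
    refine h1.neg.congr ?_
    filter_upwards [e3] with x hx3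
    have h4 := hx3 j
    change sampleMean N X x (fun y => E (x, y) * T (x, y) * γ j (x, y)) = _ at h4
    -- By `e3`, γ̄ + mean ETγ = 0. Expanding ET = T + αT + T² + Td + T³/2 and inserting the leading
    -- terms of α and δ yields the truncated row with τ = 1/2 and the two cubic terms of
    -- `cubicCoef`.
    have e : sampleMean N X x (fun y => γ j (x, y) * (1 + (T (x, y) + (T (x, y) * T (x, y) +
        1 / 2 * (T (x, y) * (T (x, y) * T (x, y))))))) =
        sampleMean N X x (fun y => γ j (x, y)) +
        sampleMean N X x (fun y => E (x, y) * T (x, y) * γ j (x, y)) -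
        α x * sampleMean N X x (fun y => γ j (x, y) * T (x, y)) -
        sampleMean N X x (fun y => γ j (x, y) * (T (x, y) * d (x, y))) -
        1 / 2 * sampleMean N X x (fun y => γ j (x, y) * (T (x, y) *
          ((s (x, y) - T (x, y)) * (s (x, y) + T (x, y))))) -
        sampleMean N X x (fun y => (E (x, y) - 1 - s (x, y) - 1 / 2 * (s (x, y) * s (x, y))) *
          (T (x, y) * γ j (x, y))) := by
      simp only [← sampleMean_const_mul, ← sampleMean_sub, ← sampleMean_add]
      refine sampleMean_congr fun i _ => ?_
      simp only [hsd, htTd]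
      ring
    have eC : ∑ k, ∑ r, ∑ s, cubicCoef S V H j k r s * mu x k * mu x r * mu x s =
        1 / 2 * (q x * ∑ i, S j i * mu x i) +
          ∑ k, ∑ a, H j k a * (mu x k * (1 / 2 * ∑ c, V a c * Q x c)) := by
      simp only [cubicCoef, add_mul, Finset.sum_add_distrib]
      congr 1
      · rw [mul_comm (q x), Finset.sum_mul, Finset.mul_sum]
        refine Finset.sum_congr rfl fun k _ => ?_
        simp only [hq, Finset.mul_sum]
        exact Finset.sum_congr rfl fun r _ => Finset.sum_congr rfl fun s _ => by ring
      · refine Finset.sum_congr rfl fun k _ => ?_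
        simp only [hQ, Finset.mul_sum, Finset.sum_mul]
        rw [Finset.sum_congr rfl fun r _ => Finset.sum_comm, Finset.sum_comm]
        refine Finset.sum_congr rfl fun a _ => ?_
        rw [Finset.sum_congr rfl fun r _ => Finset.sum_comm, Finset.sum_comm]
        exact Finset.sum_congr rfl fun c _ => Finset.sum_congr rfl fun r _ =>
          Finset.sum_congr rfl fun s _ => by ring
    have eD : ∑ k, ∑ a, H j k a * (mu x k * (del x a - 1 / 2 * ∑ c, V a c * Q x c)) =
        ∑ k, ∑ a, H j k a * mu x k * del x a -
          ∑ k, ∑ a, H j k a * (mu x k * (1 / 2 * ∑ c, V a c * Q x c)) := by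
      simp only [mul_sub, Finset.sum_sub_distrib, mul_assoc]
    rw [e, h4, eC, eD]
    ring
  · intro a
    have hAm : SampleO l N X b 1 1 (combine (φ a) mu) := SampleO.combine (hφ a) hmu
    have hAd : SampleO l N X b 2 1 (combine (φ a) del) := SampleO.combine (hφ a) hdel2
    have hA : ∀ z, combine (φ a) lam z = combine (φ a) mu z + combine (φ a) del z := fun z => by
      simp only [combine, hdel, sub_mul, Finset.sum_sub_distrib]
      ring
    -- With A = μ'φ and D = δ'φ the integrand of `e4` is -A(1 + ET) + D(E - 1 - ET). In the last
    -- bracket the first order cancels, so that product is O(n⁻²). Since A and T are each of order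
    -- n^(-1/2), E is needed in AT·E only up to its linear term; hence no cubic correction arises in
    -- the parameter rows.
    have hsT2 := hsT.mono hz le_rfl (j' := 2) (by norm_num)
    have h2 := (hE2.add hsT2).sub (hE1.mul hT)
    have h3 := (hE2.add hsT2).sub ((hT.mul hT).const_mul (1 / 2))
    have h1 := ((hAd.mul h2).sampleMean hz (by norm_num)).sub
      ((hAm.mul (hT.mul h3)).sampleMean hz (by norm_num))
    refine h1.congr ?_
    filter_upwards [e4] with x hx
    have h5 := hx a
    change sampleMean N X x (fun y => E (x, y) * (combine (φ a) lam (x, y) -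
      combine (φ a) mu (x, y)) - combine (φ a) lam (x, y) - E (x, y) * combine (φ a) lam (x, y) *
        T (x, y)) = 0 at h5
    rw [← sub_zero (sampleMean N X x _ - _), ← h5, ← sampleMean_sub, ← sampleMean_sub]
    refine sampleMean_congr fun i _ => ?_
    simp only [hA]
    ring

end Reduction

/-! ### Expansions of the two estimators along a regime -/

section Link

variable {I 𝒳 : Type*} {m p : ℕ} {l : Filter I} {N : I → ℕ} {X : I → ℕ → 𝒳} {b : 𝒳 → ℝ}
  {g : 𝒳 → EuclideanSpace ℝ (Fin p) → EuclideanSpace ℝ (Fin m)}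
  {Θ : Set (EuclideanSpace ℝ (Fin p))} {θs : EuclideanSpace ℝ (Fin p)} {r : ℝ}
  {S : Matrix (Fin m) (Fin m) ℝ} {Γ : Matrix (Fin m) (Fin p) ℝ} {D : 𝒳 → ℝ}
  {θ : I → EuclideanSpace ℝ (Fin p)}

/-- The parameter displacement and the multiplier as one vector. -/
def joinVec (θ θs : EuclideanSpace ℝ (Fin p)) (v : Fin m → ℝ) : Fin p ⊕ Fin m → ℝ
  | .inl a => θ a - θs a
  | .inr j => v j

lemma add_thetaPart_joinVec (θ θs : EuclideanSpace ℝ (Fin p)) (v : Fin m → ℝ) :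
    θs + thetaPart (joinVec θ θs v) = θ := by
  ext a
  simp [joinVec]

/-- Cubic coefficients in the multiplier, as cubic coefficients in all variables. -/
def liftCoef (c : Fin m → Fin m → Fin m → Fin m → ℝ) (i j k r : Fin p ⊕ Fin m) : ℝ :=
  match i, j, k, r with
  | .inr i, .inr j, .inr k, .inr r => c i j k r
  | _, _, _, _ => 0

lemma sum_liftCoef_inl (c : Fin m → Fin m → Fin m → Fin m → ℝ) (a : Fin p)
    (β : Fin p ⊕ Fin m → ℝ) :
    ∑ k, ∑ r, ∑ s, liftCoef c (.inl a) k r s * (β k * β r * β s) = 0 := by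
  simp [liftCoef]

lemma sum_liftCoef_inr (c : Fin m → Fin m → Fin m → Fin m → ℝ) (j : Fin m)
    (β : Fin p ⊕ Fin m → ℝ) :
    ∑ k, ∑ r, ∑ s, liftCoef c (.inr j) k r s * (β k * β r * β s) =
      ∑ k, ∑ r, ∑ s, c j k r s * β (.inr k) * β (.inr r) * β (.inr s) := by
  simp [liftCoef, Fintype.sum_sum_type, mul_assoc]

namespace MomentRegime

lemma sampleO_g_sub (h : MomentRegime l N X b g Θ θs r S Γ D) (hθ : Tendsto θ l (𝓝 θs))
    (hu : ∀ a, OrdO l (rate N) 1 (fun x => θ x a - θs a)) (j : Fin m) :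
    SampleO l N X b 1 1 (fun z => g z.2 (θ z.1) j - g z.2 θs j) := by
  have h1 : OrdO l (rate N) 1 (fun x => ∑ a, |θ x a - θs a|) :=
    OrdO.sum fun a _ => IsBigO.norm_left (hu a)
  have h2 := (SampleO.of_ordO (X := X) (b := b) h1).mul h.sampleO_b
  refine IsBigO.trans (IsBigO.of_bound 1 ?_) h2
  rw [eventually_sampleFilter_iff]
  filter_upwards [h.smooth, h.eventually_mem_ball hθ] with x hx hθx i hi
  have hb := h.toSampleZone.pos (X x i)
  have hsum := norm_le_sum_abs (θ x - θs)
  rw [one_mul, Real.norm_of_nonneg (mul_nonneg (Finset.sum_nonneg fun a _ => abs_nonneg _) hb.le)]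
  calc ‖g (X x i) (θ x) j - g (X x i) θs j‖ ≤ ‖g (X x i) (θ x) - g (X x i) θs‖ :=
        PiLp.norm_apply_le (g (X x i) (θ x) - g (X x i) θs) j
    _ ≤ b (X x i) * ‖θ x - θs‖ :=
        (hx i hi).norm_sub_le hθx (Metric.mem_ball_self h.pos_radius)
    _ ≤ b (X x i) * ∑ a, |θ x a - θs a| := by gcongr; exact hsum
    _ = _ := mul_comm _ _

lemma ordO_cov (h : MomentRegime l N X b g Θ θs r S Γ D) (hθ : Tendsto θ l (𝓝 θs))
    (hu : ∀ a, OrdO l (rate N) 1 (fun x => θ x a - θs a)) (j k : Fin m) :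
    OrdO l (rate N) 1 (fun x => sampleMean N X x (fun y => g y (θ x) j * g y (θ x) k) - S j k) := by
  have hg0 := fun j => h.sampleO_g (θ := fun _ => θs) tendsto_const_nhds j
  have h1 := ((h.sampleO_g_sub hθ hu j).mul (h.sampleO_g hθ k)).add
    ((hg0 j).mul (h.sampleO_g_sub hθ hu k))
  refine ((h1.sampleMean h.toSampleZone (by norm_num)).add (h.cov j k)).congr
    (Eventually.of_forall fun x => ?_)
  rw [← add_sub_assoc, ← sampleMean_add]
  congr 1
  exact sampleMean_congr fun i _ => by ring

/-- Moving the argument from `θs` to the estimate changes one factor at a time by O(n^(-1/2) b). The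
reduction of the ETEL equations works with moments at the estimate, while the limits concern `θs`.
-/
lemma ordO_third (h : MomentRegime l N X b g Θ θs r S Γ D) (hθ : Tendsto θ l (𝓝 θs))
    (hu : ∀ a, OrdO l (rate N) 1 (fun x => θ x a - θs a)) {H : Fin m → Fin m → Fin m → ℝ}
    (hH : ∀ j k s, OrdO l (rate N) 1 (fun x => sampleMean N X x
      (fun y => g y θs j * (g y θs k * g y θs s)) - H j k s)) (j k s : Fin m) :
    OrdO l (rate N) 1 (fun x => sampleMean N X x
      (fun y => g y (θ x) j * (g y (θ x) k * g y (θ x) s)) - H j k s) := by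
  have hg0 := fun j => h.sampleO_g (θ := fun _ => θs) tendsto_const_nhds j
  have h1 := (((h.sampleO_g_sub hθ hu j).mul ((h.sampleO_g hθ k).mul (h.sampleO_g hθ s))).add
    ((hg0 j).mul ((h.sampleO_g_sub hθ hu k).mul (h.sampleO_g hθ s)))).add
    ((hg0 j).mul ((hg0 k).mul (h.sampleO_g_sub hθ hu s)))
  refine ((h1.sampleMean h.toSampleZone (by norm_num)).add (hH j k s)).congr
    (Eventually.of_forall fun x => ?_)
  rw [← add_sub_assoc, ← sampleMean_add]
  congr 1
  exact sampleMean_congr fun i _ => by ring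

lemma ordO_joinVec {v : I → Fin m → ℝ} (hu : ∀ a, OrdO l (rate N) 1 (fun x => θ x a - θs a))
    (hv : ∀ j, OrdO l (rate N) 1 (fun x => v x j)) (i : Fin p ⊕ Fin m) :
    OrdO l (rate N) 1 (fun x => joinVec (θ x) θs (v x) i) := by
  rcases i with a | j
  · exact hu a
  · exact hv j

/-- The polynomial estimating equations of the EL estimator. -/
lemma EL_equations (h : MomentRegime l N X b g Θ θs r S Γ D)
    (hest : ∀ᶠ x in l, IsELEstimate g Θ (fun i : Fin (N x) => X x i) (θ x)) :
    ∃ β : I → Fin p ⊕ Fin m → ℝ, (∀ x a, β x (.inl a) = θ x a - θs a) ∧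
      (∀ i, OrdO l (rate N) 1 (fun x => β x i)) ∧
      ∀ i, OrdO l (rate N) 4 (fun x => sampleMean N X x (fun y => rowFun (g y) θs 1 i (β x)) +
        ∑ k, ∑ r, ∑ s, liftCoef 0 i k r s * (β x k * β x r * β x s)) := by
  obtain ⟨hθ, hu, lam, hlam, e1, e2⟩ := h.exists_EL_multiplier hest
  refine ⟨fun x => joinVec (θ x) θs (lam x), fun x a => rfl, ordO_joinVec hu hlam, fun i => ?_⟩
  have htilt : ∀ x y, tilt (g y) θs (joinVec (θ x) θs (lam x)) =
      combine (fun j (z : I × 𝒳) => g z.2 (θ z.1) j) (fun x j => lam x j) (x, y) := fun x y => by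
    rw [tilt, add_thetaPart_joinVec]
    rfl
  have hin : ∀ x y, ⟪lam x, g y (θ x)⟫_ℝ =
      combine (fun j (z : I × 𝒳) => g z.2 (θ z.1) j) (fun x j => lam x j) (x, y) := fun x y => by
    rw [inner_eq_sum]
    rfl
  simp only [hin] at e1 e2
  rcases i with a | j
  · simp only [sum_liftCoef_inl, add_zero, rowFun, htilt, add_thetaPart_joinVec]
    refine ordO_polynomial_EL h.toSampleZone (fun j => h.sampleO_g hθ j) hlam
      (f := fun z => ∑ j, lam z.1 j * fderiv ℝ (g z.2) (θ z.1) (EuclideanSpace.single a 1) j)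
      ?_ ?_
    · refine SampleO.sum fun j _ => ?_
      have := (SampleO.of_ordO (X := X) (b := b) (hlam j)).mul (h.sampleO_deriv hθ a j)
      exact this.mono h.toSampleZone (by norm_num) le_rfl
    · filter_upwards [e2] with x hx
      simpa only [inner_eq_sum] using hx a
  · simp only [sum_liftCoef_inr, Pi.zero_apply, zero_mul, Finset.sum_const_zero, add_zero, rowFun,
      htilt, add_thetaPart_joinVec]
    exact ordO_polynomial_EL h.toSampleZone (fun j => h.sampleO_g hθ j) hlam
      (f := fun z => g z.2 (θ z.1) j) (h.sampleO_g hθ j) (e1.mono fun x hx => hx j)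

/-- The polynomial estimating equations of the ETEL estimator. -/
lemma ETEL_equations (h : MomentRegime l N X b g Θ θs r S Γ D)
    (hest : ∀ᶠ x in l, IsETELEstimate g Θ (fun i : Fin (N x) => X x i) (θ x))
    {V : Fin m → Fin m → ℝ} {H : Fin m → Fin m → Fin m → ℝ}
    (hV : ∀ v : Fin m → ℝ, ∀ k, v k = ∑ j, V k j * ∑ i, S j i * v i)
    (hH : ∀ j k s, OrdO l (rate N) 1 (fun x => sampleMean N X x
      (fun y => g y θs j * (g y θs k * g y θs s)) - H j k s)) :
    ∃ β : I → Fin p ⊕ Fin m → ℝ, (∀ x a, β x (.inl a) = θ x a - θs a) ∧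
      (∀ i, OrdO l (rate N) 1 (fun x => β x i)) ∧
      ∀ i, OrdO l (rate N) 4 (fun x => sampleMean N X x
        (fun y => rowFun (g y) θs (1 / 2) i (β x)) +
        ∑ k, ∑ r, ∑ s, liftCoef (cubicCoef S V H) i k r s * (β x k * β x r * β x s)) := by
  obtain ⟨hθ, hu, α, lam, kap, hα, hlam, hkap, e1, e2, e3, e4⟩ := h.exists_ETEL_multiplier hest
  -- The counterpart of the EL multiplier is -κ and not the tilting parameter λ.
  set mu : I → Fin m → ℝ := fun x j => -kap x j with hmud
  have hmu : ∀ j, OrdO l (rate N) 1 (fun x => mu x j) := fun j => (hkap j).neg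
  refine ⟨fun x => joinVec (θ x) θs (mu x), fun x a => rfl, ordO_joinVec hu hmu, fun i => ?_⟩
  set γ : Fin m → I × 𝒳 → ℝ := fun j z => g z.2 (θ z.1) j with hγ
  set φ : Fin p → Fin m → I × 𝒳 → ℝ := fun a j z =>
    fderiv ℝ (g z.2) (θ z.1) (EuclideanSpace.single a 1) j with hφ
  have htilt : ∀ x y, tilt (g y) θs (joinVec (θ x) θs (mu x)) = combine γ mu (x, y) :=
    fun x y => by
      rw [tilt, add_thetaPart_joinVec]
      rfl
  have hlin : ∀ x y, ⟪lam x, g y (θ x)⟫_ℝ = combine γ (fun x j => lam x j) (x, y) := fun x y => by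
    rw [inner_eq_sum]
    rfl
  have hkin : ∀ x y, ⟪kap x, g y (θ x)⟫_ℝ = -combine γ mu (x, y) := fun x y => by
    simp [inner_eq_sum, combine, hmud, hγ]
  have hlφ : ∀ x y a, ⟪lam x, fderiv ℝ (g y) (θ x) (EuclideanSpace.single a 1)⟫_ℝ =
      combine (φ a) (fun x j => lam x j) (x, y) := fun x y a => by
    rw [inner_eq_sum]
    rfl
  have hkφ : ∀ x y a, ⟪kap x, fderiv ℝ (g y) (θ x) (EuclideanSpace.single a 1)⟫_ℝ =
      -combine (φ a) mu (x, y) := fun x y a => by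
    simp [inner_eq_sum, combine, hmud, hφ]
  simp only [hlin, hkin, inner_add_left, hlφ, hkφ] at e1 e2 e3 e4
  have main := ordO_polynomial_ETEL (γ := γ) (φ := φ) h.toSampleZone (fun j => h.sampleO_g hθ j)
    (fun a j => h.sampleO_deriv hθ a j) hα hlam hmu (S := S) (V := V) (H := H)
    (h.ordO_cov hθ hu) (h.ordO_third hθ hu hH) hV e1 e2
    (by
      filter_upwards [e3] with x hx j
      rw [← hx j, ← neg_one_mul, ← sampleMean_const_mul]
      exact sampleMean_congr fun i _ => by ring)
    (by
      filter_upwards [e4] with x hx a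
      rw [← hx a]
      exact sampleMean_congr fun i _ => by ring)
  rcases i with a | j
  · simp only [sum_liftCoef_inl, add_zero, rowFun, htilt, add_thetaPart_joinVec]
    exact main.2 a
  · simp only [sum_liftCoef_inr, rowFun, htilt, add_thetaPart_joinVec]
    exact main.1 j

end MomentRegime

/-- The expansion of a solution of polynomial estimating equations. -/
lemma MomentRegime.expansion (h : MomentRegime l N X b g Θ θs r S Γ D) {τ : ℝ} (hτ : |τ| ≤ 1)
    {C : Fin p ⊕ Fin m → Fin p ⊕ Fin m → Fin p ⊕ Fin m → Fin p ⊕ Fin m → ℝ}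
    {β : I → Fin p ⊕ Fin m → ℝ} (hβ : ∀ i, OrdO l (rate N) 1 (fun x => β x i))
    (heq : ∀ i, OrdO l (rate N) 4 (fun x => sampleMean N X x
        (fun y => rowFun (g y) θs τ i (β x)) +
        ∑ k, ∑ r, ∑ s, C i k r s * (β x k * β x r * β x s)))
    {A M : Fin p ⊕ Fin m → Fin p ⊕ Fin m → ℝ}
    {m2 : Fin p ⊕ Fin m → Fin p ⊕ Fin m → Fin p ⊕ Fin m → ℝ}
    {m3 : Fin p ⊕ Fin m → Fin p ⊕ Fin m → Fin p ⊕ Fin m → Fin p ⊕ Fin m → ℝ}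
    (hA : ∀ i k, ∑ j, A i j * M j k = if i = k then 1 else 0)
    (h0 : ∀ i, OrdO l (rate N) 1 (fun x => sampleMean N X x fun y => (rowJet (g y) θs τ i).c0))
    (h1 : ∀ i j, OrdO l (rate N) 1
      (fun x => sampleMean N X x (fun y => (rowJet (g y) θs τ i).c1 j) - M i j))
    (h2 : ∀ i j k, OrdO l (rate N) 1
      (fun x => sampleMean N X x (fun y => (rowJet (g y) θs τ i).c2 j k) - m2 i j k))
    (h3 : ∀ i j k r, OrdO l (rate N) 0
      (fun x => sampleMean N X x (fun y => (rowJet (g y) θs τ i).c3 j k r) - m3 i j k r))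
    (i : Fin p ⊕ Fin m) :
    OrdO l (rate N) 4 (fun x => β x i -
      (solOne A (fun i => sampleMean N X x fun y => (rowJet (g y) θs τ i).c0) i +
      solTwo A m2 (fun i => sampleMean N X x fun y => (rowJet (g y) θs τ i).c0)
        (fun i j => sampleMean N X x (fun y => (rowJet (g y) θs τ i).c1 j) - M i j) i +
      solThree A m2 (fun i j k r => m3 i j k r + C i j k r)
        (fun i => sampleMean N X x fun y => (rowJet (g y) θs τ i).c0)
        (fun i j => sampleMean N X x (fun y => (rowJet (g y) θs τ i).c1 j) - M i j)
        (fun i j k => sampleMean N X x (fun y => (rowJet (g y) θs τ i).c2 j k) - m2 i j k) i) +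
      ∑ j, A i j * ∑ k, ∑ r, ∑ s, (sampleMean N X x (fun y => (rowJet (g y) θs τ j).c3 k r s) -
        m3 j k r s) * (β x k * β x r * β x s)) := by
  obtain ⟨K, -, hK⟩ := exists_hasJet_row m p
  refine expansion_of_estimating_equations h.tendsto_rate hA hβ h0 h1 h2 h3 (fun j => ?_) i
  have hjet : ∀ᶠ x in l, ∀ i < N x, HasJet (rowFun (g (X x i)) θs τ j) (rowJet (g (X x i)) θs τ j)
      (b (X x i)) (K * b (X x i)) := by
    filter_upwards [h.smooth] with x hx i hi
    exact hK _ _ _ _ _ (hx i hi) (h.one_le _) (h.large _) hτ j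
  have h4 := sampleMean_sub_eval h.toSampleZone (f := fun y => rowFun (g y) θs τ j)
    (c := fun y => rowJet (g y) θs τ j) hjet hβ
  refine ((heq j).sub h4).congr (Eventually.of_forall fun x => ?_)
  simp only [Jet.eval, Jet.part1, Jet.part2, Jet.part3, sampleMean_add, sampleMean_sum,
    sampleMean_mul_const]
  simp only [add_sub_cancel, mul_assoc]
  have e : ∀ k r s, (m3 j k r s + C j k r s +
      (sampleMean N X x (fun y => (rowJet (g y) θs τ j).c3 k r s) - m3 j k r s)) =
      sampleMean N X x (fun y => (rowJet (g y) θs τ j).c3 k r s) + C j k r s := fun k r s => by ring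
  simp only [e, add_mul, Finset.sum_add_distrib]
  ring

end Link

/-! ### Consequences of the regularity conditions -/

section Separation

variable {Ω 𝒳 : Type*} [MeasurableSpace Ω] [MeasurableSpace 𝒳] {m p : ℕ}
  {μ : Measure Ω} [IsProbabilityMeasure μ] {P : Measure 𝒳} {x : ℕ → Ω → 𝒳}
  {g : 𝒳 → EuclideanSpace ℝ (Fin p) → EuclideanSpace ℝ (Fin m)}
  {Θ : Set (EuclideanSpace ℝ (Fin p))} {θs : EuclideanSpace ℝ (Fin p)}

lemma isProbabilityMeasure_of_hasLaw {X : Ω → 𝒳} (h : HasLaw X P μ) : IsProbabilityMeasure P := by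
  rw [← h.map_eq]
  exact Measure.isProbabilityMeasure_map h.aemeasurable

namespace RegularityConditions

lemma isProbabilityMeasure (h : RegularityConditions μ P x g Θ θs) : IsProbabilityMeasure P :=
  isProbabilityMeasure_of_hasLaw (h.law 0)

/-- The moment functions are dominated in `L²`. -/
lemma exists_dom (h : RegularityConditions μ P x g Θ θs) : ∃ D : 𝒳 → ℝ, Integrable D P ∧
    ∀ᵐ y ∂P, ∀ θ ∈ Θ, ‖g y θ‖ ^ 2 ≤ D y ∧ ‖g y θ‖ ≤ D y := by
  have := h.isProbabilityMeasure
  obtain ⟨δ, hδ, d, hd, hb⟩ := h.moment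
  refine ⟨fun y => 1 + d y, (integrable_const _).add hd, ?_⟩
  filter_upwards [hb] with y hy θ hθ
  have h1 := hy θ hθ
  have h0 : 0 ≤ ‖g y θ‖ ^ (2 + δ) := by positivity
  rcases le_total ‖g y θ‖ 1 with h2 | h2
  · have := norm_nonneg (g y θ)
    constructor <;> nlinarith
  · have h3 : ‖g y θ‖ ^ (2 : ℝ) ≤ ‖g y θ‖ ^ (2 + δ) :=
      Real.rpow_le_rpow_of_exponent_le h2 (by linarith)
    rw [Real.rpow_two] at h3
    constructor <;> nlinarith

lemma integrable_moment (h : RegularityConditions μ P x g Θ θs) {θ : EuclideanSpace ℝ (Fin p)}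
    (hθ : θ ∈ Θ) : Integrable (fun y => g y θ) P := by
  obtain ⟨D, hD, hb⟩ := h.exists_dom
  refine hD.mono' (h.measurable θ hθ).aestronglyMeasurable ?_
  filter_upwards [hb] with y hy using (hy θ hθ).2

lemma integrable_coord (h : RegularityConditions μ P x g Θ θs) {θ : EuclideanSpace ℝ (Fin p)}
    (hθ : θ ∈ Θ) (j : Fin m) : Integrable (fun y => g y θ j) P :=
  (EuclideanSpace.proj (𝕜 := ℝ) j).integrable_comp (h.integrable_moment hθ)

lemma integral_coord (h : RegularityConditions μ P x g Θ θs) {θ : EuclideanSpace ℝ (Fin p)}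
    (hθ : θ ∈ Θ) (j : Fin m) : (∫ y, g y θ ∂P) j = ∫ y, g y θ j ∂P :=
  ((EuclideanSpace.proj (𝕜 := ℝ) j).integral_comp_comm (h.integrable_moment hθ)).symm

/-- The oscillation of the moment function near a parameter has a small mean. -/
lemma exists_osc (h : RegularityConditions μ P x g Θ θs) {θ0 : EuclideanSpace ℝ (Fin p)}
    (hθ0 : θ0 ∈ Θ) {η : ℝ} (hη : 0 < η) :
    ∃ r > 0, ∃ o : 𝒳 → ℝ, Integrable o P ∧ ∫ y, o y ∂P < η ∧
      ∀ᵐ y ∂P, ∀ θ ∈ Θ, θ ∈ Metric.ball θ0 r → ‖g y θ - g y θ0‖ ≤ o y := by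
  obtain ⟨D, hD, hb⟩ := h.exists_dom
  -- The oscillations over shrinking balls tend to zero a.e. by continuity at `θ0` and are dominated
  -- by 2D, so their means tend to zero.
  set F : ℕ → 𝒳 → ℝ≥0∞ := fun n y =>
    ⨆ θ' ∈ Θ ∩ Metric.ball θ0 (1 / ((n : ℝ) + 1)), ‖g y θ' - g y θ0‖ₑ with hF
  have hbound : ∀ n, ∀ᵐ y ∂P, F n y ≤ ENNReal.ofReal (2 * D y) := fun n => by
    filter_upwards [hb] with y hy
    refine iSup₂_le fun θ hθ => ?_
    rw [← ofReal_norm]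
    refine ENNReal.ofReal_le_ofReal ((norm_sub_le _ _).trans ?_)
    linarith [(hy θ hθ.1).2, (hy θ0 hθ0).2]
  have hfin : ∫⁻ y, ENNReal.ofReal (2 * D y) ∂P ≠ ∞ :=
    ((hD.const_mul 2).lintegral_lt_top).ne
  have hlim : ∀ᵐ y ∂P, Tendsto (fun n => F n y) atTop (𝓝 0) := by
    filter_upwards [h.continuous θ0 hθ0] with y hy
    rw [ENNReal.tendsto_nhds_zero]
    intro ε hε
    have h1 : Tendsto (fun θ => ‖g y θ - g y θ0‖ₑ) (𝓝[Θ] θ0) (𝓝 0) := by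
      have := (hy.tendsto.sub_const (g y θ0)).enorm
      simpa using this
    obtain ⟨δ, hδ, hsub⟩ := Metric.mem_nhdsWithin_iff.1 (h1.eventually (ge_mem_nhds hε))
    have h2 : ∀ᶠ n : ℕ in atTop, 1 / ((n : ℝ) + 1) < δ :=
      tendsto_one_div_add_atTop_nhds_zero_nat.eventually_lt_const hδ
    filter_upwards [h2] with n hn
    exact iSup₂_le fun θ hθ => hsub ⟨Metric.ball_subset_ball hn.le hθ.2, hθ.1⟩
  have hconv := tendsto_lintegral_of_dominated_convergence' (μ := P) (F := F) (f := fun _ => 0)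
    (fun y => ENNReal.ofReal (2 * D y)) (fun n => h.measurable_osc θ0 hθ0 _ (by positivity))
    hbound hfin hlim
  rw [lintegral_zero] at hconv
  obtain ⟨n, hn⟩ := (hconv.eventually_lt_const (ENNReal.ofReal_pos.2 hη)).exists
  have hFfin : ∀ᵐ y ∂P, F n y ≠ ∞ := by
    filter_upwards [hbound n] with y hy using (hy.trans_lt ENNReal.ofReal_lt_top).ne
  have hFm : AEMeasurable (F n) P := h.measurable_osc θ0 hθ0 _ (by positivity)
  refine ⟨1 / ((n : ℝ) + 1), by positivity, fun y => (F n y).toReal, ?_, ?_, ?_⟩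
  · exact integrable_toReal_of_lintegral_ne_top hFm (hn.trans ENNReal.ofReal_lt_top).ne
  · rw [integral_toReal hFm (hFfin.mono fun y hy => hy.lt_top)]
    exact (ENNReal.lt_ofReal_iff_toReal_lt (hn.trans ENNReal.ofReal_lt_top).ne).1 hn
  · filter_upwards [hFfin] with y hy θ hθ hball
    have h3 : ‖g y θ - g y θ0‖ₑ ≤ F n y := le_iSup₂_of_le θ ⟨hθ, hball⟩ le_rfl
    have h4 := ENNReal.toReal_mono hy h3
    simpa using h4

/-- Away from `θs` the sample moments are bounded away from zero, uniformly in the parameter. -/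
lemma separation (h : RegularityConditions μ P x g Θ θs) {ρ : ℝ} (hρ : 0 < ρ) :
    ∃ η > 0, ∀ᶠ z in whp μ, ∀ θ ∈ Θ, ρ ≤ ‖θ - θs‖ →
      ∃ j, η ≤ |empMean x z fun y => g y θ j| := by
  set K := Θ \ Metric.ball θs ρ with hK
  have hKc : IsCompact K := h.compact.diff Metric.isOpen_ball
  have key : ∃ η > 0, ∀ᶠ z in whp μ, ∀ θ ∈ K, θ ∈ Θ →
      ∃ j, η ≤ |empMean x z fun y => g y θ j| := by
    -- Wald's compactness argument: the property passes to subsets and finite unions, so it is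
    -- enough to have it near each point. There a population moment of modulus η loses at most η/4
    -- to sampling error and η/4 to the oscillation.
    refine hKc.induction_on (p := fun s => ∃ η > 0, ∀ᶠ z in whp μ, ∀ θ ∈ s, θ ∈ Θ →
      ∃ j, η ≤ |empMean x z fun y => g y θ j|) ⟨1, one_pos, by simp⟩ ?_ ?_ ?_
    · rintro s t hst ⟨η, hη, ht⟩
      exact ⟨η, hη, ht.mono fun z hz θ hθ => hz θ (hst hθ)⟩
    · rintro s t ⟨η, hη, hs⟩ ⟨η', hη', ht⟩
      refine ⟨min η η', lt_min hη hη', ?_⟩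
      filter_upwards [hs, ht] with z hz hz' θ hθ hΘ
      rcases hθ with hθ | hθ
      · obtain ⟨j, hj⟩ := hz θ hθ hΘ
        exact ⟨j, (min_le_left _ _).trans hj⟩
      · obtain ⟨j, hj⟩ := hz' θ hθ hΘ
        exact ⟨j, (min_le_right _ _).trans hj⟩
    · intro θ0 hθ0
      have hΘ0 : θ0 ∈ Θ := hθ0.1
      have hne : ∫ y, g y θ0 ∂P ≠ 0 := fun h0 => by
        have := (h.unique_solution θ0 hΘ0).1 h0
        exact hθ0.2 (this ▸ Metric.mem_ball_self hρ)
      obtain ⟨j, hj⟩ : ∃ j, ∫ y, g y θ0 j ∂P ≠ 0 := by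
        by_contra! hall
        refine hne (PiLp.ext fun j => ?_)
        rw [h.integral_coord hΘ0, hall]
        rfl
      set η := |∫ y, g y θ0 j ∂P| with hη
      have hη0 : 0 < η := abs_pos.2 hj
      obtain ⟨r, hr, o, ho, hoi, hob⟩ := h.exists_osc hΘ0 (by positivity : 0 < η / 4)
      refine ⟨Metric.ball θ0 r, mem_nhdsWithin_of_mem_nhds (Metric.ball_mem_nhds _ hr), η / 2,
        by positivity, ?_⟩
      have h1 := (tendsto_empMean h.indep h.law (h.integrable_coord hΘ0 j)).abs
      have h2 := tendsto_empMean h.indep h.law ho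
      have h3 : ∀ᶠ z : ℕ × Ω in whp μ, ∀ i, ∀ θ ∈ Θ, θ ∈ Metric.ball θ0 r →
          ‖g (x i z.2) θ - g (x i z.2) θ0‖ ≤ o (x i z.2) :=
        eventually_whp_of_ae (by
          filter_upwards [ae_all_iff.2 fun i => HasLaw.ae_comp (h.law i) hob] with ω hω n i
          exact hω i)
      filter_upwards [h1.eventually_const_lt (by linarith : η * (3 / 4) < η),
        h2.eventually_lt_const hoi, h3] with z hz1 hz2 hz3 θ hθ hΘ
      refine ⟨j, ?_⟩
      have h4 : |empMean x z (fun y => g y θ j) - empMean x z (fun y => g y θ0 j)| ≤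
          empMean x z o := by
        rw [empMean, empMean, ← sampleMean_sub, empMean, sampleMean, sampleMean, abs_mul,
          abs_of_nonneg (by positivity)]
        refine mul_le_mul_of_nonneg_left ((Finset.abs_sum_le_sum_abs _ _).trans
          (Finset.sum_le_sum fun i _ => ?_)) (by positivity)
        exact (PiLp.norm_apply_le (g (x i z.2) θ - g (x i z.2) θ0) j).trans (hz3 i θ hΘ hθ)
      have h5 := abs_sub_abs_le_abs_sub (empMean x z fun y => g y θ0 j)
        (empMean x z fun y => g y θ j)
      rw [abs_sub_comm] at h5
      linarith
  obtain ⟨η, hη, hev⟩ := key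
  refine ⟨η, hη, hev.mono fun z hz θ hθ hle => hz θ ⟨hθ, fun hb => ?_⟩ hθ⟩
  rw [mem_ball_iff_norm] at hb
  linarith

end RegularityConditions

end Separation

/-! ### Moments of graded forms in normalized sums -/

section Graded

variable {Ω 𝒳 : Type*} [MeasurableSpace Ω] [MeasurableSpace 𝒳] {p : ℕ}
  {μ : Measure Ω} [IsProbabilityMeasure μ] {P : Measure 𝒳} {x : ℕ → Ω → 𝒳} {b : 𝒳 → ℝ}

/-- Centered functions of an observation, the function `a j` being of the order `b ^ w j`, where
`b` has six moments. -/
structure GradedFamily {J : Type*} (P : Measure 𝒳) (b : 𝒳 → ℝ) (a : J → 𝒳 → ℝ) (w : J → ℕ) :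
    Prop where
  one_le : ∀ y, 1 ≤ b y
  integrable_b : Integrable (fun y => b y ^ 6) P
  meas : ∀ j, Measurable (a j)
  mean : ∀ j, ∫ y, a j y ∂P = 0
  bound : ∃ K : ℝ, 0 ≤ K ∧ ∀ j, ∀ᵐ y ∂P, |a j y| ≤ K * b y ^ w j

variable {J : Type*} {a : J → 𝒳 → ℝ} {w : J → ℕ}

/-- A product of total weight at most six, and each of its subproducts, is dominated by a multiple
of b⁶ because b ≥ 1. -/
lemma GradedFamily.integrable_prod (h : GradedFamily P b a w) {K : Type*} [Fintype K]
    {f : K → J} (hf : ∑ k, w (f k) ≤ 6) (B : Finset K) :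
    Integrable (fun y => ∏ k ∈ B, a (f k) y) P := by
  obtain ⟨C, hC, hb⟩ := h.bound
  refine (h.integrable_b.const_mul (C ^ B.card)).mono'
    (Finset.measurable_fun_prod B fun k _ => h.meas _).aestronglyMeasurable ?_
  have hall : ∀ᵐ y ∂P, ∀ k : K, |a (f k) y| ≤ C * b y ^ w (f k) := ae_all_iff.2 fun k => hb _
  filter_upwards [hall] with y hy
  rw [Real.norm_eq_abs, Finset.abs_prod]
  refine (Finset.prod_le_prod (fun k _ => abs_nonneg _) fun k _ => hy k).trans ?_
  rw [Finset.prod_mul_distrib, Finset.prod_const, Finset.prod_pow_eq_pow_sum]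
  refine mul_le_mul_of_nonneg_left (pow_le_pow_right₀ (h.one_le y) ?_) (by positivity)
  exact (Finset.sum_le_univ_sum_of_nonneg fun k => Nat.zero_le _).trans hf

namespace GradedFamily

lemma integrable_two (h : GradedFamily P b a w) (hind : iIndepFun x μ)
    (hlaw : ∀ i, HasLaw (x i) P μ) {i j : J} (hw : w i + w j ≤ 6) (n : ℕ) :
    Integrable (fun ω => normSum x n (a i) ω * normSum x n (a j) ω) μ := by
  have := integrable_prod_normSum hind hlaw (a := fun k : Fin 2 => a (![i, j] k))
    (fun k => h.meas _) (fun B => h.integrable_prod (f := ![i, j])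
      (by simpa [Fin.sum_univ_succ] using hw) B) n Finset.univ
  simpa [Fin.prod_univ_succ] using this

lemma integrable_three (h : GradedFamily P b a w) (hind : iIndepFun x μ)
    (hlaw : ∀ i, HasLaw (x i) P μ) {i j k : J} (hw : w i + w j + w k ≤ 6) (n : ℕ) :
    Integrable (fun ω => normSum x n (a i) ω * normSum x n (a j) ω * normSum x n (a k) ω) μ := by
  have := integrable_prod_normSum hind hlaw (a := fun s : Fin 3 => a (![i, j, k] s))
    (fun k => h.meas _) (fun B => h.integrable_prod (f := ![i, j, k])
      (by simpa [Fin.sum_univ_succ, add_assoc] using hw) B) n Finset.univ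
  simpa [Fin.prod_univ_succ, mul_assoc] using this

lemma integrable_four (h : GradedFamily P b a w) (hind : iIndepFun x μ)
    (hlaw : ∀ i, HasLaw (x i) P μ) {i j k r : J} (hw : w i + w j + w k + w r ≤ 6) (n : ℕ) :
    Integrable (fun ω => normSum x n (a i) ω * normSum x n (a j) ω * normSum x n (a k) ω *
      normSum x n (a r) ω) μ := by
  have := integrable_prod_normSum hind hlaw (a := fun s : Fin 4 => a (![i, j, k, r] s))
    (fun k => h.meas _) (fun B => h.integrable_prod (f := ![i, j, k, r])
      (by simpa [Fin.sum_univ_succ, add_assoc] using hw) B) n Finset.univ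
  simpa [Fin.prod_univ_succ, mul_assoc] using this

lemma tendsto_two (h : GradedFamily P b a w) (hind : iIndepFun x μ)
    (hlaw : ∀ i, HasLaw (x i) P μ) {i j : J} (hw : w i + w j ≤ 6) :
    Tendsto (fun n => ∫ ω, normSum x n (a i) ω * normSum x n (a j) ω ∂μ) atTop
      (𝓝 (∫ y, a i y * a j y ∂P)) := by
  have := isProbabilityMeasure_of_hasLaw (hlaw 0)
  refine tendsto_const_nhds.congr' ?_
  filter_upwards [eventually_ne_atTop 0] with n hn
  exact (integral_normSum_two hind hlaw (a := fun k : Fin 2 => a (![i, j] k))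
    (fun k => h.meas _) (fun B => h.integrable_prod (f := ![i, j])
      (by simpa [Fin.sum_univ_succ] using hw) B) (fun k => h.mean _) hn).symm

lemma tendsto_three (h : GradedFamily P b a w) (hind : iIndepFun x μ)
    (hlaw : ∀ i, HasLaw (x i) P μ) {i j k : J} (hw : w i + w j + w k ≤ 6) :
    Tendsto (fun n => ∫ ω, normSum x n (a i) ω * normSum x n (a j) ω * normSum x n (a k) ω ∂μ)
      atTop (𝓝 0) := by
  have := isProbabilityMeasure_of_hasLaw (hlaw 0)
  exact tendsto_integral_normSum_three hind hlaw (a := fun s : Fin 3 => a (![i, j, k] s))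
    (fun k => h.meas _) (fun B => h.integrable_prod (f := ![i, j, k])
      (by simpa [Fin.sum_univ_succ, add_assoc] using hw) B) fun k => h.mean _

lemma tendsto_four (h : GradedFamily P b a w) (hind : iIndepFun x μ)
    (hlaw : ∀ i, HasLaw (x i) P μ) {i j k r : J} (hw : w i + w j + w k + w r ≤ 6) :
    Tendsto (fun n => ∫ ω, normSum x n (a i) ω * normSum x n (a j) ω * normSum x n (a k) ω *
      normSum x n (a r) ω ∂μ) atTop (𝓝 ((∫ y, a i y * a j y ∂P) * (∫ y, a k y * a r y ∂P) +
        (∫ y, a i y * a k y ∂P) * (∫ y, a j y * a r y ∂P) +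
        (∫ y, a i y * a r y ∂P) * (∫ y, a j y * a k y ∂P))) := by
  have := isProbabilityMeasure_of_hasLaw (hlaw 0)
  exact tendsto_integral_normSum_four hind hlaw (a := fun s : Fin 4 => a (![i, j, k, r] s))
    (fun k => h.meas _) (fun B => h.integrable_prod (f := ![i, j, k, r])
      (by simpa [Fin.sum_univ_succ, add_assoc] using hw) B) fun k => h.mean _

lemma memLp_two (h : GradedFamily P b a w) {j : J} (hw : w j ≤ 3) : MemLp (a j) 2 P := by
  rw [memLp_two_iff_integrable_sq (h.meas j).aestronglyMeasurable]
  have := h.integrable_prod (f := fun _ : Fin 2 => j)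
    (by simp only [Fin.sum_const, smul_eq_mul]; lia) Finset.univ
  simpa [Fin.prod_univ_succ, sq] using this

end GradedFamily

lemma memLp_normSum (hlaw : ∀ i, HasLaw (x i) P μ) {f : 𝒳 → ℝ} (hf : MemLp f 2 P) (n : ℕ) :
    MemLp (normSum x n f) 2 μ :=
  (memLp_finsetSum _ fun i _ => memLp_comp_law (hlaw i) hf).const_mul _

/-- The covariance of integrable random variables with an integrable product. -/
lemma covariance_eq_integral_mul_sub {X Y : Ω → ℝ} (hX : Integrable X μ) (hY : Integrable Y μ)
    (hXY : Integrable (fun ω => X ω * Y ω) μ) :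
    cov[X, Y; μ] = ∫ ω, X ω * Y ω ∂μ - (∫ ω, X ω ∂μ) * ∫ ω, Y ω ∂μ := by
  rw [covariance]
  have e : ∀ ω, (X ω - ∫ ω, X ω ∂μ) * (Y ω - ∫ ω, Y ω ∂μ) =
      X ω * Y ω - X ω * (∫ ω, Y ω ∂μ) - (∫ ω, X ω ∂μ) * Y ω +
        (∫ ω, X ω ∂μ) * ∫ ω, Y ω ∂μ := fun ω => by ring
  have h1 : Integrable (fun ω => X ω * Y ω - X ω * ∫ ω, Y ω ∂μ) μ := hXY.sub (hX.mul_const _)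
  have h2 : Integrable (fun ω => X ω * Y ω - X ω * (∫ ω, Y ω ∂μ) - (∫ ω, X ω ∂μ) * Y ω) μ :=
    h1.sub (hY.const_mul _)
  simp only [e]
  rw [integral_add h2 (integrable_const _), integral_sub h1 (hY.const_mul _),
    integral_sub hXY (hX.mul_const _), integral_mul_const, integral_const_mul]
  simp

/-- The coefficients of an expansion are compatible with a grading of its functions. -/
structure IsGraded (P : Measure 𝒳) (b : 𝒳 → ℝ) (c : ExpansionData 𝒳 p) (w : Fin c.k → ℕ) :
    Prop where
  family : GradedFamily P b (fun j y => c.a y j) w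
  le_three : ∀ j, w j ≤ 3
  lin : ∀ l j, c.lin l j ≠ 0 → w j ≤ 1
  quad : ∀ l j j', c.quad l j j' ≠ 0 → w j + w j' ≤ 3
  cub : ∀ l j j' j'', c.cub l j j' j'' ≠ 0 → w j + w j' + w j'' ≤ 5

namespace IsGraded

variable {c : ExpansionData 𝒳 p} {w : Fin c.k → ℕ}

lemma z_eq (c : ExpansionData 𝒳 p) (n : ℕ) (ω : Ω) (j : Fin c.k) :
    c.z x n ω j = normSum x n (fun y => c.a y j) ω := rfl

lemma memLp_psi (h : IsGraded P b c w) (hlaw : ∀ i, HasLaw (x i) P μ) (n : ℕ) (l : Fin p) :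
    MemLp (c.psi x n l) 2 μ :=
  memLp_finsetSum _ fun j _ =>
    (memLp_normSum hlaw (h.family.memLp_two (h.le_three j)) n).const_mul _

lemma memLp_q (h : IsGraded P b c w) (hind : iIndepFun x μ) (hlaw : ∀ i, HasLaw (x i) P μ)
    (n : ℕ) (l : Fin p) : MemLp (c.q x n l) 2 μ := by
  refine memLp_finsetSum _ fun j _ => memLp_finsetSum _ fun j' _ => ?_
  by_cases h0 : c.quad l j j' = 0
  · simp [h0]
  · have hw := h.quad l j j' h0
    have h2 := h.family.integrable_two hind hlaw (i := j) (j := j') (by lia) n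
    have h4 := h.family.integrable_four hind hlaw (i := j) (j := j') (k := j) (r := j') (by lia) n
    have h5 : MemLp (fun ω => normSum x n (fun y => c.a y j) ω *
        normSum x n (fun y => c.a y j') ω) 2 μ := by
      rw [memLp_two_iff_integrable_sq h2.aestronglyMeasurable]
      refine h4.congr (Eventually.of_forall fun ω => ?_)
      ring
    refine (h5.const_mul (c.quad l j j')).ae_eq (Eventually.of_forall fun ω => ?_)
    simp only [z_eq]
    ring

lemma integrable_r (h : IsGraded P b c w) (hind : iIndepFun x μ) (hlaw : ∀ i, HasLaw (x i) P μ)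
    (n : ℕ) (l : Fin p) : Integrable (c.r x n l) μ := by
  refine integrable_finsetSum _ fun j _ => integrable_finsetSum _ fun j' _ =>
    integrable_finsetSum _ fun j'' _ => ?_
  by_cases h0 : c.cub l j j' j'' = 0
  · simp [h0]
  · have hw := h.cub l j j' j'' h0
    have h3 := h.family.integrable_three hind hlaw (i := j) (j := j') (k := j'') (by lia) n
    refine (h3.const_mul (c.cub l j j' j'')).congr (Eventually.of_forall fun ω => ?_)
    simp only [z_eq]
    ring

lemma mean_r (h : IsGraded P b c w) (hind : iIndepFun x μ) (hlaw : ∀ i, HasLaw (x i) P μ)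
    (l : Fin p) : Tendsto (fun n => ∫ ω, c.r x n l ω ∂μ) atTop (𝓝 0) := by
  have key : ∀ j j' j'', (∀ n, Integrable (fun ω => c.cub l j j' j'' * c.z x n ω j * c.z x n ω j' *
        c.z x n ω j'') μ) ∧
      Tendsto (fun n => ∫ ω, c.cub l j j' j'' * c.z x n ω j * c.z x n ω j' * c.z x n ω j'' ∂μ)
        atTop (𝓝 0) := by
    intro j j' j''
    by_cases h0 : c.cub l j j' j'' = 0
    · simp [h0]
    · have hw := h.cub l j j' j'' h0
      simp only [mul_assoc (c.cub l j j' j''), integral_const_mul]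
      refine ⟨fun n => ?_, ?_⟩
      · exact (h.family.integrable_three hind hlaw (i := j) (j := j') (k := j'') (by lia) n).const_mul _
      · have := (h.family.tendsto_three hind hlaw (i := j) (j := j') (k := j'')
          (by lia)).const_mul (c.cub l j j' j'')
        rw [mul_zero] at this
        exact this
  have h1 : Tendsto (fun n => ∑ j, ∑ j', ∑ j'', ∫ ω, c.cub l j j' j'' * c.z x n ω j *
      c.z x n ω j' * c.z x n ω j'' ∂μ) atTop (𝓝 (∑ j : Fin c.k, ∑ j' : Fin c.k,
        ∑ j'' : Fin c.k, 0)) :=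
    tendsto_finsetSum _ fun j _ => tendsto_finsetSum _ fun j' _ => tendsto_finsetSum _ fun j'' _ =>
      (key j j' j'').2
  simp only [Finset.sum_const_zero] at h1
  refine h1.congr fun n => ?_
  simp only [ExpansionData.r]
  rw [integral_finsetSum _ fun j _ => integrable_finsetSum _ fun j' _ =>
    integrable_finsetSum _ fun j'' _ => (key j j' j'').1 n]
  refine Finset.sum_congr rfl fun j _ => ?_
  rw [integral_finsetSum _ fun j' _ => integrable_finsetSum _ fun j'' _ => (key j j' j'').1 n]
  refine Finset.sum_congr rfl fun j' _ => ?_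
  rw [integral_finsetSum _ fun j'' _ => (key j j' j'').1 n]

/-- The product of two forms as a sum over all indices. -/
lemma r_mul_psi (c : ExpansionData 𝒳 p) (n : ℕ) (l l' : Fin p) (ω : Ω) :
    c.r x n l ω * c.psi x n l' ω = ∑ j, ∑ j', ∑ j'', ∑ i, (c.cub l j j' j'' * c.lin l' i) *
      (c.z x n ω j * c.z x n ω j' * c.z x n ω j'' * c.z x n ω i) := by
  simp only [ExpansionData.r, ExpansionData.psi, Finset.sum_mul]
  refine Finset.sum_congr rfl fun j _ => Finset.sum_congr rfl fun j' _ =>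
    Finset.sum_congr rfl fun j'' _ => ?_
  rw [Finset.mul_sum]
  exact Finset.sum_congr rfl fun i _ => by ring

lemma q_mul_q (c : ExpansionData 𝒳 p) (n : ℕ) (l l' : Fin p) (ω : Ω) :
    c.q x n l ω * c.q x n l' ω = ∑ j, ∑ j', ∑ i, ∑ i', (c.quad l j j' * c.quad l' i i') *
      (c.z x n ω j * c.z x n ω j' * c.z x n ω i * c.z x n ω i') := by
  simp only [ExpansionData.q, Finset.sum_mul]
  refine Finset.sum_congr rfl fun j _ => Finset.sum_congr rfl fun j' _ => ?_
  rw [Finset.mul_sum]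
  refine Finset.sum_congr rfl fun i _ => ?_
  rw [Finset.mul_sum]
  exact Finset.sum_congr rfl fun i' _ => by ring

/-- Convergence of the mean of a graded quartic form. -/
lemma quartic (h : IsGraded P b c w) (hind : iIndepFun x μ) (hlaw : ∀ i, HasLaw (x i) P μ)
    {C : Fin c.k → Fin c.k → Fin c.k → Fin c.k → ℝ}
    (hC : ∀ i j k r, C i j k r ≠ 0 → w i + w j + w k + w r ≤ 6) :
    (∀ n, Integrable (fun ω => ∑ i, ∑ j, ∑ k, ∑ r, C i j k r *
      (c.z x n ω i * c.z x n ω j * c.z x n ω k * c.z x n ω r)) μ) ∧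
    ∃ L : ℝ, Tendsto (fun n => ∫ ω, ∑ i, ∑ j, ∑ k, ∑ r, C i j k r *
      (c.z x n ω i * c.z x n ω j * c.z x n ω k * c.z x n ω r) ∂μ) atTop (𝓝 L) := by
  have key : ∀ i j k r, (∀ n, Integrable (fun ω => C i j k r *
        (c.z x n ω i * c.z x n ω j * c.z x n ω k * c.z x n ω r)) μ) ∧
      ∃ L : ℝ, Tendsto (fun n => ∫ ω, C i j k r *
        (c.z x n ω i * c.z x n ω j * c.z x n ω k * c.z x n ω r) ∂μ) atTop (𝓝 L) := by
    intro i j k r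
    by_cases h0 : C i j k r = 0
    · simp only [h0, zero_mul, integral_zero]
      exact ⟨fun _ => integrable_zero _ _ _, 0, tendsto_const_nhds⟩
    · have hw := hC i j k r h0
      simp only [integral_const_mul]
      exact ⟨fun n => (h.family.integrable_four hind hlaw hw n).const_mul _, _,
        (h.family.tendsto_four hind hlaw hw).const_mul _⟩
  choose hint L hL using key
  refine ⟨fun n => integrable_finsetSum _ fun i _ => integrable_finsetSum _ fun j _ =>
    integrable_finsetSum _ fun k _ => integrable_finsetSum _ fun r _ => hint i j k r n,
    ∑ i, ∑ j, ∑ k, ∑ r, L i j k r, ?_⟩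
  refine (tendsto_finsetSum _ fun i _ => tendsto_finsetSum _ fun j _ => tendsto_finsetSum _
    fun k _ => tendsto_finsetSum _ fun r _ => hL i j k r).congr fun n => ?_
  rw [integral_finsetSum _ fun i _ => integrable_finsetSum _ fun j _ =>
    integrable_finsetSum _ fun k _ => integrable_finsetSum _ fun r _ => hint i j k r n]
  refine Finset.sum_congr rfl fun i _ => ?_
  rw [integral_finsetSum _ fun j _ =>
    integrable_finsetSum _ fun k _ => integrable_finsetSum _ fun r _ => hint i j k r n]
  refine Finset.sum_congr rfl fun j _ => ?_
  rw [integral_finsetSum _ fun k _ => integrable_finsetSum _ fun r _ => hint i j k r n]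
  refine Finset.sum_congr rfl fun k _ => ?_
  rw [integral_finsetSum _ fun r _ => hint i j k r n]

lemma integrable_r_psi (h : IsGraded P b c w) (hind : iIndepFun x μ)
    (hlaw : ∀ i, HasLaw (x i) P μ) (n : ℕ) (l l' : Fin p) :
    Integrable (fun ω => c.r x n l ω * c.psi x n l' ω) μ := by
  simp only [r_mul_psi]
  refine (h.quartic hind hlaw (C := fun j j' j'' i => c.cub l j j' j'' * c.lin l' i)
    fun j j' j'' i hne => ?_).1 n
  have h1 := h.cub l j j' j'' (left_ne_zero_of_mul hne)
  have h2 := h.lin l' i (right_ne_zero_of_mul hne)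
  lia

lemma covariance_r_psi (h : IsGraded P b c w) (hind : iIndepFun x μ)
    (hlaw : ∀ i, HasLaw (x i) P μ) (n : ℕ) (l l' : Fin p) :
    cov[c.r x n l, c.psi x n l'; μ] = ∫ ω, c.r x n l ω * c.psi x n l' ω ∂μ -
      (∫ ω, c.r x n l ω ∂μ) * ∫ ω, c.psi x n l' ω ∂μ :=
  covariance_eq_integral_mul_sub (h.integrable_r hind hlaw n l)
    ((h.memLp_psi hlaw n l').integrable one_le_two) (h.integrable_r_psi hind hlaw n l l')

lemma integral_psi (h : IsGraded P b c w) (hlaw : ∀ i, HasLaw (x i) P μ) (n : ℕ) (l : Fin p) :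
    ∫ ω, c.psi x n l ω ∂μ = 0 := by
  have hm : ∀ j, MemLp (fun y => c.a y j) 2 P := fun j => h.family.memLp_two (h.le_three j)
  have hi : ∀ i j, Integrable (fun ω => c.a (x i ω) j) μ := fun i j =>
    (memLp_comp_law (hlaw i) (hm j)).integrable one_le_two
  have h0 : ∀ j, ∫ ω, c.z x n ω j ∂μ = 0 := fun j => by
    simp only [ExpansionData.z, integral_const_mul]
    rw [integral_finsetSum _ fun i _ => hi i j, Finset.sum_eq_zero fun i _ => ?_, mul_zero]
    exact ((hlaw i).integral_comp (f := fun y => c.a y j) (hm j).aestronglyMeasurable).trans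
      (h.family.mean j)
  have hz : ∀ j, Integrable (fun ω => c.lin l j * c.z x n ω j) μ := fun j =>
    ((memLp_normSum hlaw (hm j) n).integrable one_le_two).const_mul _
  simp only [ExpansionData.psi]
  rw [integral_finsetSum _ fun j _ => hz j]
  refine Finset.sum_eq_zero fun j _ => ?_
  rw [integral_const_mul, h0, mul_zero]

/-- The terms of the `O(n⁻²)` variance converge. -/
lemma exists_limit (h : IsGraded P b c w) (hind : iIndepFun x μ) (hlaw : ∀ i, HasLaw (x i) P μ)
    (l l' : Fin p) : ∃ W : ℝ, Tendsto (fun n => c.secondOrderVariance μ x n l l') atTop (𝓝 W) := by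
  have hrp : ∀ l l', ∃ L : ℝ, Tendsto (fun n => cov[c.r x n l, c.psi x n l'; μ]) atTop (𝓝 L) := by
    intro l l'
    obtain ⟨-, L, hL⟩ := h.quartic hind hlaw (C := fun j j' j'' i => c.cub l j j' j'' * c.lin l' i)
      fun j j' j'' i hne => by
        have h1 := h.cub l j j' j'' (left_ne_zero_of_mul hne)
        have h2 := h.lin l' i (right_ne_zero_of_mul hne)
        lia
    refine ⟨L, hL.congr fun n => ?_⟩
    rw [h.covariance_r_psi hind hlaw, h.integral_psi hlaw, mul_zero, sub_zero]
    simp only [r_mul_psi]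
  have hq : ∃ L : ℝ, Tendsto (fun n => ∫ ω, c.q x n l ω * c.q x n l' ω ∂μ) atTop (𝓝 L) := by
    simp only [q_mul_q]
    refine (h.quartic hind hlaw (C := fun j j' i i' => c.quad l j j' * c.quad l' i i')
      fun j j' i i' hne => ?_).2
    have h1 := h.quad l j j' (left_ne_zero_of_mul hne)
    have h2 := h.quad l' i i' (right_ne_zero_of_mul hne)
    lia
  have hq1 : ∀ l, ∃ L : ℝ, Tendsto (fun n => ∫ ω, c.q x n l ω ∂μ) atTop (𝓝 L) := by
    intro l
    have key : ∀ j j', (∀ n, Integrable (fun ω => c.quad l j j' * c.z x n ω j * c.z x n ω j') μ) ∧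
        ∃ L : ℝ, Tendsto (fun n => ∫ ω, c.quad l j j' * c.z x n ω j * c.z x n ω j' ∂μ)
          atTop (𝓝 L) := by
      intro j j'
      by_cases h0 : c.quad l j j' = 0
      · simp only [h0, zero_mul, integral_zero]
        exact ⟨fun _ => integrable_zero _ _ _, 0, tendsto_const_nhds⟩
      · have hw := h.quad l j j' h0
        simp only [mul_assoc, integral_const_mul]
        exact ⟨fun n => (h.family.integrable_two hind hlaw (i := j) (j := j') (by lia) n).const_mul _,
          _, (h.family.tendsto_two hind hlaw (i := j) (j := j') (by lia)).const_mul _⟩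
    choose hint L hL using key
    refine ⟨∑ j, ∑ j', L j j', ?_⟩
    refine (tendsto_finsetSum _ fun j _ => tendsto_finsetSum _ fun j' _ => hL j j').congr
      fun n => ?_
    simp only [ExpansionData.q]
    rw [integral_finsetSum _ fun j _ => integrable_finsetSum _ fun j' _ => hint j j' n]
    refine Finset.sum_congr rfl fun j _ => ?_
    rw [integral_finsetSum _ fun j' _ => hint j j' n]
  obtain ⟨L1, h1⟩ := hrp l l'
  obtain ⟨L2, h2⟩ := hrp l' l
  obtain ⟨L3, h3⟩ := hq
  obtain ⟨L4, h4⟩ := hq1 l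
  obtain ⟨L5, h5⟩ := hq1 l'
  refine ⟨L3 - L4 * L5 + L1 + L2, (((h3.sub (h4.mul h5)).add h1).add h2).congr fun n => ?_⟩
  rw [ExpansionData.secondOrderVariance, covariance_comm (c.psi x n l)]
  congr 2
  have hm := h.memLp_q hind hlaw n
  exact (covariance_eq_integral_mul_sub ((hm l).integrable one_le_two)
    ((hm l').integrable one_le_two) ((hm l).integrable_mul (hm l'))).symm

end IsGraded

/-- A cubic form in normalized sums that are uncorrelated with another one. -/
lemma GradedFamily.tendsto_cubic (h : GradedFamily P b a w) (hind : iIndepFun x μ)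
    (hlaw : ∀ i, HasLaw (x i) P μ) {A : Type*} [Fintype A] {f : A → J} {e : J}
    (hf : ∀ k, w (f k) ≤ 1) (he : w e ≤ 1) (h0 : ∀ k, ∫ y, a (f k) y * a e y ∂P = 0)
    (C : A → A → A → ℝ) :
    Tendsto (fun n => ∫ ω, (∑ k, ∑ r, ∑ s, C k r s * (normSum x n (a (f k)) ω *
      normSum x n (a (f r)) ω * normSum x n (a (f s)) ω)) * normSum x n (a e) ω ∂μ) atTop (𝓝 0) := by
  have hw : ∀ k r s, w (f k) + w (f r) + w (f s) + w e ≤ 6 := fun k r s => by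
    have := hf k
    have := hf r
    have := hf s
    lia
  -- In each of the three pairings of the limit the factor `e` is matched with some `f k`, and that
  -- covariance is zero by `h0`.
  have key : Tendsto (fun n => ∑ k, ∑ r, ∑ s, C k r s * ∫ ω, normSum x n (a (f k)) ω *
      normSum x n (a (f r)) ω * normSum x n (a (f s)) ω * normSum x n (a e) ω ∂μ) atTop
      (𝓝 (∑ k : A, ∑ r : A, ∑ s : A, C k r s * 0)) :=
    tendsto_finsetSum _ fun k _ => tendsto_finsetSum _ fun r _ => tendsto_finsetSum _ fun s _ => by
      have := (h.tendsto_four hind hlaw (hw k r s)).const_mul (C k r s)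
      simpa [h0] using this
  simp only [mul_zero, Finset.sum_const_zero] at key
  refine key.congr fun n => ?_
  have hint : ∀ k r s, Integrable (fun ω => C k r s * (normSum x n (a (f k)) ω *
      normSum x n (a (f r)) ω * normSum x n (a (f s)) ω * normSum x n (a e) ω)) μ := fun k r s =>
    (h.integrable_four hind hlaw (hw k r s) n).const_mul _
  simp only [Finset.sum_mul, mul_assoc (C _ _ _)]
  rw [integral_finsetSum _ fun k _ => integrable_finsetSum _ fun r _ =>
    integrable_finsetSum _ fun s _ => hint k r s]
  refine Finset.sum_congr rfl fun k _ => ?_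
  rw [integral_finsetSum _ fun r _ => integrable_finsetSum _ fun s _ => hint k r s]
  refine Finset.sum_congr rfl fun r _ => ?_
  rw [integral_finsetSum _ fun s _ => hint k r s]
  exact Finset.sum_congr rfl fun s _ => (integral_const_mul _ _).symm

end Graded

/-! ### The coefficients of the estimating equations as functions of an observation -/

section RowCoefficients

/-- Indices of the coefficients of degrees zero, one and two of the estimating functions. -/
abbrev RowIndex (m p : ℕ) : Type :=
  (Fin p ⊕ Fin m) ⊕ ((Fin p ⊕ Fin m) × (Fin p ⊕ Fin m)) ⊕
    ((Fin p ⊕ Fin m) × (Fin p ⊕ Fin m) × (Fin p ⊕ Fin m))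

/-- The order in the bound `b` of the coefficients. -/
def rowWeight {m p : ℕ} : RowIndex m p → ℕ
  | .inl _ => 1
  | .inr (.inl _) => 2
  | .inr (.inr _) => 3

lemma rowWeight_le {m p : ℕ} (j : RowIndex m p) : rowWeight j ≤ 3 := by
  rcases j with i | i | i <;> simp [rowWeight]

/-- The coefficients of degrees zero, one and two of the estimating functions. -/
def rowCoef {𝒳 : Type*} {m p : ℕ}
    (g : 𝒳 → EuclideanSpace ℝ (Fin p) → EuclideanSpace ℝ (Fin m))
    (θs : EuclideanSpace ℝ (Fin p)) : RowIndex m p → 𝒳 → ℝ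
  | .inl i => fun y => (rowJet (g y) θs 1 i).c0
  | .inr (.inl (i, j)) => fun y => (rowJet (g y) θs 1 i).c1 j
  | .inr (.inr (i, j, k)) => fun y => (rowJet (g y) θs 1 i).c2 j k

/-- A bound `b ≥ 1` with six moments for the derivatives of the moment functions on a ball. -/
structure SmoothBound {𝒳 : Type*} [MeasurableSpace 𝒳] {m p : ℕ} (P : Measure 𝒳)
    (g : 𝒳 → EuclideanSpace ℝ (Fin p) → EuclideanSpace ℝ (Fin m))
    (Θ : Set (EuclideanSpace ℝ (Fin p))) (θs : EuclideanSpace ℝ (Fin p)) (r : ℝ) (b : 𝒳 → ℝ) :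
    Prop where
  pos_radius : 0 < r
  ball : Metric.ball θs r ⊆ Θ
  one_le : ∀ y, 1 ≤ b y
  large : ∀ y, p < b y * r
  integrable : Integrable (fun y => b y ^ 6) P
  smooth : ∀ᵐ y ∂P, LocallySmooth (g y) θs r (b y)

variable {Ω 𝒳 : Type*} [MeasurableSpace Ω] [MeasurableSpace 𝒳] {m p : ℕ} {μ : Measure Ω}
  [IsProbabilityMeasure μ] {P : Measure 𝒳} {x : ℕ → Ω → 𝒳}
  {g : 𝒳 → EuclideanSpace ℝ (Fin p) → EuclideanSpace ℝ (Fin m)}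
  {Θ : Set (EuclideanSpace ℝ (Fin p))} {θs : EuclideanSpace ℝ (Fin p)} {r : ℝ} {b : 𝒳 → ℝ}

/-- Adding the constant 1 + (p + 1) / r to the given bound secures both b ≥ 1 and p < b r
everywhere, and costs no moments under a probability measure. -/
lemma RegularityConditions.exists_smoothBound (h : RegularityConditions μ P x g Θ θs) {s : ℝ≥0∞}
    (hs : 6 ≤ s) (hsm : SmoothnessConditions P g θs s) :
    ∃ (r : ℝ) (b : 𝒳 → ℝ), SmoothBound P g Θ θs r b ∧ MemLp b s P := by
  have := h.isProbabilityMeasure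
  obtain ⟨b0, hb0, N, hN, hθN, hsm⟩ := hsm
  obtain ⟨r, hr, hball⟩ := Metric.isOpen_iff.1 (hN.inter isOpen_interior) θs ⟨hθN, h.interior⟩
  set b : 𝒳 → ℝ := fun y => ‖b0 y‖ + (1 + (p + 1) / r) with hb
  have hbp : ∀ y, 1 ≤ b y := fun y => by
    have := norm_nonneg (b0 y)
    have : 0 ≤ ((p : ℝ) + 1) / r := by positivity
    simp only [hb]
    linarith
  have hmem : MemLp b s P := hb0.norm.add (memLp_const _)
  refine ⟨r, b, ⟨hr, fun θ hθ => interior_subset (hball hθ).2, hbp, fun y => ?_, ?_, ?_⟩, hmem⟩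
  · have h1 : ((p : ℝ) + 1) / r * r = p + 1 := by field_simp
    have h2 : 0 ≤ (‖b0 y‖ + 1) * r := by positivity
    simp only [hb]
    nlinarith
  · have h6 : MemLp b ((6 : ℕ) : ℝ≥0∞) P := hmem.mono_exponent (by simpa using hs)
    refine (h6.integrable_norm_pow (by norm_num)).congr (Eventually.of_forall fun y => ?_)
    simp only [Real.norm_of_nonneg (zero_le_one.trans (hbp y))]
  · filter_upwards [hsm] with y hy
    have hle : b0 y ≤ b y := by
      have h1 := le_abs_self (b0 y)
      have : 0 ≤ ((p : ℝ) + 1) / r := by positivity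
      simp only [hb, Real.norm_eq_abs]
      linarith
    refine ⟨hy.1.mono fun θ hθ => (hball hθ).1, fun k hk θ hθ => ?_, fun k hk θ hθ θ' hθ' => ?_⟩
    · exact ((hy.2 k hk).1 θ (hball hθ).1).trans hle
    · exact ((hy.2 k hk).2 θ (hball hθ).1 θ' (hball hθ').1).trans (by gcongr)

/-- An a.e. equality between functions of an observation holds along the sample. -/
lemma empMean_sub_eq_rate_mul (hlaw : ∀ i, HasLaw (x i) P μ) {f f' : 𝒳 → ℝ} {c : ℝ}
    (hf : f' =ᵐ[P] fun y => f y - c) :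
    ∀ᶠ z in whp μ, empMean x z f - c = rate Prod.fst z * normSum x z.1 f' z.2 := by
  have h1 : ∀ᶠ z : ℕ × Ω in whp μ, ∀ i, f' (x i z.2) = f (x i z.2) - c :=
    eventually_whp_of_ae ((ae_all_iff.2 fun i => HasLaw.ae_comp (hlaw i) hf).mono fun ω hω _ => hω)
  filter_upwards [h1, tendsto_fst_whp.eventually_ne_atTop 0] with z hz hn
  have hn0 : (0 : ℝ) < z.1 := by positivity
  rw [normSum, ← mul_assoc]
  change _ = rate Prod.fst z * rate Prod.fst z * _
  rw [← sq, rate_sq, Finset.sum_congr rfl fun i _ => hz i, Finset.sum_sub_distrib, mul_sub,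
    empMean, sampleMean]
  simp
  field_simp

namespace SmoothBound

lemma exists_hasJet (h : SmoothBound P g Θ θs r b) : ∃ K : ℝ, 0 < K ∧ ∀ τ : ℝ, |τ| ≤ 1 →
    ∀ᵐ y ∂P, ∀ i, HasJet (rowFun (g y) θs τ i) (rowJet (g y) θs τ i) (b y) (K * b y) := by
  obtain ⟨K, hK, hjet⟩ := exists_hasJet_row m p
  refine ⟨K, hK, fun τ hτ => ?_⟩
  filter_upwards [h.smooth] with y hy i
  exact hjet _ _ _ _ _ hy (h.one_le y) (h.large y) hτ i

lemma jetAEMeasurable (h : SmoothBound P g Θ θs r b)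
    (hm : ∀ θ ∈ Θ, Measurable fun y => g y θ) (τ : ℝ) (i : Fin p ⊕ Fin m) :
    JetAEMeasurable (fun y => rowJet (g y) θs τ i) P :=
  jetAEMeasurable_rowJet h.pos_radius h.smooth (fun θ hθ => (hm θ (h.ball hθ)).aemeasurable) τ i

lemma aemeasurable_rowCoef (h : SmoothBound P g Θ θs r b)
    (hm : ∀ θ ∈ Θ, Measurable fun y => g y θ) (j : RowIndex m p) :
    AEMeasurable (rowCoef g θs j) P := by
  rcases j with i | ⟨i, j⟩ | ⟨i, j, k⟩
  · exact (h.jetAEMeasurable hm 1 i).c0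
  · exact (h.jetAEMeasurable hm 1 i).c1 j
  · exact (h.jetAEMeasurable hm 1 i).c2 j k

lemma exists_rowCoef_le (h : SmoothBound P g Θ θs r b) : ∃ K : ℝ, 0 ≤ K ∧ ∀ᵐ y ∂P, ∀ j,
    |rowCoef g θs j y| ≤ K * b y ^ rowWeight j := by
  obtain ⟨K, hK, hjet⟩ := h.exists_hasJet
  refine ⟨K, hK.le, ?_⟩
  filter_upwards [hjet 1 (by simp)] with y hy j
  rcases j with i | ⟨i, j⟩ | ⟨i, j, k⟩
  · exact ((hy i).b0).trans_eq (by rw [rowWeight]; ring)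
  · exact ((hy i).b1 j).trans_eq (by rw [rowWeight]; ring)
  · exact ((hy i).b2 j k).trans_eq (by rw [rowWeight]; ring)

lemma integrable_rowCoef (h : SmoothBound P g Θ θs r b)
    (hm : ∀ θ ∈ Θ, Measurable fun y => g y θ) (j : RowIndex m p) :
    Integrable (rowCoef g θs j) P := by
  obtain ⟨K, hK, hle⟩ := h.exists_rowCoef_le
  refine (h.integrable.const_mul K).mono' (h.aemeasurable_rowCoef hm j).aestronglyMeasurable ?_
  filter_upwards [hle] with y hy
  refine (hy j).trans (mul_le_mul_of_nonneg_left ?_ hK)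
  exact pow_le_pow_right₀ (h.one_le y) ((rowWeight_le j).trans (by norm_num))

lemma integrable_c3 (h : SmoothBound P g Θ θs r b)
    (hm : ∀ θ ∈ Θ, Measurable fun y => g y θ) {τ : ℝ} (hτ : |τ| ≤ 1) (i j k s : Fin p ⊕ Fin m) :
    Integrable (fun y => (rowJet (g y) θs τ i).c3 j k s) P := by
  obtain ⟨K, hK, hle⟩ := h.exists_hasJet
  refine (h.integrable.const_mul K).mono'
    ((h.jetAEMeasurable hm τ i).c3 j k s).aestronglyMeasurable ?_
  filter_upwards [hle τ hτ] with y hy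
  refine ((hy i).b3 j k s).trans ?_
  rw [mul_assoc, ← pow_succ']
  exact mul_le_mul_of_nonneg_left (pow_le_pow_right₀ (h.one_le y) (by norm_num)) hK.le

lemma memLp_c3 (h : SmoothBound P g Θ θs r b) (hb : MemLp b 8 P)
    (hm : ∀ θ ∈ Θ, Measurable fun y => g y θ) {τ : ℝ} (hτ : |τ| ≤ 1) (i j k s : Fin p ⊕ Fin m) :
    MemLp (fun y => (rowJet (g y) θs τ i).c3 j k s) 2 P := by
  obtain ⟨K, hK, hle⟩ := h.exists_hasJet
  have hmeas := ((h.jetAEMeasurable hm τ i).c3 j k s).aestronglyMeasurable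
  have hb8 : MemLp b ((8 : ℕ) : ℝ≥0∞) P := by simpa using hb
  rw [memLp_two_iff_integrable_sq hmeas]
  refine ((hb8.integrable_norm_pow (by norm_num)).const_mul (K ^ 2)).mono' (hmeas.pow 2) ?_
  filter_upwards [hle τ hτ] with y hy
  have h1 := (hy i).b3 j k s
  have hb0 : 0 ≤ b y := zero_le_one.trans (h.one_le y)
  rw [Real.norm_of_nonneg (sq_nonneg _), Real.norm_of_nonneg hb0, ← sq_abs]
  calc |(rowJet (g y) θs τ i).c3 j k s| ^ 2 ≤ (K * b y * b y ^ 3) ^ 2 := by gcongr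
    _ = K ^ 2 * b y ^ 8 := by ring

/-- Measurable versions of the centered coefficients. -/
lemma exists_gradedFamily [IsProbabilityMeasure P] (h : SmoothBound P g Θ θs r b)
    (hm : ∀ θ ∈ Θ, Measurable fun y => g y θ) :
    ∃ a : RowIndex m p → 𝒳 → ℝ, GradedFamily P b a rowWeight ∧
      ∀ j, a j =ᵐ[P] fun y => rowCoef g θs j y - ∫ y, rowCoef g θs j y ∂P := by
  have hae := h.aemeasurable_rowCoef hm
  set E : RowIndex m p → ℝ := fun j => ∫ y, rowCoef g θs j y ∂P with hE
  have heq : ∀ j, (fun y => (hae j).mk _ y - E j) =ᵐ[P] fun y => rowCoef g θs j y - E j :=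
    fun j => (hae j).ae_eq_mk.symm.sub (EventuallyEq.refl _ _)
  refine ⟨fun j y => (hae j).mk _ y - E j, ⟨h.one_le, h.integrable,
    fun j => (hae j).measurable_mk.sub_const _, fun j => ?_, ?_⟩, heq⟩
  · rw [integral_congr_ae (heq j), integral_sub (h.integrable_rowCoef hm j) (integrable_const _)]
    simp [hE]
  · obtain ⟨K, hK, hle⟩ := h.exists_rowCoef_le
    have hE0 : 0 ≤ ∑ j, |E j| := Finset.sum_nonneg fun j _ => abs_nonneg _
    refine ⟨K + ∑ j, |E j|, by positivity, fun j => ?_⟩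
    filter_upwards [hle, heq j] with y hy hj
    rw [hj]
    have h1 : 1 ≤ b y ^ rowWeight j := one_le_pow₀ (h.one_le y)
    have h2 : |E j| ≤ ∑ j, |E j| :=
      Finset.single_le_sum (f := fun j => |E j|) (fun j _ => abs_nonneg _) (Finset.mem_univ j)
    calc |rowCoef g θs j y - E j| ≤ |rowCoef g θs j y| + |E j| := abs_sub _ _
      _ ≤ K * b y ^ rowWeight j + (∑ j, |E j|) * b y ^ rowWeight j :=
          add_le_add (hy j) (h2.trans (le_mul_of_one_le_right hE0 h1))
      _ = _ := by ring

end SmoothBound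

end RowCoefficients

/-! ### The bordered matrix of the first-order conditions -/

section Bordered

variable {m p : ℕ} {S : Matrix (Fin m) (Fin m) ℝ} {Γ : Matrix (Fin m) (Fin p) ℝ}

/-- The Jacobian of the first-order conditions. -/
def bordered (S : Matrix (Fin m) (Fin m) ℝ) (Γ : Matrix (Fin m) (Fin p) ℝ) :
    Matrix (Fin p ⊕ Fin m) (Fin p ⊕ Fin m) ℝ :=
  Matrix.fromBlocks 0 Γ.transpose Γ S

lemma bordered_inl_inl (a c : Fin p) : bordered S Γ (.inl a) (.inl c) = 0 := rfl

lemma bordered_inr_inl (j : Fin m) (a : Fin p) : bordered S Γ (.inr j) (.inl a) = Γ j a := rfl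

lemma bordered_inr_inr (j k : Fin m) : bordered S Γ (.inr j) (.inr k) = S j k := rfl

/-- A kernel vector (u, w) satisfies Γu + Sw = 0 and Γ'w = 0. Pairing the first with w gives w'Sw =
0, hence w = 0, then Γu = 0 and u = 0. -/
lemma det_bordered_ne_zero
    (pos : ∀ v : EuclideanSpace ℝ (Fin m), v ≠ 0 → 0 < ∑ j, ∑ k, S j k * (v j * v k))
    (inj : ∀ u : EuclideanSpace ℝ (Fin p), (∀ j, ∑ a, Γ j a * u a = 0) → u = 0) :
    (bordered S Γ).det ≠ 0 := by
  intro h0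
  obtain ⟨v, hv, hMv⟩ := Matrix.exists_mulVec_eq_zero_iff.2 h0
  have hr : ∀ j, ∑ a, Γ j a * v (.inl a) + ∑ k, S j k * v (.inr k) = 0 := fun j => by
    have := congrFun hMv (.inr j)
    simpa [bordered, Matrix.mulVec, dotProduct, Fintype.sum_sum_type] using this
  have hl : ∀ a, ∑ j, Γ j a * v (.inr j) = 0 := fun a => by
    have := congrFun hMv (.inl a)
    simpa [bordered, Matrix.mulVec, dotProduct, Fintype.sum_sum_type] using this
  have hw : (WithLp.toLp 2 fun j => v (.inr j) : EuclideanSpace ℝ (Fin m)) = 0 := by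
    by_contra hne
    have hpos := pos _ hne
    have e1 : ∑ j, v (.inr j) * (∑ a, Γ j a * v (.inl a) + ∑ k, S j k * v (.inr k)) = 0 := by
      simp [hr]
    have e2 : ∑ j, v (.inr j) * ∑ a, Γ j a * v (.inl a) = 0 := by
      simp only [Finset.mul_sum]
      rw [Finset.sum_comm]
      refine Finset.sum_eq_zero fun a _ => ?_
      calc ∑ j, v (.inr j) * (Γ j a * v (.inl a)) = (∑ j, Γ j a * v (.inr j)) * v (.inl a) := by
            rw [Finset.sum_mul]
            exact Finset.sum_congr rfl fun j _ => by ring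
        _ = 0 := by rw [hl, zero_mul]
    simp only [mul_add, Finset.sum_add_distrib, e2, zero_add] at e1
    refine hpos.ne' (Eq.trans (Finset.sum_congr rfl fun j _ => ?_) e1)
    rw [Finset.mul_sum]
    exact Finset.sum_congr rfl fun k _ => by ring
  have hw' : ∀ j, v (.inr j) = 0 := fun j => congrFun (congrArg WithLp.ofLp hw) j
  have hu : (WithLp.toLp 2 fun a => v (.inl a) : EuclideanSpace ℝ (Fin p)) = 0 :=
    inj _ fun j => by simpa [hw'] using hr j
  refine hv (funext fun i => ?_)
  rcases i with a | j
  · exact congrFun (congrArg WithLp.ofLp hu) a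
  · exact hw' j

lemma bordered_inv_mul (h : (bordered S Γ).det ≠ 0) (i k : Fin p ⊕ Fin m) :
    ∑ j, (bordered S Γ)⁻¹ i j * bordered S Γ j k = if i = k then 1 else 0 := by
  rw [← Matrix.mul_apply, Matrix.nonsing_inv_mul _ h.isUnit, Matrix.one_apply]

lemma bordered_mul_inv (h : (bordered S Γ).det ≠ 0) (i k : Fin p ⊕ Fin m) :
    ∑ j, bordered S Γ i j * (bordered S Γ)⁻¹ j k = if i = k then 1 else 0 := by
  rw [← Matrix.mul_apply, Matrix.mul_nonsing_inv _ h.isUnit, Matrix.one_apply]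

/-- The linear terms of the parameter and of the multiplier are uncorrelated. -/
lemma bordered_inv_orthogonal (h : (bordered S Γ).det ≠ 0) (hS : S.transpose = S) (κ : Fin m)
    (l : Fin p) :
    ∑ i, ∑ j, (bordered S Γ)⁻¹ (.inr κ) (.inr i) * ((bordered S Γ)⁻¹ (.inl l) (.inr j) * S i j) =
      0 := by
  set A := (bordered S Γ)⁻¹ with hA
  have hsymm : ∀ i j, A i j = A j i := fun i j => by
    have h1 : (bordered S Γ).transpose = bordered S Γ := by
      rw [bordered, Matrix.fromBlocks_transpose, hS]
      simp
    have h2 : A.transpose = A := by rw [hA, Matrix.transpose_nonsing_inv, h1]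
    exact congrFun (congrFun h2 j) i
  -- Write 1 for the parameter block and 2 for the multiplier block. Then ΓA₁₁ + SA₂₁ = 0 and A₂₂Γ =
  -- 0, whence A₂₂SA₂₁ = -A₂₂ΓA₁₁ = 0.
  have h1 : ∀ i, ∑ a, Γ i a * A (.inl a) (.inl l) + ∑ j, S i j * A (.inr j) (.inl l) = 0 :=
    fun i => by
      simpa [bordered_inr_inl, bordered_inr_inr, Fintype.sum_sum_type] using
        bordered_mul_inv h (.inr i) (.inl l)
  have h2 : ∀ a, ∑ i, A (.inr κ) (.inr i) * Γ i a = 0 := fun a => by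
    simpa [bordered_inl_inl, bordered_inr_inl, Fintype.sum_sum_type] using
      bordered_inv_mul h (.inr κ) (.inl a)
  have h3 : ∑ i, A (.inr κ) (.inr i) * ∑ a, Γ i a * A (.inl a) (.inl l) = 0 := by
    simp only [Finset.mul_sum]
    rw [Finset.sum_comm]
    refine Finset.sum_eq_zero fun a _ => ?_
    simp only [← mul_assoc, ← Finset.sum_mul, h2, zero_mul]
  calc _ = ∑ i, A (.inr κ) (.inr i) * ∑ j, S i j * A (.inr j) (.inl l) := by
        refine Finset.sum_congr rfl fun i _ => ?_
        rw [Finset.mul_sum]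
        refine Finset.sum_congr rfl fun j _ => ?_
        rw [hsymm (.inl l)]
        ring
    _ = ∑ i, A (.inr κ) (.inr i) * (∑ a, Γ i a * A (.inl a) (.inl l) +
          ∑ j, S i j * A (.inr j) (.inl l)) := by
        simp only [mul_add, Finset.sum_add_distrib, h3, zero_add]
    _ = 0 := by simp [h1]

end Bordered

/-! ### The regime of the sample -/

section Regime

variable {Ω 𝒳 : Type*} [MeasurableSpace Ω] [MeasurableSpace 𝒳] {m p : ℕ} {μ : Measure Ω}
  [IsProbabilityMeasure μ] {P : Measure 𝒳} {x : ℕ → Ω → 𝒳}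
  {g : 𝒳 → EuclideanSpace ℝ (Fin p) → EuclideanSpace ℝ (Fin m)}
  {Θ : Set (EuclideanSpace ℝ (Fin p))} {θs : EuclideanSpace ℝ (Fin p)} {r : ℝ} {b : 𝒳 → ℝ}

namespace RegularityConditions

lemma mem (h : RegularityConditions μ P x g Θ θs) : θs ∈ Θ := interior_subset h.interior

lemma integrable_mul (h : RegularityConditions μ P x g Θ θs) (j k : Fin m) :
    Integrable (fun y => g y θs j * g y θs k) P := by
  obtain ⟨D, hD, hb⟩ := h.exists_dom
  refine hD.mono' ((h.integrable_coord h.mem j).aestronglyMeasurable.mul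
    (h.integrable_coord h.mem k).aestronglyMeasurable) ?_
  filter_upwards [hb] with y hy
  rw [norm_mul]
  calc ‖g y θs j‖ * ‖g y θs k‖ ≤ ‖g y θs‖ * ‖g y θs‖ :=
        mul_le_mul (PiLp.norm_apply_le _ _) (PiLp.norm_apply_le _ _) (norm_nonneg _) (norm_nonneg _)
    _ = ‖g y θs‖ ^ 2 := (sq _).symm
    _ ≤ D y := (hy θs h.mem).1

lemma integral_moment (h : RegularityConditions μ P x g Θ θs) (j : Fin m) :
    ∫ y, g y θs j ∂P = 0 := by
  rw [← h.integral_coord h.mem j, (h.unique_solution θs h.mem).2 rfl]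
  simp

/-- The form is E[(v'g)²]. If it vanishes, then v'g = 0 almost everywhere, so E[gg']v = 0, against
nonsingularity. -/
lemma cov_pos (h : RegularityConditions μ P x g Θ θs) (v : EuclideanSpace ℝ (Fin m))
    (hv : v ≠ 0) : 0 < ∑ j, ∑ k, momentCov P g θs j k * (v j * v k) := by
  have hint := h.integrable_mul
  set f : 𝒳 → ℝ := fun y => ∑ j, v j * g y θs j with hf
  have hfi : ∀ j, Integrable (fun y => g y θs j * f y) P := fun j => by
    simp only [hf, Finset.mul_sum]
    refine integrable_finsetSum _ fun k _ => ((hint j k).const_mul (v k)).congr ?_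
    exact Eventually.of_forall fun y => by ring
  have hrow : ∀ j, ∫ y, g y θs j * f y ∂P = ∑ k, momentCov P g θs j k * v k := fun j => by
    simp only [hf, Finset.mul_sum]
    rw [integral_finsetSum _ fun k _ => ((hint j k).const_mul (v k)).congr
      (Eventually.of_forall fun y => by ring : _ =ᵐ[P] fun y => g y θs j * (v k * g y θs k))]
    refine Finset.sum_congr rfl fun k _ => ?_
    rw [momentCov, Matrix.of_apply, ← integral_mul_const]
    exact integral_congr_ae (Eventually.of_forall fun y => by ring)
  have hsq : ∫ y, f y * f y ∂P = ∑ j, ∑ k, momentCov P g θs j k * (v j * v k) := by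
    have e : ∀ y, f y * f y = ∑ j, v j * (g y θs j * f y) := fun y => by
      simp only [← mul_assoc, ← Finset.sum_mul]
      rfl
    simp only [e]
    rw [integral_finsetSum _ fun j _ => (hfi j).const_mul (v j)]
    refine Finset.sum_congr rfl fun j _ => ?_
    rw [integral_const_mul, hrow, Finset.mul_sum]
    exact Finset.sum_congr rfl fun k _ => by ring
  have hsqi : Integrable (fun y => f y * f y) P := by
    have : Integrable (fun y => ∑ j, v j * (g y θs j * f y)) P :=
      integrable_finsetSum _ fun j _ => (hfi j).const_mul (v j)
    refine this.congr (Eventually.of_forall fun y => ?_)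
    simp only [← mul_assoc, ← Finset.sum_mul]
    rfl
  rw [← hsq]
  refine (integral_nonneg fun y => mul_self_nonneg _).lt_of_ne fun h0 => hv ?_
  have hf0 := (integral_eq_zero_iff_of_nonneg (fun y => mul_self_nonneg _) hsqi).1 h0.symm
  have hv0 : (momentCov P g θs).mulVec v = 0 := by
    funext j
    rw [Matrix.mulVec, dotProduct, ← hrow]
    refine integral_eq_zero_of_ae ?_
    filter_upwards [hf0] with y hy
    rw [mul_self_eq_zero.1 hy, mul_zero]
    rfl
  have := Matrix.eq_zero_of_mulVec_eq_zero h.nonsingular hv0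
  ext j
  exact congrFun this j

lemma jac_inj (h : RegularityConditions μ P x g Θ θs) (u : EuclideanSpace ℝ (Fin p))
    (hu : ∀ j, ∑ a, momentJacobian P g θs j a * u a = 0) : u = 0 := by
  have h1 := LinearMap.finrank_range_add_finrank_ker (momentJacobian P g θs).mulVecLin
  have h2 : Module.finrank ℝ (LinearMap.range (momentJacobian P g θs).mulVecLin) = p := h.full_rank
  rw [h2, Module.finrank_fin_fun] at h1
  have h3 : LinearMap.ker (momentJacobian P g θs).mulVecLin = ⊥ :=
    Submodule.finrank_eq_zero.1 (by lia)
  have h4 : (momentJacobian P g θs).mulVecLin u.ofLp = 0 := funext hu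
  have h5 := LinearMap.ker_eq_bot'.1 h3 _ h4
  ext j
  exact congrFun h5 j

lemma transpose_momentCov : (momentCov P g θs).transpose = momentCov P g θs := by
  ext j k
  simp only [momentCov, Matrix.transpose_apply, Matrix.of_apply]
  exact integral_congr_ae (Eventually.of_forall fun y => mul_comm _ _)

lemma det_bordered (h : RegularityConditions μ P x g Θ θs) :
    (bordered (momentCov P g θs) (momentJacobian P g θs)).det ≠ 0 :=
  det_bordered_ne_zero h.cov_pos h.jac_inj

lemma integral_rowCoef_zero (h : RegularityConditions μ P x g Θ θs) (i : Fin p ⊕ Fin m) :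
    ∫ y, rowCoef g θs (.inl i) y ∂P = 0 := by
  rcases i with a | j
  · simp [rowCoef, rowJet_c0_inl]
  · simpa only [rowCoef, rowJet_c0_inr] using h.integral_moment j

lemma integral_rowCoef_one (i j : Fin p ⊕ Fin m) :
    ∫ y, rowCoef g θs (.inr (.inl (i, j))) y ∂P =
      bordered (momentCov P g θs) (momentJacobian P g θs) i j := by
  rcases i with i | i <;> rcases j with j | j <;>
    simp [rowCoef, rowJet_c1_inl_inl, rowJet_c1_inl_inr, rowJet_c1_inr_inl, rowJet_c1_inr_inr,
      bordered, momentCov, momentJacobian]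

/-- The sample is regular on events on which the centered coefficients are of the order
`n ^ (-1/2)`. -/
lemma exists_momentRegime (h : RegularityConditions μ P x g Θ θs) (hb : SmoothBound P g Θ θs r b)
    {l : Filter (ℕ × Ω)} (hl : l ≤ whp μ)
    (hc : ∀ j, OrdO l (rate Prod.fst) 1
      (fun z => empMean x z (rowCoef g θs j) - ∫ y, rowCoef g θs j y ∂P)) :
    ∃ D, MomentRegime l Prod.fst (fun z i => x i z.2) b g Θ θs r (momentCov P g θs)
      (momentJacobian P g θs) D := by
  obtain ⟨D, hD, hdom⟩ := h.exists_dom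
  have hae : ∀ {q : 𝒳 → Prop}, (∀ᵐ y ∂P, q y) → ∀ᶠ z in l, ∀ i < z.1, q (x i z.2) := fun hq =>
    hl (eventually_whp_of_ae ((ae_all_iff.2 fun i => HasLaw.ae_comp (h.law i) hq).mono
      fun ω hω n i _ => hω i))
  have hlim : ∀ {f : 𝒳 → ℝ}, Integrable f P →
      OrdO l (rate Prod.fst) 0 (fun z => empMean x z f) := fun hf => by
    have := ((tendsto_empMean h.indep h.law hf).mono_left hl).isBigO_one ℝ
    simpa [OrdO] using this
  refine ⟨D, ⟨⟨tendsto_fst_whp.mono_left hl, hb.one_le, hlim hb.integrable⟩, hb.pos_radius, hb.large,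
    hae hb.smooth, hb.ball, fun j => ?_, fun j k => ?_, fun j a => ?_,
    hae (hdom.mono fun y hy θ hθ => (hy θ hθ).1), hlim hD, fun ρ hρ => ?_, h.cov_pos, h.jac_inj⟩⟩
  · have := hc (.inl (.inr j))
    rw [h.integral_rowCoef_zero] at this
    simpa only [rowCoef, rowJet_c0_inr, sub_zero] using this
  · have := hc (.inr (.inl (.inr j, .inr k)))
    rw [integral_rowCoef_one] at this
    simpa only [rowCoef, rowJet_c1_inr_inr, bordered_inr_inr] using this
  · have := hc (.inr (.inl (.inr j, .inl a)))
    rw [integral_rowCoef_one] at this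
    simpa only [rowCoef, rowJet_c1_inr_inl, bordered_inr_inl] using this
  · obtain ⟨η, hη, hev⟩ := h.separation hρ
    exact ⟨η, hη, hl hev⟩

end RegularityConditions

end Regime

/-! ### The terms of the expansion as forms in normalized sums -/

section Terms

variable {J : Type*} [Fintype J] {w : J → ℕ} {n : ℕ} {f : (J → ℝ) → ℝ}

lemma IsForm1.map_mul (h : IsForm1 w n f) (ε : ℝ) (z : J → ℝ) :
    f (fun j => ε * z j) = ε * f z := by
  obtain ⟨c, -, hf⟩ := h
  simp only [hf, Finset.mul_sum]
  exact Finset.sum_congr rfl fun j _ => by ring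

lemma IsForm2.map_mul (h : IsForm2 w n f) (ε : ℝ) (z : J → ℝ) :
    f (fun j => ε * z j) = ε ^ 2 * f z := by
  obtain ⟨c, -, hf⟩ := h
  simp only [hf, Finset.mul_sum]
  exact Finset.sum_congr rfl fun j _ => Finset.sum_congr rfl fun k _ => by ring

lemma IsForm3.map_mul (h : IsForm3 w n f) (ε : ℝ) (z : J → ℝ) :
    f (fun j => ε * z j) = ε ^ 3 * f z := by
  obtain ⟨c, -, hf⟩ := h
  simp only [hf, Finset.mul_sum]
  exact Finset.sum_congr rfl fun j _ => Finset.sum_congr rfl fun k _ =>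
    Finset.sum_congr rfl fun l _ => by ring

variable {m p : ℕ}

/-- The linear term of the expansion. -/
def rowOne (A : Fin p ⊕ Fin m → Fin p ⊕ Fin m → ℝ) (z : RowIndex m p → ℝ) (i : Fin p ⊕ Fin m) : ℝ :=
  solOne A (fun i => z (.inl i)) i

/-- The quadratic term of the expansion. -/
def rowTwo (A : Fin p ⊕ Fin m → Fin p ⊕ Fin m → ℝ)
    (m2 : Fin p ⊕ Fin m → Fin p ⊕ Fin m → Fin p ⊕ Fin m → ℝ) (z : RowIndex m p → ℝ)
    (i : Fin p ⊕ Fin m) : ℝ :=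
  solTwo A m2 (fun i => z (.inl i)) (fun i j => z (.inr (.inl (i, j)))) i

/-- The cubic term of the expansion. -/
def rowThree (A : Fin p ⊕ Fin m → Fin p ⊕ Fin m → ℝ)
    (m2 : Fin p ⊕ Fin m → Fin p ⊕ Fin m → Fin p ⊕ Fin m → ℝ)
    (m3 : Fin p ⊕ Fin m → Fin p ⊕ Fin m → Fin p ⊕ Fin m → Fin p ⊕ Fin m → ℝ)
    (z : RowIndex m p → ℝ) (i : Fin p ⊕ Fin m) : ℝ :=
  solThree A m2 m3 (fun i => z (.inl i)) (fun i j => z (.inr (.inl (i, j))))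
    (fun i j k => z (.inr (.inr (i, j, k)))) i

variable (A : Fin p ⊕ Fin m → Fin p ⊕ Fin m → ℝ)
  (m2 : Fin p ⊕ Fin m → Fin p ⊕ Fin m → Fin p ⊕ Fin m → ℝ)
  (m3 : Fin p ⊕ Fin m → Fin p ⊕ Fin m → Fin p ⊕ Fin m → Fin p ⊕ Fin m → ℝ)
  (i : Fin p ⊕ Fin m)

lemma isForm1_rowOne : IsForm1 rowWeight 1 (fun z => rowOne A z i) :=
  isForm1_solOne (e0 := fun i => (.inl i : RowIndex m p)) A (fun _ => le_rfl) i

lemma isForm2_rowTwo : IsForm2 rowWeight 3 (fun z => rowTwo A m2 z i) :=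
  isForm2_solTwo (e0 := fun i => (.inl i : RowIndex m p))
    (e1 := fun i j => (.inr (.inl (i, j)) : RowIndex m p)) A m2 (fun _ => le_rfl)
    (fun _ _ => le_rfl) i

lemma isForm3_rowThree : IsForm3 rowWeight 5 (fun z => rowThree A m2 m3 z i) :=
  isForm3_solThree (e0 := fun i => (.inl i : RowIndex m p))
    (e1 := fun i j => (.inr (.inl (i, j)) : RowIndex m p))
    (e2 := fun i j k => (.inr (.inr (i, j, k)) : RowIndex m p)) A m2 m3 (fun _ => le_rfl)
    (fun _ _ => le_rfl) (fun _ _ _ => le_rfl) i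

/-- The mean cubic coefficients enter the third-order term linearly and multiply first-order terms
only. The comparison of the two estimators thus reduces to cubic forms in first-order terms. -/
lemma rowThree_sub (m3' : Fin p ⊕ Fin m → Fin p ⊕ Fin m → Fin p ⊕ Fin m → Fin p ⊕ Fin m → ℝ)
    (z : RowIndex m p → ℝ) :
    rowThree A m2 m3' z i - rowThree A m2 m3 z i = -∑ j, A i j * ∑ k, ∑ r, ∑ s,
      (m3' j k r s - m3 j k r s) * (rowOne A z k * rowOne A z r * rowOne A z s) := by
  simp only [rowThree, solThree, rowOne, sub_mul, Finset.sum_sub_distrib, mul_sub, mul_add,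
    Finset.sum_add_distrib]
  ring

variable {𝒳 Ω : Type*} [MeasurableSpace 𝒳] {P : Measure 𝒳} {b : 𝒳 → ℝ}

/-- The data of an expansion `c` are those of the formal solution of the estimating equations. -/
structure IsFormal (P : Measure 𝒳) (b : 𝒳 → ℝ) (x : ℕ → Ω → 𝒳) (a : RowIndex m p → 𝒳 → ℝ)
    (A : Fin p ⊕ Fin m → Fin p ⊕ Fin m → ℝ)
    (m2 : Fin p ⊕ Fin m → Fin p ⊕ Fin m → Fin p ⊕ Fin m → ℝ)
    (m3 : Fin p ⊕ Fin m → Fin p ⊕ Fin m → Fin p ⊕ Fin m → Fin p ⊕ Fin m → ℝ)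
    (c : ExpansionData 𝒳 p) : Prop where
  graded : ∃ w, IsGraded P b c w
  psi : ∀ n l ω, c.psi x n l ω = rowOne A (fun j => normSum x n (a j) ω) (.inl l)
  q : ∀ n l ω, c.q x n l ω = rowTwo A m2 (fun j => normSum x n (a j) ω) (.inl l)
  r : ∀ n l ω, c.r x n l ω = rowThree A m2 m3 (fun j => normSum x n (a j) ω) (.inl l)

/-- The graded-form lemmas supply coefficients free of n and ω; enumeration of `RowIndex m p` brings
them into the shape of `ExpansionData`. -/
lemma GradedFamily.exists_isFormal {a : RowIndex m p → 𝒳 → ℝ} (h : GradedFamily P b a rowWeight)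
    (x : ℕ → Ω → 𝒳) : ∃ c : ExpansionData 𝒳 p, IsFormal P b x a A m2 m3 c := by
  choose c1 hc1 hf1 using fun l : Fin p => isForm1_rowOne A (.inl l)
  choose c2 hc2 hf2 using fun l : Fin p => isForm2_rowTwo A m2 (.inl l)
  choose c3 hc3 hf3 using fun l : Fin p => isForm3_rowThree A m2 m3 (.inl l)
  beta_reduce at hf1 hf2 hf3
  set e := (Fintype.equivFin (RowIndex m p)).symm
  refine ⟨⟨Fintype.card (RowIndex m p), fun y j => a (e j) y, fun l j => c1 l (e j),
    fun l j k => c2 l (e j) (e k), fun l j k s => c3 l (e j) (e k) (e s)⟩,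
    ⟨fun j => rowWeight (e j), ⟨⟨h.one_le, h.integrable_b, fun j => h.meas _, fun j => h.mean _, ?_⟩,
      fun j => rowWeight_le _, fun l j => hc1 l _, fun l j k => hc2 l _ _,
      fun l j k s => hc3 l _ _ _⟩⟩, fun n l ω => ?_, fun n l ω => ?_, fun n l ω => ?_⟩
  · obtain ⟨K, hK, hb⟩ := h.bound
    exact ⟨K, hK, fun j => hb _⟩
  · rw [hf1, ← e.sum_comp]
    rfl
  · rw [hf2, ← e.sum_comp]
    refine Finset.sum_congr rfl fun j _ => ?_
    rw [← e.sum_comp]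
    rfl
  · rw [hf3, ← e.sum_comp]
    refine Finset.sum_congr rfl fun j _ => ?_
    rw [← e.sum_comp]
    refine Finset.sum_congr rfl fun k _ => ?_
    rw [← e.sum_comp]
    rfl

end Terms

/-! ### The remainder of the expansion -/

section Remainder

variable {Ω 𝒳 : Type*} [MeasurableSpace Ω] [MeasurableSpace 𝒳] {m p : ℕ} {μ : Measure Ω}
  [IsProbabilityMeasure μ] {P : Measure 𝒳} {x : ℕ → Ω → 𝒳}
  {g : 𝒳 → EuclideanSpace ℝ (Fin p) → EuclideanSpace ℝ (Fin m)}
  {Θ : Set (EuclideanSpace ℝ (Fin p))} {θs : EuclideanSpace ℝ (Fin p)} {r : ℝ} {b : 𝒳 → ℝ}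
  {a : RowIndex m p → 𝒳 → ℝ} {c : ExpansionData 𝒳 p}
  {θhat : ℕ → Ω → EuclideanSpace ℝ (Fin p)}

/-- The inverse of the Jacobian of the first-order conditions. -/
def rowInv (P : Measure 𝒳) (g : 𝒳 → EuclideanSpace ℝ (Fin p) → EuclideanSpace ℝ (Fin m))
    (θs : EuclideanSpace ℝ (Fin p)) (i j : Fin p ⊕ Fin m) : ℝ :=
  (bordered (momentCov P g θs) (momentJacobian P g θs))⁻¹ i j

/-- The mean of the coefficients of degree two. -/
def rowMeanTwo (P : Measure 𝒳) (g : 𝒳 → EuclideanSpace ℝ (Fin p) → EuclideanSpace ℝ (Fin m))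
    (θs : EuclideanSpace ℝ (Fin p)) (i j k : Fin p ⊕ Fin m) : ℝ :=
  ∫ y, rowCoef g θs (.inr (.inr (i, j, k))) y ∂P

/-- The mean of the coefficients of degree three. -/
def rowMeanThree (P : Measure 𝒳) (g : 𝒳 → EuclideanSpace ℝ (Fin p) → EuclideanSpace ℝ (Fin m))
    (θs : EuclideanSpace ℝ (Fin p)) (τ : ℝ) (i j k s : Fin p ⊕ Fin m) : ℝ :=
  ∫ y, (rowJet (g y) θs τ i).c3 j k s ∂P

/-- Parameters `β` that contain `θhat - θs` satisfy, to fourth order, polynomial estimating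
equations whenever the centered coefficients are of the order `n ^ (-1/2)`. -/
def HasRowEquations (μ : Measure Ω) (P : Measure 𝒳) (x : ℕ → Ω → 𝒳)
    (g : 𝒳 → EuclideanSpace ℝ (Fin p) → EuclideanSpace ℝ (Fin m))
    (θs : EuclideanSpace ℝ (Fin p)) (τ : ℝ)
    (C : Fin p ⊕ Fin m → Fin p ⊕ Fin m → Fin p ⊕ Fin m → Fin p ⊕ Fin m → ℝ)
    (θhat : ℕ → Ω → EuclideanSpace ℝ (Fin p)) : Prop :=
  ∀ l ≤ whp μ, (∀ j, OrdO l (rate Prod.fst) 1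
      (fun z => empMean x z (rowCoef g θs j) - ∫ y, rowCoef g θs j y ∂P)) →
    ∃ β : ℕ × Ω → Fin p ⊕ Fin m → ℝ, (∀ z a, β z (.inl a) = θhat z.1 z.2 a - θs a) ∧
      (∀ i, OrdO l (rate Prod.fst) 1 (fun z => β z i)) ∧
      ∀ i, OrdO l (rate Prod.fst) 4 (fun z => empMean x z (fun y => rowFun (g y) θs τ i (β z)) +
        ∑ k, ∑ r, ∑ s, C i k r s * (β z k * β z r * β z s))

lemma rpow_three_halves (n : ℕ) : (n : ℝ) ^ (3 / 2 : ℝ) = √(n : ℝ) ^ 3 := by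
  rw [Real.rpow_div_two_eq_sqrt _ (Nat.cast_nonneg n), ← Real.rpow_natCast]
  norm_num

/-- The remainder in terms of the unscaled forms. -/
lemma IsFormal.remainder_eq {A : Fin p ⊕ Fin m → Fin p ⊕ Fin m → ℝ}
    {m2 : Fin p ⊕ Fin m → Fin p ⊕ Fin m → Fin p ⊕ Fin m → ℝ}
    {m3 : Fin p ⊕ Fin m → Fin p ⊕ Fin m → Fin p ⊕ Fin m → Fin p ⊕ Fin m → ℝ}
    (h : IsFormal P b x a A m2 m3 c) (z : ℕ × Ω) (l : Fin p) {ζ : RowIndex m p → ℝ}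
    (hζ : ∀ j, ζ j = rate Prod.fst z * normSum x z.1 (a j) z.2) :
    c.remainder x θhat θs z.1 l z.2 = (θhat z.1 z.2 l - θs l) -
      (rowOne A ζ (.inl l) + rowTwo A m2 ζ (.inl l) + rowThree A m2 m3 ζ (.inl l)) := by
  have h1 : (z.1 : ℝ) ^ (-(1 / 2) : ℝ) = rate Prod.fst z := by
    rw [rate, Real.sqrt_eq_rpow, Real.rpow_neg (Nat.cast_nonneg _)]
  have h3 : (z.1 : ℝ) ^ (-(3 / 2) : ℝ) = rate Prod.fst z ^ 3 := by
    rw [rate, Real.rpow_neg (Nat.cast_nonneg _), rpow_three_halves, inv_pow]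
  obtain rfl : ζ = fun j => rate Prod.fst z * normSum x z.1 (a j) z.2 := funext hζ
  rw [ExpansionData.remainder, h.psi, h.q, h.r, h1, h3, ← rate_sq (N := Prod.fst) z,
    (isForm1_rowOne A _).map_mul, (isForm2_rowTwo A m2 _).map_mul,
    (isForm3_rowThree A m2 m3 _).map_mul]

lemma ordO_normSum (hlaw : ∀ i, HasLaw (x i) P μ)
    (ha : ∀ j, a j =ᵐ[P] fun y => rowCoef g θs j y - ∫ y, rowCoef g θs j y ∂P)
    {l : Filter (ℕ × Ω)} (hl : l ≤ whp μ)
    (hz : ∀ j, (fun z : ℕ × Ω => normSum x z.1 (a j) z.2) =O[l] fun _ => (1 : ℝ))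
    (j : RowIndex m p) : OrdO l (rate Prod.fst) 1
      (fun z => empMean x z (rowCoef g θs j) - ∫ y, rowCoef g θs j y ∂P) := by
  have h1 := (isBigO_refl (fun z : ℕ × Ω => rate Prod.fst z) l).mul (hz j)
  refine OrdO.congr (f := fun z => rate Prod.fst z * normSum x z.1 (a j) z.2) ?_ ?_
  · simpa [OrdO] using h1
  · filter_upwards [hl (empMean_sub_eq_rate_mul hlaw (ha j))] with z hz using hz.symm

/-- The remainder along a filter on which the normalized sums are bounded. -/
lemma IsFormal.remainder_bounds (hreg : RegularityConditions μ P x g Θ θs)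
    (hb : SmoothBound P g Θ θs r b)
    (ha : ∀ j, a j =ᵐ[P] fun y => rowCoef g θs j y - ∫ y, rowCoef g θs j y ∂P) {τ : ℝ}
    (hτ : |τ| ≤ 1) {C : Fin p ⊕ Fin m → Fin p ⊕ Fin m → Fin p ⊕ Fin m → Fin p ⊕ Fin m → ℝ}
    (hc : IsFormal P b x a (rowInv P g θs) (rowMeanTwo P g θs)
      (fun i j k s => rowMeanThree P g θs τ i j k s + C i j k s) c)
    (heq : HasRowEquations μ P x g θs τ C θhat) {l : Filter (ℕ × Ω)} (hl : l ≤ whp μ)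
    (hz : ∀ j, (fun z : ℕ × Ω => normSum x z.1 (a j) z.2) =O[l] fun _ => (1 : ℝ)) (κ : Fin p) :
    Tendsto (fun z : ℕ × Ω => (z.1 : ℝ) ^ (3 / 2 : ℝ) * c.remainder x θhat θs z.1 κ z.2) l (𝓝 0) ∧
    ((∀ i j k s, OrdO l (rate Prod.fst) 1
        (fun z => empMean x z (fun y => (rowJet (g y) θs τ i).c3 j k s) -
          rowMeanThree P g θs τ i j k s)) →
      (fun z : ℕ × Ω => (z.1 : ℝ) ^ 2 * c.remainder x θhat θs z.1 κ z.2) =O[l]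
        fun _ => (1 : ℝ)) := by
  have hdev := ordO_normSum hreg.law ha hl hz
  obtain ⟨D, hR⟩ := hreg.exists_momentRegime hb hl hdev
  obtain ⟨β, hβu, hβ, hβeq⟩ := heq l hl hdev
  have hε : Tendsto (rate (Prod.fst : ℕ × Ω → ℕ)) l (𝓝 0) := hR.tendsto_rate
  have e0 : ∀ y i, (rowJet (g y) θs τ i).c0 = rowCoef g θs (.inl i) y := fun y i =>
    rowJet_c0_eq _ _ _ 1 i
  have e1 : ∀ y i j, (rowJet (g y) θs τ i).c1 j = rowCoef g θs (.inr (.inl (i, j))) y :=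
    fun y i j => rowJet_c1_eq _ _ _ 1 i j
  have e2 : ∀ y i j k, (rowJet (g y) θs τ i).c2 j k = rowCoef g θs (.inr (.inr (i, j, k))) y :=
    fun y i j k => rowJet_c2_eq _ _ _ 1 i j k
  set E : Fin p ⊕ Fin m → Fin p ⊕ Fin m → Fin p ⊕ Fin m → Fin p ⊕ Fin m → ℕ × Ω → ℝ :=
    fun i j k s z => empMean x z (fun y => (rowJet (g y) θs τ i).c3 j k s) -
      rowMeanThree P g θs τ i j k s with hE
  have hE0 : ∀ i j k s, Tendsto (E i j k s) l (𝓝 0) := fun i j k s => by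
    have h1 := (tendsto_empMean hreg.indep hreg.law
      (hb.integrable_c3 hreg.measurable hτ i j k s)).mono_left hl
    have h2 := h1.sub_const (rowMeanThree P g θs τ i j k s)
    rwa [← rowMeanThree, sub_self] at h2
  have hexp := hR.expansion hτ hβ hβeq (A := rowInv P g θs)
    (M := bordered (momentCov P g θs) (momentJacobian P g θs)) (m2 := rowMeanTwo P g θs)
    (m3 := rowMeanThree P g θs τ) (bordered_inv_mul hreg.det_bordered)
    (fun i => by
      have := hdev (.inl i)
      rw [hreg.integral_rowCoef_zero] at this
      simpa only [e0, sub_zero] using this)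
    (fun i j => by
      have := hdev (.inr (.inl (i, j)))
      rw [RegularityConditions.integral_rowCoef_one] at this
      simpa only [e1] using this)
    (fun i j k => by
      have := hdev (.inr (.inr (i, j, k)))
      simpa only [e2, rowMeanTwo] using this)
    (fun i j k s => by
      have := (hE0 i j k s).isBigO_one ℝ
      simpa [OrdO, hE] using this) (.inl κ)
  -- The contribution of the sampling error of the cubic coefficients. It is not part of r̄: the law
  -- of large numbers makes it o(n^(-3/2)), and a root-n rate for these coefficients makes it
  -- O(n⁻²).
  set T : ℕ × Ω → ℝ := fun z => ∑ j, rowInv P g θs (.inl κ) j * ∑ k, ∑ r, ∑ s,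
    E j k r s z * (β z k * β z r * β z s) with hT
  have hrem : OrdO l (rate Prod.fst) 4 (fun z => c.remainder x θhat θs z.1 κ z.2 + T z) := by
    refine hexp.congr ?_
    have hall : ∀ᶠ z in whp μ, ∀ j, empMean x z (rowCoef g θs j) - ∫ y, rowCoef g θs j y ∂P =
        rate Prod.fst z * normSum x z.1 (a j) z.2 :=
      eventually_all.2 fun j => empMean_sub_eq_rate_mul hreg.law (ha j)
    filter_upwards [hl hall] with z hz
    rw [hc.remainder_eq z κ hz, hβu]
    simp only [e0, e1, e2, rowOne, rowTwo, rowThree, hreg.integral_rowCoef_zero,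
      RegularityConditions.integral_rowCoef_one, sub_zero]
    rfl
  have hβ3 : ∀ k r s, OrdO l (rate Prod.fst) 3 (fun z => β z k * β z r * β z s) := fun k r s =>
    ((hβ k).mul (hβ r)).mul (hβ s)
  constructor
  · have hT0 : T =o[l] fun z => rate Prod.fst z ^ 3 := by
      refine IsLittleO.fun_sum fun j _ => IsLittleO.const_mul_left (IsLittleO.fun_sum fun k _ =>
        IsLittleO.fun_sum fun r _ => IsLittleO.fun_sum fun s _ => ?_) _
      have := ((isLittleO_one_iff ℝ).2 (hE0 j k r s)).mul_isBigO (hβ3 k r s)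
      simpa only [one_mul] using this
    have h4 : (fun z => rate (Prod.fst : ℕ × Ω → ℕ) z ^ 4) =o[l] fun z => rate Prod.fst z ^ 3 := by
      have := ((isLittleO_one_iff ℝ).2 hε).mul_isBigO
        (isBigO_refl (fun z => rate (Prod.fst : ℕ × Ω → ℕ) z ^ 3) l)
      simpa only [one_mul, ← pow_succ'] using this
    have h5 := ((hrem.trans_isLittleO h4).sub hT0).tendsto_div_nhds_zero
    refine h5.congr fun z => ?_
    simp only [add_sub_cancel_right, rate]
    rw [rpow_three_halves, inv_pow, div_inv_eq_mul, mul_comm]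
  · intro hE1
    have hT1 : OrdO l (rate Prod.fst) 4 T :=
      OrdO.sum fun j _ => OrdO.const_mul _ (OrdO.sum fun k _ => OrdO.sum fun r _ =>
        OrdO.sum fun s _ => (hE1 j k r s).mul (hβ3 k r s))
    have h1 := (isBigO_refl (fun z : ℕ × Ω => (z.1 : ℝ) ^ 2) l).mul (hrem.sub hT1)
    refine h1.congr' (Eventually.of_forall fun z => by simp only [add_sub_cancel_right]) ?_
    filter_upwards [hR.eventually_ne] with z hz
    have hz0 : (z.1 : ℝ) ≠ 0 := by exact_mod_cast hz
    rw [show rate (Prod.fst : ℕ × Ω → ℕ) z ^ 4 = (rate Prod.fst z ^ 2) ^ 2 by ring, rate_sq]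
    field_simp

end Remainder

/-! ### The stochastic expansions of the estimators -/

section Estimators

variable {Ω 𝒳 : Type*} [MeasurableSpace Ω] [MeasurableSpace 𝒳] {m p : ℕ} {μ : Measure Ω}
  [IsProbabilityMeasure μ] {P : Measure 𝒳} {x : ℕ → Ω → 𝒳}
  {g : 𝒳 → EuclideanSpace ℝ (Fin p) → EuclideanSpace ℝ (Fin m)}
  {Θ : Set (EuclideanSpace ℝ (Fin p))} {θs : EuclideanSpace ℝ (Fin p)} {r : ℝ} {b : 𝒳 → ℝ}
  {a : RowIndex m p → 𝒳 → ℝ} {c : ExpansionData 𝒳 p}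
  {θhat : ℕ → Ω → EuclideanSpace ℝ (Fin p)}

lemma isBigO_whpOn_sum {K : Type*} [Fintype K] (X : K → ℕ → Ω → ℝ) (M : ℝ) (k : K) :
    (fun z : ℕ × Ω => X k z.1 z.2) =O[whpOn μ (fun n ω => ∑ k, |X k n ω|) M] fun _ => (1 : ℝ) := by
  refine IsBigO.of_bound M ((eventually_whpOn_bound _ _).mono fun z hz => ?_)
  rw [norm_one, mul_one]
  refine le_trans ?_ ((le_abs_self _).trans hz)
  exact Finset.single_le_sum (f := fun k => |X k z.1 z.2|) (fun k _ => abs_nonneg _)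
    (Finset.mem_univ k)

lemma boundedInProbability_normSum (hind : iIndepFun x μ) (hlaw : ∀ i, HasLaw (x i) P μ)
    {f : 𝒳 → ℝ} (hf : MemLp f 2 P) (h0 : ∫ y, f y ∂P = 0) :
    BoundedInProbability μ (fun n ω => normSum x n f ω) := by
  have := boundedInProbability_empMean hind hlaw hf
  refine cast (congrArg (BoundedInProbability μ) (funext₂ fun n ω => ?_)) this
  rw [h0, sub_zero, empMean, sampleMean, normSum, ← mul_assoc, ← div_eq_mul_inv,
    Real.sqrt_div_self', one_div]

/-- A formal solution of the estimating equations is a stochastic expansion. -/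
lemma IsFormal.isStochasticExpansion (hreg : RegularityConditions μ P x g Θ θs)
    (hb : SmoothBound P g Θ θs r b) (hG : GradedFamily P b a rowWeight)
    (ha : ∀ j, a j =ᵐ[P] fun y => rowCoef g θs j y - ∫ y, rowCoef g θs j y ∂P) {τ : ℝ}
    (hτ : |τ| ≤ 1) {C : Fin p ⊕ Fin m → Fin p ⊕ Fin m → Fin p ⊕ Fin m → Fin p ⊕ Fin m → ℝ}
    (hc : IsFormal P b x a (rowInv P g θs) (rowMeanTwo P g θs)
      (fun i j k s => rowMeanThree P g θs τ i j k s + C i j k s) c)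
    (heq : HasRowEquations μ P x g θs τ C θhat) :
    IsStochasticExpansion μ P x θhat θs c := by
  obtain ⟨w, hw⟩ := hc.graded
  refine ⟨fun j => hw.family.memLp_two (hw.le_three j), hw.family.mean, hw.memLp_psi hreg.law,
    hw.memLp_q hreg.indep hreg.law, hw.integrable_r hreg.indep hreg.law,
    hw.integrable_r_psi hreg.indep hreg.law, hw.mean_r hreg.indep hreg.law, fun κ => ?_⟩
  -- On the events where this one tight variable is at most M, all normalized sums are bounded and
  -- the deterministic expansion applies.
  refine tendstoInMeasure_of_whpOn (Y := fun n ω => ∑ j, |normSum x n (a j) ω|)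
    (BoundedInProbability.sum _ fun j _ => (boundedInProbability_normSum hreg.indep hreg.law
      (hG.memLp_two (rowWeight_le j)) (hG.mean j)).abs) fun M => ?_
  exact (hc.remainder_bounds hreg hb ha hτ heq (whpOn_le _ _)
    (isBigO_whpOn_sum (fun j n ω => normSum x n (a j) ω) M) κ).1

/-- Under eighth moments the remainder is of the order `n⁻²`. -/
lemma IsFormal.boundedInProbability_remainder (hreg : RegularityConditions μ P x g Θ θs)
    (hb : SmoothBound P g Θ θs r b) (hb8 : MemLp b 8 P) (hG : GradedFamily P b a rowWeight)
    (ha : ∀ j, a j =ᵐ[P] fun y => rowCoef g θs j y - ∫ y, rowCoef g θs j y ∂P) {τ : ℝ}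
    (hτ : |τ| ≤ 1) {C : Fin p ⊕ Fin m → Fin p ⊕ Fin m → Fin p ⊕ Fin m → Fin p ⊕ Fin m → ℝ}
    (hc : IsFormal P b x a (rowInv P g θs) (rowMeanTwo P g θs)
      (fun i j k s => rowMeanThree P g θs τ i j k s + C i j k s) c)
    (heq : HasRowEquations μ P x g θs τ C θhat) (κ : Fin p) :
    BoundedInProbability μ (fun (n : ℕ) ω => (n : ℝ) ^ 2 * c.remainder x θhat θs n κ ω) := by
  -- Besides the normalized sums, the scaled deviations of the cubic coefficients have to be tight.
  -- These coefficients are of order b⁴, so their variance takes eight moments of b.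
  set X : RowIndex m p ⊕ ((Fin p ⊕ Fin m) × (Fin p ⊕ Fin m) × (Fin p ⊕ Fin m) × (Fin p ⊕ Fin m)) →
      ℕ → Ω → ℝ := Sum.elim (fun j n ω => normSum x n (a j) ω) fun q n ω => √(n : ℝ) *
    (empMean x (n, ω) (fun y => (rowJet (g y) θs τ q.1).c3 q.2.1 q.2.2.1 q.2.2.2) -
      rowMeanThree P g θs τ q.1 q.2.1 q.2.2.1 q.2.2.2) with hX
  have hXb : ∀ k, BoundedInProbability μ (X k) := by
    rintro (j | ⟨i, j, k, s⟩)
    · exact boundedInProbability_normSum hreg.indep hreg.law (hG.memLp_two (rowWeight_le j))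
        (hG.mean j)
    · exact boundedInProbability_empMean hreg.indep hreg.law
        (hb.memLp_c3 hb8 hreg.measurable hτ i j k s)
  refine boundedInProbability_of_whpOn (BoundedInProbability.sum Finset.univ fun k _ => (hXb k).abs)
    fun M => ?_
  refine (hc.remainder_bounds hreg hb ha hτ heq (whpOn_le _ _)
    (fun j => isBigO_whpOn_sum X M (.inl j)) κ).2 fun i j k s => ?_
  have h1 := (isBigO_refl (fun z : ℕ × Ω => rate Prod.fst z) _).mul
    (isBigO_whpOn_sum (μ := μ) X M (.inr (i, j, k, s)))
  refine OrdO.congr (f := fun z => rate Prod.fst z * X (.inr (i, j, k, s)) z.1 z.2) ?_ ?_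
  · simpa [OrdO] using h1
  · filter_upwards [whpOn_le _ _ (tendsto_fst_whp.eventually_ne_atTop 0)] with z hz
    have hz0 : √(z.1 : ℝ) ≠ 0 := by
      have : (0 : ℝ) < z.1 := by positivity
      positivity
    simp only [hX, Sum.elim_inr, rate]
    rw [← mul_assoc, inv_mul_cancel₀ hz0, one_mul]

lemma hasRowEquations_EL (hreg : RegularityConditions μ P x g Θ θs)
    (hb : SmoothBound P g Θ θs r b) (hEL : IsELEstimator μ x g Θ θhat) :
    HasRowEquations μ P x g θs 1 (liftCoef 0) θhat := by
  intro l hl hdev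
  obtain ⟨D, hR⟩ := hreg.exists_momentRegime hb hl hdev
  have hest : ∀ᶠ z in whp μ, IsELEstimate g Θ (fun i : Fin z.1 => x i z.2) (θhat z.1 z.2) :=
    eventually_whp_iff.2 hEL
  exact hR.EL_equations (θ := fun z : ℕ × Ω => θhat z.1 z.2) (hl hest)

/-- The additional cubic coefficients of the ETEL estimator. -/
def etelCoef (P : Measure 𝒳) (g : 𝒳 → EuclideanSpace ℝ (Fin p) → EuclideanSpace ℝ (Fin m))
    (θs : EuclideanSpace ℝ (Fin p)) : Fin m → Fin m → Fin m → Fin m → ℝ :=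
  cubicCoef (momentCov P g θs) (fun j k => (momentCov P g θs)⁻¹ j k)
    fun j k s => rowMeanTwo P g θs (.inr j) (.inr k) (.inr s)

lemma hasRowEquations_ETEL (hreg : RegularityConditions μ P x g Θ θs)
    (hb : SmoothBound P g Θ θs r b) (hETEL : IsETELEstimator μ x g Θ θhat) :
    HasRowEquations μ P x g θs (1 / 2) (liftCoef (etelCoef P g θs)) θhat := by
  intro l hl hdev
  obtain ⟨D, hR⟩ := hreg.exists_momentRegime hb hl hdev
  have hest : ∀ᶠ z in whp μ, IsETELEstimate g Θ (fun i : Fin z.1 => x i z.2) (θhat z.1 z.2) :=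
    eventually_whp_iff.2 hETEL
  refine hR.ETEL_equations (θ := fun z : ℕ × Ω => θhat z.1 z.2) (hl hest) (fun v k => ?_) fun j k s => ?_
  · have h1 : (momentCov P g θs)⁻¹.mulVec ((momentCov P g θs).mulVec v) = v := by
      rw [Matrix.mulVec_mulVec, Matrix.nonsing_inv_mul _ hreg.nonsingular.isUnit, Matrix.one_mulVec]
    exact (congrFun h1 k).symm
  · have := hdev (.inr (.inr (.inr j, .inr k, .inr s)))
    simpa only [rowMeanTwo, rowCoef, rowJet_c2_inr_inr] using this

/-! ### Comparison of the cubic terms -/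

/-- The influence functions of the parameter and of the multiplier. -/
def influence (A : Fin p ⊕ Fin m → Fin p ⊕ Fin m → ℝ) (a : RowIndex m p → 𝒳 → ℝ)
    (k : Fin p ⊕ Fin m) (y : 𝒳) : ℝ :=
  -∑ j, A k j * a (.inl j) y

lemma rowOne_normSum (A : Fin p ⊕ Fin m → Fin p ⊕ Fin m → ℝ) (n : ℕ) (ω : Ω) (k : Fin p ⊕ Fin m) :
    rowOne A (fun j => normSum x n (a j) ω) k = normSum x n (influence A a k) ω := by
  simp only [rowOne, solOne, normSum, influence, Finset.sum_neg_distrib, Finset.mul_sum, mul_neg]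
  rw [Finset.sum_comm]
  congr 1
  exact Finset.sum_congr rfl fun i _ => Finset.sum_congr rfl fun j _ => by ring

lemma GradedFamily.influence [IsProbabilityMeasure P] (h : GradedFamily P b a rowWeight)
    (A : Fin p ⊕ Fin m → Fin p ⊕ Fin m → ℝ) :
    GradedFamily P b (influence A a) fun _ => 1 := by
  have hint : ∀ j, Integrable (a j) P := fun j =>
    (h.memLp_two (rowWeight_le j)).integrable one_le_two
  refine ⟨h.one_le, h.integrable_b, fun k => ?_, fun k => ?_, ?_⟩
  · exact (Finset.measurable_fun_sum _ fun j _ => (h.meas _).const_mul _).neg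
  · simp only [_root_.influence]
    rw [integral_neg, integral_finsetSum _ fun j _ => (hint _).const_mul _]
    simp [integral_const_mul, h.mean]
  · obtain ⟨K, hK, hle⟩ := h.bound
    refine ⟨∑ k, ∑ j, |A k j| * K, by positivity, fun k => ?_⟩
    have hall : ∀ᵐ y ∂P, ∀ j : Fin p ⊕ Fin m, |a (.inl j) y| ≤ K * b y ^ 1 :=
      ae_all_iff.2 fun j => hle (.inl j)
    filter_upwards [hall] with y hy
    have hb0 : 0 ≤ b y ^ 1 := by
      have := h.one_le y
      positivity
    rw [_root_.influence, abs_neg]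
    calc |∑ j, A k j * a (.inl j) y| ≤ ∑ j, |A k j| * (K * b y ^ 1) := by
          refine (Finset.abs_sum_le_sum_abs _ _).trans (Finset.sum_le_sum fun j _ => ?_)
          rw [abs_mul]
          exact mul_le_mul_of_nonneg_left (hy j) (abs_nonneg _)
      _ = (∑ j, |A k j| * K) * b y ^ 1 := by
          rw [Finset.sum_mul]
          exact Finset.sum_congr rfl fun j _ => by ring
      _ ≤ (∑ k, ∑ j, |A k j| * K) * b y ^ 1 := by
          refine mul_le_mul_of_nonneg_right ?_ hb0
          exact Finset.single_le_sum (f := fun k => ∑ j, |A k j| * K)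
            (fun k _ => by positivity) (Finset.mem_univ k)

/-- The influence functions of the parameter and of the multiplier are uncorrelated. -/
lemma integral_influence_mul (hreg : RegularityConditions μ P x g Θ θs)
    (ha : ∀ j, a j =ᵐ[P] fun y => rowCoef g θs j y - ∫ y, rowCoef g θs j y ∂P)
    (κ : Fin m) (l : Fin p) :
    ∫ y, influence (rowInv P g θs) a (.inr κ) y * influence (rowInv P g θs) a (.inl l) y ∂P = 0 := by
  have ha0 : ∀ i, a (.inl i) =ᵐ[P] fun y => (rowJet (g y) θs 1 i).c0 := fun i => by
    filter_upwards [ha (.inl i)] with y hy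
    rw [hy, hreg.integral_rowCoef_zero, sub_zero, rowCoef]
  have hall : ∀ᵐ y ∂P, ∀ i, a (.inl i) y = (rowJet (g y) θs 1 i).c0 := ae_all_iff.2 ha0
  -- The parameter rows have no constant term, so both influence functions are linear in g(y, θs),
  -- and their covariance is the block product that `bordered_inv_orthogonal` shows to vanish.
  have e : ∀ᵐ y ∂P, influence (rowInv P g θs) a (.inr κ) y * influence (rowInv P g θs) a (.inl l) y =
      ∑ i, ∑ j, rowInv P g θs (.inr κ) (.inr i) * (rowInv P g θs (.inl l) (.inr j) *
        (g y θs i * g y θs j)) := by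
    filter_upwards [hall] with y hy
    simp only [influence, hy, Fintype.sum_sum_type, rowJet_c0_inl, rowJet_c0_inr, mul_zero,
      Finset.sum_const_zero, zero_add, neg_mul_neg, Finset.sum_mul_sum]
    exact Finset.sum_congr rfl fun i _ => Finset.sum_congr rfl fun j _ => by ring
  have hint : ∀ i j, Integrable (fun y => rowInv P g θs (.inr κ) (.inr i) *
      (rowInv P g θs (.inl l) (.inr j) * (g y θs i * g y θs j))) P := fun i j =>
    ((hreg.integrable_mul i j).const_mul _).const_mul _
  rw [integral_congr_ae e, integral_finsetSum _ fun i _ => integrable_finsetSum _ fun j _ => hint i j]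
  rw [← bordered_inv_orthogonal hreg.det_bordered RegularityConditions.transpose_momentCov κ l]
  refine Finset.sum_congr rfl fun i _ => ?_
  rw [integral_finsetSum _ fun j _ => hint i j]
  refine Finset.sum_congr rfl fun j _ => ?_
  rw [integral_const_mul, integral_const_mul]
  rfl

lemma sum_eq_sum_inr {D : Fin p ⊕ Fin m → Fin p ⊕ Fin m → Fin p ⊕ Fin m → ℝ}
    (h1 : ∀ u k s, D (.inl u) k s = 0) (h2 : ∀ j u s, D j (.inl u) s = 0)
    (h3 : ∀ j k u, D j k (.inl u) = 0) (β : Fin p ⊕ Fin m → ℝ) :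
    ∑ k, ∑ r, ∑ s, D k r s * (β k * β r * β s) = ∑ k, ∑ r, ∑ s,
      D (.inr k) (.inr r) (.inr s) * (β (.inr k) * β (.inr r) * β (.inr s)) := by
  simp [Fintype.sum_sum_type, h1, h2, h3]

/-- Cubic forms in the linear terms of the multiplier are asymptotically uncorrelated with the
linear term of the parameter. -/
lemma tendsto_cubic_mul (hreg : RegularityConditions μ P x g Θ θs)
    (hG : GradedFamily P b a rowWeight)
    (ha : ∀ j, a j =ᵐ[P] fun y => rowCoef g θs j y - ∫ y, rowCoef g θs j y ∂P)
    {Δ : Fin p ⊕ Fin m → Fin p ⊕ Fin m → Fin p ⊕ Fin m → Fin p ⊕ Fin m → ℝ}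
    (h1 : ∀ i u k s, Δ i (.inl u) k s = 0) (h2 : ∀ i j u s, Δ i j (.inl u) s = 0)
    (h3 : ∀ i j k u, Δ i j k (.inl u) = 0) (i : Fin p ⊕ Fin m) (l : Fin p) :
    Tendsto (fun n => ∫ ω, (-∑ j, rowInv P g θs i j * ∑ k, ∑ r, ∑ s, Δ j k r s *
        (rowOne (rowInv P g θs) (fun j => normSum x n (a j) ω) k *
        rowOne (rowInv P g θs) (fun j => normSum x n (a j) ω) r *
        rowOne (rowInv P g θs) (fun j => normSum x n (a j) ω) s)) *
      rowOne (rowInv P g θs) (fun j => normSum x n (a j) ω) (.inl l) ∂μ) atTop (𝓝 0) := by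
  have := hreg.isProbabilityMeasure
  have h := (hG.influence (rowInv P g θs)).tendsto_cubic hreg.indep hreg.law
    (f := fun κ : Fin m => (.inr κ)) (e := .inl l) (fun _ => le_rfl) le_rfl
    (fun κ => integral_influence_mul hreg ha κ l)
    (fun k r s => -∑ j, rowInv P g θs i j * Δ j (.inr k) (.inr r) (.inr s))
  refine h.congr fun n => integral_congr_ae (Eventually.of_forall fun ω => ?_)
  simp only [rowOne_normSum]
  congr 1
  simp only [sum_eq_sum_inr (h1 _) (h2 _) (h3 _), neg_mul, Finset.sum_neg_distrib,
    Finset.sum_mul, Finset.mul_sum]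
  congr 1
  symm
  rw [Finset.sum_comm]
  refine Finset.sum_congr rfl fun k _ => ?_
  rw [Finset.sum_comm]
  refine Finset.sum_congr rfl fun r _ => ?_
  rw [Finset.sum_comm]
  exact Finset.sum_congr rfl fun s _ => Finset.sum_congr rfl fun j _ => by ring

end Estimators

/-! ### Comparison of the expansions of the two estimators -/

section Comparison

variable {Ω 𝒳 : Type*} [MeasurableSpace Ω] [MeasurableSpace 𝒳] {m p : ℕ} {μ : Measure Ω}
  [IsProbabilityMeasure μ] {P : Measure 𝒳} {x : ℕ → Ω → 𝒳}
  {g : 𝒳 → EuclideanSpace ℝ (Fin p) → EuclideanSpace ℝ (Fin m)}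
  {Θ : Set (EuclideanSpace ℝ (Fin p))} {θs : EuclideanSpace ℝ (Fin p)} {r : ℝ} {b : 𝒳 → ℝ}
  {a : RowIndex m p → 𝒳 → ℝ} {c c' : ExpansionData 𝒳 p}

/-- The mean coefficients of degree three depend on `τ` only in the multiplier. -/
lemma SmoothBound.rowMeanThree_sub (hb : SmoothBound P g Θ θs r b)
    (hm : ∀ θ ∈ Θ, Measurable fun y => g y θ) {τ τ' : ℝ} (hτ : |τ| ≤ 1) (hτ' : |τ'| ≤ 1)
    (i j k s : Fin p ⊕ Fin m) :
    rowMeanThree P g θs τ i j k s - rowMeanThree P g θs τ' i j k s =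
      liftCoef (fun i j k s => (τ - τ') * ∫ y, g y θs i * (g y θs j * (g y θs k * g y θs s)) ∂P)
        i j k s := by
  rw [rowMeanThree, rowMeanThree,
    ← integral_sub (hb.integrable_c3 hm hτ i j k s) (hb.integrable_c3 hm hτ' i j k s)]
  simp only [rowJet_c3_sub, integral_const_mul]
  rcases i with i | i <;> rcases j with j | j <;> rcases k with k | k <;> rcases s with s | s <;>
    simp [liftCoef]

/-- The cubic terms of two expansions that differ only in cubic coefficients of the multiplier. -/
lemma IsFormal.tendsto_integral_sub_mul (hreg : RegularityConditions μ P x g Θ θs)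
    (hb : SmoothBound P g Θ θs r b) (hG : GradedFamily P b a rowWeight)
    (ha : ∀ j, a j =ᵐ[P] fun y => rowCoef g θs j y - ∫ y, rowCoef g θs j y ∂P)
    {τ τ' : ℝ} (hτ : |τ| ≤ 1) (hτ' : |τ'| ≤ 1) {C C' : Fin m → Fin m → Fin m → Fin m → ℝ}
    (hc : IsFormal P b x a (rowInv P g θs) (rowMeanTwo P g θs)
      (fun i j k s => rowMeanThree P g θs τ i j k s + liftCoef C i j k s) c)
    (hc' : IsFormal P b x a (rowInv P g θs) (rowMeanTwo P g θs)
      (fun i j k s => rowMeanThree P g θs τ' i j k s + liftCoef C' i j k s) c') (l l' : Fin p) :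
    Tendsto (fun n => ∫ ω, (c'.r x n l ω - c.r x n l ω) * c.psi x n l' ω ∂μ) atTop (𝓝 0) := by
  have hsub := hb.rowMeanThree_sub hreg.measurable hτ' hτ
  -- The difference has two sources, the coefficient τ of T³ and the extra cubic terms; both are
  -- supported on indices that all belong to the multiplier block.
  have hΔ : ∀ i j k s, rowMeanThree P g θs τ' i j k s + liftCoef C' i j k s -
      (rowMeanThree P g θs τ i j k s + liftCoef C i j k s) = liftCoef (fun i j k s => (τ' - τ) *
        (∫ y, g y θs i * (g y θs j * (g y θs k * g y θs s)) ∂P) + C' i j k s - C i j k s)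
        i j k s := fun i j k s => by
    rw [add_sub_add_comm, hsub]
    rcases i with i | i <;> rcases j with j | j <;> rcases k with k | k <;> rcases s with s | s <;>
      simp [liftCoef]
    ring
  refine (tendsto_cubic_mul hreg hG ha (Δ := liftCoef fun i j k s => (τ' - τ) *
    (∫ y, g y θs i * (g y θs j * (g y θs k * g y θs s)) ∂P) + C' i j k s - C i j k s)
    (fun i u k s => ?_) (fun i j u s => ?_) (fun i j k u => ?_) (.inl l) l').congr fun n => ?_
  · rcases i with i | i <;> simp [liftCoef]
  · rcases i with i | i <;> rcases j with j | j <;> simp [liftCoef]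
  · rcases i with i | i <;> rcases j with j | j <;> rcases k with k | k <;> simp [liftCoef]
  · refine integral_congr_ae (Eventually.of_forall fun ω => ?_)
    simp only
    rw [hc.r, hc'.r, hc.psi, rowThree_sub]
    simp only [hΔ]

lemma IsFormal.psi_eq {A : Fin p ⊕ Fin m → Fin p ⊕ Fin m → ℝ}
    {m2 : Fin p ⊕ Fin m → Fin p ⊕ Fin m → Fin p ⊕ Fin m → ℝ}
    {m3 m3' : Fin p ⊕ Fin m → Fin p ⊕ Fin m → Fin p ⊕ Fin m → Fin p ⊕ Fin m → ℝ}
    (h : IsFormal P b x a A m2 m3 c) (h' : IsFormal P b x a A m2 m3' c') (n : ℕ) (l : Fin p) :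
    c'.psi x n l = c.psi x n l :=
  funext fun ω => (h'.psi n l ω).trans (h.psi n l ω).symm

lemma IsFormal.q_eq {A : Fin p ⊕ Fin m → Fin p ⊕ Fin m → ℝ}
    {m2 : Fin p ⊕ Fin m → Fin p ⊕ Fin m → Fin p ⊕ Fin m → ℝ}
    {m3 m3' : Fin p ⊕ Fin m → Fin p ⊕ Fin m → Fin p ⊕ Fin m → Fin p ⊕ Fin m → ℝ}
    (h : IsFormal P b x a A m2 m3 c) (h' : IsFormal P b x a A m2 m3' c') (n : ℕ) (l : Fin p) :
    c'.q x n l = c.q x n l :=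
  funext fun ω => (h'.q n l ω).trans (h.q n l ω).symm

/-- Since ψ̄ has mean zero and is common to both expansions, the means of the cubic terms drop out
of all these covariances. -/
lemma IsFormal.covariance_sub {A : Fin p ⊕ Fin m → Fin p ⊕ Fin m → ℝ}
    {m2 : Fin p ⊕ Fin m → Fin p ⊕ Fin m → Fin p ⊕ Fin m → ℝ}
    {m3 m3' : Fin p ⊕ Fin m → Fin p ⊕ Fin m → Fin p ⊕ Fin m → Fin p ⊕ Fin m → ℝ}
    (h : IsFormal P b x a A m2 m3 c) (h' : IsFormal P b x a A m2 m3' c') (hind : iIndepFun x μ)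
    (hlaw : ∀ i, HasLaw (x i) P μ) (n : ℕ) (l l' : Fin p) :
    cov[fun ω => c'.r x n l ω - c.r x n l ω, c.psi x n l'; μ] =
        ∫ ω, (c'.r x n l ω - c.r x n l ω) * c.psi x n l' ω ∂μ ∧
      cov[c'.r x n l, c'.psi x n l'; μ] - cov[c.r x n l, c.psi x n l'; μ] =
        ∫ ω, (c'.r x n l ω - c.r x n l ω) * c.psi x n l' ω ∂μ := by
  obtain ⟨w, hw⟩ := h.graded
  obtain ⟨w', hw'⟩ := h'.graded
  have h1 := hw.integrable_r_psi hind hlaw n l l'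
  have h2 := hw'.integrable_r_psi hind hlaw n l l'
  have hp := hw.integral_psi hlaw n l'
  have hp' := hw'.integral_psi hlaw n l'
  have e : ∀ ω, (c'.r x n l ω - c.r x n l ω) * c.psi x n l' ω =
      c'.r x n l ω * c'.psi x n l' ω - c.r x n l ω * c.psi x n l' ω := fun ω => by
    rw [h.psi_eq h']
    ring
  constructor
  · rw [covariance_eq_integral_mul_sub (X := fun ω => c'.r x n l ω - c.r x n l ω)
      ((hw'.integrable_r hind hlaw n l).sub (hw.integrable_r hind hlaw n l))
      ((hw.memLp_psi hlaw n l').integrable one_le_two)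
      ((h2.sub h1).congr (Eventually.of_forall fun ω => (e ω).symm)), hp, mul_zero, sub_zero]
  · rw [hw'.covariance_r_psi hind hlaw, hw.covariance_r_psi hind hlaw, hp, hp', mul_zero, mul_zero,
      sub_zero, sub_zero, ← integral_sub h2 h1]
    simp only [e]

/-- The `O(n⁻²)` variances of two such expansions agree in the limit. -/
lemma IsFormal.tendsto_secondOrderVariance {A : Fin p ⊕ Fin m → Fin p ⊕ Fin m → ℝ}
    {m2 : Fin p ⊕ Fin m → Fin p ⊕ Fin m → Fin p ⊕ Fin m → ℝ}
    {m3 m3' : Fin p ⊕ Fin m → Fin p ⊕ Fin m → Fin p ⊕ Fin m → Fin p ⊕ Fin m → ℝ}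
    (h : IsFormal P b x a A m2 m3 c) (h' : IsFormal P b x a A m2 m3' c') (hind : iIndepFun x μ)
    (hlaw : ∀ i, HasLaw (x i) P μ)
    (hlim : ∀ l l', Tendsto (fun n => ∫ ω, (c'.r x n l ω - c.r x n l ω) * c.psi x n l' ω ∂μ)
      atTop (𝓝 0)) {l l' : Fin p} {W : ℝ}
    (hW : Tendsto (fun n => c.secondOrderVariance μ x n l l') atTop (𝓝 W)) :
    Tendsto (fun n => c'.secondOrderVariance μ x n l l') atTop (𝓝 W) := by
  have key := (hW.add (hlim l l')).add (hlim l' l)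
  rw [add_zero, add_zero] at key
  refine key.congr fun n => ?_
  rw [← (h.covariance_sub h' hind hlaw n l l').2, ← (h.covariance_sub h' hind hlaw n l' l).2,
    ExpansionData.secondOrderVariance, ExpansionData.secondOrderVariance, h.q_eq h', h.q_eq h',
    covariance_comm (c.psi x n l), covariance_comm (c'.psi x n l)]
  ring

end Comparison

end

theorem theorem7 {Ω 𝒳 : Type*} [MeasurableSpace Ω] [MeasurableSpace 𝒳] {m p : ℕ}
    (μ : Measure Ω) [IsProbabilityMeasure μ] (P : Measure 𝒳) (x : ℕ → Ω → 𝒳)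
    (g : 𝒳 → EuclideanSpace ℝ (Fin p) → EuclideanSpace ℝ (Fin m))
    (Θ : Set (EuclideanSpace ℝ (Fin p))) (θs : EuclideanSpace ℝ (Fin p))
    (hreg : RegularityConditions μ P x g Θ θs)
    (hsmooth : SmoothnessConditions P g θs 6)
    (θEL θETEL : ℕ → Ω → EuclideanSpace ℝ (Fin p))
    (hEL : IsELEstimator μ x g Θ θEL) (hETEL : IsETELEstimator μ x g Θ θETEL) :
    ∃ (cEL cETEL : ExpansionData 𝒳 p) (W : Matrix (Fin p) (Fin p) ℝ),
      -- the two estimators have stochastic expansions, and their `O(n⁻²)` variances are equal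
      HasSecondOrderVariance μ P x θEL θs cEL W ∧
      HasSecondOrderVariance μ P x θETEL θs cETEL W ∧
      -- the terms of orders `n^(-1/2)` and `n⁻¹` coincide
      (∀ n l ω, cETEL.psi x n l ω = cEL.psi x n l ω) ∧
      (∀ n l ω, cETEL.q x n l ω = cEL.q x n l ω) ∧
      -- the difference of the terms of order `n^(-3/2)` is asymptotically uncorrelated with `ψ̄`
      (∀ l l', Tendsto
        (fun n => cov[fun ω => cETEL.r x n l ω - cEL.r x n l ω, cEL.psi x n l'; μ])
        atTop (𝓝 0)) ∧
      -- under eighth moments the remainders are of order `n⁻²`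
      (SmoothnessConditions P g θs 8 → ∀ l,
        BoundedInProbability μ (fun (n : ℕ) ω => (n : ℝ) ^ 2 * cEL.remainder x θEL θs n l ω) ∧
        BoundedInProbability μ (fun (n : ℕ) ω => (n : ℝ) ^ 2 * cETEL.remainder x θETEL θs n l ω)) := by
  have := hreg.isProbabilityMeasure
  -- The expansions are fixed before the eighth-moment hypothesis is introduced, so a single bound b
  -- must serve both claims. It is taken with eight moments whenever one exists.
  obtain ⟨r, b, hb, hb8⟩ : ∃ (r : ℝ) (b : 𝒳 → ℝ), SmoothBound P g Θ θs r b ∧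
      (SmoothnessConditions P g θs 8 → MemLp b 8 P) := by
    by_cases h8 : SmoothnessConditions P g θs 8
    · obtain ⟨r, b, hb, hmem⟩ := hreg.exists_smoothBound (by norm_num) h8
      exact ⟨r, b, hb, fun _ => hmem⟩
    · obtain ⟨r, b, hb, -⟩ := hreg.exists_smoothBound le_rfl hsmooth
      exact ⟨r, b, hb, fun h => absurd h h8⟩
  obtain ⟨a, hG, ha⟩ := hb.exists_gradedFamily hreg.measurable
  -- Both expansions are built on the same functions `a`, the same inverse Jacobian and the same
  -- quadratic coefficients. They differ in the cubic coefficients alone: τ = 1 without correction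
  -- for EL, τ = 1/2 with `etelCoef` for ETEL.
  obtain ⟨cEL, hc⟩ := hG.exists_isFormal (rowInv P g θs) (rowMeanTwo P g θs)
    (fun i j k s => rowMeanThree P g θs 1 i j k s + liftCoef 0 i j k s) x
  obtain ⟨cETEL, hc'⟩ := hG.exists_isFormal (rowInv P g θs) (rowMeanTwo P g θs)
    (fun i j k s => rowMeanThree P g θs (1 / 2) i j k s + liftCoef (etelCoef P g θs) i j k s) x
  have hτ : |(1 : ℝ)| ≤ 1 := by simp
  have hτ' : |(1 / 2 : ℝ)| ≤ 1 := by norm_num [abs_le]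
  have heq := hasRowEquations_EL hreg hb hEL
  have heq' := hasRowEquations_ETEL hreg hb hETEL
  have hlim := hc.tendsto_integral_sub_mul hreg hb hG ha hτ hτ' hc'
  obtain ⟨w, hw⟩ := hc.graded
  choose W hW using hw.exists_limit hreg.indep hreg.law
  refine ⟨cEL, cETEL, Matrix.of W,
    ⟨hc.isStochasticExpansion hreg hb hG ha hτ heq, hW⟩,
    ⟨hc'.isStochasticExpansion hreg hb hG ha hτ' heq', fun l l' =>
      hc.tendsto_secondOrderVariance hc' hreg.indep hreg.law hlim (hW l l')⟩,
    fun n l ω => congrFun (hc.psi_eq hc' n l) ω, fun n l ω => congrFun (hc.q_eq hc' n l) ω,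
    fun l l' => ?_, fun h8 l => ⟨?_, ?_⟩⟩
  · exact (hlim l l').congr fun n => (hc.covariance_sub hc' hreg.indep hreg.law n l l').1.symm
  · exact hc.boundedInProbability_remainder hreg hb (hb8 h8) hG ha hτ heq l
  · exact hc'.boundedInProbability_remainder hreg hb (hb8 h8) hG ha hτ' heq' l
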